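/- Let $\mathcal G=(V,E)$ be a finite connected undirected graph without self-loops (multiple edges allowed), with end-vertices $e_-,e_+$ and conductance $W_e>0$ for each $e\in E$, and no killing measure. Fix $x_0\in V$ and $u>0$. For $a\in\mathbb R$ let $P_\varphi^{\{x_0\},a}$ be the law of the Gaussian free field conditioned to equal $a$ at $x_0$, i.e. the probability measure on $\{f\in\mathbb R^V: f_{x_0}=a\}$ with density proportional to $\exp\big(-\tfrac12\sum_{e}W_e(f_{e_+}-f_{e_-})^2\big)$ with respect to $\prod_{x\ne x_0}df_x$. For $\Phi\in\mathbb R_+^V$ put $J_e(\Phi)=W_e\Phi_{e_-}\Phi_{e_+}$. **Enlarged process.** Let $\varphi^{(0)}\sim P_\varphi^{\{x_0\},0}$, let $(X_t)_{t\ge0}$ be the Markov jump process started at $x_0$ which crosses each edge $e$ adjacent to its position at rate $W_e$, and let $(N_e)_{e\in E}$ be Poisson point processes on $\mathbb R_+$ with intensity $1$, all independent. Let $\ell_x(t)=\int_0^t 1_{\{X_s=x\}}ds$, $\tau_u=\inf\{t\ge 0:\ell_{x_0}(t)=u\}$, $\Phi_x=|\varphi^{(0)}_x|$, $\Phi_x(t)=\sqrt{\Phi_x^2+2\ell_x(t)}$,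 and let $K_e(t)$ be the number of crossings of $e$ by $X$ up to time $t$. Conditionally on $\varphi^{(0)},X,(N_e)$, let the $n_e(0)$ be independent, $n_e(0)$ being Poisson with parameter $2J_e(\Phi)$ if the signs of $\varphi^{(0)}$ at $e_-$ and $e_+$ agree (with the convention that the sign at $x_0$ is $+1$), and $n_e(0)=0$ otherwise. Set $$n_e(t)=n_e(0)+N_e(J_e(\Phi(t)))-N_e(J_e(\Phi))+K_e(t),\qquad \mathcal C(t)=\{e\in E: n_e(t)>0\}.$$ Conditionally on all of this, let $\sigma\in\{-1,+1\}^V$ be constant on each cluster induced by $\mathcal C(\tau_u)$, with independent uniform signs on the clusters not containing $x_0$ and $\sigma_{x_0}=+1$. Let $\varphi^{(u)}_x=\sigma_x\Phi_x(\tau_u)$. **Self-interacting process.** Given $\check\varphi\in\mathbb R^V$ with $\check\varphi_{x_0}=\sqrt{2u}$, let $(N_e)$ be independent Poisson point processes on $\mathbb R_+$ of intensity $1$. The process $\check X$ starts at $x_0$; with $\check\ell_x(t)=\int_0^t1_{\{\check X_s=x\}}ds$ and $\check\Phi_x(t)=\sqrt{\check\varphi_x^2-2\check\ell_x(t)}$,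 put $\check n_e(t)=N_e(2J_e(\check\Phi(t)))$ if the signs of $\check\varphi$ at $e_-$ and $e_+$ agree and $\check n_e(t)=0$ otherwise, and $\check{\mathcal C}(t)=\{e:\check n_e(t)>0\}$. The process $\check X$ jumps only when some $\check n_e$ drops by $1$. If this drop does not create a new cluster of $\check{\mathcal C}$, $\check X$ crosses $e$ with probability $1/2$ and does not move with probability $1/2$, independently of everything else; if it does create a new cluster, $\check X$ moves to, or stays at, the unique end of $e$ which is in the cluster of $x_0$ in the new configuration. Let $\check T=\inf\{t\ge0:\exists x\in V,\ \check\Phi_x(t)=0\}$. **Theorem.** The random vector $\varphi^{(u)}$ has law $P_\varphi^{\{x_0\},\sqrt{2u}}$. Moreover, conditionally on $\varphi^{(u)}=\check\varphi$, the process $\big(X_t,(n_e(t))_{e\in E}\big)_{0\le t\le\tau_u}$ has the law of $\big(\check X_{\check T-t},(\check n_e(\check T-t))_{e\in E}\big)_{0\le t\le\check T}$. -/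

import Mathlib

open MeasureTheory ProbabilityTheory
open scoped ENNReal NNReal

noncomputable section

open scoped Classical

/-- A weighted undirected multigraph without self-loops: `fst e` and `snd e` are the two
end-vertices of the (non-oriented) edge `e`, in an irrelevant order, and `W e > 0` is the
conductance of `e`. -/
structure Network (V E : Type*) where
  fst : E → V
  snd : E → V
  ne : ∀ e, fst e ≠ snd e
  W : E → ℝ
  W_pos : ∀ e, 0 < W e

/-- The trajectory of a process with values in `V × (E → ℕ)` that lives on a compact time interval
`[0, T]`: the lifetime `T`, and the path, frozen at its final value after time `T`. The σ-algebra
is the product one, generated by `T` and by the evaluations at deterministic times. -/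
abbrev Trajectory (V E : Type*) := ℝ × (ℝ≥0 → V × (E → ℕ))

/-- The jump process which sits at `Y 0`, `Y 1`, ... successively, and which arrives at `Y (k + 1)`
at time `T (k + 1)` (never, if `T (k + 1) = ∞`). -/
def stepPath {V : Type*} (T : ℕ → ℝ≥0∞) (Y : ℕ → V) (t : ℝ) : V :=
  Y (Nat.card {k : ℕ // T (k + 1) ≤ ENNReal.ofReal t})

/-- The local time at `x` up to time `t` of the path `X`. -/
def localTime {V : Type*} (X : ℝ → V) (t : ℝ) (x : V) : ℝ :=
  ∫ s in (0 : ℝ)..t, if X s = x then (1 : ℝ) else 0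

/-- The `k`-th point (`k = 0, 1, ...`) of the point process on `ℝ₊` with spacings `γ`. -/
def point (γ : ℕ → ℝ) (k : ℕ) : ℝ := ∑ i ∈ Finset.range (k + 1), γ i

/-- The number `N(r)` of points in `[0, r]`. -/
def countUpTo (γ : ℕ → ℝ) (r : ℝ) : ℕ := Nat.card {k : ℕ // point γ k ≤ r}

/-- The number `N(r-)` of points in `[0, r)`. -/
def countBefore (γ : ℕ → ℝ) (r : ℝ) : ℕ := Nat.card {k : ℕ // point γ k < r}

/-- The law of the spacings of independent Poisson point processes on `ℝ₊` with intensity `1`,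
one for each `e : E`: the spacings are i.i.d. exponential variables of parameter `1`. -/
def poissonSpacings (E : Type*) [Fintype E] : Measure (E → ℕ → ℝ) :=
  Measure.pi fun _ : E => Measure.infinitePi fun _ : ℕ => expMeasure 1

/-- The law of a sequence of independent fair coins. -/
def fairCoins : Measure (ℕ → Bool) :=
  Measure.infinitePi fun _ : ℕ => uniformOn (Set.univ : Set Bool)

/-- The sign of the field `φ`, with the convention that the sign at `x₀` is `+1`. -/
def fieldSign {V : Type*} (x₀ : V) (φ : V → ℝ) (x : V) : SignType :=
  if x = x₀ then 1 else SignType.sign (φ x)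

/-- Extension to `V` by the value `a` at `x₀`. -/
def extendAt {V : Type*} (x₀ : V) (a : ℝ) (f : {x : V // x ≠ x₀} → ℝ) (x : V) : ℝ :=
  if h : x = x₀ then a else f ⟨x, h⟩

namespace Network

variable {V E : Type*} (G : Network V E)

/-- `e` is adjacent to `x`. -/
def Incident (e : E) (x : V) : Prop := G.fst e = x ∨ G.snd e = x

/-- The end-vertex of `e` opposite to its end-vertex `x`. -/
def other (e : E) (x : V) : V := if x = G.fst e then G.snd e else G.fst e

/-- The graph on `V` spanned by a set `C` of open edges; its connected components are the clusters
induced by `C`. -/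
def openGraph (C : Set E) : SimpleGraph V :=
  SimpleGraph.fromRel fun x y => ∃ e ∈ C, G.fst e = x ∧ G.snd e = y

/-- The weights `J_e(Φ)`. -/
def J (Φ : V → ℝ) (e : E) : ℝ := G.W e * Φ (G.fst e) * Φ (G.snd e)

/-! ### The pinned Gaussian free field -/

/-- The Dirichlet form (without killing measure). -/
def energy [Fintype E] (f : V → ℝ) : ℝ := ∑ e, G.W e * (f (G.fst e) - f (G.snd e)) ^ 2

/-- The law of the Gaussian free field conditioned to be equal to `a` at `x₀`: the probability
measure on `{f | f x₀ = a}` with density proportional to `exp (-energy f / 2)` with respect to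
the Lebesgue measure `∏_{x ≠ x₀} df_x`. -/
def pinnedGFF [Fintype V] [Fintype E] (x₀ : V) (a : ℝ) : Measure (V → ℝ) :=
  ((volume : Measure ({x : V // x ≠ x₀} → ℝ)).tilted
    fun f => -(1 / 2) * G.energy (extendAt x₀ a f)).map (extendAt x₀ a)

/-! ### The Markov jump process

At its `k`-th step, being at `x`, the process waits for the first of the independent exponential
clocks `ξ k e` of rates `W e`, `e` adjacent to `x`, and crosses the corresponding edge. -/

/-- The law of the clocks. -/
def clockLaw [Fintype E] : Measure (ℕ → E → ℝ) :=
  Measure.infinitePi fun _ : ℕ => Measure.pi fun e => expMeasure (G.W e)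

/-- The edge adjacent to `x` whose clock rings first (none if no edge is adjacent to `x`). -/
def firstEdge (x : V) (c : E → ℝ) : Option E :=
  if h : ∃ e, G.Incident e x ∧ ∀ e', G.Incident e' x → c e ≤ c e' then some h.choose else none

/-- The time of the `k`-th jump (`0` for `k = 0`) and the position after that jump. -/
def walkState (x₀ : V) (ξ : ℕ → E → ℝ) : ℕ → ℝ≥0∞ × V
  | 0 => (0, x₀)
  | k + 1 =>
    match G.firstEdge (walkState x₀ ξ k).2 (ξ k) with
    | none => (⊤, (walkState x₀ ξ k).2)
    | some e => ((walkState x₀ ξ k).1 + ENNReal.ofReal (ξ k e), G.other e (walkState x₀ ξ k).2)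

/-- The Markov jump process `X` started from `x₀`. -/
def walk (x₀ : V) (ξ : ℕ → E → ℝ) : ℝ → V :=
  stepPath (fun k => (G.walkState x₀ ξ k).1) (fun k => (G.walkState x₀ ξ k).2)

/-- The number `K_e(t)` of crossings of the edge `e` by `X` up to time `t`. -/
def crossings (x₀ : V) (ξ : ℕ → E → ℝ) (t : ℝ) (e : E) : ℕ :=
  Nat.card {k : ℕ // (G.walkState x₀ ξ (k + 1)).1 ≤ ENNReal.ofReal t ∧
    G.firstEdge (G.walkState x₀ ξ k).2 (ξ k) = some e}

/-- The inverse local time `τ_u` of `X` at `x₀`. -/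
def tau (x₀ : V) (u : ℝ) (ξ : ℕ → E → ℝ) : ℝ :=
  sInf {t : ℝ | 0 ≤ t ∧ localTime (G.walk x₀ ξ) t x₀ = u}

/-! ### The enlarged process `(X_t, n_e(t))` -/

/-- `Φ_x(t)`. -/
def Phi (x₀ : V) (φ : V → ℝ) (ξ : ℕ → E → ℝ) (t : ℝ) (x : V) : ℝ :=
  √(|φ x| ^ 2 + 2 * localTime (G.walk x₀ ξ) t x)

/-- `n_e(t) = n_e(0) + N_e(J_e(Φ(t))) - N_e(J_e(Φ)) + K_e(t)`, where `N_e` has spacings `γ e`. (The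
subtraction of natural numbers does not truncate, as `J_e(Φ(t)) ≥ J_e(Φ)` for `t ≥ 0`.) -/
def stack (x₀ : V) (φ : V → ℝ) (ξ : ℕ → E → ℝ) (γ : E → ℕ → ℝ) (n₀ : E → ℕ) (t : ℝ) (e : E) : ℕ :=
  n₀ e + (countUpTo (γ e) (G.J (G.Phi x₀ φ ξ t) e) - countUpTo (γ e) (G.J (fun x => |φ x|) e)) +
    G.crossings x₀ ξ t e

/-- The process `(X_t, (n_e(t)))` for `0 ≤ t ≤ τ_u`. -/
def trajectory (x₀ : V) (u : ℝ) (φ : V → ℝ) (ξ : ℕ → E → ℝ) (γ : E → ℕ → ℝ) (n₀ : E → ℕ) :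
    Trajectory V E :=
  (G.tau x₀ u ξ, fun t =>
    (G.walk x₀ ξ (min (t : ℝ) (G.tau x₀ u ξ)),
      G.stack x₀ φ ξ γ n₀ (min (t : ℝ) (G.tau x₀ u ξ))))

/-- The field `φ^{(u)} = σ Φ(τ_u)`. -/
def finalField (x₀ : V) (u : ℝ) (φ : V → ℝ) (ξ : ℕ → E → ℝ) (σ : V → ℤˣ) (x : V) : ℝ :=
  ((σ x : ℤ) : ℝ) * G.Phi x₀ φ ξ (G.tau x₀ u ξ) x

/-- The law of the initial stacks `(n_e(0))` given the initial field `φ`: independent, Poisson of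
parameter `2 J_e(|φ|)` if the signs at the two ends of `e` agree, and `0` otherwise. -/
def initialStackLaw [Fintype E] (x₀ : V) (φ : V → ℝ) : Measure (E → ℕ) :=
  Measure.pi fun e =>
    if fieldSign x₀ φ (G.fst e) * fieldSign x₀ φ (G.snd e) = 1 then
      poissonMeasure (2 * G.J (fun x => |φ x|) e).toNNReal
    else Measure.dirac 0

/-- The law of independent uniform signs on the clusters induced by the open edges `C`, with sign
`+1` on the cluster of `x₀`: in other words, the uniform law on the assignments of signs that are
constant on clusters and equal to `+1` at `x₀`. -/
def clusterSignLaw (x₀ : V) (C : Set E) : Measure (V → ℤˣ) :=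
  uniformOn {σ | σ x₀ = 1 ∧ ∀ x y, (G.openGraph C).Reachable x y → σ x = σ y}

/-- The random variables on `(Ω, P)` from which `(X_t, n_e(t))_{t ≤ τ_u}` and `φ^{(u)}` are built:
* the pinned field `φ₀`, the clocks `ξ` of the jump process and the spacings `γ` of the Poisson
  processes `N_e` are independent, with the prescribed laws;
* given `(φ₀, ξ, γ)`, the initial stacks `n₀` have the law `initialStackLaw`;
* given `(φ₀, ξ, γ, n₀)`, the signs `σ` have the law `clusterSignLaw`
  for the configuration `𝒞(τ_u) = {e | n_e(τ_u) > 0}`. -/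
structure IsEnlarged [Fintype V] [Fintype E] (x₀ : V) (u : ℝ) {Ω : Type*} [MeasurableSpace Ω]
    (P : Measure Ω) (φ₀ : Ω → V → ℝ) (ξ : Ω → ℕ → E → ℝ) (γ : Ω → E → ℕ → ℝ) (n₀ : Ω → E → ℕ)
    (σ : Ω → V → ℤˣ) : Prop where
  law_base : HasLaw (fun ω => (φ₀ ω, ξ ω, γ ω))
    ((G.pinnedGFF x₀ 0).prod (G.clockLaw.prod (poissonSpacings E))) P
  aemeasurable_stacks : AEMeasurable n₀ P
  law_stacks : ∀ A : Set ((V → ℝ) × (ℕ → E → ℝ) × (E → ℕ → ℝ)), MeasurableSet A → ∀ n : E → ℕ,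
    P {ω | (φ₀ ω, ξ ω, γ ω) ∈ A ∧ n₀ ω = n} =
      ∫⁻ ω in {ω | (φ₀ ω, ξ ω, γ ω) ∈ A}, G.initialStackLaw x₀ (φ₀ ω) {n} ∂P
  aemeasurable_signs : AEMeasurable σ P
  law_signs : ∀ A : Set ((V → ℝ) × (ℕ → E → ℝ) × (E → ℕ → ℝ) × (E → ℕ)), MeasurableSet A →
    ∀ s : V → ℤˣ,
    P {ω | (φ₀ ω, ξ ω, γ ω, n₀ ω) ∈ A ∧ σ ω = s} =
      ∫⁻ ω in {ω | (φ₀ ω, ξ ω, γ ω, n₀ ω) ∈ A},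
        G.clusterSignLaw x₀
          {e | 0 < G.stack x₀ (φ₀ ω) (ξ ω) (γ ω) (n₀ ω) (G.tau x₀ u (ξ ω)) e} {s} ∂P

/-! ### The self-interacting process `(X̌_t, ň_e(t))`

The process is a function of the field `φ`, of the spacings `γ e` of the Poisson processes `N_e`,
and of fair coins `c k`. -/

/-- `Φ̌ = √(φ² - 2 ℓ)`, as a function of the local times `ℓ`. -/
def checkPhi (φ ℓ : V → ℝ) (x : V) : ℝ := √(|φ x| ^ 2 - 2 * ℓ x)

/-- `ň_e`, as a function of the local times `ℓ`: it is `N_e(2 J_e(Φ̌))` if the signs of `φ` at the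
two ends of `e` agree, and `0` otherwise. As `J_e` decreases in time, counting the points of
`[0, 2 J_e)` gives the right-continuous version of the process. -/
def checkStack (x₀ : V) (φ : V → ℝ) (γ : E → ℕ → ℝ) (ℓ : V → ℝ) (e : E) : ℕ :=
  if fieldSign x₀ φ (G.fst e) * fieldSign x₀ φ (G.snd e) = 1 then
    countBefore (γ e) (2 * G.J (checkPhi φ ℓ) e)
  else 0

/-- The time that the process, being at `x` with local times `ℓ`, waits until one of the stacks
drops. -/
def checkWait (x₀ : V) (φ : V → ℝ) (γ : E → ℕ → ℝ) (x : V) (ℓ : V → ℝ) : ℝ :=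
  sInf {s : ℝ | 0 ≤ s ∧
    ∃ e, G.checkStack x₀ φ γ (ℓ + Pi.single x s) e < G.checkStack x₀ φ γ ℓ e}

/-- The position after the drop of the stack at `e`, if the process was at `x`: `C` is the
configuration of open edges after the drop, and `coin` is a fair coin. If the drop creates no new
cluster (the two ends of `e` are still connected), the process crosses `e` or not according to the
coin; if it creates one, the process goes to the end of `e` which is in the cluster of `x₀`. -/
def checkMove (x₀ : V) (x : V) (e : E) (C : Set E) (coin : Bool) : V :=
  if (G.openGraph C).Reachable (G.fst e) (G.snd e) then
    if coin then G.other e x else x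
  else if (G.openGraph C).Reachable x₀ (G.fst e) then G.fst e else G.snd e

/-- The time of the `k`-th drop (`0` for `k = 0`, `∞` if there are fewer than `k` drops), and the
position and the local times right after it. -/
def checkState (x₀ : V) (φ : V → ℝ) (γ : E → ℕ → ℝ) (c : ℕ → Bool) : ℕ → ℝ≥0∞ × V × (V → ℝ)
  | 0 => (0, x₀, 0)
  | k + 1 =>
    let T := (checkState x₀ φ γ c k).1
    let x := (checkState x₀ φ γ c k).2.1
    let ℓ := (checkState x₀ φ γ c k).2.2
    let s := G.checkWait x₀ φ γ x ℓ
    let ℓ' := ℓ + Pi.single x s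
    if h : ∃ e, G.checkStack x₀ φ γ ℓ' e < G.checkStack x₀ φ γ ℓ e then
      (T + ENNReal.ofReal s,
        G.checkMove x₀ x h.choose {e | 0 < G.checkStack x₀ φ γ ℓ' e} (c k), ℓ')
    else (⊤, x, ℓ)

/-- The process `X̌`. -/
def checkWalk (x₀ : V) (φ : V → ℝ) (γ : E → ℕ → ℝ) (c : ℕ → Bool) : ℝ → V :=
  stepPath (fun k => (G.checkState x₀ φ γ c k).1) (fun k => (G.checkState x₀ φ γ c k).2.1)

/-- `Ť`, the first time when `Φ̌` vanishes somewhere. -/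
def checkT (x₀ : V) (φ : V → ℝ) (γ : E → ℕ → ℝ) (c : ℕ → Bool) : ℝ :=
  sInf {t : ℝ | 0 ≤ t ∧ ∃ x, checkPhi φ (localTime (G.checkWalk x₀ φ γ c) t) x = 0}

/-- The time-reversed process `(X̌_{Ť-t}, (ň_e(Ť-t)))` for `0 ≤ t ≤ Ť`. -/
def checkTrajectory (x₀ : V) (φ : V → ℝ) (γ : E → ℕ → ℝ) (c : ℕ → Bool) : Trajectory V E :=
  (G.checkT x₀ φ γ c, fun t =>
    (G.checkWalk x₀ φ γ c (max (G.checkT x₀ φ γ c - t) 0),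
      G.checkStack x₀ φ γ
        (localTime (G.checkWalk x₀ φ γ c) (max (G.checkT x₀ φ γ c - t) 0))))

/-- The law of the time-reversed process `(X̌_{Ť-t}, (ň_e(Ť-t)))_{0 ≤ t ≤ Ť}` started from the field
`φ`. -/
def checkLaw [Fintype E] [MeasurableSpace V] (x₀ : V) (φ : V → ℝ) : Measure (Trajectory V E) :=
  ((poissonSpacings E).prod fairCoins).map fun p => G.checkTrajectory x₀ φ p.1 p.2

end Network

end

noncomputable section

open scoped Classical
open ENNReal (ofReal ofReal_mul ofReal_ne_top ofReal_le_ofReal ofReal_prod_of_nonneg ofReal_add)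
open Real (exp exp_add exp_sum exp_pos exp_nonneg sqrt_pos sqrt_nonneg measurable_exp sq_sqrt)
open Finset (univ range mem_univ mem_filter mem_range sum_le_sum sum_congr sum_comm
  sum_add_distrib prod_congr mul_prod_erase ne_of_mem_erase)
open Function (update update_of_ne update_self)
open Set (Ioi Ioo mem_ofPred_eq indicator_of_mem indicator_of_notMem indicator_apply)

set_option linter.unusedSectionVars false

/-! Work with the halved squared field r = Φ²/2. A time s spent at x adds s to r_x for the enlarged
process and removes s from it for the self-interacting one. Given the field and the stacks at one
end of the time interval, a trajectory is determined by its skeleton: the successive positions,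
holding times and edges at which a stack changes. The theorem compares two densities on triples
(field, stacks, skeleton).

Forward density. The clocks of the edges and the remaining points of the processes N_e are
independent competing alarms. At x, an event at e = {x, y} is a crossing, with rate W_e, or a point
of N_e, with rate dJ_e/dr_x = W_e √(r_y / r_x). The total hazard accumulated is the increment of
H(r) = ∑_x W_x r_x + ∑_e J_e, where W_x is the total conductance at x. Hence the density is the
product of the rates times exp(-(H(final) - H(initial))) (`fwdInt_le_fwdExp`).

Backward density. Given signs σ, the stacks start as Poisson variables of parameter 2J_e on the
edges whose ends agree. At y, the levels 2J_e of the adjacent edges all decrease in proportion to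
√r_y, so the stack at e = {x, y} drops with rate 2W_e √(r_x / r_y), and the move chosen has
probability 1/2, 1 or 0. The surviving points contribute (2J_e)^n/n! at the end of the reversed run
(`capExp_dropExp_le_bwdInt`, `lintegral_checkStack_le`).

Three facts match the densities. First, half the energy of σΦ plus the sum of 2J_e over agreeing
edges is H(r), whatever σ (`energy_signField`). Second, the Jacobian from the field to r is, up to a
constant, the product of r_z^(-1/2) over z ≠ x₀; letting the omitted vertex follow the position
converts a drop rate √(r_x / r_y) into a crossing rate 1. Third, the number of sign assignments
constant on clusters is unchanged when an edge is opened inside a cluster, and is at least halved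
when the edge merges two clusters; this compensates the factor 2 and the probability of the move.
The last two facts give a one-step detailed balance inequality (`bwdRate_mul_le`), which is chained
along the skeleton (`bwdProd_mul_le`) and combined with the first one in `revDens_le`. The integrals
over skeletons correspond by translating the field by the local times and reflecting a holding time
at x₀ (`lintegral_bwdInt_eq_fwdInt`).

Only inequalities are proved. The joint law of the final field and trajectory, and the one built
from the Gaussian field and the reversed self-interacting process, are both probability measures; if
one dominates the other, they coincide (`hasLaw_and_hasCondDistrib_of_lintegral_le`). So the
self-interacting law need only be bounded above and the enlarged law below. In particular the
finiteness of τ_u, exact masses and negligible coincidences need no separate treatment. The Gaussian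
normalizations for the boundary values 0 and √(2u) agree by translation. -/

/-- The configurations outside of `x₀`. -/
abbrev Off {V : Type*} (x₀ : V) := {x : V // x ≠ x₀} → ℝ

/-! ### Independent sequences -/

section Sequences

/-- Prepend a term to a sequence. -/
def seqCons {X : Type*} (a : X) (f : ℕ → X) (k : ℕ) : X := Nat.casesOn k a f

@[simp] theorem seqCons_zero {X : Type*} (a : X) (f : ℕ → X) : seqCons a f 0 = a := rfl

@[simp] theorem seqCons_succ {X : Type*} (a : X) (f : ℕ → X) (k : ℕ) :
    seqCons a f (k + 1) = f k := rfl

variable {X : Type*} [MeasurableSpace X]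

/-- The first `n` terms of `f`, followed by `g`. -/
def seqConcat (n : ℕ) (f g : ℕ → X) (k : ℕ) : X := if k < n then f k else g (k - n)

theorem measurable_seqCons : Measurable fun p : X × (ℕ → X) => seqCons p.1 p.2 := by
  refine measurable_pi_lambda _ fun k => ?_
  cases k with
  | zero => exact measurable_fst
  | succ k => exact (measurable_pi_apply k).comp measurable_snd

theorem Measurable.seqCons {Z : Type*} [MeasurableSpace Z] {f : Z → X} {g : Z → ℕ → X}
    (hf : Measurable f) (hg : Measurable g) : Measurable fun z => seqCons (f z) (g z) :=
  measurable_seqCons.comp (hf.prodMk hg)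

theorem measurable_seqConcat (n : ℕ) :
    Measurable fun p : (ℕ → X) × (ℕ → X) => seqConcat n p.1 p.2 := by
  refine measurable_pi_lambda _ fun k => ?_
  unfold seqConcat
  split_ifs
  exacts [(measurable_pi_apply k).comp measurable_fst, (measurable_pi_apply _).comp measurable_snd]

variable (ρ : Measure X) [IsProbabilityMeasure ρ]

/-- A cylinder pulls back to a product of two cylinders, the second one with its indices shifted by
`n`, and its mass splits accordingly. -/
theorem measurePreserving_seqConcat (n : ℕ) :
    MeasurePreserving (fun p : (ℕ → X) × (ℕ → X) => seqConcat n p.1 p.2)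
      ((Measure.infinitePi fun _ => ρ).prod (Measure.infinitePi fun _ => ρ))
      (Measure.infinitePi fun _ => ρ) := by
  refine ⟨measurable_seqConcat n, Measure.eq_infinitePi _ fun s t ht => ?_⟩
  rw [Measure.map_apply (measurable_seqConcat n) (.pi s.countable_toSet fun _ _ => ht _)]
  have : (fun p : (ℕ → X) × (ℕ → X) => seqConcat n p.1 p.2) ⁻¹' (Set.pi s t) =
      (Set.pi ↑(s.filter (· < n)) t) ×ˢ
        (Set.pi ↑((s.filter (¬ · < n)).image (· - n)) fun k => t (k + n)) := by
    ext p
    simp only [Set.mem_preimage, Set.mem_pi, Finset.mem_coe, Set.mem_prod, mem_filter,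
      Finset.mem_image, seqConcat]
    constructor
    · refine fun h => ⟨fun i hi => by simpa [hi.2] using h i hi.1, ?_⟩
      rintro _ ⟨i, ⟨hi, hn⟩, rfl⟩
      have := h i hi
      rw [if_neg hn] at this
      rwa [Nat.sub_add_cancel (not_lt.1 hn)]
    · rintro ⟨h1, h2⟩ i hi
      split_ifs with hn
      · exact h1 i ⟨hi, hn⟩
      · have := h2 (i - n) ⟨i, ⟨hi, hn⟩, rfl⟩
        rwa [Nat.sub_add_cancel (not_lt.1 hn)] at this
  rw [this, Measure.prod_prod, Measure.infinitePi_pi _ fun i _ => ht i,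
    Measure.infinitePi_pi _ fun i _ => ht (i + n), Finset.prod_image,
    ← Finset.prod_filter_mul_prod_filter_not s (· < n)]
  · congr 1
    refine prod_congr rfl fun i hi => ?_
    rw [Nat.sub_add_cancel (not_lt.1 (mem_filter.1 hi).2)]
  · intro i hi j hj hij
    have h1 := (mem_filter.1 hi).2
    have h2 := (mem_filter.1 hj).2
    simp only at hij
    omega

theorem measurePreserving_seqCons :
    MeasurePreserving (fun p : X × (ℕ → X) => seqCons p.1 p.2)
      (ρ.prod (Measure.infinitePi fun _ => ρ)) (Measure.infinitePi fun _ => ρ) := by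
  have h := (measurePreserving_eval_infinitePi (fun _ : ℕ => ρ) 0).prod
    (MeasurePreserving.id (Measure.infinitePi fun _ : ℕ => ρ))
  refine ⟨measurable_seqCons, ?_⟩
  rw [← h.map_eq, Measure.map_map measurable_seqCons h.measurable]
  refine Eq.trans ?_ (measurePreserving_seqConcat ρ 1).map_eq
  congr 1
  ext p k
  cases k <;> simp [seqConcat, Function.comp]

theorem measurePreserving_seqUpdate (n : ℕ) :
    MeasurePreserving (fun p : (ℕ → X) × X => update p.1 n p.2)
      ((Measure.infinitePi fun _ => ρ).prod ρ) (Measure.infinitePi fun _ => ρ) := by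
  have hm : Measurable fun p : (ℕ → X) × X => update p.1 n p.2 := by
    refine measurable_pi_lambda _ fun k => ?_
    by_cases h : k = n
    · subst h; simpa using measurable_snd
    · simp only [ne_eq, h, not_false_eq_true, update_of_ne]
      exact (measurable_pi_apply k).comp measurable_fst
  refine ⟨hm, Measure.eq_infinitePi _ fun s t ht => ?_⟩
  rw [Measure.map_apply hm (.pi s.countable_toSet fun _ _ => ht _)]
  have : (fun p : (ℕ → X) × X => update p.1 n p.2) ⁻¹' (Set.pi s t) =
      (Set.pi ↑(s.erase n) t) ×ˢ (if n ∈ s then t n else Set.univ) := by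
    ext p
    simp only [Set.mem_preimage, Set.mem_pi, Finset.mem_coe, Set.mem_prod, Finset.mem_erase]
    constructor
    · refine fun h => ⟨fun i hi => by simpa [hi.1] using h i hi.2, ?_⟩
      split_ifs with hn
      · simpa using h n hn
      · trivial
    · rintro ⟨h1, h2⟩ i hi
      by_cases hin : i = n
      · subst hin; simpa [hi] using h2
      · simpa [hin] using h1 i ⟨hin, hi⟩
  rw [this, Measure.prod_prod, Measure.infinitePi_pi _ fun i _ => ht i]
  split_ifs with hn
  · rw [mul_comm, mul_prod_erase s (fun i => ρ (t i)) hn]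
  · simp [Finset.erase_eq_of_notMem hn]

theorem lintegral_seqCons {F : (ℕ → X) → ℝ≥0∞} (hF : Measurable F) :
    ∫⁻ f, F f ∂(Measure.infinitePi fun _ => ρ) =
      ∫⁻ a, ∫⁻ f, F (seqCons a f) ∂(Measure.infinitePi fun _ => ρ) ∂ρ := by
  rw [← (measurePreserving_seqCons ρ).lintegral_comp hF, lintegral_prod]
  exact (hF.comp measurable_seqCons).aemeasurable

theorem lintegral_seqUpdate (n : ℕ) {F : (ℕ → X) → ℝ≥0∞} (hF : Measurable F) :
    ∫⁻ f, F f ∂(Measure.infinitePi fun _ => ρ) =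
      ∫⁻ f, ∫⁻ a, F (update f n a) ∂ρ ∂(Measure.infinitePi fun _ => ρ) := by
  have h := measurePreserving_seqUpdate ρ n
  rw [← h.lintegral_comp hF, lintegral_prod]
  exact (hF.comp h.measurable).aemeasurable

theorem lintegral_seqConcat (n : ℕ) {F : (ℕ → X) → ℝ≥0∞} (hF : Measurable F) :
    ∫⁻ f, F f ∂(Measure.infinitePi fun _ => ρ) =
      ∫⁻ f, ∫⁻ g, F (seqConcat n f g) ∂(Measure.infinitePi fun _ => ρ)
        ∂(Measure.infinitePi fun _ => ρ) := by
  rw [← (measurePreserving_seqConcat ρ n).lintegral_comp hF, lintegral_prod]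
  exact (hF.comp (measurable_seqConcat n)).aemeasurable

end Sequences

/-! ### Finite families of independent variables -/

section FinitePi

variable {ι : Type*} [Fintype ι] {X : ι → Type*} [∀ i, MeasurableSpace (X i)]
  (μ : ∀ i, Measure (X i)) [∀ i, IsProbabilityMeasure (μ i)]

theorem measurable_piUpdate (i : ι) :
    Measurable fun p : (∀ i, X i) × X i => update p.1 i p.2 := by
  refine measurable_pi_lambda _ fun k => ?_
  by_cases h : k = i
  · subst h; simpa using measurable_snd
  · simp only [update_of_ne h]
    exact (measurable_pi_apply k).comp measurable_fst

theorem measurePreserving_piUpdate (i : ι) :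
    MeasurePreserving (fun p : (∀ i, X i) × X i => update p.1 i p.2)
      ((Measure.pi μ).prod (μ i)) (Measure.pi μ) := by
  refine ⟨measurable_piUpdate i, (Measure.pi_eq fun t ht => ?_).symm⟩
  rw [Measure.map_apply (measurable_piUpdate i) (.univ_pi ht)]
  have : (fun p : (∀ i, X i) × X i => update p.1 i p.2) ⁻¹' (Set.univ.pi t) =
      (Set.univ.pi (update t i Set.univ)) ×ˢ (t i) := by
    ext p
    simp only [Set.mem_preimage, Set.mem_univ_pi, Set.mem_prod]
    constructor
    · refine fun h => ⟨fun k => ?_, by simpa using h i⟩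
      by_cases hk : k = i
      · subst hk; simp
      · simpa [hk] using h k
    · rintro ⟨h1, h2⟩ k
      by_cases hk : k = i
      · subst hk; simpa using h2
      · simpa [hk] using h1 k
  rw [this, Measure.prod_prod, Measure.pi_pi, ← mul_prod_erase _ _ (mem_univ i),
    ← mul_prod_erase _ (fun k => μ k (t k)) (mem_univ i), mul_comm]
  simp only [update_self, measure_univ, one_mul]
  congr 1
  refine prod_congr rfl fun k hk => ?_
  rw [update_of_ne (ne_of_mem_erase hk)]

theorem lintegral_piUpdate (i : ι) {F : (∀ i, X i) → ℝ≥0∞} (hF : Measurable F) :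
    ∫⁻ f, F f ∂(Measure.pi μ) =
      ∫⁻ f, ∫⁻ a, F (update f i a) ∂(μ i) ∂(Measure.pi μ) := by
  have h := measurePreserving_piUpdate μ i
  rw [← h.lintegral_comp hF, lintegral_prod]
  exact (hF.comp h.measurable).aemeasurable

/-- If each `μ i`, restricted to `A i`, is `c i` times its image under `f i`, then the product
measure has the same property. -/
theorem prod_mul_lintegral_map_le (A : ∀ i, Set (X i)) (c : ι → ℝ≥0∞)
    (f : ∀ i, X i → X i) (hf : ∀ i, Measurable (f i))
    (h : ∀ i, (μ i).restrict (A i) = c i • (μ i).map (f i))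
    {F : (∀ i, X i) → ℝ≥0∞} (hF : Measurable F) :
    (∏ i, c i) * ∫⁻ x, F (fun i => f i (x i)) ∂(Measure.pi μ) =
      ∫⁻ x in Set.univ.pi A, F x ∂(Measure.pi μ) := by
  have (i : ι) : IsProbabilityMeasure ((μ i).map (f i)) :=
    Measure.isProbabilityMeasure_map (hf i).aemeasurable
  have key : (Measure.pi μ).restrict (Set.univ.pi A) =
      (∏ i, c i) • (Measure.pi μ).map fun x i => f i (x i) := by
    rw [Measure.restrict_pi_pi, Measure.pi_map_pi fun i => (hf i).aemeasurable]
    refine Measure.pi_eq fun t ht => ?_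
    rw [Measure.smul_apply, Measure.pi_pi, smul_eq_mul, ← Finset.prod_mul_distrib]
    refine prod_congr rfl fun i _ => ?_
    rw [h i, Measure.smul_apply, smul_eq_mul]
  rw [key, lintegral_smul_measure, lintegral_map hF (by fun_prop), smul_eq_mul]

end FinitePi

/-! ### Exponential variables -/

section Exponential

theorem lintegral_expMeasure {w : ℝ} (F : ℝ → ℝ≥0∞) :
    ∫⁻ x, F x ∂(expMeasure w) =
      ∫⁻ x in Ioi 0, ofReal (w * exp (-(w * x))) * F x := by
  have hm : Measurable (gammaPDF 1 w) := (measurable_exponentialPDFReal w).ennreal_ofReal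
  rw [expMeasure, gammaMeasure, lintegral_withDensity_eq_lintegral_mul_non_measurable _ hm
    (Filter.Eventually.of_forall fun x => ENNReal.ofReal_lt_top),
    ← lintegral_indicator measurableSet_Ioi]
  refine lintegral_congr_ae ?_
  filter_upwards [compl_mem_ae_iff.2 (measure_singleton (0 : ℝ))] with x hx
  have hx : x ≠ 0 := hx
  simp only [Pi.mul_apply, indicator_apply, Set.mem_Ioi]
  change exponentialPDF w x * _ = _
  rw [exponentialPDF_eq]
  rcases lt_or_gt_of_ne hx with h | h
  · simp [not_le.2 h, not_lt.2 h.le]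
  · simp [h, h.le]

instance instIsProbabilityMeasureExpOne : IsProbabilityMeasure (expMeasure 1) :=
  isProbabilityMeasure_expMeasure one_pos

theorem ae_pos_expMeasure (w : ℝ) : ∀ᵐ x ∂(expMeasure w), 0 < x := by
  rw [ae_iff, ← setLIntegral_one, ← lintegral_indicator (by measurability), lintegral_expMeasure]
  refine (setLIntegral_congr_fun measurableSet_Ioi fun x hx => ?_).trans (lintegral_zero)
  have hx : 0 < x := hx
  simp [hx]

/-- The lack of memory of the exponential law. -/
theorem expMeasure_restrict_Ioi {w c : ℝ} (hc : 0 ≤ c) :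
    (expMeasure w).restrict (Ioi c) =
      ofReal (exp (-(w * c))) • (expMeasure w).map (· + c) := by
  ext A hA
  rw [Measure.restrict_apply hA, Measure.smul_apply, Measure.map_apply (by fun_prop) hA,
    smul_eq_mul]
  have hA' : MeasurableSet ((fun x => x + c) ⁻¹' A) := hA.preimage (by fun_prop)
  rw [← setLIntegral_one, ← setLIntegral_one, ← lintegral_indicator hA',
    ← lintegral_indicator (hA.inter measurableSet_Ioi), lintegral_expMeasure, lintegral_expMeasure,
    ← lintegral_const_mul' _ _ ofReal_ne_top, ← lintegral_indicator measurableSet_Ioi,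
    ← lintegral_indicator measurableSet_Ioi]
  rw [← lintegral_add_right_eq_self _ c]
  refine lintegral_congr fun x => ?_
  by_cases hx : 0 < x
  · have h1 : 0 < x + c := by linarith
    by_cases hxA : x + c ∈ A
    · simp only [indicator_apply, Set.mem_Ioi, Set.mem_inter_iff, Set.mem_preimage, hx, h1,
        hxA, if_true, true_and, lt_add_iff_pos_left, mul_one]
      rw [← ofReal_mul (by positivity), mul_left_comm, ← exp_add]
      congr 3; ring
    · simp [indicator_apply, hxA]
  · have : ¬ c < x + c := by linarith
    simp [indicator_apply, hx, this]

theorem lintegral_expMeasure_shift {w c : ℝ} (hc : 0 ≤ c) {F : ℝ → ℝ≥0∞} (hF : Measurable F) :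
    ∫⁻ x in Ioi c, F x ∂(expMeasure w) =
      ofReal (exp (-(w * c))) * ∫⁻ x, F (x + c) ∂(expMeasure w) := by
  rw [expMeasure_restrict_Ioi hc, lintegral_smul_measure, lintegral_map hF (by fun_prop),
    smul_eq_mul]

theorem expMeasure_Ioi {w c : ℝ} (hw : 0 < w) (hc : 0 ≤ c) :
    expMeasure w (Ioi c) = ofReal (exp (-(w * c))) := by
  have := isProbabilityMeasure_expMeasure hw
  have h := lintegral_expMeasure_shift (w := w) hc (F := 1) measurable_one
  simpa using h

end Exponential

/-! ### Poisson processes given by their spacings -/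

section Spacings

/-- The law of a sequence of i.i.d. exponential variables of parameter `1`. -/
abbrev spacingLaw : Measure (ℕ → ℝ) := Measure.infinitePi fun _ : ℕ => expMeasure 1

/-- The spacings of a locally finite simple point process on the positive half line. -/
def GoodSpacing (γ : ℕ → ℝ) : Prop :=
  (∀ k, 0 < γ k) ∧ Filter.Tendsto (point γ) Filter.atTop Filter.atTop

theorem point_succ (γ : ℕ → ℝ) (k : ℕ) : point γ (k + 1) = point γ k + γ (k + 1) := by
  simp [point, Finset.sum_range_succ _ (k + 1)]

theorem point_zero (γ : ℕ → ℝ) : point γ 0 = γ 0 := by simp [point]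

theorem point_succ' (γ : ℕ → ℝ) (k : ℕ) :
    point γ (k + 1) = γ 0 + point (fun i => γ (i + 1)) k := by
  rw [point, Finset.sum_range_succ', add_comm]; rfl

theorem measurable_point (k : ℕ) : Measurable fun γ : ℕ → ℝ => point γ k :=
  Finset.measurable_fun_sum _ fun i _ => measurable_pi_apply i

theorem strictMono_point {γ : ℕ → ℝ} (h : ∀ k, 0 < γ k) : StrictMono (point γ) :=
  strictMono_nat_of_lt_succ fun k => by rw [point_succ]; linarith [h (k + 1)]

theorem point_pos {γ : ℕ → ℝ} (h : ∀ k, 0 < γ k) (k : ℕ) : 0 < point γ k :=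
  Finset.sum_pos (fun i _ => h i) (by simp)

theorem countUpTo_eq {γ : ℕ → ℝ} (h : ∀ k, 0 < γ k) {n : ℕ} {r : ℝ}
    (h1 : ∀ k < n, point γ k ≤ r) (h2 : r < point γ n) : countUpTo γ r = n := by
  have : {k : ℕ | point γ k ≤ r} = Set.Iio n := by
    ext k
    refine ⟨fun hk => ?_, fun hk => h1 k hk⟩
    by_contra hn
    exact absurd (h2.trans_le ((strictMono_point h).monotone (not_lt.1 hn))) (not_lt.2 hk)
  exact (Nat.card_congr (Equiv.setCongr this)).trans (by simp)

theorem countBefore_eq {γ : ℕ → ℝ} (h : ∀ k, 0 < γ k) {n : ℕ} {r : ℝ}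
    (h1 : ∀ k < n, point γ k < r) (h2 : r ≤ point γ n) : countBefore γ r = n := by
  have : {k : ℕ | point γ k < r} = Set.Iio n := by
    ext k
    refine ⟨fun hk => ?_, fun hk => h1 k hk⟩
    by_contra hn
    exact absurd (h2.trans ((strictMono_point h).monotone (not_lt.1 hn))) (not_le.2 hk)
  exact (Nat.card_congr (Equiv.setCongr this)).trans (by simp)

theorem GoodSpacing.exists_countUpTo {γ : ℕ → ℝ} (h : GoodSpacing γ) (r : ℝ) :
    ∃ n, (∀ k < n, point γ k ≤ r) ∧ r < point γ n := by
  have hex : ∃ n, r < point γ n := (h.2.eventually_gt_atTop r).exists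
  exact ⟨Nat.find hex, fun k hk => not_lt.1 (Nat.find_min hex hk), Nat.find_spec hex⟩

theorem GoodSpacing.exists_countBefore {γ : ℕ → ℝ} (h : GoodSpacing γ) (r : ℝ) :
    ∃ n, (∀ k < n, point γ k < r) ∧ r ≤ point γ n := by
  have hex : ∃ n, r ≤ point γ n := (h.2.eventually_ge_atTop r).exists
  exact ⟨Nat.find hex, fun k hk => not_le.1 (Nat.find_min hex hk), Nat.find_spec hex⟩

theorem countUpTo_of_nonpos {γ : ℕ → ℝ} (h : ∀ k, 0 < γ k) {r : ℝ} (hr : r ≤ 0) :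
    countUpTo γ r = 0 :=
  countUpTo_eq h (by simp) (hr.trans_lt (point_pos h 0))

theorem countBefore_of_nonpos {γ : ℕ → ℝ} (h : ∀ k, 0 < γ k) {r : ℝ} (hr : r ≤ 0) :
    countBefore γ r = 0 :=
  countBefore_eq h (by simp) (hr.trans (point_pos h 0).le)

/-- Exponential Markov inequality: the Laplace transform of the sum of `n` terms is `θ ^ n` with `θ
< 1`, so the sums all stay below `a` with probability at most `exp a * θ ^ n` for every `n`. This
serves both for the local finiteness of the Poisson processes and for the non-explosion of the walk.
-/
theorem ae_exists_lt_sum {X : Type*} [MeasurableSpace X] (ρ : Measure X) [IsProbabilityMeasure ρ]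
    {g : X → ℝ} (hg : Measurable g) (hpos : ∀ᵐ x ∂ρ, 0 < g x) :
    ∀ᵐ ω ∂(Measure.infinitePi fun _ : ℕ => ρ), ∀ a : ℕ, ∃ n,
      (a : ℝ) < ∑ i ∈ range n, g (ω i) := by
  have hm : ∀ n, Measurable fun ω : ℕ → X => ∑ i ∈ range n, g (ω i) := fun n =>
    Finset.measurable_sum _ fun i _ => hg.comp (measurable_pi_apply i)
  set θ : ℝ≥0∞ := ∫⁻ x, ofReal (exp (-g x)) ∂ρ with hθ
  have hθ1 : θ < 1 := by
    have h1 : ∫⁻ _, 1 ∂ρ = 1 := by simp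
    rw [← h1]
    refine lintegral_strict_mono (NeZero.ne ρ) measurable_const.aemeasurable ?_ ?_
    · refine ne_top_of_le_ne_top (h1 ▸ ENNReal.one_ne_top) (lintegral_mono_ae ?_)
      filter_upwards [hpos] with x hx
      exact ENNReal.ofReal_le_one.2 (Real.exp_le_one_iff.2 (by linarith))
    · filter_upwards [hpos] with x hx
      exact ENNReal.ofReal_lt_one.2 (Real.exp_lt_one_iff.2 (by linarith))
  have hint : ∀ n, ∫⁻ ω, ofReal (exp (-∑ i ∈ range n, g (ω i)))
      ∂(Measure.infinitePi fun _ : ℕ => ρ) = θ ^ n := by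
    intro n
    induction n with
    | zero => simp
    | succ n ih =>
      rw [lintegral_seqCons ρ (F := fun ω => ofReal
        (exp (-∑ i ∈ range (n + 1), g (ω i)))) (((hm _).neg.exp).ennreal_ofReal)]
      simp only [Finset.sum_range_succ', seqCons_zero, seqCons_succ, neg_add, exp_add]
      simp_rw [ofReal_mul (exp_pos _).le]
      simp_rw [lintegral_mul_const' _ _ ofReal_ne_top, ih]
      rw [lintegral_const_mul' _ _ (ENNReal.pow_ne_top hθ1.ne_top), ← hθ, pow_succ]
  rw [ae_all_iff]
  intro a
  rw [ae_iff]
  simp only [not_exists, not_lt]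
  have hle : ∀ n : ℕ, (Measure.infinitePi fun _ : ℕ => ρ)
      {ω | ∀ n, ∑ i ∈ range n, g (ω i) ≤ a} ≤ ofReal (exp a) * θ ^ n := by
    intro n
    rw [← hint n, ← lintegral_const_mul' _ _ ofReal_ne_top, ← setLIntegral_one]
    refine (setLIntegral_mono' ?_ fun γ hγ => ?_).trans (setLIntegral_le_lintegral _ _)
    · rw [Set.ofPred_forall]
      exact MeasurableSet.iInter fun n => measurableSet_le (hm n) measurable_const
    · rw [← ofReal_mul (by positivity), ← exp_add, ← ENNReal.ofReal_one]
      refine ofReal_le_ofReal (Real.one_le_exp ?_)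
      linarith [hγ n]
  have hlim : Filter.Tendsto (fun n : ℕ => ofReal (exp a) * θ ^ n)
      Filter.atTop (nhds 0) := by
    rw [← mul_zero (ofReal (exp a))]
    exact ENNReal.Tendsto.const_mul (ENNReal.tendsto_pow_atTop_nhds_zero_of_lt_one hθ1)
      (Or.inr ofReal_ne_top)
  exact le_antisymm (ge_of_tendsto' hlim hle) bot_le

theorem ae_goodSpacing : ∀ᵐ γ ∂spacingLaw, GoodSpacing γ := by
  have h1 : ∀ᵐ γ ∂spacingLaw, ∀ k, 0 < γ k := by
    rw [ae_all_iff]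
    exact fun k => (measurePreserving_eval_infinitePi
      (fun _ : ℕ => expMeasure 1) k).quasiMeasurePreserving.ae (ae_pos_expMeasure 1)
  filter_upwards [h1, ae_exists_lt_sum (expMeasure 1) measurable_id (ae_pos_expMeasure 1)] with γ hp hu
  refine ⟨hp, Filter.tendsto_atTop_atTop_of_monotone (strictMono_point hp).monotone fun b => ?_⟩
  obtain ⟨a, ha⟩ := exists_nat_ge b
  obtain ⟨n, hn⟩ := hu a
  refine ⟨n, ha.trans (hn.le.trans ?_)⟩
  exact Finset.sum_le_sum_of_subset_of_nonneg (Finset.range_mono n.le_succ) fun i _ _ => (hp i).le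

end Spacings

/-! ### Measurability of counting functions -/

section NatCard

/-- `Nat.card` of an infinite set is 0, so the value 0 mixes the empty and the infinite cases. The
nonzero values are decomposed over finite sets, and 0 is treated as the complement. -/
theorem measurable_natCard {Z : Type*} [MeasurableSpace Z] {p : ℕ → Z → Prop}
    (hp : ∀ k, MeasurableSet {z | p k z}) : Measurable fun z => Nat.card {k // p k z} := by
  have h1 : ∀ n : ℕ, n ≠ 0 → MeasurableSet {z | Nat.card {k // p k z} = n} := by
    intro n hn
    have : {z | Nat.card {k // p k z} = n} =
        ⋃ S : Finset ℕ, ⋃ _ : S.card = n, ⋂ k, {z | p k z ↔ k ∈ S} := by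
      ext z
      simp only [mem_ofPred_eq, Set.mem_iUnion, Set.mem_iInter, exists_prop]
      constructor
      · intro h
        have hfin : {k | p k z}.Finite := by
          exact Set.finite_coe_iff.1 (Nat.finite_of_card_ne_zero (h.trans_ne hn))
        refine ⟨hfin.toFinset, ?_, fun k => by simp⟩
        rw [← h, ← Set.ncard_eq_toFinset_card _ hfin]
        rfl
      · rintro ⟨S, hS, h⟩
        exact (Nat.card_congr (Equiv.subtypeEquivRight h)).trans (by simp [hS])
    rw [this]
    refine MeasurableSet.iUnion fun S => MeasurableSet.iUnion fun _ => MeasurableSet.iInter fun k => ?_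
    by_cases hk : k ∈ S
    · simpa [hk] using hp k
    · simp only [hk, iff_false]
      exact (hp k).compl
  refine measurable_to_countable' fun n => ?_
  by_cases hn : n = 0
  · subst hn
    have : (fun z => Nat.card {k // p k z}) ⁻¹' {0} =
        (⋃ n : ℕ, ⋃ _ : n ≠ 0, {z | Nat.card {k // p k z} = n})ᶜ := by
      ext z
      simp only [Set.mem_preimage, Set.mem_singleton_iff, Set.mem_compl_iff, Set.mem_iUnion,
        mem_ofPred_eq, exists_prop, not_exists, not_and]
      exact ⟨fun h i hi h' => hi (h'.symm.trans h), fun h => by_contra fun h' => h _ h' rfl⟩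
    rw [this]
    exact (MeasurableSet.iUnion fun n => MeasurableSet.iUnion fun h => h1 n h).compl
  · exact h1 n hn

theorem Measurable.countUpTo {Z : Type*} [MeasurableSpace Z] {γ : Z → ℕ → ℝ} {r : Z → ℝ}
    (hγ : Measurable γ) (hr : Measurable r) : Measurable fun z => countUpTo (γ z) (r z) :=
  measurable_natCard fun k => measurableSet_le ((measurable_point k).comp hγ) hr

theorem Measurable.countBefore {Z : Type*} [MeasurableSpace Z] {γ : Z → ℕ → ℝ} {r : Z → ℝ}
    (hγ : Measurable γ) (hr : Measurable r) : Measurable fun z => countBefore (γ z) (r z) :=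
  measurable_natCard fun k => measurableSet_lt ((measurable_point k).comp hγ) hr

end NatCard

/-! ### Lack of memory and splicing of Poisson processes -/

section Spacings

/-- The sum of the first `n` spacings. -/
def psum (γ : ℕ → ℝ) (n : ℕ) : ℝ := ∑ i ∈ range n, γ i

@[simp] theorem psum_zero (γ : ℕ → ℝ) : psum γ 0 = 0 := by simp [psum]

theorem psum_succ (γ : ℕ → ℝ) (n : ℕ) : psum γ (n + 1) = psum γ n + γ n := by
  simp [psum, Finset.sum_range_succ]

theorem psum_succ_eq_point (γ : ℕ → ℝ) (n : ℕ) : psum γ (n + 1) = point γ n := rfl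

theorem measurable_psum (n : ℕ) : Measurable fun γ : ℕ → ℝ => psum γ n :=
  Finset.measurable_fun_sum _ fun i _ => measurable_pi_apply i

theorem psum_congr {γ γ' : ℕ → ℝ} {n : ℕ} (h : ∀ k < n, γ k = γ' k) : psum γ n = psum γ' n :=
  sum_congr rfl fun k hk => h k (mem_range.1 hk)

theorem psum_update (γ : ℕ → ℝ) {n m : ℕ} (h : n ≤ m) (x : ℝ) :
    psum (update γ m x) n = psum γ n :=
  psum_congr fun k hk => update_of_ne (by omega) _ _

theorem psum_nonneg {γ : ℕ → ℝ} (h : ∀ k, 0 < γ k) (n : ℕ) : 0 ≤ psum γ n :=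
  Finset.sum_nonneg fun i _ => (h i).le

/-- Increase the first term of a sequence. -/
def addHead (c : ℝ) (γ : ℕ → ℝ) : ℕ → ℝ := seqCons (γ 0 + c) fun k => γ (k + 1)

theorem measurable_addHead : Measurable fun p : ℝ × (ℕ → ℝ) => addHead p.1 p.2 :=
  Measurable.seqCons (by fun_prop) (by fun_prop)

theorem Measurable.addHead {Z : Type*} [MeasurableSpace Z] {f : Z → ℝ} {g : Z → ℕ → ℝ}
    (hf : Measurable f) (hg : Measurable g) : Measurable fun z => addHead (f z) (g z) :=
  measurable_addHead.comp (hf.prodMk hg)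

theorem point_seqCons_zero (a : ℝ) (γ : ℕ → ℝ) : point (seqCons a γ) 0 = a := by simp [point]

theorem point_seqCons_succ (a : ℝ) (γ : ℕ → ℝ) (k : ℕ) :
    point (seqCons a γ) (k + 1) = a + point γ k := by
  rw [point_succ']; rfl

theorem point_addHead (c : ℝ) (γ : ℕ → ℝ) (k : ℕ) : point (addHead c γ) k = point γ k + c := by
  cases k with
  | zero => simp [point, addHead]
  | succ k => rw [addHead, point_seqCons_succ, point_succ']; ring

theorem GoodSpacing.addHead {γ : ℕ → ℝ} (h : GoodSpacing γ) {c : ℝ} (hc : 0 ≤ c) :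
    GoodSpacing (addHead c γ) := by
  refine ⟨fun k => ?_, ?_⟩
  · cases k with
    | zero => simp [_root_.addHead]; linarith [h.1 0]
    | succ k => exact h.1 (k + 1)
  · simp only [funext (point_addHead c γ)]
    exact Filter.tendsto_atTop_add_const_right _ _ h.2

theorem GoodSpacing.seqCons {γ : ℕ → ℝ} (h : GoodSpacing γ) {c : ℝ} (hc : 0 < c) :
    GoodSpacing (seqCons c γ) := by
  refine ⟨fun k => ?_, ?_⟩
  · cases k with
    | zero => simpa
    | succ k => exact h.1 k
  · rw [← Filter.tendsto_add_atTop_iff_nat 1]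
    simp only [point_seqCons_succ]
    exact Filter.tendsto_atTop_add_const_left _ _ h.2

theorem countUpTo_addHead (c : ℝ) (γ : ℕ → ℝ) (r : ℝ) :
    countUpTo (addHead c γ) r = countUpTo γ (r - c) := by
  simp only [countUpTo, point_addHead, le_sub_iff_add_le]

theorem countUpTo_seqCons {γ : ℕ → ℝ} (h : GoodSpacing γ) {c r : ℝ} (hc : 0 < c) (hr : c ≤ r) :
    countUpTo (seqCons c γ) r = countUpTo γ (r - c) + 1 := by
  obtain ⟨n, h1, h2⟩ := h.exists_countUpTo (r - c)
  rw [countUpTo_eq h.1 h1 h2]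
  refine countUpTo_eq (h.seqCons hc).1 (fun k hk => ?_) ?_
  · cases k with
    | zero => simpa [point_seqCons_zero] using hr
    | succ k => rw [point_seqCons_succ]; linarith [h1 k (by omega)]
  · rw [point_seqCons_succ]; linarith

theorem countUpTo_seqCons_of_lt {γ : ℕ → ℝ} (h : GoodSpacing γ) {c r : ℝ} (hc : 0 < c)
    (hr : r < c) : countUpTo (seqCons c γ) r = 0 :=
  countUpTo_eq (h.seqCons hc).1 (by simp) (by simpa [point_seqCons_zero] using hr)

/-- Lack of memory of the first spacing: given that there is no point up to `c`, the points beyond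
`c` form a fresh Poisson process. -/
theorem spacingLaw_restrict {c : ℝ} (hc : 0 ≤ c) :
    spacingLaw.restrict {γ | c < γ 0} =
      ofReal (exp (-c)) • spacingLaw.map (addHead c) := by
  have hm : Measurable (addHead c) := Measurable.addHead measurable_const measurable_id
  have hs : MeasurableSet {γ : ℕ → ℝ | c < γ 0} :=
    measurableSet_lt measurable_const (measurable_pi_apply 0)
  refine Measure.ext_of_lintegral _ fun F hF => ?_
  rw [lintegral_smul_measure, lintegral_map hF hm, smul_eq_mul, ← lintegral_indicator hs,
    lintegral_seqCons _ (hF.indicator hs),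
    lintegral_seqCons _ (F := fun γ => F (addHead c γ)) (hF.comp hm)]
  have : ∀ a, ∫⁻ f, {γ : ℕ → ℝ | c < γ 0}.indicator F (seqCons a f) ∂spacingLaw =
      (Ioi c).indicator (fun a => ∫⁻ f, F (seqCons a f) ∂spacingLaw) a := by
    intro a
    by_cases h : c < a <;> simp [indicator_apply, h]
  have hF' : Measurable fun a => ∫⁻ f, F (seqCons a f) ∂spacingLaw :=
    (hF.comp measurable_seqCons).lintegral_prod_right'
  rw [lintegral_congr this, lintegral_indicator measurableSet_Ioi,
    lintegral_expMeasure_shift hc hF', one_mul]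
  rfl

/-- Change of variables in the law of an exponential variable. -/
theorem lintegral_hazard_le {w : ℝ} {S : Set ℝ} (hS : MeasurableSet S) {H H' : ℝ → ℝ}
    (hH : ∀ s ∈ S, HasDerivAt H (H' s) s) (hinj : Set.InjOn H S) (hpos : ∀ s ∈ S, 0 < H s)
    (F : ℝ → ℝ≥0∞) :
    ∫⁻ s in S, ofReal (|H' s|) * (ofReal (w * exp (-(w * H s))) * F (H s)) ≤
      ∫⁻ x, F x ∂(expMeasure w) := by
  rw [lintegral_expMeasure, ← lintegral_image_eq_lintegral_abs_deriv_mul hS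
    (fun s hs => (hH s hs).hasDerivWithinAt) hinj
    fun x => ofReal (w * exp (-(w * x))) * F x]
  refine lintegral_mono_set ?_
  rintro _ ⟨s, hs, rfl⟩
  exact hpos s hs

/-- The points of `γ` up to level `a`, followed by the points of `δ` translated by `a`. -/
def splice (a : ℝ) (γ δ : ℕ → ℝ) : ℕ → ℝ :=
  seqConcat (countUpTo γ a) γ (addHead (a - psum γ (countUpTo γ a)) δ)

theorem measurable_splice (a : ℝ) :
    Measurable fun p : (ℕ → ℝ) × (ℕ → ℝ) => splice a p.1 p.2 := by
  have hN : Measurable fun p : (ℕ → ℝ) × (ℕ → ℝ) => countUpTo p.1 a :=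
    Measurable.countUpTo measurable_fst measurable_const
  have : Measurable fun q : ℕ × ((ℕ → ℝ) × (ℕ → ℝ)) =>
      seqConcat q.1 q.2.1 (addHead (a - psum q.2.1 q.1) q.2.2) := by
    refine measurable_from_prod_countable_right fun n => ?_
    refine (measurable_seqConcat n).comp (measurable_fst.prodMk ?_)
    exact Measurable.addHead (measurable_const.sub ((measurable_psum n).comp measurable_fst))
      measurable_snd
  exact this.comp (hN.prodMk measurable_id)

theorem psum_seqConcat (n : ℕ) (γ δ : ℕ → ℝ) : psum (seqConcat n γ δ) n = psum γ n :=
  psum_congr fun k hk => by simp [seqConcat, hk]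

theorem psum_seqConcat_succ (n : ℕ) (γ δ : ℕ → ℝ) :
    psum (seqConcat n γ δ) (n + 1) = psum γ n + δ 0 := by
  rw [psum_succ, psum_seqConcat]; simp [seqConcat]

theorem countUpTo_eq_iff {γ : ℕ → ℝ} (h : GoodSpacing γ) {a : ℝ} (ha : 0 ≤ a) (n : ℕ) :
    countUpTo γ a = n ↔ psum γ n ≤ a ∧ a < psum γ (n + 1) := by
  have key : ∀ n, psum γ n ≤ a → a < psum γ (n + 1) → countUpTo γ a = n := by
    intro n h1 h2
    refine countUpTo_eq h.1 (fun k hk => ?_) h2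
    refine le_trans ?_ h1
    obtain ⟨m, rfl⟩ : ∃ m, n = m + 1 := ⟨n - 1, by omega⟩
    exact (strictMono_point h.1).monotone (by omega)
  refine ⟨fun hn => ?_, fun h => key n h.1 h.2⟩
  obtain ⟨m, h1, h2⟩ := h.exists_countUpTo a
  have hm : psum γ m ≤ a := by
    cases m with
    | zero => simpa
    | succ m => exact h1 m (by omega)
  obtain rfl : m = n := (key m hm h2).symm.trans hn
  exact ⟨hm, h2⟩

theorem lintegral_eq_tsum_count {a : ℝ} (ha : 0 ≤ a) (K : (ℕ → ℝ) → ℕ → ℝ≥0∞)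
    (hK : ∀ n, Measurable fun γ => K γ n) :
    ∫⁻ γ, K γ (countUpTo γ a) ∂spacingLaw =
      ∑' n, ∫⁻ γ, {γ | psum γ n ≤ a ∧ a < psum γ (n + 1)}.indicator (fun γ => K γ n) γ
        ∂spacingLaw := by
  have hs : ∀ n, MeasurableSet {γ : ℕ → ℝ | psum γ n ≤ a ∧ a < psum γ (n + 1)} := fun n =>
    (measurableSet_le (measurable_psum n) measurable_const).inter
      (measurableSet_lt measurable_const (measurable_psum (n + 1)))
  rw [← lintegral_tsum fun n => ((hK n).indicator (hs n)).aemeasurable]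
  refine lintegral_congr_ae ?_
  filter_upwards [ae_goodSpacing] with γ hγ
  rw [tsum_eq_single (countUpTo γ a)]
  · rw [indicator_of_mem]
    exact (countUpTo_eq_iff hγ ha _).1 rfl
  · intro n hn
    rw [indicator_of_notMem]
    exact fun h => hn ((countUpTo_eq_iff hγ ha _).2 h).symm

/-- Split according to the number `n` of points up to `a`. In the spliced sequence the old spacing
`n` enters only through the event that it exceeds `a - psum γ n`; the probability of this event is
the factor which the lack of memory produces for the unspliced sequence. -/
theorem measurePreserving_splice {a : ℝ} (ha : 0 ≤ a) :
    MeasurePreserving (fun p : (ℕ → ℝ) × (ℕ → ℝ) => splice a p.1 p.2)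
      (spacingLaw.prod spacingLaw) spacingLaw := by
  refine ⟨measurable_splice a, Measure.ext_of_lintegral _ fun F hF => ?_⟩
  rw [lintegral_map hF (measurable_splice a),
    lintegral_prod (fun p : (ℕ → ℝ) × (ℕ → ℝ) => F (splice a p.1 p.2))
      (hF.comp (measurable_splice a)).aemeasurable]
  have hcc : ∀ n, Measurable fun p : (ℕ → ℝ) × (ℕ → ℝ) =>
      F (seqConcat n p.1 (addHead (a - psum p.1 n) p.2)) := fun n => by
    refine hF.comp ((measurable_seqConcat n).comp (measurable_fst.prodMk ?_))
    exact Measurable.addHead (measurable_const.sub ((measurable_psum n).comp measurable_fst))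
      measurable_snd
  have hG : ∀ n, Measurable fun γ : ℕ → ℝ =>
      ∫⁻ δ, F (seqConcat n γ (addHead (a - psum γ n) δ)) ∂spacingLaw :=
    fun n => (hcc n).lintegral_prod_right'
  have hs : ∀ n, MeasurableSet {γ : ℕ → ℝ | psum γ n ≤ a ∧ a < psum γ (n + 1)} := fun n =>
    (measurableSet_le (measurable_psum n) measurable_const).inter
      (measurableSet_lt measurable_const (measurable_psum (n + 1)))
  refine (lintegral_eq_tsum_count ha (fun γ n => ∫⁻ δ, F (seqConcat n γ (addHead (a - psum γ n) δ))
    ∂spacingLaw) hG).trans ?_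
  refine Eq.trans ?_ (lintegral_eq_tsum_count ha (fun γ _ => F γ) fun _ => hF).symm
  refine tsum_congr fun n => ?_
  rw [lintegral_seqUpdate _ n ((hG n).indicator (hs n)),
    lintegral_seqConcat _ n (hF.indicator (hs n))]
  refine lintegral_congr fun γ => ?_
  have e1 : ∀ x, seqConcat n (update γ n x) = seqConcat n γ := by
    intro x; funext δ k
    simp only [seqConcat]
    split_ifs with h
    · rw [update_of_ne (by omega)]
    · rfl
  by_cases h : psum γ n ≤ a
  · have hc : 0 ≤ a - psum γ n := by linarith
    have hl : ∀ x, {γ : ℕ → ℝ | psum γ n ≤ a ∧ a < psum γ (n + 1)}.indicator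
        (fun γ => ∫⁻ δ, F (seqConcat n γ (addHead (a - psum γ n) δ)) ∂spacingLaw)
          (update γ n x) = (Ioi (a - psum γ n)).indicator
        (fun _ => ∫⁻ δ, F (seqConcat n γ (addHead (a - psum γ n) δ)) ∂spacingLaw) x := by
      intro x
      simp only [indicator_apply, mem_ofPred_eq, psum_succ, psum_update γ le_rfl, h,
        update_self, true_and, e1, Set.mem_Ioi, sub_lt_iff_lt_add']
    have hr : ∀ δ, {γ : ℕ → ℝ | psum γ n ≤ a ∧ a < psum γ (n + 1)}.indicator F
        (seqConcat n γ δ) = {δ : ℕ → ℝ | a - psum γ n < δ 0}.indicator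
          (fun δ => F (seqConcat n γ δ)) δ := by
      intro δ
      simp only [indicator_apply, mem_ofPred_eq, psum_seqConcat_succ, psum_seqConcat, h,
        true_and, sub_lt_iff_lt_add']
    simp_rw [hl, hr]
    rw [lintegral_indicator measurableSet_Ioi, lintegral_const, Measure.restrict_apply_univ,
      expMeasure_Ioi one_pos hc, one_mul, lintegral_indicator
        (measurableSet_lt measurable_const (measurable_pi_apply 0)), spacingLaw_restrict hc,
      lintegral_smul_measure, lintegral_map, smul_eq_mul, mul_comm]
    · exact hF.comp ((measurable_seqConcat n).comp (measurable_const.prodMk measurable_id))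
    · exact Measurable.addHead measurable_const measurable_id
  · simp [psum_update γ le_rfl, psum_seqConcat, h]

/-- With `a` the initial value of J_e, this reads N_e(J_e(Φ(t))) - N_e(J_e(Φ)) off a fresh process
`δ`. -/
theorem countUpTo_splice {a : ℝ} (ha : 0 ≤ a) {γ δ : ℕ → ℝ} (hγ : GoodSpacing γ)
    (hδ : GoodSpacing δ) {t : ℝ} (ht : 0 ≤ t) :
    countUpTo (splice a γ δ) (a + t) = countUpTo γ a + countUpTo δ t := by
  obtain ⟨h1, h2⟩ := (countUpTo_eq_iff hγ ha _).1 rfl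
  set N := countUpTo γ a with hN
  have hpos : ∀ k, 0 < splice a γ δ k := by
    intro k
    simp only [splice, seqConcat, ← hN]
    split_ifs; exacts [hγ.1 k, (hδ.addHead (by linarith)).1 _]
  have hps : ∀ j, psum (splice a γ δ) (N + (j + 1)) = a + point δ j := by
    intro j
    induction j with
    | zero =>
      rw [zero_add, splice, psum_seqConcat_succ, point_zero]
      simp only [addHead, seqCons_zero]; linarith
    | succ j ih =>
      rw [← add_assoc, psum_succ, ih, point_succ, ← add_assoc]
      have e : N + j + 1 - N = j + 1 := by omega
      simp only [splice, seqConcat, ← hN, addHead, e, seqCons_succ]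
      rw [if_neg (by omega), add_assoc]
  obtain ⟨n, h3, h4⟩ := hδ.exists_countUpTo t
  rw [countUpTo_eq hδ.1 h3 h4]
  refine countUpTo_eq hpos (fun k hk => ?_) ?_
  · rcases lt_or_ge k N with hkN | hkN
    · have : point (splice a γ δ) k = point γ k := by
        simp only [← psum_succ_eq_point]
        refine psum_congr fun i hi => ?_
        simp [splice, seqConcat, ← hN, show i < N by omega]
      rw [this]
      obtain ⟨m, hm⟩ : ∃ m, N = m + 1 := ⟨N - 1, by omega⟩
      rw [hm] at h1 hkN
      have := (strictMono_point hγ.1).monotone (show k ≤ m by omega)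
      rw [psum_succ_eq_point] at h1
      linarith
    · obtain ⟨j, rfl⟩ := Nat.exists_eq_add_of_le hkN
      rw [← psum_succ_eq_point, add_assoc, hps]
      linarith [h3 j (by omega)]
  · rw [← psum_succ_eq_point, add_assoc, hps]; linarith

end Spacings

/-! ### Measurability through countable fibers and entrance times -/

section DiscreteFibers

variable {Z Y : Type*} [MeasurableSpace Z] [MeasurableSpace Y]

/-- A function which depends measurably on a parameter and on a countably valued map is
measurable. -/
theorem measurable_of_fibers {D : Type*} [Countable D] {g : Z → D}
    (hg : ∀ d, MeasurableSet {z | g z = d}) {f : D → Z → Y} (hf : ∀ d, Measurable (f d)) :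
    Measurable fun z => f (g z) z := by
  intro A hA
  have : (fun z => f (g z) z) ⁻¹' A = ⋃ d, {z | g z = d} ∩ f d ⁻¹' A := by
    ext z; simp
  rw [this]
  exact MeasurableSet.iUnion fun d => (hg d).inter (hf d hA)

theorem measurableSet_fiber_pred {ι : Type*} [Countable ι] {p : Z → ι → Prop}
    (hp : ∀ i, MeasurableSet {z | p z i}) (q : ι → Prop) : MeasurableSet {z | p z = q} := by
  have : {z | p z = q} = ⋂ i, {z | p z i ↔ q i} := by
    ext z; simp [funext_iff]
  rw [this]
  refine MeasurableSet.iInter fun i => ?_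
  by_cases h : q i
  · simpa [h] using hp i
  · simp only [h, iff_false]
    exact (hp i).compl

theorem measurableSet_fiber_set {ι : Type*} [Countable ι] {p : Z → Set ι}
    (hp : ∀ i, MeasurableSet {z | i ∈ p z}) (q : Set ι) : MeasurableSet {z | p z = q} := by
  have : {z | p z = q} = ⋂ i, {z | i ∈ p z ↔ i ∈ q} := by
    ext z; simp [Set.ext_iff]
  rw [this]
  refine MeasurableSet.iInter fun i => ?_
  by_cases h : i ∈ q
  · simpa [h] using hp i
  · simp only [h, iff_false]
    exact (hp i).compl

theorem Measurable.fiber [MeasurableSingletonClass Y] {g : Z → Y} (hg : Measurable g) (y : Y) :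
    MeasurableSet {z | g z = y} := hg (measurableSet_singleton y)

theorem measurableSet_exists {ι : Type*} [Countable ι] {p : ι → Z → Prop}
    (hp : ∀ i, MeasurableSet {z | p i z}) : MeasurableSet {z | ∃ i, p i z} := by
  have : {z | ∃ i, p i z} = ⋃ i, {z | p i z} := by ext z; simp
  rw [this]
  exact MeasurableSet.iUnion hp

theorem measurableSet_forall {ι : Type*} [Countable ι] {p : ι → Z → Prop}
    (hp : ∀ i, MeasurableSet {z | p i z}) : MeasurableSet {z | ∀ i, p i z} := by
  have : {z | ∀ i, p i z} = ⋂ i, {z | p i z} := by ext z; simp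
  rw [this]
  exact MeasurableSet.iInter hp

instance instMeasurableSingletonClassUnitsInt : MeasurableSingletonClass ℤˣ :=
  ⟨fun s => ⟨{(s : ℤ)}, measurableSet_singleton _, by ext t; simp [Units.ext_iff]⟩⟩

/-- The entrance time in a set of times which is closed upwards. -/
theorem measurable_sInf_of_monotone {p : Z → ℝ → Prop} (hm : ∀ t, MeasurableSet {z | p z t})
    (hp : ∀ z s t, 0 ≤ s → s ≤ t → p z s → p z t) :
    Measurable fun z => sInf {t : ℝ | 0 ≤ t ∧ p z t} := by
  refine measurable_of_Iio fun q => ?_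
  -- The first alternative covers `sInf ∅ = 0`; since `p z` is upward closed, emptiness can be
  -- tested on the integers. In the other case rational times suffice, again because `p z` is upward
  -- closed.
  have : (fun z => sInf {t : ℝ | 0 ≤ t ∧ p z t}) ⁻¹' Set.Iio q =
      {z | (0 < q ∧ ∀ n : ℕ, ¬ p z n) ∨ ∃ r : ℚ, ((0 : ℝ) ≤ r ∧ (r : ℝ) < q) ∧ p z r} := by
    ext z
    simp only [Set.mem_preimage, Set.mem_Iio, mem_ofPred_eq]
    rcases Set.eq_empty_or_nonempty {t : ℝ | 0 ≤ t ∧ p z t} with h | ⟨t0, h0, ht0⟩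
    · rw [h, Real.sInf_empty]
      have h' : ∀ t : ℝ, 0 ≤ t → ¬ p z t := fun t ht hp' => by
        have : t ∈ {t : ℝ | 0 ≤ t ∧ p z t} := ⟨ht, hp'⟩
        rw [h] at this; exact this
      constructor
      · exact fun hq => Or.inl ⟨hq, fun n => h' n n.cast_nonneg⟩
      · rintro (hq | ⟨r, hr, hr'⟩)
        exacts [hq.1, absurd hr' (h' r hr.1)]
    · rw [csInf_lt_iff (s := {t : ℝ | 0 ≤ t ∧ p z t}) ⟨0, fun t ht => ht.1⟩ ⟨t0, h0, ht0⟩]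
      constructor
      · rintro ⟨t, ⟨ht, hpt⟩, htq⟩
        obtain ⟨r, hr1, hr2⟩ := exists_rat_btwn htq
        exact Or.inr ⟨r, ⟨ht.trans hr1.le, hr2⟩, hp z t r ht hr1.le hpt⟩
      · rintro (hq | ⟨r, hr, hr'⟩)
        · obtain ⟨n, hn⟩ := exists_nat_ge t0
          exact absurd (hp z t0 n h0 hn ht0) (hq.2 n)
        · exact ⟨r, ⟨hr.1, hr'⟩, hr.2⟩
  rw [this]
  have e1 : MeasurableSet {z | ∀ n : ℕ, ¬ p z n} :=
    measurableSet_forall fun n => (hm n).compl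
  refine MeasurableSet.union ((MeasurableSet.const _).inter e1) ?_
  exact measurableSet_exists fun r : ℚ => (MeasurableSet.const _).inter (hm r)

end DiscreteFibers

/-! ### Local times of measurable paths -/

section Paths

variable {V Z : Type*} [MeasurableSpace Z] [MeasurableSpace V]

theorem measurable_stepPath {T : Z → ℕ → ℝ≥0∞} {Y : Z → ℕ → V} {t : Z → ℝ}
    (hT : ∀ k, Measurable fun z => T z k) (hY : ∀ k, Measurable fun z => Y z k)
    (ht : Measurable t) : Measurable fun z => stepPath (T z) (Y z) (t z) := by
  have hN : Measurable fun z => Nat.card {k : ℕ // T z (k + 1) ≤ ofReal (t z)} :=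
    measurable_natCard fun k => measurableSet_le (hT (k + 1)) ht.ennreal_ofReal
  exact measurable_of_fibers hN.fiber hY

variable [MeasurableSingletonClass V]

theorem measurable_localTime {X : Z → ℝ → V} (hX : Measurable fun p : Z × ℝ => X p.1 p.2)
    {t : Z → ℝ} (ht : Measurable t) (x : V) : Measurable fun z => localTime (X z) (t z) x := by
  have hf : Measurable fun p : Z × ℝ => if X p.1 p.2 = x then (1 : ℝ) else 0 :=
    Measurable.ite (hX (measurableSet_singleton x)) measurable_const measurable_const
  have aux : ∀ a b : Z → ℝ, Measurable a → Measurable b →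
      Measurable fun z => ∫ s in Set.Ioc (a z) (b z), if X z s = x then (1 : ℝ) else 0 := by
    intro a b ha hb
    have hm : MeasurableSet {p : Z × ℝ | a p.1 < p.2 ∧ p.2 ≤ b p.1} :=
      (measurableSet_lt (ha.comp measurable_fst) measurable_snd).inter
        (measurableSet_le measurable_snd (hb.comp measurable_fst))
    have := ((hf.indicator hm).stronglyMeasurable.integral_prod_right' (ν := volume)).measurable
    convert this using 2 with z
    rw [← integral_indicator measurableSet_Ioc]
    rfl
  simp only [localTime, intervalIntegral]
  exact (aux _ _ measurable_const ht).sub (aux _ _ ht measurable_const)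

theorem intervalIntegrable_occupation {X : ℝ → V} (hX : Measurable X) (x : V) (a b : ℝ) :
    IntervalIntegrable (fun s => if X s = x then (1 : ℝ) else 0) volume a b := by
  refine (intervalIntegrable_const (c := (1 : ℝ))).mono_fun' ?_ ?_
  · exact (Measurable.ite (hX (measurableSet_singleton x)) measurable_const
      measurable_const).aestronglyMeasurable
  · exact Filter.Eventually.of_forall fun s => by dsimp only; split_ifs <;> simp

theorem localTime_sub {X : ℝ → V} (hX : Measurable X) (x : V) (a b : ℝ) :
    localTime X b x - localTime X a x = ∫ s in a..b, if X s = x then (1 : ℝ) else 0 :=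
  intervalIntegral.integral_interval_sub_left (intervalIntegrable_occupation hX x _ _)
    (intervalIntegrable_occupation hX x _ _)

theorem localTime_mono {X : ℝ → V} (hX : Measurable X) (x : V) :
    Monotone fun t => localTime X t x := by
  intro a b hab
  have := localTime_sub hX x a b
  have h2 : (0 : ℝ) ≤ ∫ s in a..b, if X s = x then (1 : ℝ) else 0 :=
    intervalIntegral.integral_nonneg hab fun s _ => by split_ifs <;> simp
  dsimp only
  linarith

theorem localTime_zero {X : ℝ → V} (x : V) : localTime X 0 x = 0 := by
  simp [localTime]

theorem localTime_nonneg {X : ℝ → V} (hX : Measurable X) (x : V) {t : ℝ} (ht : 0 ≤ t) :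
    0 ≤ localTime X t x := by
  rw [← localTime_zero (X := X) x]; exact localTime_mono hX x ht

theorem continuous_localTime {X : ℝ → V} (hX : Measurable X) (x : V) :
    Continuous fun t => localTime X t x :=
  intervalIntegral.continuous_primitive (fun a b => intervalIntegrable_occupation hX x a b) 0

/-- The first time when the local time is equal to `u` is also the first time when it is at least
`u`. -/
theorem sInf_localTime_eq {X : ℝ → V} (hX : Measurable X) (x : V) {u : ℝ} (hu : 0 < u) :
    sInf {t : ℝ | 0 ≤ t ∧ localTime X t x = u} = sInf {t : ℝ | 0 ≤ t ∧ u ≤ localTime X t x} := by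
  have key : ∀ t : ℝ, 0 ≤ t → u ≤ localTime X t x → ∃ s ≤ t, 0 ≤ s ∧ localTime X s x = u := by
    intro t ht hut
    have := intermediate_value_Icc ht (continuous_localTime hX x).continuousOn
    obtain ⟨s, hs, hs'⟩ := this ⟨by rw [localTime_zero]; exact hu.le, hut⟩
    exact ⟨s, hs.2, hs.1, hs'⟩
  have hsub : {t : ℝ | 0 ≤ t ∧ localTime X t x = u} ⊆ {t : ℝ | 0 ≤ t ∧ u ≤ localTime X t x} :=
    fun t ht => ⟨ht.1, ht.2.ge⟩
  rcases Set.eq_empty_or_nonempty {t : ℝ | 0 ≤ t ∧ u ≤ localTime X t x} with h | h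
  · rw [h, Set.subset_eq_empty hsub h]
  · obtain ⟨t, ht, hut⟩ := h
    obtain ⟨s, -, hs⟩ := key t ht hut
    refine le_antisymm (le_csInf ⟨t, ht, hut⟩ fun t ⟨ht, hut⟩ => ?_)
      (csInf_le_csInf ⟨0, fun t (ht : 0 ≤ t ∧ u ≤ localTime X t x) => ht.1⟩ ⟨s, hs⟩ hsub)
    obtain ⟨s, hst, hs⟩ := key t ht hut
    exact (csInf_le ⟨0, fun t (ht : 0 ≤ t ∧ localTime X t x = u) => ht.1⟩ hs).trans hst

end Paths

/-! ### The self-interacting process driven by arbitrary stacks -/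

namespace Network

section Steps

variable {V E : Type*} (G : Network V E) (x₀ : V)

/-- A choice of an edge satisfying `p`. -/
def chooseEdge (p : E → Prop) : Option E := if h : ∃ e, p e then some h.choose else none

theorem firstEdge_eq_chooseEdge (x : V) (c : E → ℝ) :
    G.firstEdge x c =
      chooseEdge fun e => G.Incident e x ∧ ∀ e', G.Incident e' x → c e ≤ c e' := rfl

/-- One step of the recursion for `checkState`, given the set `p` of the edges whose stack drops. -/
def checkStep (p : E → Prop) (T : ℝ≥0∞) (x : V) (ℓ : V → ℝ) (s : ℝ) (ℓ' : V → ℝ) (C : Set E)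
    (coin : Bool) : ℝ≥0∞ × V × (V → ℝ) :=
  if h : ∃ e, p e then (T + ofReal s, G.checkMove x₀ x h.choose C coin, ℓ') else (⊤, x, ℓ)

/-- The time before one of the stacks drops, if the stacks are the functions `st` of the local
times. -/
def dropWait (st : (V → ℝ) → E → ℕ) (x : V) (ℓ : V → ℝ) : ℝ :=
  sInf {s : ℝ | 0 ≤ s ∧ ∃ e, st (ℓ + Pi.single x s) e < st ℓ e}

/-- The analogue of `checkState` for a process started at `x` whose stacks are the functions `st` of
the local times. -/
def dropState (st : (V → ℝ) → E → ℕ) (x : V) (c : ℕ → Bool) : ℕ → ℝ≥0∞ × V × (V → ℝ)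
  | 0 => (0, x, 0)
  | k + 1 =>
    G.checkStep x₀
      (fun e => st ((dropState st x c k).2.2 + Pi.single (dropState st x c k).2.1
        (dropWait st (dropState st x c k).2.1 (dropState st x c k).2.2)) e <
          st (dropState st x c k).2.2 e)
      (dropState st x c k).1 (dropState st x c k).2.1 (dropState st x c k).2.2
      (dropWait st (dropState st x c k).2.1 (dropState st x c k).2.2)
      ((dropState st x c k).2.2 + Pi.single (dropState st x c k).2.1
        (dropWait st (dropState st x c k).2.1 (dropState st x c k).2.2))
      {e | 0 < st ((dropState st x c k).2.2 + Pi.single (dropState st x c k).2.1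
        (dropWait st (dropState st x c k).2.1 (dropState st x c k).2.2)) e} (c k)

/-- The process started at `x` whose stacks are the functions `st` of the local times. -/
def dropWalk (st : (V → ℝ) → E → ℕ) (x : V) (c : ℕ → Bool) : ℝ → V :=
  stepPath (fun k => (G.dropState x₀ st x c k).1) (fun k => (G.dropState x₀ st x c k).2.1)

/-- The first time when the local time of the process exceeds `r` somewhere. -/
def dropTime (st : (V → ℝ) → E → ℕ) (r : V → ℝ) (x : V) (c : ℕ → Bool) : ℝ :=
  sInf {t : ℝ | 0 ≤ t ∧ ∃ y, r y ≤ localTime (G.dropWalk x₀ st x c) t y}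

/-- The recursion uses the field and the spacings only through the stacks as functions of the local
times. That form, with an arbitrary starting point, is stable under restarting at the first drop,
which a process started at `x₀` from a field is not. -/
theorem checkState_eq (φ : V → ℝ) (γ : E → ℕ → ℝ) (c : ℕ → Bool) (k : ℕ) :
    G.checkState x₀ φ γ c k = G.dropState x₀ (G.checkStack x₀ φ γ) x₀ c k := by
  induction k with
  | zero => rfl
  | succ k ih => rw [checkState, dropState, ← ih]; rfl

theorem checkWalk_eq (φ : V → ℝ) (γ : E → ℕ → ℝ) (c : ℕ → Bool) :
    G.checkWalk x₀ φ γ c = G.dropWalk x₀ (G.checkStack x₀ φ γ) x₀ c := by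
  unfold checkWalk dropWalk
  simp only [checkState_eq]

/-- A real square root vanishes exactly when its argument is nonpositive, so the extinction time is
the entrance time in an upward closed set, namely where some local time is at least `φ ^ 2 / 2`. -/
theorem checkT_eq (φ : V → ℝ) (γ : E → ℕ → ℝ) (c : ℕ → Bool) :
    G.checkT x₀ φ γ c = G.dropTime x₀ (G.checkStack x₀ φ γ) (fun y => φ y ^ 2 / 2) x₀ c := by
  unfold checkT dropTime
  simp only [checkWalk_eq, checkPhi, Real.sqrt_eq_zero', sq_abs]
  congr 1
  ext t
  refine and_congr Iff.rfl (exists_congr fun y => ?_)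
  constructor <;> intro h <;> linarith

end Steps

variable {V E : Type*} [Fintype V] [Fintype E] [MeasurableSpace V] [MeasurableSingletonClass V]
  (G : Network V E) (x₀ : V)

/-! ### Measurability of the walk and of the enlarged process -/

section Walk

theorem measurableSet_firstEdge (x : V) (o : Option E) :
    MeasurableSet {c : E → ℝ | G.firstEdge x c = o} := by
  let _ : MeasurableSpace (Option E) := ⊤
  have h : Measurable fun c : E → ℝ => G.firstEdge x c :=
    measurable_of_fibers (Y := Option E) (Z := E → ℝ) (D := E → Prop)
      (g := fun c e => G.Incident e x ∧ ∀ e', G.Incident e' x → c e ≤ c e')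
      (f := fun p _ => chooseEdge p)
      (measurableSet_fiber_pred fun e => ?_) (fun p => measurable_const)
  · exact h (MeasurableSpace.measurableSet_top (s := {o}))
  refine (MeasurableSet.const _).inter (measurableSet_forall fun e' => ?_)
  by_cases h : G.Incident e' x
  · simpa [h] using measurableSet_le (measurable_pi_apply e) (measurable_pi_apply e')
  · simp [h]

theorem measurable_walkState (k : ℕ) :
    Measurable fun ξ : ℕ → E → ℝ => G.walkState x₀ ξ k := by
  induction k with
  | zero => exact measurable_const
  | succ k ih =>
    have hstep : ∀ (x : V) (o : Option E), Measurable fun p : ℝ≥0∞ × (ℕ → E → ℝ) =>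
        (match o with
          | none => ((⊤ : ℝ≥0∞), x)
          | some e => (p.1 + ofReal (p.2 k e), G.other e x)) := by
      intro x o
      cases o with
      | none => exact measurable_const
      | some e => dsimp only; fun_prop
    have h1 : ∀ x : V, Measurable fun ξ : ℕ → E → ℝ =>
        (match G.firstEdge x (ξ k) with
          | none => ((⊤ : ℝ≥0∞), x)
          | some e => ((G.walkState x₀ ξ k).1 + ofReal (ξ k e), G.other e x)) := by
      intro x
      refine measurable_of_fibers (g := fun ξ : ℕ → E → ℝ => G.firstEdge x (ξ k))
        (f := fun o ξ => (match o with
          | none => ((⊤ : ℝ≥0∞), x)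
          | some e => ((G.walkState x₀ ξ k).1 + ofReal (ξ k e), G.other e x)))
        (fun o => (G.measurableSet_firstEdge x o).preimage (measurable_pi_apply k)) fun o => ?_
      exact (hstep x o).comp (ih.fst.prodMk measurable_id)
    exact measurable_of_fibers (g := fun ξ : ℕ → E → ℝ => (G.walkState x₀ ξ k).2)
      (f := fun x ξ => (match G.firstEdge x (ξ k) with
          | none => ((⊤ : ℝ≥0∞), x)
          | some e => ((G.walkState x₀ ξ k).1 + ofReal (ξ k e), G.other e x)))
      ih.snd.fiber h1

variable {Z : Type*} [MeasurableSpace Z]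

theorem measurable_walk {ξ : Z → ℕ → E → ℝ} {t : Z → ℝ} (hξ : Measurable ξ) (ht : Measurable t) :
    Measurable fun z => G.walk x₀ (ξ z) (t z) :=
  measurable_stepPath (fun k => (G.measurable_walkState x₀ k).fst.comp hξ)
    (fun k => (G.measurable_walkState x₀ k).snd.comp hξ) ht

theorem measurable_walk_path (ξ : ℕ → E → ℝ) : Measurable (G.walk x₀ ξ) :=
  G.measurable_walk x₀ measurable_const measurable_id

theorem measurable_walk_localTime {ξ : Z → ℕ → E → ℝ} {t : Z → ℝ} (hξ : Measurable ξ)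
    (ht : Measurable t) (x : V) : Measurable fun z => localTime (G.walk x₀ (ξ z)) (t z) x :=
  measurable_localTime (X := fun z => G.walk x₀ (ξ z))
    (G.measurable_walk (Z := Z × ℝ) (ξ := fun p => ξ p.1) x₀ (hξ.comp measurable_fst)
      measurable_snd) ht x

theorem measurable_tau {u : ℝ} (hu : 0 < u) {ξ : Z → ℕ → E → ℝ} (hξ : Measurable ξ) :
    Measurable fun z => G.tau x₀ u (ξ z) := by
  simp only [tau, sInf_localTime_eq (G.measurable_walk_path x₀ _) x₀ hu]
  refine measurable_sInf_of_monotone (p := fun z t => u ≤ localTime (G.walk x₀ (ξ z)) t x₀)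
    (fun t => measurableSet_le measurable_const
      (G.measurable_walk_localTime x₀ hξ measurable_const x₀)) fun z s t _ hst h => ?_
  exact h.trans (localTime_mono (G.measurable_walk_path x₀ _) x₀ hst)

theorem measurable_crossings {ξ : Z → ℕ → E → ℝ} {t : Z → ℝ} (hξ : Measurable ξ)
    (ht : Measurable t) (e : E) : Measurable fun z => G.crossings x₀ (ξ z) (t z) e := by
  refine measurable_natCard fun k => ?_
  refine (measurableSet_le ((G.measurable_walkState x₀ (k + 1)).fst.comp hξ)
    ht.ennreal_ofReal).inter ?_
  have : {z | G.firstEdge (G.walkState x₀ (ξ z) k).2 (ξ z k) = some e} =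
      {z | ∃ x, (G.walkState x₀ (ξ z) k).2 = x ∧ G.firstEdge x (ξ z k) = some e} := by
    ext z; simp
  change MeasurableSet {z | G.firstEdge (G.walkState x₀ (ξ z) k).2 (ξ z k) = some e}
  rw [this]
  refine measurableSet_exists fun x => MeasurableSet.inter ?_ ?_
  · exact ((G.measurable_walkState x₀ k).snd.comp hξ).fiber x
  · exact (G.measurableSet_firstEdge x (some e)).preimage ((measurable_pi_apply k).comp hξ)

theorem measurable_Phi {φ : Z → V → ℝ} {ξ : Z → ℕ → E → ℝ} {t : Z → ℝ} (hφ : Measurable φ)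
    (hξ : Measurable ξ) (ht : Measurable t) (x : V) :
    Measurable fun z => G.Phi x₀ (φ z) (ξ z) (t z) x := by
  have h1 := G.measurable_walk_localTime x₀ hξ ht x
  have h2 : Measurable fun z => |φ z x| := ((measurable_pi_apply x).comp hφ).abs
  exact ((h2.pow_const 2).add (h1.const_mul 2)).sqrt

theorem measurable_stack {φ : Z → V → ℝ} {ξ : Z → ℕ → E → ℝ} {γ : Z → E → ℕ → ℝ}
    {n₀ : Z → E → ℕ} {t : Z → ℝ} (hφ : Measurable φ) (hξ : Measurable ξ) (hγ : Measurable γ)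
    (hn : Measurable n₀) (ht : Measurable t) (e : E) :
    Measurable fun z => G.stack x₀ (φ z) (ξ z) (γ z) (n₀ z) (t z) e := by
  have hγe : Measurable fun z => γ z e := (measurable_pi_apply e).comp hγ
  have h1 : Measurable fun z => G.J (G.Phi x₀ (φ z) (ξ z) (t z)) e :=
    ((G.measurable_Phi x₀ hφ hξ ht (G.fst e)).const_mul _).mul
      (G.measurable_Phi x₀ hφ hξ ht (G.snd e))
  have h2 : Measurable fun z => G.J (fun x => |φ z x|) e :=
    ((((measurable_pi_apply (G.fst e)).comp hφ).abs).const_mul _).mul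
      (((measurable_pi_apply (G.snd e)).comp hφ).abs)
  exact (((measurable_pi_apply e).comp hn).add ((hγe.countUpTo h1).sub (hγe.countUpTo h2))).add
    (G.measurable_crossings x₀ hξ ht e)

theorem measurable_trajectory {u : ℝ} (hu : 0 < u) {φ : Z → V → ℝ} {ξ : Z → ℕ → E → ℝ}
    {γ : Z → E → ℕ → ℝ} {n₀ : Z → E → ℕ} (hφ : Measurable φ) (hξ : Measurable ξ)
    (hγ : Measurable γ) (hn : Measurable n₀) :
    Measurable fun z => G.trajectory x₀ u (φ z) (ξ z) (γ z) (n₀ z) := by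
  have hτ := G.measurable_tau x₀ hu hξ
  refine hτ.prodMk (measurable_pi_lambda _ fun t => ?_)
  have ht : Measurable fun z => min (t : ℝ) (G.tau x₀ u (ξ z)) := measurable_const.min hτ
  exact (G.measurable_walk x₀ hξ ht).prodMk
    (measurable_pi_lambda _ fun e => G.measurable_stack x₀ hφ hξ hγ hn ht e)

theorem measurable_finalField {u : ℝ} (hu : 0 < u) {φ : Z → V → ℝ} {ξ : Z → ℕ → E → ℝ}
    {σ : Z → V → ℤˣ} (hφ : Measurable φ) (hξ : Measurable ξ) (hσ : Measurable σ) :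
    Measurable fun z => G.finalField x₀ u (φ z) (ξ z) (σ z) := by
  refine measurable_pi_lambda _ fun x => ?_
  have h1 : Measurable fun z => (((σ z x : ℤ) : ℝ)) :=
    (measurable_of_countable fun s : ℤˣ => ((s : ℤ) : ℝ)).comp ((measurable_pi_apply x).comp hσ)
  exact h1.mul (G.measurable_Phi x₀ hφ hξ (G.measurable_tau x₀ hu hξ) x)

end Walk

/-! ### Measurability of the self-interacting process -/

section Check

theorem checkPhi_antitone {φ ℓ ℓ' : V → ℝ} {x : V} (h : ℓ x ≤ ℓ' x) :
    checkPhi φ ℓ' x ≤ checkPhi φ ℓ x :=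
  Real.sqrt_le_sqrt (by linarith)

theorem countBefore_mono {γ : ℕ → ℝ} (h : GoodSpacing γ) {r s : ℝ} (hrs : r ≤ s) :
    countBefore γ r ≤ countBefore γ s := by
  obtain ⟨n, h1, h2⟩ := h.exists_countBefore r
  obtain ⟨m, h3, h4⟩ := h.exists_countBefore s
  rw [countBefore_eq h.1 h1 h2, countBefore_eq h.1 h3 h4]
  by_contra hmn
  exact absurd (h1 m (not_le.1 hmn)) (not_lt.2 (hrs.trans h4))

theorem checkStack_antitone {φ ℓ ℓ' : V → ℝ} {γ : E → ℕ → ℝ} (hγ : ∀ e, GoodSpacing (γ e))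
    (h : ∀ x, ℓ x ≤ ℓ' x) (e : E) : G.checkStack x₀ φ γ ℓ' e ≤ G.checkStack x₀ φ γ ℓ e := by
  unfold checkStack
  split_ifs
  · refine countBefore_mono (hγ e) ?_
    have hW := (G.W_pos e).le
    refine mul_le_mul_of_nonneg_left ?_ two_pos.le
    unfold J
    have h0 : ∀ ℓ x, 0 ≤ checkPhi φ ℓ x := fun _ _ => sqrt_nonneg _
    exact mul_le_mul (mul_le_mul_of_nonneg_left (checkPhi_antitone (h _)) hW)
      (checkPhi_antitone (h _)) (h0 _ _) (mul_nonneg hW (h0 _ _))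
  · exact le_rfl

variable {Z : Type*} [MeasurableSpace Z]

theorem measurable_checkPhi {φ ℓ : Z → V → ℝ} (hφ : Measurable φ) (hℓ : Measurable ℓ) (x : V) :
    Measurable fun z => checkPhi (φ z) (ℓ z) x := by
  have h2 : Measurable fun z => |φ z x| := ((measurable_pi_apply x).comp hφ).abs
  exact ((h2.pow_const 2).sub (((measurable_pi_apply x).comp hℓ).const_mul 2)).sqrt

theorem measurableSet_fieldSign {φ : Z → V → ℝ} (hφ : Measurable φ) (x y : V) :
    MeasurableSet {z | fieldSign x₀ (φ z) x * fieldSign x₀ (φ z) y = 1} := by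
  let _ : MeasurableSpace SignType := ⊤
  have hsign : Measurable fun r : ℝ => SignType.sign r := by
    have : (fun r : ℝ => SignType.sign r) =
        fun r => if 0 < r then 1 else if r < 0 then -1 else 0 := by
      funext r; rw [sign_apply]
    rw [this]
    exact Measurable.ite measurableSet_Ioi measurable_const
      (Measurable.ite measurableSet_Iio measurable_const measurable_const)
  have h : ∀ x s, MeasurableSet {z | fieldSign x₀ (φ z) x = s} := by
    intro x s
    unfold fieldSign
    split_ifs
    · exact MeasurableSet.const _
    · exact (MeasurableSpace.measurableSet_top (s := {s})).preimage
        (hsign.comp ((measurable_pi_apply x).comp hφ))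
  have : {z | fieldSign x₀ (φ z) x * fieldSign x₀ (φ z) y = 1} =
      {z | ∃ p : SignType × SignType, (fieldSign x₀ (φ z) x = p.1 ∧ fieldSign x₀ (φ z) y = p.2) ∧
        p.1 * p.2 = 1} := by
    ext z; simp
  exact this ▸ measurableSet_exists fun p => ((h x p.1).inter (h y p.2)).inter
    (MeasurableSet.const _)

theorem measurable_checkStack {φ ℓ : Z → V → ℝ} {γ : Z → E → ℕ → ℝ} (hφ : Measurable φ)
    (hγ : Measurable γ) (hℓ : Measurable ℓ) (e : E) :
    Measurable fun z => G.checkStack x₀ (φ z) (γ z) (ℓ z) e := by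
  have h1 := measurableSet_fieldSign x₀ hφ (G.fst e) (G.snd e)
  unfold checkStack
  refine Measurable.ite h1 ?_ measurable_const
  refine Measurable.countBefore ((measurable_pi_apply e).comp hγ) (Measurable.const_mul ?_ _)
  exact ((measurable_checkPhi hφ hℓ _).const_mul _).mul (measurable_checkPhi hφ hℓ _)

theorem measurable_add_single {ℓ : Z → V → ℝ} {x : Z → V} {s : Z → ℝ} (hℓ : Measurable ℓ)
    (hx : Measurable x) (hs : Measurable s) :
    Measurable fun z => ℓ z + Pi.single (x z) (s z) := by
  refine measurable_of_fibers (g := x) (f := fun y z => ℓ z + Pi.single y (s z)) hx.fiber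
    fun y => ?_
  refine hℓ.add (measurable_pi_lambda _ fun v => ?_)
  by_cases h : v = y
  · subst h; simpa using hs
  · simp [h]

/-- A measurable family of stacks which are antitone functions of the local times. -/
structure MeasStack (st : Z → (V → ℝ) → E → ℕ) : Prop where
  joint : ∀ e, Measurable fun p : Z × (V → ℝ) => st p.1 p.2 e
  anti : ∀ z ℓ ℓ', (∀ x, ℓ x ≤ ℓ' x) → ∀ e, st z ℓ' e ≤ st z ℓ e

theorem MeasStack.meas {st : Z → (V → ℝ) → E → ℕ} (hst : MeasStack st) (ℓ : Z → V → ℝ)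
    (hℓ : Measurable ℓ) (e : E) : Measurable fun z => st z (ℓ z) e :=
  (hst.joint e).comp (measurable_id.prodMk hℓ)

theorem MeasStack.comp {Y : Type*} [MeasurableSpace Y] {st : Z → (V → ℝ) → E → ℕ}
    (hst : MeasStack st) {g : Y → Z} (hg : Measurable g) : MeasStack fun y => st (g y) :=
  ⟨fun e => (hst.joint e).comp ((hg.comp measurable_fst).prodMk measurable_snd),
    fun y => hst.anti (g y)⟩

theorem measurable_dropWait {st : Z → (V → ℝ) → E → ℕ} (hst : MeasStack st) {ℓ : Z → V → ℝ}
    {x : Z → V} (hx : Measurable x) (hℓ : Measurable ℓ) :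
    Measurable fun z => dropWait (st z) (x z) (ℓ z) := by
  let p : Z → ℝ → Prop := fun z s => ∃ e, st z (ℓ z + Pi.single (x z) s) e < st z (ℓ z) e
  have hm : ∀ t, MeasurableSet {z | p z t} := fun t =>
    measurableSet_exists fun e => measurableSet_lt
      (hst.meas _ (measurable_add_single hℓ hx measurable_const) e) (hst.meas _ hℓ e)
  have hp : ∀ z s t, 0 ≤ s → s ≤ t → p z s → p z t := by
    rintro z s t hs hst' ⟨e, he⟩
    refine ⟨e, lt_of_le_of_lt (hst.anti z _ _ (fun y => ?_) e) he⟩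
    by_cases h : y = x z
    · subst h; simpa using hst'
    · simp [h]
  exact measurable_sInf_of_monotone hm hp

theorem measurable_checkMove {x : Z → V} {C : Z → Set E} {b : Z → Bool} (e : E)
    (hx : Measurable x) (hC : ∀ e, MeasurableSet {z | e ∈ C z}) (hb : Measurable b) :
    Measurable fun z => G.checkMove x₀ (x z) e (C z) (b z) :=
  measurable_of_fibers (g := x) (f := fun y z => G.checkMove x₀ y e (C z) (b z)) hx.fiber fun y =>
    measurable_of_fibers (g := C) (f := fun S z => G.checkMove x₀ y e S (b z)) (measurableSet_fiber_set hC)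
      fun S => (measurable_of_countable fun b => G.checkMove x₀ y e S b).comp hb

theorem measurable_checkStep {p : Z → E → Prop} {T : Z → ℝ≥0∞} {x : Z → V} {ℓ ℓ' : Z → V → ℝ}
    {s : Z → ℝ} {C : Z → Set E} {b : Z → Bool} (hp : ∀ e, MeasurableSet {z | p z e})
    (hT : Measurable T) (hx : Measurable x) (hℓ : Measurable ℓ) (hℓ' : Measurable ℓ')
    (hs : Measurable s) (hC : ∀ e, MeasurableSet {z | e ∈ C z}) (hb : Measurable b) :
    Measurable fun z => G.checkStep x₀ (p z) (T z) (x z) (ℓ z) (s z) (ℓ' z) (C z) (b z) := by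
  refine measurable_of_fibers (g := p)
    (f := fun q z => G.checkStep x₀ q (T z) (x z) (ℓ z) (s z) (ℓ' z) (C z) (b z))
    (measurableSet_fiber_pred hp) fun q => ?_
  unfold checkStep
  by_cases h : ∃ e, q e
  · simp only [h, dite_true]
    exact (hT.add hs.ennreal_ofReal).prodMk
      ((G.measurable_checkMove x₀ h.choose hx hC hb).prodMk hℓ')
  · simp only [h, dite_false]
    exact measurable_const.prodMk (hx.prodMk hℓ)

theorem measurable_dropState {st : Z → (V → ℝ) → E → ℕ} (hst : MeasStack st) {x : Z → V}
    {c : Z → ℕ → Bool} (hx : Measurable x) (hc : Measurable c) (k : ℕ) :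
    Measurable fun z => G.dropState x₀ (st z) (x z) (c z) k := by
  induction k with
  | zero => exact measurable_const.prodMk (hx.prodMk measurable_const)
  | succ k ih =>
    have hx := ih.snd.fst
    have hℓ := ih.snd.snd
    have hs := measurable_dropWait hst hx hℓ
    have hℓ' := measurable_add_single hℓ hx hs
    have hck : Measurable fun z => c z k := (measurable_pi_apply k).comp hc
    exact G.measurable_checkStep x₀ (fun e => measurableSet_lt (hst.meas _ hℓ' e) (hst.meas _ hℓ e))
      ih.fst hx hℓ hℓ' hs (fun e => measurableSet_lt measurable_const (hst.meas _ hℓ' e)) hck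

theorem measurable_dropWalk {st : Z → (V → ℝ) → E → ℕ} (hst : MeasStack st) {x : Z → V}
    {c : Z → ℕ → Bool} {t : Z → ℝ} (hx : Measurable x) (hc : Measurable c) (ht : Measurable t) :
    Measurable fun z => G.dropWalk x₀ (st z) (x z) (c z) (t z) :=
  measurable_stepPath (fun k => (G.measurable_dropState x₀ hst hx hc k).fst)
    (fun k => (G.measurable_dropState x₀ hst hx hc k).snd.fst) ht

theorem measurable_dropWalk_path (st : (V → ℝ) → E → ℕ) (x : V) (c : ℕ → Bool) :
    Measurable (G.dropWalk x₀ st x c) :=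
  measurable_stepPath (fun _ => measurable_const) (fun _ => measurable_const) measurable_id

theorem measurable_dropWalk_localTime {st : Z → (V → ℝ) → E → ℕ} (hst : MeasStack st) {x : Z → V}
    {c : Z → ℕ → Bool} {t : Z → ℝ} (hx : Measurable x) (hc : Measurable c) (ht : Measurable t) :
    Measurable fun z => localTime (G.dropWalk x₀ (st z) (x z) (c z)) (t z) := by
  refine measurable_pi_lambda _ fun y => ?_
  exact measurable_localTime (X := fun z => G.dropWalk x₀ (st z) (x z) (c z))
    (G.measurable_dropWalk (Z := Z × ℝ) (st := fun p => st p.1) (x := fun p => x p.1)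
      (c := fun p => c p.1) x₀ (hst.comp measurable_fst) (hx.comp measurable_fst)
      (hc.comp measurable_fst) measurable_snd) ht y

theorem measurable_dropTime {st : Z → (V → ℝ) → E → ℕ} (hst : MeasStack st) {x : Z → V}
    {c : Z → ℕ → Bool} {r : Z → V → ℝ} (hr : Measurable r) (hx : Measurable x)
    (hc : Measurable c) : Measurable fun z => G.dropTime x₀ (st z) (r z) (x z) (c z) := by
  refine measurable_sInf_of_monotone
    (p := fun z t => ∃ y, r z y ≤ localTime (G.dropWalk x₀ (st z) (x z) (c z)) t y)
    (fun t => ?_) ?_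
  · exact measurableSet_exists fun y => measurableSet_le ((measurable_pi_apply y).comp hr)
      ((measurable_pi_apply y).comp
        (G.measurable_dropWalk_localTime x₀ hst hx hc measurable_const))
  · rintro z s t - hst ⟨y, hy⟩
    exact ⟨y, hy.trans (localTime_mono (G.measurable_dropWalk_path x₀ _ _ _) y hst)⟩

theorem measStack_checkStack {φ : Z → V → ℝ} {γ : Z → E → ℕ → ℝ} (hφ : Measurable φ)
    (hγ : Measurable γ) (hgood : ∀ z e, GoodSpacing (γ z e)) :
    MeasStack fun z => G.checkStack x₀ (φ z) (γ z) where
  joint e := G.measurable_checkStack (φ := fun p : Z × (V → ℝ) => φ p.1) (γ := fun p => γ p.1) x₀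
    (hφ.comp measurable_fst) (hγ.comp measurable_fst) measurable_snd e
  anti z _ _ h e := G.checkStack_antitone x₀ (hgood z) h e

/-- Good spacings are required everywhere and not almost everywhere: the waiting times are entrance
times, measurable thanks to the monotonicity of the stacks, which holds for good spacings.
`exists_goodSpacing_modification` reduces the general case to this one. -/
theorem measurable_checkTrajectory {φ : Z → V → ℝ} {γ : Z → E → ℕ → ℝ} {c : Z → ℕ → Bool}
    (hφ : Measurable φ) (hγ : Measurable γ) (hc : Measurable c)
    (hgood : ∀ z e, GoodSpacing (γ z e)) :
    Measurable fun z => G.checkTrajectory x₀ (φ z) (γ z) (c z) := by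
  have hst := G.measStack_checkStack x₀ hφ hγ hgood
  simp only [checkTrajectory, checkT_eq, checkWalk_eq]
  have hr : Measurable fun z => fun y => φ z y ^ 2 / 2 := by fun_prop
  have hT := G.measurable_dropTime (x := fun _ => x₀) x₀ hst hr measurable_const hc
  refine hT.prodMk (measurable_pi_lambda _ fun t => ?_)
  have ht := (hT.sub (measurable_const (a := (t : ℝ)))).max (measurable_const (a := (0 : ℝ)))
  exact (G.measurable_dropWalk x₀ hst measurable_const hc ht).prodMk (measurable_pi_lambda _
    (hst.meas _ (G.measurable_dropWalk_localTime x₀ hst measurable_const hc ht)))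

end Check

end Network

/-! ### A σ-algebra on lists -/

section Lists

variable {α β Z : Type*} [MeasurableSpace α] [MeasurableSpace β] [MeasurableSpace Z]

/-- The σ-algebra on lists for which a set is measurable if its lists of length `m` form a
measurable subset of `Fin m → α`. -/
instance instMeasurableSpaceList : MeasurableSpace (List α) :=
  ⨅ m, (inferInstance : MeasurableSpace (Fin m → α)).map List.ofFn

theorem measurable_ofFn (m : ℕ) : Measurable (List.ofFn : (Fin m → α) → List α) := by
  intro s hs
  exact MeasurableSpace.measurableSet_iInf.1 hs m

theorem measurable_of_list {g : List α → β}
    (hg : ∀ m, Measurable fun v : Fin m → α => g (List.ofFn v)) :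
    Measurable g := fun _ hA => MeasurableSpace.measurableSet_iInf.2 fun m => hg m hA

theorem measurable_list_length : Measurable (List.length : List α → ℕ) :=
  measurable_of_list fun m => by simp

/-- The σ-algebra on lists is a final one, which says nothing directly about products with a
parameter space. Decompose along the length and recover the entries by `getD`; the default value
forces the case of an empty `α`, where only the empty list exists, to be separate. -/
theorem measurable_of_prod_list {g : Z × List α → β}
    (hg : ∀ m, Measurable fun p : Z × (Fin m → α) => g (p.1, List.ofFn p.2)) : Measurable g := by
  rcases isEmpty_or_nonempty α with hα | ⟨⟨a₀⟩⟩
  · have : g = (fun p : Z × (Fin 0 → α) => g (p.1, List.ofFn p.2)) ∘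
        fun p : Z × List α => (p.1, Fin.elim0) := by
      funext p
      rcases p with ⟨z, _ | ⟨a, L⟩⟩
      · simp
      · exact hα.elim a
    rw [this]
    exact (hg 0).comp (measurable_fst.prodMk measurable_const)
  · have hT : ∀ m, Measurable fun (L : List α) (i : Fin m) => L.getD i a₀ := by
      refine fun m => measurable_of_list fun m' => measurable_pi_lambda _ fun i => ?_
      by_cases h : (i : ℕ) < m'
      · simpa [List.getD_eq_getElem?_getD, h] using measurable_pi_apply (⟨i, h⟩ : Fin m')
      · simp [List.getD_eq_getElem?_getD, h]
    have := measurable_of_fibers (g := fun p : Z × List α => p.2.length)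
      (f := fun m p => g (p.1, List.ofFn fun i : Fin m => p.2.getD i a₀))
      (measurable_list_length.comp measurable_snd).fiber fun m =>
        (hg m).comp (measurable_fst.prodMk ((hT m).comp measurable_snd))
    convert this using 2 with p
    rcases p with ⟨z, L⟩
    simp

theorem measurable_list_cons : Measurable fun p : α × List α => p.1 :: p.2 := by
  refine measurable_of_prod_list fun m => ?_
  have : (fun p : α × (Fin m → α) => p.1 :: List.ofFn p.2) =
      fun p => List.ofFn (Fin.cons p.1 p.2 : Fin (m + 1) → α) := by
    funext p; simp [List.ofFn_succ]
  change Measurable fun p : α × (Fin m → α) => p.1 :: List.ofFn p.2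
  rw [this]
  refine (measurable_ofFn _).comp (measurable_pi_lambda _ fun i => ?_)
  refine Fin.cases ?_ (fun j => ?_) i
  exacts [measurable_fst, (measurable_pi_apply j).comp measurable_snd]

theorem measurable_list_concat : Measurable fun p : α × List α => p.2 ++ [p.1] := by
  refine measurable_of_prod_list fun m => ?_
  have : (fun p : α × (Fin m → α) => List.ofFn p.2 ++ [p.1]) =
      fun p => List.ofFn (Fin.snoc p.2 p.1 : Fin (m + 1) → α) := by
    funext p; rw [List.ofFn_succ']; simp [List.concat_eq_append]
  change Measurable fun p : α × (Fin m → α) => List.ofFn p.2 ++ [p.1]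
  rw [this]
  refine (measurable_ofFn _).comp (measurable_pi_lambda _ fun i => ?_)
  refine Fin.lastCases ?_ (fun j => ?_) i
  · simpa using measurable_fst
  · simp only [Fin.snoc_castSucc]
    exact (measurable_pi_apply j).comp measurable_snd

theorem Measurable.list_cons {f : Z → α} {g : Z → List α} (hf : Measurable f) (hg : Measurable g) :
    Measurable fun z => f z :: g z :=
  measurable_list_cons.comp (hf.prodMk hg)

theorem Measurable.list_concat {f : Z → α} {g : Z → List α} (hf : Measurable f)
    (hg : Measurable g) : Measurable fun z => g z ++ [f z] :=
  measurable_list_concat.comp (hf.prodMk hg)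

/-- Functions defined by recursion on a list, with parameters updated along the list. -/
theorem measurable_list_rec {g : List α → Z → β} (h0 : Measurable (g []))
    (h1 : ∀ L : ℕ, (Measurable fun p : Z × (Fin L → α) => g (List.ofFn p.2) p.1) →
      Measurable fun p : (Z × α) × (Fin L → α) => g (p.1.2 :: List.ofFn p.2) p.1.1) :
    Measurable fun p : Z × List α => g p.2 p.1 := by
  refine measurable_of_prod_list fun m => ?_
  induction m with
  | zero =>
    simp only [List.ofFn_zero]
    exact h0.comp measurable_fst
  | succ m ih =>
    have := h1 m ih
    simp only [List.ofFn_succ]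
    exact this.comp ((measurable_fst.prodMk ((measurable_pi_apply 0).comp measurable_snd)).prodMk
      (measurable_pi_lambda _ fun i => (measurable_pi_apply _).comp measurable_snd))

end Lists

/-- The skeleton of a path with finitely many events: the list of the successive positions, holding
times and edges at which an event happens, and the last position and holding time. -/
abbrev Skeleton (V E : Type*) := List (V × ℝ × E) × V × ℝ

/-! ### Integration over skeletons and its reversal -/

section Skeletons

variable {V E : Type*}

/-- The local time at `z` of a list of holding times. -/
def listTime (L : List (V × ℝ × E)) (z : V) : ℝ :=
  (L.map fun p => if p.1 = z then p.2.1 else 0).sum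

/-- The final local time at `z`. -/
def skelTime (p : Skeleton V E) (z : V) : ℝ :=
  listTime p.1 z + if p.2.1 = z then p.2.2 else 0

@[simp] theorem listTime_nil (z : V) : listTime ([] : List (V × ℝ × E)) z = 0 := rfl

@[simp] theorem listTime_cons (x : V) (s : ℝ) (e : E) (L : List (V × ℝ × E)) (z : V) :
    listTime ((x, s, e) :: L) z = (if x = z then s else 0) + listTime L z := by
  simp [listTime]

@[simp] theorem listTime_concat (x : V) (s : ℝ) (e : E) (L : List (V × ℝ × E)) (z : V) :
    listTime (L ++ [(x, s, e)]) z = listTime L z + if x = z then s else 0 := by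
  simp [listTime]

variable [Fintype V] [Fintype E]

/-- The sum over the skeletons with at most `M` events, from `x` to `x₀`, whose local time at `x₀`
is `u`, computed from the first event to the last one. -/
def fwdInt (x₀ : V) : ℕ → V → ℝ → (Skeleton V E → ℝ≥0∞) → ℝ≥0∞
  | 0, x, u, f => if x = x₀ then f ([], x₀, u) else 0
  | M + 1, x, u, f => (if x = x₀ then f ([], x₀, u) else 0) +
      ∑ e : E, ∑ y : V, ∫⁻ s : ℝ, fwdInt x₀ M y (u - if x = x₀ then s else 0)
        fun p => f ((x, s, e) :: p.1, p.2)

/-- The sum over the skeletons with at most `M` events, from `x₀` to `x`, whose local time at `x₀`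
is `u`, computed from the last event to the first one. -/
def bwdInt (x₀ : V) : ℕ → V → ℝ → (Skeleton V E → ℝ≥0∞) → ℝ≥0∞
  | 0, x, u, f => if x = x₀ then f ([], x₀, u) else 0
  | M + 1, x, u, f => (if x = x₀ then f ([], x₀, u) else 0) +
      ∫⁻ s : ℝ, ∑ e : E, ∑ y : V, bwdInt x₀ M y (u - if x = x₀ then s else 0)
        fun p => f (p.1 ++ [(p.2.1, p.2.2, e)], x, s)

variable [MeasurableSpace V] [MeasurableSingletonClass V] [MeasurableSpace E]
  [MeasurableSingletonClass E]

theorem measurable_listTime (z : V) : Measurable fun L : List (V × ℝ × E) => listTime L z := by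
  have := measurable_list_rec (α := V × ℝ × E) (Z := Unit) (g := fun L _ => listTime L z)
    measurable_const fun m ih => ?_
  · exact this.comp (measurable_const.prodMk measurable_id : Measurable fun L => ((), L))
  · simp only [listTime, List.map_cons, List.sum_cons]
    refine Measurable.add ?_ (ih.comp (measurable_fst.fst.prodMk measurable_snd))
    exact Measurable.ite (measurable_fst.snd.fst (measurableSet_singleton z))
      measurable_fst.snd.snd.fst measurable_const

theorem measurable_skelTime (z : V) : Measurable fun p : Skeleton V E => skelTime p z := by
  refine ((measurable_listTime z).comp measurable_fst).add ?_
  exact Measurable.ite (measurable_snd.fst (measurableSet_singleton z))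
      measurable_snd.snd measurable_const

variable (V E) in
/-- The measure on the alternating sequences of `k + 1` edges and of `k` positions and holding
times. -/
def midMeasure : ℕ → Measure (E × List (V × ℝ × E))
  | 0 => (Measure.count : Measure E).map fun e => (e, [])
  | k + 1 => (((Measure.count : Measure E).prod ((Measure.count : Measure V).prod
      (volume : Measure ℝ))).prod (midMeasure k)).map
      fun q => (q.1.1, (q.1.2.1, q.1.2.2, q.2.1) :: q.2.2)

instance instSFiniteMidMeasure (k : ℕ) : SFinite (midMeasure V E k) := by
  induction k with
  | zero => unfold midMeasure; infer_instance
  | succ k ih => unfold midMeasure; infer_instance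

theorem lintegral_midMeasure_zero {f : E × List (V × ℝ × E) → ℝ≥0∞} (hf : Measurable f) :
    ∫⁻ p, f p ∂midMeasure V E 0 = ∑ e, f (e, []) := by
  have h0 : Measurable fun e : E => (e, ([] : List (V × ℝ × E))) :=
    measurable_id.prodMk measurable_const
  rw [midMeasure, lintegral_map hf h0, lintegral_count, tsum_fintype]

theorem lintegral_midMeasure_succ (k : ℕ) {f : E × List (V × ℝ × E) → ℝ≥0∞} (hf : Measurable f) :
    ∫⁻ p, f p ∂midMeasure V E (k + 1) = ∑ e, ∑ y, ∫⁻ s : ℝ, ∫⁻ p,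
      f (e, (y, s, p.1) :: p.2) ∂midMeasure V E k := by
  have h0 : Measurable fun q : (E × V × ℝ) × (E × List (V × ℝ × E)) =>
      (q.1.1, (q.1.2.1, q.1.2.2, q.2.1) :: q.2.2) := by
    refine measurable_fst.fst.prodMk (Measurable.list_cons ?_ measurable_snd.snd)
    exact measurable_fst.snd.fst.prodMk (measurable_fst.snd.snd.prodMk measurable_snd.fst)
  have h1 : Measurable fun q : (E × V × ℝ) × (E × List (V × ℝ × E)) =>
      f (q.1.1, (q.1.2.1, q.1.2.2, q.2.1) :: q.2.2) := hf.comp h0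
  rw [midMeasure, lintegral_map hf h0, lintegral_prod _ h1.aemeasurable]
  have h2 := h1.lintegral_prod_right' (ν := midMeasure V E k)
  rw [lintegral_prod _ h2.aemeasurable, lintegral_count, tsum_fintype]
  refine sum_congr rfl fun e _ => ?_
  have h3 : Measurable fun q : V × ℝ => ∫⁻ p, f (e, (q.1, q.2, p.1) :: p.2) ∂midMeasure V E k :=
    h2.comp (measurable_const.prodMk measurable_id : Measurable fun q : V × ℝ => (e, q))
  rw [lintegral_prod _ h3.aemeasurable, lintegral_count, tsum_fintype]

/-- The measure is a product over an alternating sequence, so by Tonelli its last triple may be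
integrated first. This is what allows the events to be read in either chronological order. -/
theorem lintegral_midMeasure_succ' (k : ℕ) {f : E × List (V × ℝ × E) → ℝ≥0∞} (hf : Measurable f) :
    ∫⁻ p, f p ∂midMeasure V E (k + 1) = ∑ e, ∑ y, ∫⁻ s : ℝ, ∫⁻ p,
      f (p.1, p.2 ++ [(y, s, e)]) ∂midMeasure V E k := by
  induction k generalizing f with
  | zero =>
    rw [lintegral_midMeasure_succ 0 hf]
    have e1 : ∀ (e : E) (y : V) (s : ℝ), ∫⁻ p, f (e, (y, s, p.1) :: p.2) ∂midMeasure V E 0 =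
        ∑ e', f (e, [(y, s, e')]) := fun e y s => lintegral_midMeasure_zero (hf.comp
      (measurable_const.prodMk ((measurable_const.prodMk (measurable_const.prodMk
        measurable_fst)).list_cons measurable_snd)))
    have e2 : ∀ (e : E) (y : V) (s : ℝ), ∫⁻ p, f (p.1, p.2 ++ [(y, s, e)]) ∂midMeasure V E 0 =
        ∑ e', f (e', [(y, s, e)]) := fun e y s => lintegral_midMeasure_zero (hf.comp
      (measurable_fst.prodMk (measurable_const.list_concat measurable_snd)))
    simp only [e1, e2]
    have e3 : ∀ (e e' : E) (y : V), Measurable fun s : ℝ => f (e, [(y, s, e')]) := fun e e' y =>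
      hf.comp (measurable_const.prodMk ((measurable_const.prodMk (measurable_id.prodMk
        measurable_const)).list_cons measurable_const))
    simp only [lintegral_finsetSum _ fun e' _ => e3 _ e' _,
      lintegral_finsetSum _ fun e' _ => e3 e' _ _]
    simp only [sum_comm (s := (univ : Finset V))]
    rw [sum_comm]
  | succ k ih =>
    have hm : ∀ e e2 y y2, Measurable fun q : (ℝ × ℝ) × (E × List (V × ℝ × E)) =>
        f (e, ((y, q.1.1, q.2.1) :: q.2.2) ++ [(y2, q.1.2, e2)]) := fun e e2 y y2 =>
      hf.comp (measurable_const.prodMk (Measurable.list_concat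
        (measurable_const.prodMk (measurable_fst.snd.prodMk measurable_const))
        ((measurable_const.prodMk (measurable_fst.fst.prodMk
          measurable_snd.fst)).list_cons measurable_snd.snd)))
    have hI := fun e e2 y y2 => (hm e e2 y y2).lintegral_prod_right' (ν := midMeasure V E k)
    obtain ⟨I, hI'⟩ : ∃ I : E → E → V → V → ℝ → ℝ → ℝ≥0∞, ∀ e e2 y y2 s s2, ∫⁻ p,
        f (e, ((y, s, p.1) :: p.2) ++ [(y2, s2, e2)]) ∂midMeasure V E k = I e e2 y y2 s s2 :=
      ⟨_, fun _ _ _ _ _ _ => rfl⟩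
    simp only [hI'] at hI
    have e1 : ∀ (e : E) (y : V) (s : ℝ), ∫⁻ p, f (e, (y, s, p.1) :: p.2) ∂midMeasure V E (k + 1) =
        ∑ e2, ∑ y2, ∫⁻ s2 : ℝ, I e e2 y y2 s s2 := fun e y s => by
      simp only [← hI']
      exact ih (hf.comp (measurable_const.prodMk ((measurable_const.prodMk (measurable_const.prodMk
        measurable_fst)).list_cons measurable_snd)))
    have e2 : ∀ (e2 : E) (y2 : V) (s2 : ℝ), ∫⁻ p, f (p.1, p.2 ++ [(y2, s2, e2)]) ∂midMeasure V E
        (k + 1) = ∑ e, ∑ y, ∫⁻ s : ℝ, I e e2 y y2 s s2 := fun e y s => by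
      simp only [← hI']
      exact lintegral_midMeasure_succ k (hf.comp
        (measurable_fst.prodMk (measurable_const.list_concat measurable_snd)))
    rw [lintegral_midMeasure_succ _ hf]
    simp only [e1, e2]
    have e3 : ∀ e e2 y y2, Measurable fun s => ∫⁻ s2, I e e2 y y2 s s2 := fun e e2 y y2 =>
      (hI e e2 y y2).lintegral_prod_right' (ν := volume)
    have e4 : ∀ e e2 y y2, Measurable fun s2 => ∫⁻ s, I e e2 y y2 s s2 := fun e e2 y y2 =>
      (hI e e2 y y2).lintegral_prod_left' (μ := volume)
    have e5 : ∀ e e2 y y2, ∫⁻ s, ∫⁻ s2, I e e2 y y2 s s2 = ∫⁻ s2, ∫⁻ s, I e e2 y y2 s s2 :=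
      fun e e2 y y2 => lintegral_lintegral_swap (hI e e2 y y2).aemeasurable
    have e6 : ∀ e y, ∫⁻ s, ∑ e2, ∑ y2, ∫⁻ s2, I e e2 y y2 s s2 =
        ∑ e2, ∑ y2, ∫⁻ s, ∫⁻ s2, I e e2 y y2 s s2 := fun e y => by
      rw [lintegral_finsetSum _ fun e2 _ => Finset.measurable_sum _ fun y2 _ => e3 e e2 y y2]
      exact sum_congr rfl fun e2 _ => lintegral_finsetSum _ fun y2 _ => e3 e e2 y y2
    have e7 : ∀ e2 y2, ∫⁻ s2, ∑ e, ∑ y, ∫⁻ s, I e e2 y y2 s s2 =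
        ∑ e, ∑ y, ∫⁻ s2, ∫⁻ s, I e e2 y y2 s s2 := fun e2 y2 => by
      rw [lintegral_finsetSum _ fun e _ => Finset.measurable_sum _ fun y _ => e4 e e2 y y2]
      exact sum_congr rfl fun e _ => lintegral_finsetSum _ fun y _ => e4 e e2 y y2
    simp only [e6, e7, e5]
    simp only [sum_comm (s := (univ : Finset V)) (t := (univ : Finset E))]
    rw [sum_comm]
    refine sum_congr rfl fun e _ => sum_congr rfl fun e' _ => ?_
    rw [sum_comm]

theorem measurable_skeleton_cons (x : V) (e : E) :
    Measurable fun q : ℝ × Skeleton V E => (((x, q.1, e) :: q.2.1, q.2.2) : Skeleton V E) :=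
  ((measurable_const.prodMk (measurable_fst.prodMk measurable_const)).list_cons
    measurable_snd.fst).prodMk measurable_snd.snd

theorem measurable_skeleton_concat (x : V) (e : E) :
    Measurable fun q : ℝ × Skeleton V E =>
      ((q.2.1 ++ [(q.2.2.1, q.2.2.2, e)], x, q.1) : Skeleton V E) :=
  (((measurable_snd.snd.fst.prodMk (measurable_snd.snd.snd.prodMk measurable_const))).list_concat
    measurable_snd.fst).prodMk (measurable_const.prodMk measurable_fst)

variable {Z : Type*} [MeasurableSpace Z]

/-- The skeleton with a given middle part and a given first holding time. -/
def skelOfFirst (x₀ x : V) (u s : ℝ) (p : E × List (V × ℝ × E)) : Skeleton V E :=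
  ((x, s, p.1) :: p.2, x₀, u - (if x = x₀ then s else 0) - listTime p.2 x₀)

/-- The skeleton with a given middle part and a given last holding time. -/
def skelOfLast (x₀ x : V) (u s : ℝ) (p : E × List (V × ℝ × E)) : Skeleton V E :=
  ((x₀, u - (if x = x₀ then s else 0) - listTime p.2 x₀, p.1) :: p.2, x, s)

theorem measurable_skelOfFirst (x₀ x : V) (u : ℝ) :
    Measurable fun q : ℝ × E × List (V × ℝ × E) => skelOfFirst x₀ x u q.1 q.2 := by
  refine ((measurable_const.prodMk (measurable_fst.prodMk measurable_snd.fst)).list_cons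
    measurable_snd.snd).prodMk (measurable_const.prodMk ?_)
  refine (measurable_const.sub ?_).sub ((measurable_listTime x₀).comp measurable_snd.snd)
  split_ifs; exacts [measurable_fst, measurable_const]

theorem measurable_skelOfLast (x₀ x : V) (u : ℝ) :
    Measurable fun q : ℝ × E × List (V × ℝ × E) => skelOfLast x₀ x u q.1 q.2 := by
  refine ((measurable_const.prodMk (Measurable.prodMk ?_ measurable_snd.fst)).list_cons
    measurable_snd.snd).prodMk (measurable_const.prodMk measurable_fst)
  refine (measurable_const.sub ?_).sub ((measurable_listTime x₀).comp measurable_snd.snd)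
  split_ifs; exacts [measurable_fst, measurable_const]

/-- The last holding time is not a variable of integration: it is determined by the local time `u`
at `x₀`. With `k + 1` events there remain the first holding time `s` and the `k` middle ones. -/
theorem fwdInt_eq (x₀ : V) (M : ℕ) (x : V) (u : ℝ) {f : Skeleton V E → ℝ≥0∞} (hf : Measurable f) :
    fwdInt x₀ M x u f = (if x = x₀ then f ([], x₀, u) else 0) +
      ∑ k ∈ range M, ∫⁻ s : ℝ, ∫⁻ p, f (skelOfFirst x₀ x u s p) ∂midMeasure V E k := by
  induction M generalizing x u f with
  | zero => simp [fwdInt]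
  | succ M ih =>
    rw [fwdInt, Finset.sum_range_succ']
    congr 1
    have e0 : ∀ s, ∫⁻ p, f (skelOfFirst x₀ x u s p) ∂midMeasure V E 0 = ∑ e,
        f ([(x, s, e)], x₀, u - if x = x₀ then s else 0) := fun s => by
      rw [lintegral_midMeasure_zero (f := fun p => f (skelOfFirst x₀ x u s p)) (hf.comp
        ((measurable_skelOfFirst x₀ x u).comp (measurable_const.prodMk measurable_id)))]
      simp [skelOfFirst]
    obtain ⟨I, hI⟩ : ∃ I : ℕ → E → V → ℝ → ℝ≥0∞, ∀ k e y s, ∫⁻ s' : ℝ, ∫⁻ p,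
        f ((x, s, e) :: (skelOfFirst x₀ y (u - if x = x₀ then s else 0) s' p).1,
          (skelOfFirst x₀ y (u - if x = x₀ then s else 0) s' p).2) ∂midMeasure V E k = I k e y s :=
      ⟨_, fun _ _ _ _ => rfl⟩
    have e1 : ∀ k s, ∫⁻ p, f (skelOfFirst x₀ x u s p) ∂midMeasure V E (k + 1) =
        ∑ e, ∑ y, I k e y s := by
      intro k s
      rw [lintegral_midMeasure_succ k (f := fun p => f (skelOfFirst x₀ x u s p)) (hf.comp
        ((measurable_skelOfFirst x₀ x u).comp (measurable_const.prodMk measurable_id)))]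
      refine sum_congr rfl fun e _ => sum_congr rfl fun y _ => ?_
      rw [← hI]
      refine lintegral_congr fun s' => lintegral_congr fun p => ?_
      simp only [skelOfFirst, listTime_cons]
      congr 3
      ring
    have hm1 : ∀ e, Measurable fun s => f ([(x, s, e)], x₀, u - if x = x₀ then s else 0) := by
      intro e
      refine hf.comp (Measurable.prodMk (Measurable.list_cons (measurable_const.prodMk
        (measurable_id.prodMk measurable_const)) measurable_const)
        (measurable_const.prodMk (measurable_const.sub ?_)))
      split_ifs; exacts [measurable_id, measurable_const]
    have hm2 : ∀ k e y, Measurable (I k e y) := by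
      intro k e y
      simp only [← funext (hI k e y)]
      refine Measurable.lintegral_prod_right' (ν := volume) (f := fun q : ℝ × ℝ => ∫⁻ p,
        f ((x, q.1, e) :: (skelOfFirst x₀ y (u - if x = x₀ then q.1 else 0) q.2 p).1,
          (skelOfFirst x₀ y (u - if x = x₀ then q.1 else 0) q.2 p).2) ∂midMeasure V E k) ?_
      refine Measurable.lintegral_prod_right' (ν := midMeasure V E k)
        (f := fun q : (ℝ × ℝ) × E × List (V × ℝ × E) =>
        f ((x, q.1.1, e) :: (skelOfFirst x₀ y (u - if x = x₀ then q.1.1 else 0) q.1.2 q.2).1,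
          (skelOfFirst x₀ y (u - if x = x₀ then q.1.1 else 0) q.1.2 q.2).2)) ?_
      refine hf.comp (Measurable.prodMk (Measurable.list_cons (measurable_const.prodMk
        (measurable_fst.fst.prodMk measurable_const)) (Measurable.list_cons
        (measurable_const.prodMk (measurable_fst.snd.prodMk measurable_snd.fst))
        measurable_snd.snd)) (measurable_const.prodMk (Measurable.sub (Measurable.sub
        (measurable_const.sub ?_) ?_) ((measurable_listTime x₀).comp measurable_snd.snd))))
      · split_ifs
        exacts [measurable_fst.fst, measurable_const]
      · split_ifs
        exacts [measurable_fst.snd, measurable_const]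
    have e2 : ∀ e y s, fwdInt x₀ M y (u - if x = x₀ then s else 0)
        (fun p => f ((x, s, e) :: p.1, p.2)) =
        (if y = x₀ then f ([(x, s, e)], x₀, u - if x = x₀ then s else 0) else 0) +
        ∑ k ∈ range M, I k e y s := by
      intro e y s
      simp only [← hI]
      exact ih y _ (hf.comp ((measurable_skeleton_cons x e).comp
        (measurable_const.prodMk measurable_id)))
    simp only [e0, e1, e2]
    have e3 : ∀ e y, ∫⁻ s : ℝ, ((if y = x₀ then f ([(x, s, e)], x₀, u - if x = x₀ then s else 0)
          else 0) + ∑ k ∈ range M, I k e y s) =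
        (if y = x₀ then ∫⁻ s : ℝ, f ([(x, s, e)], x₀, u - if x = x₀ then s else 0) else 0) +
        ∑ k ∈ range M, ∫⁻ s : ℝ, I k e y s := by
      intro e y
      rw [lintegral_add_right _ (Finset.measurable_sum _ fun k _ => hm2 k e y),
        lintegral_finsetSum _ fun k _ => hm2 k e y]
      congr 1
      split_ifs <;> simp
    simp only [e3, lintegral_finsetSum _ fun e _ => hm1 e]
    simp only [sum_add_distrib, Finset.sum_ite_eq', mem_univ, if_true]
    rw [add_comm]
    congr 1
    rw [sum_congr rfl fun e _ => sum_comm, sum_comm]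
    refine sum_congr rfl fun k _ => ?_
    rw [lintegral_finsetSum _ fun e _ => Finset.measurable_sum _ fun y _ => hm2 k e y]
    exact sum_congr rfl fun e _ => (lintegral_finsetSum _ fun y _ => hm2 k e y).symm

/-- Read from the other end, it is the first holding time, at `x₀`, which is determined by `u`. -/
theorem bwdInt_eq (x₀ : V) (M : ℕ) (x : V) (u : ℝ) {f : Skeleton V E → ℝ≥0∞} (hf : Measurable f) :
    bwdInt x₀ M x u f = (if x = x₀ then f ([], x₀, u) else 0) +
      ∑ k ∈ range M, ∫⁻ s : ℝ, ∫⁻ p, f (skelOfLast x₀ x u s p) ∂midMeasure V E k := by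
  induction M generalizing x u f with
  | zero => simp [bwdInt]
  | succ M ih =>
    rw [bwdInt, Finset.sum_range_succ']
    congr 1
    have e0 : ∀ s, ∫⁻ p, f (skelOfLast x₀ x u s p) ∂midMeasure V E 0 = ∑ e,
        f ([(x₀, u - (if x = x₀ then s else 0), e)], x, s) := fun s => by
      rw [lintegral_midMeasure_zero (f := fun p => f (skelOfLast x₀ x u s p)) (hf.comp
        ((measurable_skelOfLast x₀ x u).comp (measurable_const.prodMk measurable_id)))]
      simp [skelOfLast]
    obtain ⟨I, hI⟩ : ∃ I : ℕ → E → V → ℝ → ℝ≥0∞, ∀ k e y s, ∫⁻ s' : ℝ, ∫⁻ p,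
        f ((skelOfLast x₀ y (u - if x = x₀ then s else 0) s' p).1 ++
          [(y, s', e)], x, s) ∂midMeasure V E k = I k e y s := ⟨_, fun _ _ _ _ => rfl⟩
    have e1 : ∀ k s, ∫⁻ p, f (skelOfLast x₀ x u s p) ∂midMeasure V E (k + 1) =
        ∑ e, ∑ y, I k e y s := by
      intro k s
      rw [lintegral_midMeasure_succ' k (f := fun p => f (skelOfLast x₀ x u s p)) (hf.comp
        ((measurable_skelOfLast x₀ x u).comp (measurable_const.prodMk measurable_id)))]
      refine sum_congr rfl fun e _ => sum_congr rfl fun y _ => ?_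
      rw [← hI]
      refine lintegral_congr fun s' => lintegral_congr fun p => ?_
      simp only [skelOfLast, listTime_concat, List.cons_append]
      congr 5
      ring
    have hm1 : ∀ e, Measurable fun s => f ([(x₀, u - (if x = x₀ then s else 0), e)], x, s) := by
      intro e
      refine hf.comp (Measurable.prodMk (Measurable.list_cons (measurable_const.prodMk
        (Measurable.prodMk (measurable_const.sub ?_) measurable_const)) measurable_const)
        (measurable_const.prodMk measurable_id))
      split_ifs; exacts [measurable_id, measurable_const]
    have hm2 : ∀ k e y, Measurable (I k e y) := by
      intro k e y
      simp only [← funext (hI k e y)]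
      refine Measurable.lintegral_prod_right' (ν := volume) (f := fun q : ℝ × ℝ => ∫⁻ p,
        f ((skelOfLast x₀ y (u - if x = x₀ then q.1 else 0) q.2 p).1 ++
          [(y, q.2, e)], x, q.1) ∂midMeasure V E k) ?_
      refine Measurable.lintegral_prod_right' (ν := midMeasure V E k)
        (f := fun q : (ℝ × ℝ) × E × List (V × ℝ × E) =>
        f ((skelOfLast x₀ y (u - if x = x₀ then q.1.1 else 0) q.1.2 q.2).1 ++
          [(y, q.1.2, e)], x, q.1.1)) ?_
      refine hf.comp (Measurable.prodMk (Measurable.list_concat (measurable_const.prodMk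
        (measurable_fst.snd.prodMk measurable_const)) (Measurable.list_cons (measurable_const.prodMk
        (Measurable.prodMk (Measurable.sub (Measurable.sub
        (measurable_const.sub ?_) ?_) ((measurable_listTime x₀).comp measurable_snd.snd))
        measurable_snd.fst)) measurable_snd.snd)) (measurable_const.prodMk measurable_fst.fst))
      · split_ifs
        exacts [measurable_fst.fst, measurable_const]
      · split_ifs
        exacts [measurable_fst.snd, measurable_const]
    have e2 : ∀ e y s, bwdInt x₀ M y (u - if x = x₀ then s else 0)
        (fun p => f (p.1 ++ [(p.2.1, p.2.2, e)], x, s)) =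
        (if y = x₀ then f ([(x₀, u - (if x = x₀ then s else 0), e)], x, s) else 0) +
        ∑ k ∈ range M, I k e y s := by
      intro e y s
      simp only [← hI]
      exact ih y _ (hf.comp ((measurable_skeleton_concat x e).comp
        (measurable_const.prodMk measurable_id)))
    simp only [e0, e1, e2]
    simp only [sum_add_distrib, Finset.sum_ite_eq', mem_univ, if_true]
    rw [lintegral_add_left (Finset.measurable_sum _ fun e _ => hm1 e), add_comm]
    congr 1
    rw [← lintegral_finsetSum _ fun k _ => Finset.measurable_sum _ fun e _ =>
      Finset.measurable_sum _ fun y _ => hm2 k e y]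
    refine lintegral_congr fun s => ?_
    rw [sum_congr rfl fun e _ => sum_comm, sum_comm]

theorem measurable_extendAt (x₀ : V) (a : ℝ) :
    Measurable fun r : Off x₀ => extendAt x₀ a r := by
  refine measurable_pi_lambda _ fun x => ?_
  unfold extendAt
  split_ifs; exacts [measurable_const, measurable_pi_apply _]

theorem measurable_skelTime_pi : Measurable fun p : Skeleton V E => skelTime p :=
  measurable_pi_lambda _ measurable_skelTime

/-- Reversal of the sum over the skeletons. -/
theorem lintegral_bwdInt_eq_fwdInt (x₀ : V) (u : ℝ) (M : ℕ) {f : (V → ℝ) × Skeleton V E → ℝ≥0∞}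
    (hf : Measurable f) :
    ∫⁻ r : Off x₀, bwdInt x₀ M x₀ u
        (fun p => f (extendAt x₀ u r - skelTime p, p)) =
      ∫⁻ r : Off x₀, fwdInt x₀ M x₀ u fun p => f (extendAt x₀ 0 r, p) := by
  -- At `x₀` the subtraction leaves `u - u = 0`; elsewhere it translates `r`, which preserves
  -- Lebesgue measure.
  have key : ∀ p : Skeleton V E, skelTime p x₀ = u →
      ∫⁻ r : Off x₀, f (extendAt x₀ u r - skelTime p, p) =
      ∫⁻ r : Off x₀, f (extendAt x₀ 0 r, p) := by
    intro p hp
    rw [← lintegral_sub_right_eq_self (fun r => f (extendAt x₀ 0 r, p)) fun x => skelTime p x]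
    refine lintegral_congr fun r => ?_
    congr 2
    funext x
    by_cases h : x = x₀
    · subst h; simp [extendAt, hp]
    · simp [extendAt, h]
  have hfL : Measurable fun q : (Off x₀ × ℝ) × E × List (V × ℝ × E) =>
      f (extendAt x₀ u q.1.1 - skelTime (skelOfLast x₀ x₀ u q.1.2 q.2),
        skelOfLast x₀ x₀ u q.1.2 q.2) := by
    have h1 : Measurable fun q : (Off x₀ × ℝ) × E × List (V × ℝ × E) =>
        skelOfLast x₀ x₀ u q.1.2 q.2 :=
      (measurable_skelOfLast x₀ x₀ u).comp (measurable_fst.snd.prodMk measurable_snd)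
    exact hf.comp ((((measurable_extendAt x₀ u).comp measurable_fst.fst).sub
      (measurable_skelTime_pi.comp h1)).prodMk h1)
  have hfF : Measurable fun q : (Off x₀ × ℝ) × E × List (V × ℝ × E) =>
      f (extendAt x₀ 0 q.1.1, skelOfFirst x₀ x₀ u q.1.2 q.2) := by
    have h1 : Measurable fun q : (Off x₀ × ℝ) × E × List (V × ℝ × E) =>
        skelOfFirst x₀ x₀ u q.1.2 q.2 :=
      (measurable_skelOfFirst x₀ x₀ u).comp (measurable_fst.snd.prodMk measurable_snd)
    exact hf.comp (((measurable_extendAt x₀ 0).comp measurable_fst.fst).prodMk h1)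
  have eB : ∀ r : Off x₀, bwdInt x₀ M x₀ u
        (fun p => f (extendAt x₀ u r - skelTime p, p)) = _ := fun r =>
    bwdInt_eq x₀ M x₀ u (hf.comp ((measurable_const.sub measurable_skelTime_pi).prodMk
      measurable_id))
  have eF : ∀ r : Off x₀, fwdInt x₀ M x₀ u
        (fun p => f (extendAt x₀ 0 r, p)) = _ := fun r =>
    fwdInt_eq x₀ M x₀ u (hf.comp (measurable_const.prodMk measurable_id))
  simp only [eB, eF, if_true]
  have hB : ∀ k, Measurable fun q : Off x₀ × ℝ => ∫⁻ p,
      f (extendAt x₀ u q.1 - skelTime (skelOfLast x₀ x₀ u q.2 p), skelOfLast x₀ x₀ u q.2 p)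
        ∂midMeasure V E k := fun k => hfL.lintegral_prod_right'
  have hF : ∀ k, Measurable fun q : Off x₀ × ℝ => ∫⁻ p,
      f (extendAt x₀ 0 q.1, skelOfFirst x₀ x₀ u q.2 p) ∂midMeasure V E k :=
    fun k => hfF.lintegral_prod_right'
  rw [lintegral_add_right _ (Finset.measurable_sum _ fun k _ => (hB k).lintegral_prod_right'),
    lintegral_add_right _ (Finset.measurable_sum _ fun k _ => (hF k).lintegral_prod_right'),
    lintegral_finsetSum _ fun k _ => (hB k).lintegral_prod_right',
    lintegral_finsetSum _ fun k _ => (hF k).lintegral_prod_right']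
  congr 1
  · exact key ([], x₀, u) (by simp [skelTime])
  refine sum_congr rfl fun k _ => ?_
  have swapR : ∀ {g : Off x₀ × ℝ → E × List (V × ℝ × E) → ℝ≥0∞},
      Measurable (Function.uncurry g) →
      ∫⁻ r, ∫⁻ s, ∫⁻ p, g (r, s) p ∂midMeasure V E k =
        ∫⁻ p, (∫⁻ s, ∫⁻ r, g (r, s) p) ∂midMeasure V E k := by
    intro g hg
    have h1 : Measurable fun q : Off x₀ × ℝ => ∫⁻ p, g q p ∂midMeasure V E k :=
      hg.lintegral_prod_right'
    rw [← lintegral_prod (fun q => ∫⁻ p, g q p ∂midMeasure V E k) h1.aemeasurable,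
      lintegral_lintegral_swap hg.aemeasurable]
    refine lintegral_congr fun p => ?_
    have h2 : Measurable fun q => g q p := hg.comp (measurable_id.prodMk measurable_const)
    exact lintegral_prod_symm _ h2.aemeasurable
  rw [swapR (g := fun q p => f (extendAt x₀ u q.1 - skelTime (skelOfLast x₀ x₀ u q.2 p),
    skelOfLast x₀ x₀ u q.2 p)) hfL,
    swapR (g := fun q p => f (extendAt x₀ 0 q.1, skelOfFirst x₀ x₀ u q.2 p)) hfF]
  refine lintegral_congr fun p => ?_
  -- The first and the last holding times are both spent at `x₀` and have the fixed sum `u -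
  -- listTime p.2 x₀`; changing the one which is free is a reflection.
  have hsk : ∀ s, skelOfLast x₀ x₀ u s p = skelOfFirst x₀ x₀ u (u - listTime p.2 x₀ - s) p := by
    intro s
    have h1 : u - s - listTime p.2 x₀ = u - listTime p.2 x₀ - s := by ring
    have h2 : u - (u - listTime p.2 x₀ - s) - listTime p.2 x₀ = s := by ring
    simp only [skelOfLast, skelOfFirst, if_true, h1, h2]
  rw [← lintegral_sub_left_eq_self (fun s => ∫⁻ r : Off x₀,
    f (extendAt x₀ 0 r, skelOfFirst x₀ x₀ u s p)) (u - listTime p.2 x₀)]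
  refine lintegral_congr fun s => ?_
  rw [← hsk]
  refine key (skelOfLast x₀ x₀ u s p) ?_
  simp [skelOfLast, skelTime]

end Skeletons

/-! ### Comparison of sums over skeletons -/

section SkeletonOrder

variable {V E : Type*} [Fintype V] [Fintype E]

/-- The first position of a skeleton. -/
def headPos : List (V × ℝ × E) → V × ℝ → V
  | [], q => q.1
  | p :: _, _ => p.1

@[simp] theorem headPos_nil (q : V × ℝ) : headPos ([] : List (V × ℝ × E)) q = q.1 := rfl

@[simp] theorem headPos_cons (p : V × ℝ × E) (L : List (V × ℝ × E)) (q : V × ℝ) :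
    headPos (p :: L) q = p.1 := rfl

/-- The sum only sees skeletons with the prescribed ends and the prescribed local time at `x₀`, so
pointwise bounds may use these constraints. -/
theorem fwdInt_mono (x₀ : V) (M : ℕ) (x : V) (u : ℝ) {f g : Skeleton V E → ℝ≥0∞}
    (h : ∀ p : Skeleton V E, headPos p.1 p.2 = x → p.2.1 = x₀ → skelTime p x₀ = u → f p ≤ g p) :
    fwdInt x₀ M x u f ≤ fwdInt x₀ M x u g := by
  have h0 : ∀ (x : V) (u : ℝ) (f g : Skeleton V E → ℝ≥0∞),
      (∀ p : Skeleton V E, headPos p.1 p.2 = x → p.2.1 = x₀ → skelTime p x₀ = u → f p ≤ g p) →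
      (if x = x₀ then f ([], x₀, u) else 0) ≤ if x = x₀ then g ([], x₀, u) else 0 := by
    intro x u f g h
    split_ifs with hx
    exacts [h _ hx.symm rfl (by simp [skelTime]), le_rfl]
  induction M generalizing x u f g with
  | zero => exact h0 x u f g h
  | succ M ih =>
    refine add_le_add (h0 x u f g h) (sum_le_sum fun e _ => sum_le_sum fun y _ =>
      lintegral_mono fun s => ih y _ fun p hp hl hu => h _ rfl hl ?_)
    simp only [skelTime, listTime_cons] at hu ⊢
    linarith

theorem bwdInt_mono (x₀ : V) (M : ℕ) (x : V) (u : ℝ) {f g : Skeleton V E → ℝ≥0∞}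
    (h : ∀ p : Skeleton V E, p.2.1 = x → headPos p.1 p.2 = x₀ → skelTime p x₀ = u → f p ≤ g p) :
    bwdInt x₀ M x u f ≤ bwdInt x₀ M x u g := by
  have h0 : ∀ (x : V) (u : ℝ) (f g : Skeleton V E → ℝ≥0∞),
      (∀ p : Skeleton V E, p.2.1 = x → headPos p.1 p.2 = x₀ → skelTime p x₀ = u → f p ≤ g p) →
      (if x = x₀ then f ([], x₀, u) else 0) ≤ if x = x₀ then g ([], x₀, u) else 0 := by
    intro x u f g h
    split_ifs with hx
    exacts [h _ hx.symm rfl (by simp [skelTime]), le_rfl]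
  induction M generalizing x u f g with
  | zero => exact h0 x u f g h
  | succ M ih =>
    refine add_le_add (h0 x u f g h) (lintegral_mono fun s => sum_le_sum fun e _ =>
      sum_le_sum fun y _ => ih y _ fun p hp hl hu => h _ rfl ?_ ?_)
    · rw [← hl]; obtain ⟨L, q⟩ := p; cases L <;> simp
    · simp only [skelTime, listTime_concat] at hu ⊢
      linarith

theorem fwdInt_const_mul (x₀ : V) (M : ℕ) (x : V) (u : ℝ) (c : ℝ≥0∞) (hc : c ≠ ⊤)
    (f : Skeleton V E → ℝ≥0∞) :
    fwdInt x₀ M x u (fun p => c * f p) = c * fwdInt x₀ M x u f := by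
  induction M generalizing x u f with
  | zero => simp [fwdInt]
  | succ M ih =>
    simp only [fwdInt, mul_add, Finset.mul_sum, ← lintegral_const_mul' _ _ hc, ← ih]
    simp

theorem bwdInt_const_mul (x₀ : V) (M : ℕ) (x : V) (u : ℝ) (c : ℝ≥0∞) (hc : c ≠ ⊤)
    (f : Skeleton V E → ℝ≥0∞) :
    bwdInt x₀ M x u (fun p => c * f p) = c * bwdInt x₀ M x u f := by
  induction M generalizing x u f with
  | zero => simp [bwdInt]
  | succ M ih =>
    simp only [bwdInt, mul_add, ← lintegral_const_mul' _ _ hc, Finset.mul_sum, ← ih]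
    simp

end SkeletonOrder

/-- A path with a lifetime. -/
abbrev LifePath (V E : Type*) := ℝ × (ℝ → V × (E → ℕ))

/-! ### Paths with a given skeleton and their reversal -/

section PathOps

variable {V E : Type*}

/-- The path which stays in the state `z` for the time `s`, and then follows `T`. -/
def consPath (s : ℝ) (z : V × (E → ℕ)) (T : LifePath V E) : LifePath V E :=
  (s + T.1, fun t => if t < s then z else T.2 (t - s))

/-- The path which follows `T`, and then stays in the state `z` for the time `s`. -/
def snocPath (T : LifePath V E) (s : ℝ) (z : V × (E → ℕ)) : LifePath V E :=
  (T.1 + s, fun t => if t < T.1 then T.2 t else z)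

theorem consPath_snocPath {s : ℝ} {z : V × (E → ℕ)} {T : LifePath V E} {s' : ℝ}
    {z' : V × (E → ℕ)} (hT : 0 ≤ T.1) :
    consPath s z (snocPath T s' z') = snocPath (consPath s z T) s' z' := by
  refine Prod.ext (by simp [consPath, snocPath, add_assoc]) (funext fun t => ?_)
  simp only [consPath, snocPath]
  by_cases h : t < s
  · simp [h, show t < s + T.1 by linarith]
  · simp only [h, if_false, sub_lt_iff_lt_add']

/-- The path with a given skeleton, of which the stacks increase at the times of the events. -/
def fwdPath : (E → ℕ) → List (V × ℝ × E) → V × ℝ → LifePath V E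
  | n, [], q => (q.2, fun _ => (q.1, n))
  | n, p :: L, q => consPath p.2.1 (p.1, n) (fwdPath (n + Pi.single p.2.2 1) L q)

/-- The time-reversal of `fwdPath`, with the other choice at the times of the events. -/
def bwdPath : (E → ℕ) → List (V × ℝ × E) → V × ℝ → LifePath V E
  | n, [], q => (q.2, fun _ => (q.1, n))
  | n, p :: L, q => snocPath (bwdPath (n + Pi.single p.2.2 1) L q) p.2.1 (p.1, n)

/-- The number of events at each edge. -/
def listCount : List (V × ℝ × E) → E → ℕ
  | [] => 0
  | p :: L => Pi.single p.2.2 1 + listCount L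

theorem listCount_concat (L : List (V × ℝ × E)) (p : V × ℝ × E) :
    listCount (L ++ [p]) = listCount L + Pi.single p.2.2 1 := by
  induction L with
  | nil => simp [listCount]
  | cons a L ih => simp [listCount, ih, add_assoc]

/-- The holding times are positive. -/
def posTimes (L : List (V × ℝ × E)) (q : V × ℝ) : Prop := (∀ p ∈ L, 0 < p.2.1) ∧ 0 < q.2

theorem posTimes_cons {p : V × ℝ × E} {L : List (V × ℝ × E)} {q : V × ℝ} :
    posTimes (p :: L) q ↔ 0 < p.2.1 ∧ posTimes L q := by
  simp [posTimes, and_assoc]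

theorem bwdPath_fst_pos (n : E → ℕ) {L : List (V × ℝ × E)} {q : V × ℝ} (h : posTimes L q) :
    0 < (bwdPath n L q).1 := by
  induction L generalizing n with
  | nil => exact h.2
  | cons p L ih =>
    rw [posTimes_cons] at h
    exact add_pos (ih _ h.2) h.1

theorem fwdPath_fst (n : E → ℕ) (L : List (V × ℝ × E)) (q : V × ℝ) :
    (fwdPath n L q).1 = (bwdPath n L q).1 := by
  induction L generalizing n with
  | nil => rfl
  | cons p L ih => simp only [fwdPath, bwdPath, consPath, snocPath, ih, add_comm]

/-- The last entry of a skeleton is the beginning of the reversed path. The recursive definition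
goes from the head, whereas the self-interacting process is explored from the tail. -/
theorem bwdPath_concat (n : E → ℕ) {L : List (V × ℝ × E)} {y x : V} {t s : ℝ} {e : E}
    (h : posTimes L (y, t)) :
    bwdPath n (L ++ [(y, t, e)]) (x, s) =
      consPath s (x, n + listCount L + Pi.single e 1) (bwdPath n L (y, t)) := by
  induction L generalizing n with
  | nil =>
    simp only [List.nil_append, bwdPath, snocPath, consPath, listCount, add_zero]
    rfl
  | cons p L ih =>
    rw [posTimes_cons] at h
    rw [List.cons_append, bwdPath, ih _ h.2, bwdPath, consPath_snocPath (bwdPath_fst_pos _ h.2).le,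
      listCount]
    simp only [add_assoc]

/-- An event happens at time `t`. -/
def isEvent : List (V × ℝ × E) → ℝ → Prop
  | [], _ => False
  | p :: L, t => t = p.2.1 ∨ isEvent L (t - p.2.1)

/-- Both paths are right-continuous in their own time; reversal turns one of them into a
left-continuous path. They may therefore disagree at the event times, and only there. -/
theorem fwdPath_eq_bwdPath (n : E → ℕ) {L : List (V × ℝ × E)} (q : V × ℝ) {t : ℝ}
    (ht : ¬ isEvent L t) :
    (fwdPath n L q).2 t = (bwdPath n L q).2 ((bwdPath n L q).1 - t) := by
  induction L generalizing n t with
  | nil => rfl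
  | cons p L ih =>
    rw [isEvent, not_or] at ht
    simp only [fwdPath, bwdPath, consPath, snocPath]
    rw [ih _ ht.2]
    rcases lt_or_gt_of_ne ht.1 with h | h
    · rw [if_pos h, if_neg (by linarith)]
    · rw [if_neg h.le.not_gt, if_pos (by linarith)]
      exact congrArg _ (by ring)

theorem not_isEvent_of_lifetime_le (n : E → ℕ) {L : List (V × ℝ × E)} {q : V × ℝ} {t : ℝ}
    (h : posTimes L q) (ht : (bwdPath n L q).1 ≤ t) : ¬ isEvent L t := by
  induction L generalizing n t with
  | nil => exact id
  | cons p L ih =>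
    rw [posTimes_cons] at h
    have hp := bwdPath_fst_pos (n + Pi.single p.2.2 1) h.2
    rw [bwdPath, snocPath] at ht
    rintro (h1 | h1)
    · simp only at ht; linarith
    · exact ih (n + Pi.single p.2.2 1) h.2 (by simp only at ht; linarith) h1

/-- Changing the first holding time translates all the events, and there are finitely many of them;
so a fixed time is an event time only for finitely many values of it. This makes the exceptional
skeletons negligible. -/
theorem countable_isEvent (p : V × E) (L : List (V × ℝ × E)) (t : ℝ) :
    {s : ℝ | isEvent ((p.1, s, p.2) :: L) t}.Finite := by
  have key : ∀ L : List (V × ℝ × E), {s : ℝ | isEvent L (t - s)}.Finite := by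
    intro L
    induction L generalizing t with
    | nil => simp [isEvent]
    | cons a L ih =>
      refine ((Set.finite_singleton (t - a.2.1)).union (ih (t - a.2.1))).subset ?_
      rintro s (h | h)
      · exact Or.inl (by simp only [Set.mem_singleton_iff]; linarith)
      · exact Or.inr (by rw [sub_right_comm] at h; exact h)
  refine ((Set.finite_singleton t).union (key L)).subset ?_
  rintro s (h | h)
  exacts [Or.inl h.symm, Or.inr h]

end PathOps

namespace Network

/-! ### Counting the sign assignments compatible with the clusters -/

section SignCount

variable {V E : Type*} (G : Network V E) (x₀ : V)

/-- The assignments of signs which are constant on clusters and equal to `1` at `x₀`. -/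
def clusterSigns (C : Set E) : Set (V → ℤˣ) :=
  {σ | σ x₀ = 1 ∧ ∀ x y, (G.openGraph C).Reachable x y → σ x = σ y}

theorem openGraph_adj_of_mem {C : Set E} {e : E} (he : e ∈ C) :
    (G.openGraph C).Adj (G.fst e) (G.snd e) :=
  (SimpleGraph.fromRel_adj _ _ _).2 ⟨G.ne e, Or.inl ⟨e, he, rfl, rfl⟩⟩

theorem mem_clusterSigns {C : Set E} {σ : V → ℤˣ} :
    σ ∈ G.clusterSigns x₀ C ↔ σ x₀ = 1 ∧ ∀ e ∈ C, σ (G.fst e) = σ (G.snd e) := by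
  refine and_congr Iff.rfl ⟨fun h e he => h _ _ (G.openGraph_adj_of_mem he).reachable,
    fun h x y hxy => ?_⟩
  obtain ⟨w⟩ := hxy
  induction w with
  | nil => rfl
  | cons ha _ ih =>
    rw [← ih]
    obtain ⟨-, ⟨e, he, rfl, rfl⟩ | ⟨e, he, rfl, rfl⟩⟩ := (SimpleGraph.fromRel_adj _ _ _).1 ha
    exacts [h e he, (h e he).symm]

theorem one_mem_clusterSigns (C : Set E) : (fun _ => 1) ∈ G.clusterSigns x₀ C :=
  ⟨rfl, fun _ _ _ => rfl⟩

theorem clusterSigns_insert_of_reachable {C : Set E} {e : E}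
    (h : (G.openGraph C).Reachable (G.fst e) (G.snd e)) :
    G.clusterSigns x₀ (insert e C) = G.clusterSigns x₀ C := by
  ext σ
  refine ⟨fun hσ => ?_, fun hσ => ?_⟩
  · rw [mem_clusterSigns] at hσ ⊢
    exact ⟨hσ.1, fun e' he' => hσ.2 e' (Set.mem_insert_of_mem _ he')⟩
  · have h' := hσ.2 _ _ h
    rw [mem_clusterSigns] at hσ ⊢
    refine ⟨hσ.1, fun e' he' => ?_⟩
    rcases he' with rfl | he'
    exacts [h', hσ.2 e' he']

variable [Fintype V]

/-- If `e` joins two distinct clusters, one of them, that of `w`, avoids `x₀`. Flipping the signs on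
it turns assignments agreeing across `e` into assignments disagreeing across `e`, which are still
compatible with `C`: two disjoint copies of the smaller set fit in the larger one. -/
theorem two_mul_ncard_clusterSigns_insert {C : Set E} {e : E}
    (h : ¬ (G.openGraph C).Reachable (G.fst e) (G.snd e)) :
    2 * (G.clusterSigns x₀ (insert e C)).ncard ≤ (G.clusterSigns x₀ C).ncard := by
  obtain ⟨w, hw, hwe⟩ : ∃ w, ¬ (G.openGraph C).Reachable w x₀ ∧
      ((G.openGraph C).Reachable w (G.fst e) ∧ ¬ (G.openGraph C).Reachable w (G.snd e) ∨
        (G.openGraph C).Reachable w (G.snd e) ∧ ¬ (G.openGraph C).Reachable w (G.fst e)) := by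
    by_cases h1 : (G.openGraph C).Reachable (G.fst e) x₀
    · exact ⟨G.snd e, fun h2 => h (h1.trans h2.symm), Or.inr ⟨SimpleGraph.Reachable.refl _,
        fun h2 => h h2.symm⟩⟩
    · exact ⟨G.fst e, h1, Or.inl ⟨SimpleGraph.Reachable.refl _, h⟩⟩
  let flip : (V → ℤˣ) → V → ℤˣ := fun σ v => if (G.openGraph C).Reachable w v then -σ v else σ v
  have hne : ∀ a : ℤˣ, -a ≠ a := by decide
  have hsub : G.clusterSigns x₀ (insert e C) ⊆ G.clusterSigns x₀ C := by
    intro σ hσ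
    rw [mem_clusterSigns] at hσ ⊢
    exact ⟨hσ.1, fun e' he' => hσ.2 e' (Set.mem_insert_of_mem _ he')⟩
  have hflip : flip '' G.clusterSigns x₀ (insert e C) ⊆ G.clusterSigns x₀ C := by
    rintro _ ⟨σ, hσ, rfl⟩
    refine ⟨?_, fun x y hxy => ?_⟩
    · simp [flip, hw, hσ.1]
    · have h2 := (hsub hσ).2 x y hxy
      have h3 : (G.openGraph C).Reachable w x ↔ (G.openGraph C).Reachable w y :=
        ⟨fun h => h.trans hxy, fun h => h.trans hxy.symm⟩
      simp [flip, h2, h3]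
  have hinj : Function.Injective flip := by
    intro σ τ hst
    funext v
    have := congrFun hst v
    by_cases hv : (G.openGraph C).Reachable w v
    · simpa [flip, hv] using this
    · simpa [flip, hv] using this
  have hdisj : Disjoint (G.clusterSigns x₀ (insert e C))
      (flip '' G.clusterSigns x₀ (insert e C)) := by
    rw [Set.disjoint_left]
    rintro τ hτ ⟨σ, hσ, rfl⟩
    rw [mem_clusterSigns] at hτ hσ
    have h1 := hτ.2 e (Set.mem_insert _ _)
    have h2 := hσ.2 e (Set.mem_insert _ _)
    rcases hwe with ⟨a, b⟩ | ⟨a, b⟩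
    · simp only [flip, a, b, if_true, if_false, h2] at h1
      exact hne _ h1
    · simp only [flip, a, b, if_true, if_false, h2] at h1
      exact hne _ h1.symm
  have := Set.ncard_le_ncard (Set.union_subset hsub hflip) (Set.toFinite _)
  rwa [Set.ncard_union_eq hdisj (Set.toFinite _) (Set.toFinite _),
    Set.ncard_image_of_injective _ hinj, ← two_mul] at this

end SignCount

/-! ### Rates of the events and detailed balance -/

section Weights

variable {V E : Type*} (G : Network V E) (x₀ : V)

theorem other_ne (e : E) (x : V) : G.other e x ≠ x := by
  unfold other
  split_ifs with h
  · rw [h]; exact (G.ne e).symm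
  · exact fun h' => h h'.symm

theorem incident_other (e : E) (x : V) : G.Incident e (G.other e x) := by
  unfold other Incident
  split_ifs <;> simp

theorem other_other {e : E} {x : V} (h : G.Incident e x) : G.other e (G.other e x) = x := by
  unfold other
  rcases h with h | h
  · subst h; simp [(G.ne e).symm]
  · subst h; simp [(G.ne e).symm]

theorem eq_or_eq_other {e : E} {x y : V} (hx : G.Incident e x) (hy : G.Incident e y) :
    x = y ∨ x = G.other e y := by
  unfold other
  rcases hx with rfl | rfl <;> rcases hy with rfl | rfl <;> simp [(G.ne e).symm]

theorem incident_checkMove {x : V} {e : E} (C : Set E) (b : Bool) (h : G.Incident e x) :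
    G.Incident e (G.checkMove x₀ x e C b) := by
  unfold checkMove
  split_ifs; exacts [G.incident_other e x, h, Or.inl rfl, Or.inr rfl]

/-- The rate of an event at the edge `e`, at which the process goes from `x` to `y`, when the halved
squared field is `r`. -/
def fwdRate (r : V → ℝ) (e : E) (x y : V) : ℝ :=
  if G.Incident e x then
    if y = G.other e x then G.W e
    else if y = x then G.W e * √(r (G.other e x) / r x) else 0
  else 0

/-- The probability that the self-interacting process goes from `y` to `x` if the stack at `e` drops,
when the set of open edges is `C` after the drop. -/
def moveProb (C : Set E) (e : E) (y x : V) : ℝ :=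
  ((if G.checkMove x₀ y e C true = x then 1 else 0) +
    (if G.checkMove x₀ y e C false = x then 1 else 0)) / 2

/-- The rate of the event for the time-reversed process. -/
def bwdRate (A : Set E) (n : E → ℕ) (r : V → ℝ) (e : E) (x y : V) : ℝ :=
  if G.Incident e y ∧ e ∈ A then
    2 * G.W e * √(r (G.other e y) / r y) * G.moveProb x₀ {e | 0 < n e} e y x
  else 0

/-- The product of the rates of the events of a skeleton. -/
def fwdProd : (V → ℝ) → List (V × ℝ × E) → V × ℝ → ℝ
  | _, [], q => if 0 < q.2 then 1 else 0
  | r, p :: L, q => (if 0 < p.2.1 then 1 else 0) *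
      (G.fwdRate (r + Pi.single p.1 p.2.1) p.2.2 p.1 (headPos L q) *
        fwdProd (r + Pi.single p.1 p.2.1) L q)

/-- The product of the rates of the events of a skeleton, for the time-reversed process. -/
def bwdProd (A : Set E) : (V → ℝ) → (E → ℕ) → List (V × ℝ × E) → V × ℝ → ℝ
  | _, _, [], q => if 0 < q.2 then 1 else 0
  | r, n, p :: L, q => (if 0 < p.2.1 then 1 else 0) *
      (G.bwdRate x₀ A n (r + Pi.single p.1 p.2.1) p.2.2 p.1 (headPos L q) *
        bwdProd A (r + Pi.single p.1 p.2.1) (n + Pi.single p.2.2 1) L q)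

theorem fwdRate_nonneg (r : V → ℝ) (e : E) (x y : V) : 0 ≤ G.fwdRate r e x y := by
  have := (G.W_pos e).le
  unfold fwdRate
  split_ifs <;> positivity

theorem moveProb_nonneg (C : Set E) (e : E) (y x : V) : 0 ≤ G.moveProb x₀ C e y x := by
  unfold moveProb
  split_ifs <;> norm_num

theorem bwdRate_nonneg (A : Set E) (n : E → ℕ) (r : V → ℝ) (e : E) (x y : V) :
    0 ≤ G.bwdRate x₀ A n r e x y := by
  have := (G.W_pos e).le
  have := G.moveProb_nonneg x₀ {e | 0 < n e} e y x
  unfold bwdRate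
  split_ifs <;> positivity

theorem fwdProd_nonneg (r : V → ℝ) (L : List (V × ℝ × E)) (q : V × ℝ) : 0 ≤ G.fwdProd r L q := by
  induction L generalizing r with
  | nil => unfold fwdProd; split_ifs <;> norm_num
  | cons p L ih =>
    exact mul_nonneg (by split_ifs <;> norm_num) (mul_nonneg (G.fwdRate_nonneg _ _ _ _) (ih _))

theorem bwdProd_nonneg (A : Set E) (r : V → ℝ) (n : E → ℕ) (L : List (V × ℝ × E)) (q : V × ℝ) :
    0 ≤ G.bwdProd x₀ A r n L q := by
  induction L generalizing r n with
  | nil => unfold bwdProd; split_ifs <;> norm_num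
  | cons p L ih =>
    exact mul_nonneg (by split_ifs <;> norm_num)
      (mul_nonneg (G.bwdRate_nonneg _ _ _ _ _ _ _) (ih _ _))

theorem posTimes_of_bwdProd_ne_zero {A : Set E} {r : V → ℝ} {n : E → ℕ} {L : List (V × ℝ × E)}
    {q : V × ℝ} (h : G.bwdProd x₀ A r n L q ≠ 0) : posTimes L q ∧ ∀ e, listCount L e ≠ 0 → e ∈ A := by
  induction L generalizing r n with
  | nil =>
    unfold bwdProd at h
    split_ifs at h with h1
    exacts [⟨⟨by simp, h1⟩, by simp [listCount]⟩, absurd rfl h]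
  | cons p L ih =>
    rw [bwdProd] at h
    have h1 := left_ne_zero_of_mul h
    have h2 := left_ne_zero_of_mul (right_ne_zero_of_mul h)
    obtain ⟨h3, h4⟩ := ih (right_ne_zero_of_mul (right_ne_zero_of_mul h))
    refine ⟨posTimes_cons.2 ⟨by by_contra hc; simp [hc] at h1, h3⟩, fun e he => ?_⟩
    by_cases hep : e = p.2.2
    · subst hep
      by_contra hc
      simp [bwdRate, hc] at h2
    · refine h4 e fun h0 => he ?_
      simp [listCount, h0, hep]

theorem bwdProd_concat (A : Set E) (r : V → ℝ) (n : E → ℕ) (L : List (V × ℝ × E)) (y x : V)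
    (t s : ℝ) (e : E) :
    G.bwdProd x₀ A r n (L ++ [(y, t, e)]) (x, s) =
      G.bwdProd x₀ A r n L (y, t) * (if 0 < s then 1 else 0) *
        G.bwdRate x₀ A (n + listCount L) (r + skelTime (L, y, t)) e y x := by
  have single_eq : ∀ (y : V) (t : ℝ), (fun z => if y = z then t else 0) = Pi.single y t := by
    intro y t; funext z; simp [Pi.single_apply, eq_comm]
  induction L generalizing r n with
  | nil =>
    have : skelTime (([], y, t) : Skeleton V E) = Pi.single y t := by
      rw [← single_eq]; funext z; simp [skelTime]
    simp only [List.nil_append, bwdProd, headPos_nil, listCount, add_zero, this]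
    ring
  | cons p L ih =>
    have h1 : skelTime ((p :: L, y, t) : Skeleton V E) =
        Pi.single p.1 p.2.1 + skelTime ((L, y, t) : Skeleton V E) := by
      rw [← single_eq]; funext z; obtain ⟨a, b, c⟩ := p; simp [skelTime, add_assoc]
    have h2 : headPos (L ++ [(y, t, e)]) (x, s) = headPos L (y, t) := by
      cases L <;> simp
    rw [List.cons_append, bwdProd, ih, bwdProd, h1, h2, listCount, add_assoc, add_assoc]
    ring

variable [Fintype V] [Fintype E]

/-- The product of the field over the vertices other than `x`. -/
def prodOff (r : V → ℝ) (x : V) : ℝ := ∏ z ∈ univ.erase x, √(r z)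

theorem prodOff_add_single (r : V → ℝ) (x : V) (s : ℝ) :
    prodOff (r + Pi.single x s) x = prodOff r x := by
  refine prod_congr rfl fun z hz => ?_
  rw [Pi.add_apply, Pi.single_eq_of_ne (ne_of_mem_erase hz), add_zero]

/-- If the drop creates no new cluster, each end is chosen with probability 1/2 and the number of
sign assignments does not change. If it creates one, the move is deterministic but this number at
least doubles. In both cases the prefactor 2 is absorbed. -/
theorem moveProb_mul_ncard_le (n : E → ℕ) {e : E} {y : V} (x : V) (h : G.Incident e y) :
    2 * G.moveProb x₀ {e | 0 < n e} e y x *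
        (G.clusterSigns x₀ {e' | 0 < (n + Pi.single e 1 : E → ℕ) e'}).ncard ≤
      if G.Incident e x then ((G.clusterSigns x₀ {e | 0 < n e}).ncard : ℝ) else 0 := by
  have hins : {e' | 0 < (n + Pi.single e 1 : E → ℕ) e'} = insert e {e | 0 < n e} := by
    ext e'
    by_cases he : e' = e
    · subst he; simp
    · simp [he]
  rw [hins]
  by_cases hx : G.Incident e x
  · rw [if_pos hx]
    by_cases hr : (G.openGraph {e | 0 < n e}).Reachable (G.fst e) (G.snd e)
    · rw [G.clusterSigns_insert_of_reachable x₀ hr]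
      have : G.moveProb x₀ {e | 0 < n e} e y x ≤ 1 / 2 := by
        simp only [moveProb, checkMove, hr, if_true, Bool.false_eq_true, if_false]
        have := G.other_ne e y
        split_ifs with h1 h2
        · exact absurd (h1.trans h2.symm) this
        all_goals norm_num
      nlinarith [Nat.cast_nonneg (α := ℝ) (G.clusterSigns x₀ {e | 0 < n e}).ncard]
    · have h1 := G.two_mul_ncard_clusterSigns_insert x₀ hr
      have h2 : G.moveProb x₀ {e | 0 < n e} e y x ≤ 1 := by
        unfold moveProb; split_ifs <;> norm_num
      have h3 : (2 : ℝ) * (G.clusterSigns x₀ (insert e {e | 0 < n e})).ncard ≤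
          (G.clusterSigns x₀ {e | 0 < n e}).ncard := by exact_mod_cast h1
      nlinarith [Nat.cast_nonneg (α := ℝ) (G.clusterSigns x₀ (insert e {e | 0 < n e})).ncard]
  · rw [if_neg hx]
    have h1 : ∀ b, G.checkMove x₀ y e {e | 0 < n e} b ≠ x := fun b hb =>
      hx (hb ▸ G.incident_checkMove x₀ _ b h)
    simp [moveProb, h1]

/-- One-step detailed balance. If the process does not move, both rates contain the same square
root. If it crosses `e`, the identity √(r x) · prodOff r x = √(r y) · prodOff r y turns the factor
√(r x / r y) of the backward rate into the change of the omitted vertex. The signs and the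
probability of the move are dealt with by `moveProb_mul_ncard_le`. -/
theorem bwdRate_mul_le (A : Set E) (n : E → ℕ) {r : V → ℝ} (hr : ∀ z, 0 < r z) (e : E) (x y : V) :
    G.bwdRate x₀ A n r e x y *
        ((G.clusterSigns x₀ {e' | 0 < (n + Pi.single e 1 : E → ℕ) e'}).ncard / prodOff r y) ≤
      G.fwdRate r e x y * ((G.clusterSigns x₀ {e | 0 < n e}).ncard / prodOff r x) := by
  have hP : ∀ x, 0 < prodOff r x := fun x => Finset.prod_pos fun z _ => sqrt_pos.2 (hr z)
  have hall : ∀ x, √(r x) * prodOff r x = ∏ z, √(r z) := fun x =>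
    mul_prod_erase _ (fun z => √(r z)) (mem_univ x)
  have hW := G.W_pos e
  have hR : 0 ≤ G.fwdRate r e x y * ((G.clusterSigns x₀ {e | 0 < n e}).ncard / prodOff r x) :=
    mul_nonneg (G.fwdRate_nonneg _ _ _ _) (div_nonneg (Nat.cast_nonneg _) (hP x).le)
  by_cases hy : G.Incident e y ∧ e ∈ A
  swap
  · rw [bwdRate, if_neg hy, zero_mul]; exact hR
  have hmv := G.moveProb_mul_ncard_le x₀ n x hy.1
  set c' : ℝ := ((G.clusterSigns x₀ {e' | 0 < (n + Pi.single e 1 : E → ℕ) e'}).ncard : ℝ)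
  set c : ℝ := ((G.clusterSigns x₀ {e | 0 < n e}).ncard : ℝ)
  set m := G.moveProb x₀ {e | 0 < n e} e y x
  have e1 : G.bwdRate x₀ A n r e x y * (c' / prodOff r y) =
      G.W e * √(r (G.other e y) / r y) / prodOff r y * (2 * m * c') := by
    rw [bwdRate, if_pos hy]; ring
  rw [e1]
  have hpos : 0 ≤ G.W e * √(r (G.other e y) / r y) / prodOff r y :=
    div_nonneg (mul_nonneg hW.le (sqrt_nonneg _)) (hP y).le
  refine (mul_le_mul_of_nonneg_left hmv hpos).trans ?_
  split_ifs with hx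
  swap
  · rw [mul_zero]; exact hR
  rcases G.eq_or_eq_other hx hy.1 with rfl | hxy
  · rw [fwdRate, if_pos hx, if_neg (G.other_ne e x).symm, if_pos rfl]
    exact le_of_eq (by ring)
  · have hyx : y = G.other e x := by rw [hxy, G.other_other hy.1]
    rw [fwdRate, if_pos hx, if_pos hyx, ← hxy, Real.sqrt_div (hr x).le]
    refine le_of_eq ?_
    have h1 := hall x
    rw [← hall y] at h1
    have hx' := sqrt_pos.2 (hr x)
    have hy' := sqrt_pos.2 (hr y)
    have := (hP x).ne'
    have := (hP y).ne'
    field_simp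
    linear_combination c * h1

/-- The weight omits the current position, hence does not vary during a holding time, and the
one-step inequalities telescope. The omission also permits a vanishing field at the initial
position, which is the situation at `x₀`. -/
theorem bwdProd_mul_le (A : Set E) (L : List (V × ℝ × E)) (q : V × ℝ) (n : E → ℕ) (r : V → ℝ)
    (hr : ∀ z, z ≠ headPos L q → 0 < r z) (hr' : 0 ≤ r (headPos L q)) :
    G.bwdProd x₀ A r n L q *
        ((G.clusterSigns x₀ {e | 0 < (n + listCount L) e}).ncard /
          prodOff (r + skelTime (L, q)) q.1) ≤
      G.fwdProd r L q * ((G.clusterSigns x₀ {e | 0 < n e}).ncard / prodOff r (headPos L q)) := by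
  have single_eq : ∀ (y : V) (t : ℝ), (fun z => if y = z then t else 0) = Pi.single y t := by
    intro y t; funext z; simp [Pi.single_apply, eq_comm]
  induction L generalizing n r with
  | nil =>
    have : skelTime (([], q) : Skeleton V E) = Pi.single q.1 q.2 := by
      rw [← single_eq]; funext z; simp [skelTime]
    simp only [bwdProd, fwdProd, listCount, add_zero, this, prodOff_add_single, headPos_nil]
    exact le_rfl
  | cons p L ih =>
    obtain ⟨x, s, e⟩ := p
    simp only [headPos_cons] at hr hr'
    rw [bwdProd, fwdProd]
    by_cases hs : 0 < s
    swap
    · simp [hs]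
    simp only [hs, if_true, one_mul, headPos_cons]
    have h1 : r + skelTime (((x, s, e) :: L, q) : Skeleton V E) =
        r + Pi.single x s + skelTime ((L, q) : Skeleton V E) := by
      rw [← single_eq]; funext z; simp [skelTime, add_assoc]
    have hpos : ∀ z, 0 < (r + Pi.single x s : V → ℝ) z := by
      intro z
      by_cases hz : z = x
      · subst hz; simp only [Pi.add_apply, Pi.single_eq_same]; linarith
      · simpa [hz] using hr z hz
    have h2 := ih (n + Pi.single e 1) (r + Pi.single x s) (fun z _ => hpos z) (hpos _).le
    rw [h1, listCount, ← add_assoc, mul_assoc]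
    refine (mul_le_mul_of_nonneg_left h2 (G.bwdRate_nonneg _ _ _ _ _ _ _)).trans ?_
    have h3 := mul_le_mul_of_nonneg_right
      (G.bwdRate_mul_le x₀ A n hpos e x (headPos L q)) (G.fwdProd_nonneg (r + Pi.single x s) L q)
    rw [prodOff_add_single] at h3
    calc _ = _ := by ring
      _ ≤ _ := h3
      _ = _ := by ring

end Weights

end Network

/-! ### Competing exponential alarms -/

section Alarms

/-- Cumulative hazards of the alarms `i ∈ I`; the other ones are not active. -/
structure Hazards {ι : Type*} (I : Finset ι) (H H' : ι → ℝ → ℝ) : Prop where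
  zero : ∀ i, H i 0 = 0
  inactive : ∀ i ∉ I, ∀ s, H i s = 0
  strictMono : ∀ i ∈ I, StrictMonoOn (H i) (Set.Ici 0)
  cont : ∀ i, Continuous (H i)
  deriv : ∀ i ∈ I, ∀ s, 0 < s → HasDerivAt (H i) (H' i s) s

variable {ι : Type*} [Fintype ι] {w : ι → ℝ} {I : Finset ι} {H H' : ι → ℝ → ℝ}

theorem Hazards.nonneg (h : Hazards I H H') (i : ι) {s : ℝ} (hs : 0 ≤ s) : 0 ≤ H i s := by
  by_cases hi : i ∈ I
  · rw [← h.zero i]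
    exact (h.strictMono i hi).monotoneOn Set.self_mem_Ici hs hs
  · exact (h.inactive i hi s).ge

/-- The event that the alarm `i` rings first. -/
def firstAlarm (I : Finset ι) (H : ι → ℝ → ℝ) (i : ι) : Set (ι → ℝ) :=
  {α | ∀ j, j ∈ I ∧ j ≠ i → ∃ q : ℚ, (0 : ℝ) ≤ q ∧ α i ≤ H i q ∧ H j q < α j}

/-- The order of the alarms is expressed by a rational time separating them, which gives
measurability without inverting the hazards. -/
theorem measurableSet_firstAlarm (I : Finset ι) (H : ι → ℝ → ℝ) (i : ι) :
    MeasurableSet (firstAlarm I H i) := by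
  refine measurableSet_forall fun j => ?_
  by_cases hj : j ∈ I ∧ j ≠ i
  · simp only [hj, ne_eq, not_false_eq_true, and_self, forall_const]
    exact measurableSet_exists fun q => (MeasurableSet.const _).inter
      ((measurableSet_le (measurable_pi_apply i) measurable_const).inter
        (measurableSet_lt measurable_const (measurable_pi_apply j)))
  · simp only [hj, false_imp_iff]
    exact MeasurableSet.univ

theorem disjoint_firstAlarm (h : Hazards I H H') {i j : ι} (hi : i ∈ I) (hj : j ∈ I) (hij : i ≠ j) :
    Disjoint (firstAlarm I H i) (firstAlarm I H j) := by
  rw [Set.disjoint_left]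
  intro α h1 h2
  obtain ⟨q, hq, h3, h4⟩ := h1 j ⟨hj, hij.symm⟩
  obtain ⟨q', hq', h5, h6⟩ := h2 i ⟨hi, hij⟩
  have h7 := ((h.strictMono j hj).lt_iff_lt (a := (q : ℝ)) (b := (q' : ℝ)) hq hq').1
    (h4.trans_le h5)
  have h8 := ((h.strictMono i hi).lt_iff_lt (a := (q' : ℝ)) (b := (q : ℝ)) hq' hq).1
    (h6.trans_le h3)
  exact lt_asymm h7 h8

theorem mem_firstAlarm (h : Hazards I H H') {i : ι} (hi : i ∈ I) {s : ℝ} (hs : 0 < s)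
    {α : ι → ℝ} (h1 : α i = H i s) (h2 : ∀ j ≠ i, H j s < α j) : α ∈ firstAlarm I H i := by
  rintro j ⟨hj, hij⟩
  have : ∀ᶠ t in nhdsWithin s (Ioi s), H j t < α j :=
    ((h.cont j).tendsto s).mono_left nhdsWithin_le_nhds |>.eventually_lt_const (h2 j hij)
  obtain ⟨t, ht, htt⟩ := (mem_nhdsGT_iff_exists_Ioo_subset.1 this)
  obtain ⟨q, hq1, hq2⟩ := exists_rat_btwn (show s < t from ht)
  refine ⟨q, hs.le.trans hq1.le, ?_, htt ⟨hq1, hq2⟩⟩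
  rw [h1]
  exact (h.strictMono i hi).monotoneOn hs.le (hs.le.trans hq1.le) hq1.le

variable (w) in
/-- The law of independent exponential variables. -/
abbrev alarmLaw : Measure (ι → ℝ) := Measure.pi fun i => expMeasure (w i)

theorem expMeasure_restrict_univ (w : ℝ) :
    (expMeasure w).restrict Set.univ = (1 : ℝ≥0∞) • (expMeasure w).map id := by simp

theorem alarm_residual (hw : ∀ i, 0 < w i) (h : Hazards I H H') {K : (ι → ℝ) → ℝ≥0∞}
    (hK : Measurable K) {s : ℝ} (hs : 0 ≤ s) :
    ofReal (exp (-∑ j, w j * H j s)) * ∫⁻ α, K (fun j => α j + H j s) ∂alarmLaw w =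
      ∫⁻ α in {α | ∀ j, H j s < α j}, K α ∂alarmLaw w := by
  have : ∀ i, IsProbabilityMeasure (expMeasure (w i)) := fun i => isProbabilityMeasure_expMeasure (hw i)
  have := prod_mul_lintegral_map_le (μ := fun i => expMeasure (w i))
    (fun j => Ioi (H j s)) (fun j => ofReal (exp (-(w j * H j s))))
    (fun j => (· + H j s)) (fun j => measurable_id.add_const _)
    (fun j => expMeasure_restrict_Ioi (h.nonneg j hs)) hK
  rw [← ofReal_prod_of_nonneg fun _ _ => (exp_pos _).le, ← exp_sum,
    Finset.sum_neg_distrib] at this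
  rw [this]
  congr 2
  ext α; simp

/-- Parametrize the alarm `i` by the time `s` at which its hazard reaches it; the other alarms must
then exceed their hazards at `s`, and by lack of memory their excesses are fresh. The set `T` allows
a time limit to be expressed as a constraint on `α i`. -/
theorem alarm_first_le (hw : ∀ i, 0 < w i) (h : Hazards I H H') {K : (ι → ℝ) → ℝ≥0∞}
    (hK : Measurable K) {i : ι} (hi : i ∈ I) {S : Set ℝ} (hS : MeasurableSet S)
    (hS0 : S ⊆ Ioi 0) {T : Set ℝ} (hT : MeasurableSet T) (hST : ∀ s ∈ S, H i s ∈ T) :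
    ∫⁻ s in S, ofReal (w i * |H' i s| * exp (-∑ j, w j * H j s)) *
        ∫⁻ α, K (update (fun j => α j + H j s) i (H i s)) ∂alarmLaw w ≤
      ∫⁻ α in firstAlarm I H i ∩ {α | α i ∈ T}, K α ∂alarmLaw w := by
  have : ∀ i, IsProbabilityMeasure (expMeasure (w i)) := fun i => isProbabilityMeasure_expMeasure (hw i)
  set A := firstAlarm I H i ∩ {α | α i ∈ T}
  have hA : MeasurableSet A :=
    (measurableSet_firstAlarm I H i).inter (measurable_pi_apply i hT)
  have hKA : Measurable (A.indicator K) := hK.indicator hA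
  have hU : Measurable fun q : ℝ × (ι → ℝ) => A.indicator K (update q.2 i q.1) :=
    hKA.comp (measurable_pi_lambda _ fun j => by
      by_cases hj : j = i
      · subst hj; simpa using measurable_fst
      · simp only [update_of_ne hj]
        exact (measurable_pi_apply j).comp measurable_snd)
  have hU' : Measurable (Function.uncurry fun (f : ι → ℝ) (a : ℝ) =>
      A.indicator K (update f i a)) := hU.comp measurable_swap
  rw [← lintegral_indicator hA, lintegral_piUpdate (μ := fun i => expMeasure (w i)) i hKA,
    lintegral_lintegral_swap hU'.aemeasurable]
  refine le_trans ?_ (lintegral_hazard_le (w := w i) hS (H := H i) (H' := H' i)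
    (fun s hs => h.deriv i hi s (hS0 hs))
    (((h.strictMono i hi).injOn).mono fun s hs => Set.mem_Ici.2 (Set.mem_Ioi.1 (hS0 hs)).le)
    (fun s hs => by
      rw [← h.zero i]; exact h.strictMono i hi Set.self_mem_Ici
        (Set.mem_Ici.2 (Set.mem_Ioi.1 (hS0 hs)).le) (hS0 hs)) _)
  refine setLIntegral_mono' hS fun s hs => ?_
  have hs0 : 0 < s := hS0 hs
  have hK' : Measurable fun α : ι → ℝ => K (update α i (H i s)) :=
    hK.comp (measurable_pi_lambda _ fun j => by
      by_cases hj : j = i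
      · subst hj; simp
      · simpa [hj] using measurable_pi_apply j)
  have key := prod_mul_lintegral_map_le (μ := fun i => expMeasure (w i))
    (fun j => if j = i then Set.univ else Ioi (H j s))
    (fun j => if j = i then 1 else ofReal (exp (-(w j * H j s))))
    (fun j => if j = i then id else (· + H j s))
    (fun j => by
      split_ifs; exacts [measurable_id, measurable_id.add_const _])
    (fun j => by
      split_ifs
      exacts [expMeasure_restrict_univ _, expMeasure_restrict_Ioi (h.nonneg j hs0.le)]) hK'
  have e1 : ofReal (exp (-∑ j, w j * H j s)) = ofReal
      (exp (-(w i * H i s))) * ∏ j, if j = i then (1 : ℝ≥0∞) else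
        ofReal (exp (-(w j * H j s))) := by
    rw [← mul_prod_erase _ _ (mem_univ i), if_pos rfl, one_mul,
      ← Finset.sum_neg_distrib, exp_sum,
      ofReal_prod_of_nonneg fun _ _ => (exp_pos _).le,
      ← mul_prod_erase _ _ (mem_univ i)]
    congr 1
    refine prod_congr rfl fun j hj => ?_
    rw [if_neg (ne_of_mem_erase hj)]
  have e2 : ∀ α : ι → ℝ, K (update (fun j => α j + H j s) i (H i s)) =
      K (update (fun j => (if j = i then id else (· + H j s)) (α j)) i (H i s)) := by
    intro α
    congr 1
    funext j
    by_cases hj : j = i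
    · subst hj; simp
    · simp [hj]
  have e3 : ofReal (w i * |H' i s| * exp (-∑ j, w j * H j s)) =
      ofReal |H' i s| * (ofReal (w i * exp (-(w i * H i s))) *
        ∏ j, if j = i then (1 : ℝ≥0∞) else ofReal (exp (-(w j * H j s)))) := by
    rw [ofReal_mul (mul_nonneg (hw i).le (abs_nonneg _)), e1, ofReal_mul (hw i).le,
      ofReal_mul (hw i).le]
    ring
  rw [e3, mul_assoc, mul_assoc]
  refine mul_le_mul_right (mul_le_mul_right ?_ _) _
  simp only [e2]
  rw [key, ← lintegral_indicator (MeasurableSet.univ_pi fun j => by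
    split_ifs; exacts [MeasurableSet.univ, measurableSet_Ioi])]
  refine lintegral_mono fun α => ?_
  by_cases hα : α ∈ Set.univ.pi fun j => if j = i then Set.univ else Ioi (H j s)
  swap
  · rw [indicator_of_notMem hα]; exact zero_le
  rw [indicator_of_mem hα, indicator_of_mem]
  refine ⟨mem_firstAlarm h hi hs0 (by simp) fun j hj => ?_, by simpa using hST s hs⟩
  have : α j ∈ if j = i then Set.univ else Ioi (H j s) := hα j (Set.mem_univ j)
  simp only [if_neg hj] at this
  rw [update_of_ne hj]
  exact this

/-- Decomposition according to the first alarm, before the time `b`. -/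
theorem sum_firstAlarm_add_le (hw : ∀ i, 0 < w i) (h : Hazards I H H') {K : (ι → ℝ) → ℝ≥0∞}
    (hK : Measurable K) {b : ℝ} (hb : 0 < b) :
    (∑ i ∈ I, ∫⁻ s in Ioo 0 b,
        ofReal (w i * |H' i s| * exp (-∑ j, w j * H j s)) *
        ∫⁻ α, K (update (fun j => α j + H j s) i (H i s)) ∂alarmLaw w) +
      ofReal (exp (-∑ j, w j * H j b)) * ∫⁻ α, K (fun j => α j + H j b) ∂alarmLaw w ≤
    ∫⁻ α, K α ∂alarmLaw w := by
  have hA : ∀ i, MeasurableSet (firstAlarm I H i ∩ {α | α i ∈ Set.Iic (H i b)}) := fun i =>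
    (measurableSet_firstAlarm I H i).inter (measurable_pi_apply i measurableSet_Iic)
  rw [alarm_residual hw h hK hb.le]
  refine (add_le_add_left (sum_le_sum fun i hi => alarm_first_le hw h hK hi
    measurableSet_Ioo (fun s hs => hs.1) (measurableSet_Iic (a := H i b)) fun s hs =>
      (h.strictMono i hi).monotoneOn hs.1.le hb.le hs.2.le) _).trans ?_
  rw [← lintegral_biUnion_finset (fun i hi j hj hij => ((disjoint_firstAlarm h hi hj hij).mono
    Set.inter_subset_left Set.inter_subset_left)) fun i _ => hA i, ← lintegral_union]
  · exact setLIntegral_le_lintegral _ _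
  · exact measurableSet_forall fun j => measurableSet_lt measurable_const (measurable_pi_apply j)
  · rw [Set.disjoint_left]
    intro α h1 h2
    simp only [Set.mem_iUnion] at h1
    obtain ⟨i, -, -, h3⟩ := h1
    exact absurd (h2 i) (not_lt.2 h3)

/-- Decomposition according to the first alarm. -/
theorem sum_firstAlarm_le (hw : ∀ i, 0 < w i) (h : Hazards I H H') {K : (ι → ℝ) → ℝ≥0∞}
    (hK : Measurable K) :
    ∑ i ∈ I, ∫⁻ s in Ioi 0, ofReal (w i * |H' i s| * exp (-∑ j, w j * H j s)) *
        ∫⁻ α, K (update (fun j => α j + H j s) i (H i s)) ∂alarmLaw w ≤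
    ∫⁻ α, K α ∂alarmLaw w := by
  have hA : ∀ i, MeasurableSet (firstAlarm I H i ∩ {α | α i ∈ Set.univ}) := fun i =>
    (measurableSet_firstAlarm I H i).inter (measurable_pi_apply i MeasurableSet.univ)
  refine (sum_le_sum fun i hi => alarm_first_le hw h hK hi
    measurableSet_Ioi (fun s hs => hs) MeasurableSet.univ fun s hs => trivial).trans ?_
  rw [← lintegral_biUnion_finset (fun i hi j hj hij => ((disjoint_firstAlarm h hi hj hij).mono
    Set.inter_subset_left Set.inter_subset_left)) fun i _ => hA i]
  exact setLIntegral_le_lintegral _ _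

end Alarms

section Counting

theorem natCard_eq_add_one {p : ℕ → Prop} (h0 : p 0) (hf : {k | p (k + 1)}.Finite) :
    Nat.card {k // p k} = Nat.card {k // p (k + 1)} + 1 := by
  have h : {k | p k} = insert 0 (Nat.succ '' {k | p (k + 1)}) := by
    ext k
    cases k with
    | zero => simp [h0]
    | succ k => simp
  change Nat.card {k | p k} = Nat.card {k | p (k + 1)} + 1
  rw [Nat.card_coe_set_eq, Nat.card_coe_set_eq, h,
    Set.ncard_insert_of_notMem (by simp) (hf.image _),
    Set.ncard_image_of_injective _ Nat.succ_injective]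

theorem natCard_eq_of_not {p : ℕ → Prop} (h0 : ¬ p 0) :
    Nat.card {k // p k} = Nat.card {k // p (k + 1)} := by
  have h : {k | p k} = Nat.succ '' {k | p (k + 1)} := by
    ext k
    cases k with
    | zero => simp [h0]
    | succ k => simp
  change Nat.card {k | p k} = Nat.card {k | p (k + 1)}
  rw [Nat.card_coe_set_eq, Nat.card_coe_set_eq, h,
    Set.ncard_image_of_injective _ Nat.succ_injective]

theorem ofReal_add_le_ofReal_iff {s t : ℝ} (hs : 0 < s) (a : ℝ≥0∞) :
    ofReal s + a ≤ ofReal t ↔ s ≤ t ∧ a ≤ ofReal (t - s) := by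
  by_cases hst : s ≤ t
  · have : ofReal t = ofReal s + ofReal (t - s) := by
      rw [← ofReal_add hs.le (by linarith)]; congr 1; ring
    rw [this, ENNReal.add_le_add_iff_left ofReal_ne_top]
    simp [hst]
  · simp only [hst, false_and, iff_false, not_le]
    exact lt_of_lt_of_le ((ENNReal.ofReal_lt_ofReal_iff hs).2 (not_le.1 hst)) le_self_add

theorem natCard_eq_zero_of_forall {p : ℕ → Prop} (h : ∀ k, ¬ p k) : Nat.card {k // p k} = 0 := by
  have : IsEmpty {k // p k} := ⟨fun k => h k.1 k.2⟩
  simp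

end Counting

/-! ### Concatenation of paths and hitting times of the local time -/

section Concat

variable {V : Type*}

/-- The path which stays at `x` for the time `s` and then follows `X`. -/
def concatPath (s : ℝ) (x : V) (X : ℝ → V) (t : ℝ) : V := if t < s then x else X (t - s)

variable [MeasurableSpace V] [MeasurableSingletonClass V]

theorem localTime_concatPath {s : ℝ} (hs : 0 < s) (x : V) {X : ℝ → V} (hX : Measurable X) (t : ℝ)
    (z : V) : localTime (concatPath s x X) t z =
      if t < s then (if x = z then t else 0)
      else (if x = z then s else 0) + localTime X (t - s) z := by
  have hY : Measurable (concatPath s x X) :=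
    Measurable.ite measurableSet_Iio measurable_const (hX.comp (measurable_id.sub_const s))
  have h1 : ∀ t ≤ s, localTime (concatPath s x X) t z = if x = z then t else 0 := by
    intro t ht
    have : ∀ᵐ u : ℝ, u ∈ Set.uIoc 0 t → (if concatPath s x X u = z then (1 : ℝ) else 0) =
        if x = z then 1 else 0 := by
      filter_upwards [compl_mem_ae_iff.2 (measure_singleton s : volume {s} = 0)] with u hu hu'
      have hus : u ≠ s := hu
      have : u ≤ s := by
        rcases Set.mem_uIoc.1 hu' with h | h <;> linarith
      rw [concatPath, if_pos (lt_of_le_of_ne this hus)]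
    rw [localTime, intervalIntegral.integral_congr_ae this]
    split_ifs <;> simp
  split_ifs with ht hx hx
  · rw [h1 t ht.le, if_pos hx]
  · rw [h1 t ht.le, if_neg hx]
  all_goals
    have h2 := localTime_sub hY z s t
    have h3 : ∫ u in s..t, (if concatPath s x X u = z then (1 : ℝ) else 0) =
        localTime X (t - s) z := by
      have h4 := intervalIntegral.integral_comp_sub_right (a := s) (b := t)
        (fun u => if X u = z then (1 : ℝ) else 0) s
      rw [sub_self] at h4
      rw [localTime, ← h4]
      refine intervalIntegral.integral_congr fun u hu => ?_
      rw [Set.uIcc_of_le (not_lt.1 ht)] at hu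
      simp only [concatPath, if_neg (not_lt.2 hu.1)]
    rw [h3, h1 s le_rfl] at h2
    simp only [hx, if_true, if_false] at h2 ⊢
    linarith

/-- The times when the local time at `x` is equal to `u`. -/
def hitSet (X : ℝ → V) (x : V) (u : ℝ) : Set ℝ := {t : ℝ | 0 ≤ t ∧ localTime X t x = u}

/-- The hypothesis `hu'` says that the level `u` is not reached during the first holding time. -/
theorem hitSet_concatPath {s : ℝ} (hs : 0 < s) (x x₀ : V) {X : ℝ → V} (hX : Measurable X) {u : ℝ}
    (hu : 0 < u) (hu' : 0 < u - if x = x₀ then s else 0) :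
    hitSet (concatPath s x X) x₀ u =
      (fun t => s + t) '' hitSet X x₀ (u - if x = x₀ then s else 0) := by
  ext t
  simp only [hitSet, mem_ofPred_eq, Set.mem_image, localTime_concatPath hs x hX]
  constructor
  · rintro ⟨h1, h2⟩
    by_cases ht : t < s
    · rw [if_pos ht] at h2
      by_cases hx : x = x₀
      · rw [if_pos hx] at h2 hu'; linarith
      · rw [if_neg hx] at h2; linarith
    · rw [if_neg ht] at h2
      exact ⟨t - s, ⟨by linarith, by linarith⟩, by ring⟩
  · rintro ⟨t', ⟨h1, h2⟩, rfl⟩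
    refine ⟨by linarith, ?_⟩
    rw [if_neg (by linarith), add_sub_cancel_left, h2]
    ring

theorem sInf_hitSet_concatPath {s : ℝ} (hs : 0 < s) (x x₀ : V) {X : ℝ → V} (hX : Measurable X)
    {u : ℝ} (hu : 0 < u) (hu' : 0 < u - if x = x₀ then s else 0)
    (hne : (hitSet X x₀ (u - if x = x₀ then s else 0)).Nonempty) :
    sInf (hitSet (concatPath s x X) x₀ u) =
      s + sInf (hitSet X x₀ (u - if x = x₀ then s else 0)) := by
  rw [hitSet_concatPath hs x x₀ hX hu hu']
  exact ((OrderIso.addLeft s).map_csInf' hne ⟨0, fun t ht => ht.1⟩).symm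

end Concat

namespace Network

/-! ### The walk restarted after its first event -/

section WalkShift

variable {V E : Type*} (G : Network V E)

theorem firstEdge_eq {x : V} {c : E → ℝ} {e : E} (he : G.Incident e x)
    (h : ∀ e', G.Incident e' x → e' ≠ e → c e < c e') : G.firstEdge x c = some e := by
  have hex : ∃ e, G.Incident e x ∧ ∀ e', G.Incident e' x → c e ≤ c e' := by
    refine ⟨e, he, fun e' he' => ?_⟩
    by_cases hee : e' = e
    · rw [hee]
    · exact (h e' he' hee).le
  rw [firstEdge, dif_pos hex]
  by_contra hne
  have hne' : hex.choose ≠ e := fun h' => hne (by rw [h'])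
  exact absurd (hex.choose_spec.2 e he) (not_le.2 (h _ hex.choose_spec.1 hne'))

theorem incident_of_firstEdge {x : V} {c : E → ℝ} {e : E} (h : G.firstEdge x c = some e) :
    G.Incident e x := by
  unfold firstEdge at h
  split_ifs at h with hex
  rw [← Option.some_injective _ h]
  exact hex.choose_spec.1

/-- The clocks at `x`, delayed by `s`. -/
def delay (x : V) (s : ℝ) (c : E → ℝ) (e : E) : ℝ := c e + if G.Incident e x then s else 0

theorem firstEdge_delay (x : V) (s : ℝ) (c : E → ℝ) :
    G.firstEdge x (G.delay x s c) = G.firstEdge x c := by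
  rw [firstEdge_eq_chooseEdge, firstEdge_eq_chooseEdge]
  congr 1
  funext e
  refine propext (and_congr_right fun he => forall_congr' fun e' => imp_congr_right fun he' => ?_)
  simp [delay, he, he']

/-- Clocks which are positive and for which the walks do not explode. -/
structure GoodClocks (ξ : ℕ → E → ℝ) : Prop where
  pos : ∀ k e, 0 < ξ k e
  fin : ∀ x t, {k | (G.walkState x ξ (k + 1)).1 ≤ ofReal t}.Finite

theorem walkState_succ (x : V) (ξ : ℕ → E → ℝ) (k : ℕ) :
    G.walkState x ξ (k + 1) = match G.firstEdge (G.walkState x ξ k).2 (ξ k) with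
      | none => (⊤, (G.walkState x ξ k).2)
      | some e => ((G.walkState x ξ k).1 + ofReal (ξ k e),
          G.other e (G.walkState x ξ k).2) := rfl

theorem walkState_cross {x : V} {c : E → ℝ} {e : E} (h : G.firstEdge x c = some e)
    (ξ : ℕ → E → ℝ) (k : ℕ) :
    G.walkState x (seqCons c ξ) (k + 1) = (ofReal (c e) +
      (G.walkState (G.other e x) ξ k).1, (G.walkState (G.other e x) ξ k).2) := by
  induction k with
  | zero => simp [walkState, h]
  | succ k ih =>
    rw [walkState, ih, walkState, seqCons_succ]
    cases G.firstEdge (G.walkState (G.other e x) ξ k).2 (ξ k) <;> simp [add_assoc]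

/-- All the clocks at `x` are delayed by the same amount, so the same one rings first, only later,
and the following steps use other clocks. By lack of memory, this is the effect on the walk of an
event which is not a crossing. -/
theorem walkState_delay (x : V) {s : ℝ} (hs : 0 < s) {c : E → ℝ} (hc : ∀ e, 0 < c e)
    (ξ : ℕ → E → ℝ) (k : ℕ) :
    G.walkState x (seqCons (G.delay x s c) ξ) (k + 1) = (ofReal s +
      (G.walkState x (seqCons c ξ) (k + 1)).1, (G.walkState x (seqCons c ξ) (k + 1)).2) := by
  induction k with
  | zero =>
    simp only [walkState, seqCons_zero, firstEdge_delay]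
    cases h : G.firstEdge x c with
    | none => simp
    | some e =>
      have := G.incident_of_firstEdge h
      simp only [delay, this, if_true, zero_add]
      rw [add_comm (c e), ofReal_add hs.le (hc e).le]
  | succ k ih =>
    rw [G.walkState_succ x _ (k + 1), G.walkState_succ x (seqCons c ξ) (k + 1), ih, seqCons_succ,
      seqCons_succ]
    cases G.firstEdge (G.walkState x (seqCons c ξ) (k + 1)).2 (ξ k) <;> simp [add_assoc]

/-- Non-explosion matters here: adding one jump to the count is only correct for a finite set, since
`Nat.card` of an infinite set is 0. -/
theorem walk_cross {x : V} {c : E → ℝ} {e : E} (h : G.firstEdge x c = some e) (hc : 0 < c e)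
    {ξ : ℕ → E → ℝ} (hξ : G.GoodClocks ξ) :
    G.walk x (seqCons c ξ) = concatPath (c e) x (G.walk (G.other e x) ξ) := by
  funext t
  simp only [walk, stepPath, concatPath, G.walkState_cross h, ofReal_add_le_ofReal_iff hc]
  split_ifs with ht
  · rw [natCard_eq_zero_of_forall fun k hk => absurd ht (not_lt.2 hk.1)]
    rfl
  · have ht' := not_lt.1 ht
    simp only [ht', true_and]
    rw [natCard_eq_add_one (by simp [walkState]) (hξ.fin _ _), G.walkState_cross h]

theorem crossings_cross {x : V} {c : E → ℝ} {e : E} (h : G.firstEdge x c = some e) (hc : 0 < c e)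
    {ξ : ℕ → E → ℝ} (hξ : G.GoodClocks ξ) (t : ℝ) :
    G.crossings x (seqCons c ξ) t = if t < c e then 0 else
      G.crossings (G.other e x) ξ (t - c e) + Pi.single e 1 := by
  funext e'
  simp only [crossings, G.walkState_cross h, ofReal_add_le_ofReal_iff hc]
  split_ifs with ht
  · exact natCard_eq_zero_of_forall fun k hk => absurd ht (not_lt.2 hk.1.1)
  · have ht' := not_lt.1 ht
    simp only [ht', true_and]
    by_cases hee : e' = e
    · subst hee
      rw [natCard_eq_add_one (by simp [walkState, h])
        ((hξ.fin (G.other e' x) (t - c e')).subset fun k hk => hk.1)]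
      simp only [Pi.add_apply, Pi.single_eq_same, crossings, seqCons_succ, G.walkState_cross h]
    · rw [natCard_eq_of_not (by simp [walkState, h, Ne.symm hee])]
      simp only [Pi.add_apply, Pi.single_eq_of_ne hee, crossings, seqCons_succ,
        G.walkState_cross h, add_zero]

theorem walk_delay (x : V) {s : ℝ} (hs : 0 < s) {c : E → ℝ} (hc : ∀ e, 0 < c e)
    (ξ : ℕ → E → ℝ) :
    G.walk x (seqCons (G.delay x s c) ξ) = concatPath s x (G.walk x (seqCons c ξ)) := by
  funext t
  simp only [walk, stepPath, concatPath, G.walkState_delay x hs hc, ofReal_add_le_ofReal_iff hs]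
  split_ifs with ht
  · rw [natCard_eq_zero_of_forall fun k hk => absurd ht (not_lt.2 hk.1)]
    rfl
  · have ht' := not_lt.1 ht
    simp only [ht', true_and]
    cases Nat.card {k // (G.walkState x (seqCons c ξ) (k + 1)).1 ≤ ofReal (t - s)} with
    | zero => rfl
    | succ k => rw [G.walkState_delay x hs hc]

theorem crossings_delay (x : V) {s : ℝ} (hs : 0 < s) {c : E → ℝ} (hc : ∀ e, 0 < c e)
    (ξ : ℕ → E → ℝ) (t : ℝ) :
    G.crossings x (seqCons (G.delay x s c) ξ) t =
      if t < s then 0 else G.crossings x (seqCons c ξ) (t - s) := by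
  funext e'
  simp only [crossings, G.walkState_delay x hs hc, ofReal_add_le_ofReal_iff hs]
  split_ifs with ht
  · exact natCard_eq_zero_of_forall fun k hk => absurd ht (not_lt.2 hk.1.1)
  · have ht' := not_lt.1 ht
    simp only [ht', true_and, crossings]
    congr 2
    funext k
    cases k with
    | zero => simp [walkState, firstEdge_delay]
    | succ k => rw [G.walkState_delay x hs hc, seqCons_succ, seqCons_succ]

theorem walk_zero (x : V) {ξ : ℕ → E → ℝ} (hξ : ∀ k e, 0 < ξ k e) : G.walk x ξ 0 = x := by
  have : ∀ k, 0 < (G.walkState x ξ (k + 1)).1 := by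
    intro k
    rw [walkState]
    cases G.firstEdge (G.walkState x ξ k).2 (ξ k) with
    | none => simp
    | some e => simpa using Or.inr (hξ k e)
  rw [walk, stepPath, natCard_eq_zero_of_forall fun k hk => absurd (this k) (by simpa using hk)]
  rfl

theorem crossings_zero (x : V) {ξ : ℕ → E → ℝ} (hξ : ∀ k e, 0 < ξ k e) : G.crossings x ξ 0 = 0 := by
  have : ∀ k, 0 < (G.walkState x ξ (k + 1)).1 := by
    intro k
    rw [walkState]
    cases G.firstEdge (G.walkState x ξ k).2 (ξ k) with
    | none => simp
    | some e => simpa using Or.inr (hξ k e)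
  funext e
  exact natCard_eq_zero_of_forall fun k hk => absurd (this k) (by simpa using hk.1)

variable [Fintype E]

/-- Wherever the walk stands, step `k` lasts at least (1 + ∑ 1/ξ)⁻¹, which is smaller than every
clock of that step. These lower bounds are i.i.d. and positive, so their sums diverge, for all
starting points at once. -/
theorem ae_goodClocks : ∀ᵐ ξ ∂G.clockLaw, G.GoodClocks ξ := by
  have hp : ∀ e, IsProbabilityMeasure (expMeasure (G.W e)) := fun e =>
    isProbabilityMeasure_expMeasure (G.W_pos e)
  have hpos : ∀ᵐ c ∂(Measure.pi fun e => expMeasure (G.W e)), ∀ e, 0 < c e := by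
    rw [ae_all_iff]
    exact fun e => (measurePreserving_eval (fun e => expMeasure (G.W e)) e).quasiMeasurePreserving.ae
      (ae_pos_expMeasure _)
  have h1 : ∀ᵐ ξ ∂G.clockLaw, ∀ k e, 0 < ξ k e := by
    rw [ae_all_iff]
    exact fun k => (measurePreserving_eval_infinitePi
      (fun _ : ℕ => Measure.pi fun e => expMeasure (G.W e)) k).quasiMeasurePreserving.ae hpos
  have h2 : ∀ᵐ ξ ∂G.clockLaw, ∀ a : ℕ, ∃ n,
      (a : ℝ) < ∑ i ∈ range n, (1 + ∑ e, (ξ i e)⁻¹)⁻¹ := by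
    refine ae_exists_lt_sum (Measure.pi fun e => expMeasure (G.W e))
      (g := fun c : E → ℝ => (1 + ∑ e, (c e)⁻¹)⁻¹) (by fun_prop) ?_
    filter_upwards [hpos] with c hc
    have : 0 ≤ ∑ e, (c e)⁻¹ := Finset.sum_nonneg fun e _ => (inv_pos.2 (hc e)).le
    positivity
  filter_upwards [h1, h2] with ξ hξ h2
  have hg : ∀ i, 0 < (1 + ∑ e, (ξ i e)⁻¹)⁻¹ := fun i => by
    have : 0 ≤ ∑ e, (ξ i e)⁻¹ := Finset.sum_nonneg fun e _ => (inv_pos.2 (hξ i e)).le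
    positivity
  refine ⟨hξ, fun x t => ?_⟩
  have hle : ∀ n, ofReal (∑ i ∈ range n, (1 + ∑ e, (ξ i e)⁻¹)⁻¹) ≤
      (G.walkState x ξ n).1 := by
    intro n
    induction n with
    | zero => simp
    | succ n ih =>
      rw [walkState, Finset.sum_range_succ]
      cases h : G.firstEdge (G.walkState x ξ n).2 (ξ n) with
      | none => simp
      | some e =>
        rw [ofReal_add (Finset.sum_nonneg fun i _ => (hg i).le) (hg n).le]
        refine add_le_add ih (ofReal_le_ofReal ?_)
        rw [inv_le_comm₀ (inv_pos.1 (hg n)) (hξ n e)]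
        have := Finset.single_le_sum (f := fun e => (ξ n e)⁻¹)
          (fun e _ => (inv_pos.2 (hξ n e)).le) (mem_univ e)
        linarith
  obtain ⟨a, ha⟩ := exists_nat_gt t
  obtain ⟨n, hn⟩ := h2 a
  refine (Set.finite_lt_nat n).subset fun k hk => ?_
  by_contra hkn
  have hmono : ∑ i ∈ range n, (1 + ∑ e, (ξ i e)⁻¹)⁻¹ ≤
      ∑ i ∈ range (k + 1), (1 + ∑ e, (ξ i e)⁻¹)⁻¹ :=
    Finset.sum_le_sum_of_subset_of_nonneg (Finset.range_mono (by
      have : ¬ k < n := hkn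
      omega)) fun i _ _ => (hg i).le
  have h3 := (hle (k + 1)).trans hk
  have h4 : 0 < ∑ i ∈ range (k + 1), (1 + ∑ e, (ξ i e)⁻¹)⁻¹ :=
    Finset.sum_pos (fun i _ => hg i) (by simp)
  have h5 : ∑ i ∈ range (k + 1), (1 + ∑ e, (ξ i e)⁻¹)⁻¹ ≤ t := by
    by_contra h
    exact absurd h3 (not_le.2 ((ENNReal.ofReal_lt_ofReal_iff h4).2 (not_le.1 h)))
  linarith

end WalkShift

/-! ### The weights J as functions of the halved squared field -/

section Rates

variable {V E : Type*} (G : Network V E)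

/-- The weights `J_e`, as functions of the halved squared field. -/
def rateJ (r : V → ℝ) (e : E) : ℝ := G.J (fun x => √(2 * r x)) e

/-- The increase of `rateJ` after a time `s` at `x`. -/
def hazardJ (x : V) (r : V → ℝ) (s : ℝ) (e : E) : ℝ := G.rateJ (r + Pi.single x s) e - G.rateJ r e

theorem rateJ_mono {r r' : V → ℝ} (h : r ≤ r') (e : E) : G.rateJ r e ≤ G.rateJ r' e := by
  have h1 : ∀ x, √(2 * r x) ≤ √(2 * r' x) := fun x =>
    Real.sqrt_le_sqrt (by linarith [h x])
  have hW := (G.W_pos e).le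
  exact mul_le_mul (mul_le_mul_of_nonneg_left (h1 _) hW) (h1 _) (sqrt_nonneg _)
    (mul_nonneg hW (sqrt_nonneg _))

theorem rateJ_nonneg (r : V → ℝ) (e : E) : 0 ≤ G.rateJ r e := by
  have hW := (G.W_pos e).le
  unfold rateJ J
  positivity

theorem rateJ_eq_of_incident (r : V → ℝ) {e : E} {x : V} (h : G.Incident e x) :
    G.rateJ r e = G.W e * √(2 * r x) * √(2 * r (G.other e x)) := by
  unfold rateJ J other
  rcases h with rfl | rfl
  · simp
  · rw [if_neg (G.ne e).symm]; ring

theorem hazardJ_zero (x : V) (r : V → ℝ) (e : E) : G.hazardJ x r 0 e = 0 := by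
  simp [hazardJ]

theorem hazardJ_of_not_incident {x : V} (r : V → ℝ) (s : ℝ) {e : E} (h : ¬ G.Incident e x) :
    G.hazardJ x r s e = 0 := by
  simp only [Incident, not_or] at h
  simp [hazardJ, rateJ, J, h.1, h.2]

theorem hazardJ_of_incident {x : V} (r : V → ℝ) (s : ℝ) {e : E} (h : G.Incident e x) :
    G.hazardJ x r s e =
      G.W e * √(2 * r (G.other e x)) * (√(2 * (r x + s)) - √(2 * r x)) := by
  rw [hazardJ, G.rateJ_eq_of_incident _ h, G.rateJ_eq_of_incident _ h, Pi.add_apply, Pi.add_apply,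
    Pi.single_eq_same, Pi.single_eq_of_ne (G.other_ne e x), add_zero]
  ring

theorem hazardJ_mono (x : V) (r : V → ℝ) {s t : ℝ} (h : s ≤ t) (e : E) :
    G.hazardJ x r s e ≤ G.hazardJ x r t e := by
  refine sub_le_sub_right (G.rateJ_mono (fun z => ?_) e) _
  by_cases hz : z = x
  · subst hz; simpa using h
  · simp [hz]

theorem hazardJ_strictMonoOn {x : V} {r : V → ℝ} {e : E} (h : G.Incident e x)
    (hr : ∀ z, z ≠ x → 0 < r z) (hx : 0 ≤ r x) :
    StrictMonoOn (fun s => G.hazardJ x r s e) (Set.Ici 0) := by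
  intro s hs t _ hst
  simp only [G.hazardJ_of_incident r _ h]
  have h1 : 0 < G.W e * √(2 * r (G.other e x)) :=
    mul_pos (G.W_pos e) (sqrt_pos.2 (by linarith [hr _ (G.other_ne e x)]))
  have h2 : √(2 * (r x + s)) < √(2 * (r x + t)) :=
    Real.sqrt_lt_sqrt (by linarith [Set.mem_Ici.1 hs]) (by linarith)
  nlinarith

theorem continuous_hazardJ (x : V) (r : V → ℝ) (e : E) :
    Continuous fun s => G.hazardJ x r s e := by
  by_cases h : G.Incident e x
  · simp only [G.hazardJ_of_incident r _ h]; fun_prop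
  · simp only [G.hazardJ_of_not_incident r _ h]; fun_prop

theorem hasDerivAt_hazardJ {x : V} {r : V → ℝ} {e : E} (h : G.Incident e x)
    (hr : ∀ z, z ≠ x → 0 < r z) {s : ℝ} (hx : 0 < r x + s) :
    HasDerivAt (fun s => G.hazardJ x r s e) (G.W e * √(r (G.other e x) / (r x + s))) s := by
  simp only [G.hazardJ_of_incident r _ h]
  have hz := hr _ (G.other_ne e x)
  have h1 : HasDerivAt (fun s => 2 * (r x + s)) 2 s := by
    simpa using ((hasDerivAt_id s).const_add (r x)).const_mul 2
  have h2 := ((h1.sqrt (by positivity)).sub_const (√(2 * r x))).const_mul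
    (G.W e * √(2 * r (G.other e x)))
  refine h2.congr_deriv ?_
  rw [Real.sqrt_div hz.le, Real.sqrt_mul (by norm_num), Real.sqrt_mul (by norm_num)]
  have h3 : √(2 : ℝ) ≠ 0 := by positivity
  have h4 : √(r x + s) ≠ 0 := by positivity
  field_simp

variable [Fintype V] [Fintype E]

/-- The exponent in the density of the paths. -/
def hamil (r : V → ℝ) : ℝ :=
  ∑ x, (∑ e, if G.Incident e x then G.W e else 0) * r x + ∑ e, G.rateJ r e

/-- The increment is the total hazard accumulated by the clocks and by the Poisson processes during
a stay of length `s` at `x`. The survival probabilities therefore telescope along a path. -/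
theorem hamil_add_single_sub (x : V) (r : V → ℝ) (s : ℝ) :
    G.hamil (r + Pi.single x s) - G.hamil r =
      ∑ e, G.W e * (if G.Incident e x then s else 0) + ∑ e, G.hazardJ x r s e := by
  have : ∀ z, (∑ e, if G.Incident e z then G.W e else 0) * (r + Pi.single x s : V → ℝ) z =
      (∑ e, if G.Incident e z then G.W e else 0) * r z +
        if z = x then (∑ e, if G.Incident e z then G.W e else 0) * s else 0 := by
    intro z
    by_cases hz : z = x
    · subst hz; simp [mul_add]
    · simp [hz]
  simp only [hamil, this, hazardJ, sum_add_distrib, Finset.sum_sub_distrib,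
    Finset.sum_ite_eq', mem_univ, if_true, Finset.sum_mul]
  have : ∀ e, (if G.Incident e x then G.W e else 0) * s =
      G.W e * (if G.Incident e x then s else 0) := fun e => by split_ifs <;> simp
  simp only [this]
  ring

end Rates

/-! ### The enlarged process restarted after its first event -/

section Evolution

universe v w

variable {V : Type v} {E : Type w} (G : Network V E) (x₀ : V)

/-- The process `(X_t, n_e(t))` started at `x` with the stacks `n` and the halved squared field `r`,
where `γ` are the spacings of the Poisson processes after the initial time, stopped when the local
time at `x₀` is `u`. -/
def fwdProc (x : V) (u : ℝ) (r : V → ℝ) (n : E → ℕ) (ξ : ℕ → E → ℝ) (γ : E → ℕ → ℝ) :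
    LifePath V E :=
  (sInf (hitSet (G.walk x ξ) x₀ u), fun t => (G.walk x ξ t, fun e => n e +
    countUpTo (γ e) (G.rateJ (r + localTime (G.walk x ξ) t) e - G.rateJ r e) + G.crossings x ξ t e))

/-- A function of the final field and of the process, set to `0` if the lifetime is infinite. -/
def fwdVal (F : (V → ℝ) → LifePath V E → ℝ≥0∞) (x : V) (u : ℝ) (r : V → ℝ) (n : E → ℕ) (ξ : ℕ → E → ℝ)
    (γ : E → ℕ → ℝ) : ℝ≥0∞ :=
  if (hitSet (G.walk x ξ) x₀ u).Nonempty then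
    F (r + localTime (G.walk x ξ) (sInf (hitSet (G.walk x ξ) x₀ u))) (G.fwdProc x₀ x u r n ξ γ)
  else 0

/-- A function of a field and of a path which only depends on the path up to its lifetime. -/
def IsLocal (F : (V → ℝ) → LifePath V E → ℝ≥0∞) : Prop :=
  ∀ a (T T' : LifePath V E), T.1 = T'.1 → (∀ t ≤ T.1, T.2 t = T'.2 t) → F a T = F a T'

theorem IsLocal.comp_consPath {F : (V → ℝ) → LifePath V E → ℝ≥0∞} (hF : IsLocal F) (s : ℝ)
    (z : V × (E → ℕ)) : IsLocal fun a T => F a (consPath s z T) := by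
  intro a T T' h1 h2
  refine hF _ _ _ (by simp [consPath, h1]) fun t ht => ?_
  simp only [consPath] at ht ⊢
  split_ifs
  · rfl
  · exact h2 _ (by linarith)

/-- A function of a field and of a path which is measurable along measurable processes. -/
def ProcMeasurable {V : Type v} {E : Type w} [MeasurableSpace V]
    (F : (V → ℝ) → LifePath V E → ℝ≥0∞) : Prop :=
  ∀ ⦃Z : Type w⦄ [MeasurableSpace Z] (a : Z → V → ℝ) (T : Z → LifePath V E), Measurable a →
    Measurable (fun z => (T z).1) → Measurable (fun p : Z × ℝ => (T p.1).2 p.2) →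
      Measurable fun z => F (a z) (T z)

/-- Joint measurability in the parameter and the time is preserved by concatenation and permits
evaluation at random times; the product σ-algebra on paths would not permit the latter. -/
theorem ProcMeasurable.comp_consPath [MeasurableSpace V] {F : (V → ℝ) → LifePath V E → ℝ≥0∞}
    (hF : ProcMeasurable F) (s : ℝ) (z : V × (E → ℕ)) :
    ProcMeasurable fun a T => F a (consPath s z T) := by
  intro Z _ a T ha h1 h2
  refine hF a (fun z' => consPath s z (T z')) ha (h1.const_add s) ?_
  exact Measurable.ite (measurableSet_lt measurable_snd measurable_const) measurable_const
    (h2.comp (measurable_fst.prodMk (measurable_snd.sub_const s)))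

variable [Fintype V] [Fintype E] [MeasurableSpace V] [MeasurableSingletonClass V]

/-- Common form of both kinds of events at time `s`: `k` counts the crossings and `k'` the Poisson
points which occur then. The hypotheses on `γ` say that no point is met before `s` and that the
points beyond the level of time `s` are those of `γ'`. -/
theorem fwdVal_concat {x y : V} {u s : ℝ} {r : V → ℝ} {n : E → ℕ} {ξ ξ' : ℕ → E → ℝ}
    {γ γ' : E → ℕ → ℝ} {k k' : E → ℕ} (hs : 0 < s) (hu : 0 < u)
    (hu' : 0 < u - if x = x₀ then s else 0)
    (hX : G.walk x ξ = concatPath s x (G.walk y ξ'))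
    (hc : ∀ t, G.crossings x ξ t = if t < s then 0 else G.crossings y ξ' (t - s) + k)
    (hγ1 : ∀ t < s, ∀ e, countUpTo (γ e) (G.hazardJ x r t e) = 0)
    (hγ2 : ∀ v, 0 ≤ v → ∀ e,
      countUpTo (γ e) (G.hazardJ x r s e + v) = countUpTo (γ' e) v + k' e)
    (F : (V → ℝ) → LifePath V E → ℝ≥0∞) :
    G.fwdVal x₀ F x u r n ξ γ = G.fwdVal x₀ (fun a T => F a (consPath s (x, n) T)) y
      (u - if x = x₀ then s else 0) (r + Pi.single x s) (n + (k + k')) ξ' γ' := by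
  have hXm := G.measurable_walk_path y ξ'
  unfold fwdVal
  have hiff : (hitSet (concatPath s x (G.walk y ξ')) x₀ u).Nonempty ↔
      (hitSet (G.walk y ξ') x₀ (u - if x = x₀ then s else 0)).Nonempty := by
    rw [hitSet_concatPath hs x x₀ hXm hu hu', Set.image_nonempty]
  rw [hX]
  by_cases hne : (hitSet (G.walk y ξ') x₀ (u - if x = x₀ then s else 0)).Nonempty
  swap
  · rw [if_neg (hiff.not.2 hne), if_neg hne]
  rw [if_pos (hiff.2 hne), if_pos hne]
  have h0 : 0 ≤ sInf (hitSet (G.walk y ξ') x₀ (u - if x = x₀ then s else 0)) :=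
    Real.sInf_nonneg fun t ht => ht.1
  have hfin : ∀ t, 0 ≤ t → r + localTime (concatPath s x (G.walk y ξ')) (s + t) =
      r + Pi.single x s + localTime (G.walk y ξ') t := by
    intro t ht
    funext z
    have := localTime_concatPath hs x hXm (s + t) z
    rw [if_neg (by linarith), add_sub_cancel_left] at this
    simp [this, Pi.single_apply, eq_comm, add_assoc]
  rw [sInf_hitSet_concatPath hs x x₀ hXm hu hu' hne, hfin _ h0]
  congr 1
  refine Prod.ext ?_ (funext fun t => ?_)
  · simp only [fwdProc, consPath]
    rw [hX, sInf_hitSet_concatPath hs x x₀ hXm hu hu' hne]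
  · simp only [fwdProc, consPath, hX]
    have hL : ∀ z, localTime (concatPath s x (G.walk y ξ')) t z = _ := fun z =>
      localTime_concatPath hs x hXm t z
    split_ifs with ht
    · have h1 : r + localTime (concatPath s x (G.walk y ξ')) t = r + Pi.single x t := by
        funext z
        simp [hL z, ht, Pi.single_apply, eq_comm]
      rw [h1]
      refine Prod.ext (by simp [concatPath, ht]) (funext fun e => ?_)
      have h2 := hγ1 t ht e
      unfold hazardJ at h2
      simp only [h2, hc t, ht, if_true, Pi.zero_apply, add_zero]
    · have h1 : r + localTime (concatPath s x (G.walk y ξ')) t =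
          r + Pi.single x s + localTime (G.walk y ξ') (t - s) := by
        funext z
        simp [hL z, ht, Pi.single_apply, eq_comm, add_assoc]
      rw [h1]
      refine Prod.ext (by simp [concatPath, ht]) (funext fun e => ?_)
      have h3 : 0 ≤ G.rateJ (r + Pi.single x s + localTime (G.walk y ξ') (t - s)) e -
          G.rateJ (r + Pi.single x s) e := by
        refine sub_nonneg.2 (G.rateJ_mono (fun z => ?_) e)
        have := localTime_nonneg hXm z (t := t - s) (by linarith)
        simpa using this
      have h2 := hγ2 _ h3 e
      have h4 : G.hazardJ x r s e +
          (G.rateJ (r + Pi.single x s + localTime (G.walk y ξ') (t - s)) e -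
            G.rateJ (r + Pi.single x s) e) =
          G.rateJ (r + Pi.single x s + localTime (G.walk y ξ') (t - s)) e - G.rateJ r e := by
        unfold hazardJ; ring
      rw [h4] at h2
      simp only [h2, hc t, ht, if_false, Pi.add_apply]
      ring

theorem countUpTo_addHead_hazardJ (x : V) (r : V → ℝ) {s t : ℝ} (hts : t ≤ s) {γ : ℕ → ℝ}
    (hγ : GoodSpacing γ) (e : E) :
    countUpTo (addHead (G.hazardJ x r s e) γ) (G.hazardJ x r t e) = 0 := by
  rw [countUpTo_addHead]
  exact countUpTo_of_nonpos hγ.1 (sub_nonpos.2 (G.hazardJ_mono x r hts e))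

/-- The clock of `e` rings at `s` while the other clocks at `x` and the first Poisson points exceed
their hazards. The residual clocks `c` at `x` are then forgotten, whereas the residual points are
kept in `γ`. -/
theorem fwdVal_cross {x : V} {u s : ℝ} {r : V → ℝ} (n : E → ℕ) {e : E} (he : G.Incident e x)
    (hs : 0 < s) (hu : 0 < u) (hu' : 0 < u - if x = x₀ then s else 0) {c : E → ℝ}
    (hc : ∀ e, 0 < c e) {ξ : ℕ → E → ℝ} (hξ : G.GoodClocks ξ) {γ : E → ℕ → ℝ}
    (hγ : ∀ e, GoodSpacing (γ e)) (F : (V → ℝ) → LifePath V E → ℝ≥0∞) :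
    G.fwdVal x₀ F x u r n (seqCons (update (G.delay x s c) e s) ξ)
        (fun e' => addHead (G.hazardJ x r s e') (γ e')) =
      G.fwdVal x₀ (fun a T => F a (consPath s (x, n) T)) (G.other e x)
        (u - if x = x₀ then s else 0) (r + Pi.single x s) (n + Pi.single e 1) ξ γ := by
  have hfirst : G.firstEdge x (update (G.delay x s c) e s) = some e := by
    refine G.firstEdge_eq he fun e' he' hne => ?_
    simp [hne, delay, he', hc e']
  have hce : update (G.delay x s c) e s e = s := by simp
  have hX := G.walk_cross hfirst (by rw [hce]; exact hs) hξ
  have hcr := G.crossings_cross hfirst (by rw [hce]; exact hs) hξ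
  rw [hce] at hX hcr
  have := G.fwdVal_concat x₀ (r := r) (n := n) (k := Pi.single e 1) (k' := 0) (γ' := γ)
    (γ := fun e' => addHead (G.hazardJ x r s e') (γ e')) hs hu hu' hX hcr
    (fun t ht e' => G.countUpTo_addHead_hazardJ x r ht.le (hγ e') e')
    (fun v hv e' => by rw [countUpTo_addHead, add_sub_cancel_left]; simp) F
  rw [this, add_zero]

/-- A point of N_e lies exactly at the level reached at time `s`. The walk stays at `x` with its
residual clocks `c`, and N_e continues with the sequence which follows this point. -/
theorem fwdVal_stay {x : V} {u s : ℝ} {r : V → ℝ} (n : E → ℕ) {e : E} (he : G.Incident e x)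
    (hr : ∀ z, z ≠ x → 0 < r z) (hrx : 0 ≤ r x)
    (hs : 0 < s) (hu : 0 < u) (hu' : 0 < u - if x = x₀ then s else 0) {c : E → ℝ}
    (hc : ∀ e, 0 < c e) (ξ : ℕ → E → ℝ) {γ : E → ℕ → ℝ}
    (hγ : ∀ e, GoodSpacing (γ e)) (F : (V → ℝ) → LifePath V E → ℝ≥0∞) :
    G.fwdVal x₀ F x u r n (seqCons (G.delay x s c) ξ)
        (fun e' => if e' = e then seqCons (G.hazardJ x r s e') (γ e')
          else addHead (G.hazardJ x r s e') (γ e')) =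
      G.fwdVal x₀ (fun a T => F a (consPath s (x, n) T)) x
        (u - if x = x₀ then s else 0) (r + Pi.single x s) (n + Pi.single e 1)
        (seqCons c ξ) γ := by
  have hX := G.walk_delay x hs hc ξ
  have hcr := G.crossings_delay x hs hc ξ
  have hpos : 0 < G.hazardJ x r s e := by
    rw [← G.hazardJ_zero x r e]
    exact G.hazardJ_strictMonoOn he hr hrx Set.self_mem_Ici hs.le hs
  have := G.fwdVal_concat x₀ (r := r) (n := n) (k := 0) (k' := Pi.single e 1) (γ' := γ)
    (γ := fun e' => if e' = e then seqCons (G.hazardJ x r s e') (γ e')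
          else addHead (G.hazardJ x r s e') (γ e')) hs hu hu' hX (by simpa using hcr)
    (fun t ht e' => by
      by_cases hee : e' = e
      · subst hee
        rw [if_pos rfl]
        rcases le_or_gt 0 t with h0 | h0
        · exact countUpTo_seqCons_of_lt (hγ e') hpos
            (G.hazardJ_strictMonoOn he hr hrx h0 hs.le ht)
        · refine countUpTo_of_nonpos ((hγ e').seqCons hpos).1 ?_
          rw [← G.hazardJ_zero x r e']
          exact G.hazardJ_mono x r h0.le e'
      · rw [if_neg hee]
        exact G.countUpTo_addHead_hazardJ x r ht.le (hγ e') e')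
    (fun v hv e' => by
      by_cases hee : e' = e
      · subst hee
        rw [if_pos rfl, countUpTo_seqCons (hγ e') hpos (by linarith), add_sub_cancel_left]
        simp
      · rw [if_neg hee, countUpTo_addHead, add_sub_cancel_left]; simp [hee]) F
  rw [this, zero_add]

/-- No alarm rings before `u`, so the local time at `x₀` reaches its target during the first stay.
The values at later times are irrelevant, whence the locality of `F`. -/
theorem fwdVal_const {u : ℝ} {r : V → ℝ} (n : E → ℕ) (hu : 0 < u) {c : E → ℝ}
    (hc : ∀ e, 0 < c e) {ξ : ℕ → E → ℝ} (hξ : ∀ k e, 0 < ξ k e) {γ : E → ℕ → ℝ}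
    (hγ : ∀ e, GoodSpacing (γ e)) {F : (V → ℝ) → LifePath V E → ℝ≥0∞} (hF : IsLocal F) :
    G.fwdVal x₀ F x₀ u r n (seqCons (G.delay x₀ u c) ξ)
        (fun e => addHead (G.hazardJ x₀ r u e) (γ e)) = F (r + Pi.single x₀ u) (u, fun _ => (x₀, n)) := by
  have hX := G.walk_delay x₀ hu hc ξ
  have hcr := G.crossings_delay x₀ hu hc ξ
  have hξ' : ∀ k e, 0 < seqCons c ξ k e := by
    rintro (_ | k) e
    exacts [hc e, hξ k e]
  have hXm := G.measurable_walk_path x₀ (seqCons c ξ)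
  have hL := fun t z => localTime_concatPath hu x₀ hXm t z
  have hL' : ∀ t ≤ u, localTime (concatPath u x₀ (G.walk x₀ (seqCons c ξ))) t = Pi.single x₀ t := by
    intro t ht
    funext z
    rw [hL]
    rcases ht.lt_or_eq with h | rfl
    · simp [h, Pi.single_apply, eq_comm]
    · simp [Pi.single_apply, eq_comm, localTime_zero]
  have hmem : u ∈ hitSet (concatPath u x₀ (G.walk x₀ (seqCons c ξ))) x₀ u :=
    ⟨hu.le, by rw [hL' u le_rfl]; simp⟩
  have hinf : sInf (hitSet (concatPath u x₀ (G.walk x₀ (seqCons c ξ))) x₀ u) = u := by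
    refine le_antisymm (csInf_le ⟨0, fun t ht => ht.1⟩ hmem) (le_csInf ⟨u, hmem⟩ fun t ht => ?_)
    by_contra h
    have := ht.2
    rw [hL' t (not_le.1 h).le, Pi.single_eq_same] at this
    exact h this.ge
  rw [fwdVal, hX, if_pos ⟨u, hmem⟩, hinf, hL' u le_rfl]
  refine hF _ _ _ (by simp only [fwdProc, hX, hinf]) fun t ht => ?_
  simp only [fwdProc, hX, hinf] at ht ⊢
  rw [hL' t ht]
  refine Prod.ext ?_ (funext fun e => ?_)
  · rcases ht.lt_or_eq with h | rfl
    · simp [concatPath, h]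
    · simp [concatPath, G.walk_zero x₀ hξ']
  · have h1 : countUpTo (addHead (G.hazardJ x₀ r u e) (γ e))
        (G.rateJ (r + Pi.single x₀ t) e - G.rateJ r e) = 0 :=
      G.countUpTo_addHead_hazardJ x₀ r ht (hγ e) e
    simp only [h1, hcr t]
    rcases ht.lt_or_eq with h | rfl
    · simp [h]
    · simp [G.crossings_zero x₀ hξ']

variable {Z : Type w} [MeasurableSpace Z]

theorem measurable_rateJ (e : E) : Measurable fun r : V → ℝ => G.rateJ r e := by
  unfold rateJ J; fun_prop

theorem measurable_fwdVal {F : (V → ℝ) → LifePath V E → ℝ≥0∞} (hF : ProcMeasurable F) (x : V) {u : ℝ}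
    (hu : 0 < u) (n : E → ℕ) {r : Z → V → ℝ} {ξ : Z → ℕ → E → ℝ} {γ : Z → E → ℕ → ℝ}
    (hr : Measurable r) (hξ : Measurable ξ) (hγ : Measurable γ) :
    Measurable fun z => G.fwdVal x₀ F x u (r z) n (ξ z) (γ z) := by
  have hinf : Measurable fun z => sInf (hitSet (G.walk x (ξ z)) x₀ u) := by
    have : ∀ z, sInf (hitSet (G.walk x (ξ z)) x₀ u) =
        sInf {t : ℝ | 0 ≤ t ∧ u ≤ localTime (G.walk x (ξ z)) t x₀} := fun z =>
      sInf_localTime_eq (G.measurable_walk_path x (ξ z)) x₀ hu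
    simp only [this]
    exact measurable_sInf_of_monotone (p := fun z t => u ≤ localTime (G.walk x (ξ z)) t x₀)
      (fun t => measurableSet_le measurable_const
        (G.measurable_walk_localTime x hξ measurable_const x₀)) fun z s t _ hst h =>
      h.trans (localTime_mono (G.measurable_walk_path x _) x₀ hst)
  refine Measurable.ite ?_ (hF _ _ (hr.add (measurable_pi_lambda _ fun z =>
    G.measurable_walk_localTime x hξ hinf z)) hinf (Measurable.prodMk ?_
      (measurable_pi_lambda _ fun e => ?_))) measurable_const
  -- The local time is continuous and nondecreasing, so the level is hit if and only if it is
  -- exceeded at some integer time.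
  · have : ∀ z, (hitSet (G.walk x (ξ z)) x₀ u).Nonempty ↔
        ∃ m : ℕ, u ≤ localTime (G.walk x (ξ z)) m x₀ := by
      intro z
      have hXm := G.measurable_walk_path x (ξ z)
      constructor
      · rintro ⟨t, ht, htu⟩
        obtain ⟨m, hm⟩ := exists_nat_ge t
        exact ⟨m, htu.ge.trans (localTime_mono hXm x₀ hm)⟩
      · rintro ⟨m, hm⟩
        obtain ⟨s, hs, hs'⟩ := intermediate_value_Icc (Nat.cast_nonneg (α := ℝ) m)
          (continuous_localTime hXm x₀).continuousOn (show u ∈ Set.Icc _ _ from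
            ⟨by rw [localTime_zero]; exact hu.le, hm⟩)
        exact ⟨s, hs.1, hs'⟩
    simp only [this]
    exact measurableSet_exists fun m => measurableSet_le measurable_const
      (G.measurable_walk_localTime x hξ measurable_const x₀)
  · exact G.measurable_walk x (hξ.comp measurable_fst) measurable_snd
  · refine (measurable_const.add (Measurable.countUpTo ((measurable_pi_apply e).comp
      (hγ.comp measurable_fst)) ?_)).add
        (G.measurable_crossings x (hξ.comp measurable_fst) measurable_snd e)
    refine ((G.measurable_rateJ e).comp ((hr.comp measurable_fst).add
      (measurable_pi_lambda _ fun z => ?_))).sub ((G.measurable_rateJ e).comp (hr.comp measurable_fst))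
    exact G.measurable_walk_localTime x (hξ.comp measurable_fst) measurable_snd z

end Evolution

end Network

section Alarms

variable {ι : Type*}

/-- The alarms, if the alarm `i` rings at time `s` and the others have residual values `α`. -/
def ringAt (H : ι → ℝ → ℝ) (i : ι) (s : ℝ) (α : ι → ℝ) : ι → ℝ :=
  update (fun j => α j + H j s) i (H i s)

theorem ringAt_same (H : ι → ℝ → ℝ) (i : ι) (s : ℝ) (α : ι → ℝ) : ringAt H i s α i = H i s := by
  simp [ringAt]

theorem ringAt_of_ne (H : ι → ℝ → ℝ) {i j : ι} (h : j ≠ i) (s : ℝ) (α : ι → ℝ) :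
    ringAt H i s α j = α j + H j s := by
  simp [ringAt, h]

variable [Fintype ι] {w : ι → ℝ} {I : Finset ι} {H H' : ι → ℝ → ℝ}

/-- Here `p` stands for "the position is `x₀`". At `x₀` the stay is limited by `u` and there is a
term without event; elsewhere the first event may come at any time. -/
theorem sum_ringAt_add_le (hw : ∀ i, 0 < w i) (h : Hazards I H H') {K : (ι → ℝ) → ℝ≥0∞}
    (hK : Measurable K) {u : ℝ} (hu : 0 < u) (p : Prop) {S : Set ℝ}
    (hS : S = {s | 0 < s ∧ 0 < u - if p then s else 0}) :
    (∑ i ∈ I, ∫⁻ s in S, ofReal (w i * |H' i s| * exp (-∑ j, w j * H j s)) *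
        ∫⁻ α, K (ringAt H i s α) ∂alarmLaw w) +
      (if p then ofReal (exp (-∑ j, w j * H j u)) *
        ∫⁻ α, K (fun j => α j + H j u) ∂alarmLaw w else 0) ≤ ∫⁻ α, K α ∂alarmLaw w := by
  subst hS
  by_cases hp : p
  · have : {s | 0 < s ∧ 0 < u - if p then s else 0} = Ioo 0 u := by ext s; simp [hp]
    rw [this, if_pos hp]
    exact sum_firstAlarm_add_le hw h hK hu
  · have : {s | 0 < s ∧ 0 < u - if p then s else 0} = Ioi 0 := by ext s; simp [hp, hu]
    rw [this, if_neg hp, add_zero]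
    exact sum_firstAlarm_le hw h hK

end Alarms

namespace Network

/-! ### Lower bound for the law of the enlarged process on skeletons -/

section Peel

variable {V E : Type*} (G : Network V E) (x₀ : V)

/-- The rates of the clocks and of the Poisson processes. -/
def alarmRate : E ⊕ E → ℝ := Sum.elim G.W fun _ => 1

/-- The cumulative hazards at `x` of the clocks and of the Poisson processes. -/
def alarmHazard (x : V) (r : V → ℝ) : E ⊕ E → ℝ → ℝ :=
  Sum.elim (fun e s => if G.Incident e x then s else 0) fun e s => G.hazardJ x r s e

/-- The hazard rates at `x` of the clocks and of the Poisson processes. -/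
def alarmHazardRate (x : V) (r : V → ℝ) : E ⊕ E → ℝ → ℝ :=
  Sum.elim (fun _ _ => 1) fun e s => G.W e * √(r (G.other e x) / (r x + s))

theorem alarmRate_pos (i : E ⊕ E) : 0 < G.alarmRate i := by
  cases i with
  | inl e => exact G.W_pos e
  | inr e => exact one_pos

variable [Fintype V] [Fintype E]

/-- The active alarms at `x`. -/
def activeAlarms (x : V) : Finset (E ⊕ E) :=
  (univ.filter fun e => G.Incident e x).disjSum (univ.filter fun e => G.Incident e x)

theorem hazards {x : V} {r : V → ℝ} (hr : ∀ z, z ≠ x → 0 < r z) (hrx : 0 ≤ r x) :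
    Hazards (G.activeAlarms x) (G.alarmHazard x r) (G.alarmHazardRate x r) where
  zero := by
    rintro (e | e)
    · simp [alarmHazard]
    · exact G.hazardJ_zero x r e
  inactive := by
    rintro (e | e) he s
    · have : ¬ G.Incident e x := by simpa [activeAlarms] using he
      simp [alarmHazard, this]
    · have : ¬ G.Incident e x := by simpa [activeAlarms] using he
      exact G.hazardJ_of_not_incident r s this
  strictMono := by
    rintro (e | e) he
    · have : G.Incident e x := by simpa [activeAlarms] using he
      simp only [alarmHazard, Sum.elim_inl, this, if_true]
      exact strictMono_id.strictMonoOn _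
    · have : G.Incident e x := by simpa [activeAlarms] using he
      exact G.hazardJ_strictMonoOn this hr hrx
  cont := by
    rintro (e | e)
    · simp only [alarmHazard, Sum.elim_inl]
      split_ifs <;> fun_prop
    · exact G.continuous_hazardJ x r e
  deriv := by
    rintro (e | e) he s hs
    · have : G.Incident e x := by simpa [activeAlarms] using he
      simp only [alarmHazard, alarmHazardRate, Sum.elim_inl, this, if_true]
      exact hasDerivAt_id s
    · have : G.Incident e x := by simpa [activeAlarms] using he
      exact G.hasDerivAt_hazardJ this hr (by linarith)

theorem sum_alarmRate_mul (x : V) (r : V → ℝ) (s : ℝ) :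
    ∑ j, G.alarmRate j * G.alarmHazard x r j s = G.hamil (r + Pi.single x s) - G.hamil r := by
  rw [G.hamil_add_single_sub, Fintype.sum_sum_type]
  simp [alarmRate, alarmHazard]

theorem isProbabilityMeasure_clock (e : E) : IsProbabilityMeasure (expMeasure (G.W e)) :=
  isProbabilityMeasure_expMeasure (G.W_pos e)

theorem isProbabilityMeasure_alarm (i : E ⊕ E) : IsProbabilityMeasure (expMeasure (G.alarmRate i)) :=
  isProbabilityMeasure_expMeasure (G.alarmRate_pos i)

instance isProbabilityMeasure_clockLaw : IsProbabilityMeasure G.clockLaw := by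
  have := G.isProbabilityMeasure_clock
  unfold clockLaw; infer_instance

instance isProbabilityMeasure_poissonSpacings : IsProbabilityMeasure (poissonSpacings E) := by
  unfold poissonSpacings; infer_instance

/-- The clocks and the Poisson processes may be rebuilt from independent alarms. -/
theorem lintegral_alarm_split {g : (E → ℝ) × (ℕ → E → ℝ) → ℕ → E → ℝ}
    (hg : MeasurePreserving g ((Measure.pi fun e => expMeasure (G.W e)).prod G.clockLaw) G.clockLaw)
    {f : E → ℝ × (ℕ → ℝ) → ℕ → ℝ}
    (hf : ∀ e, MeasurePreserving (f e) ((expMeasure 1).prod spacingLaw) spacingLaw)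
    {K : (ℕ → E → ℝ) × (E → ℕ → ℝ) → ℝ≥0∞} (hK : Measurable K) :
    ∫⁻ α, ∫⁻ q, K (g (fun e => α (.inl e), q.1), fun e => f e (α (.inr e), q.2 e))
      ∂(G.clockLaw.prod (poissonSpacings E)) ∂(alarmLaw G.alarmRate) =
    ∫⁻ q, K q ∂(G.clockLaw.prod (poissonSpacings E)) := by
  have := G.isProbabilityMeasure_clock
  have := G.isProbabilityMeasure_alarm
  have hF : MeasurePreserving (fun p : (E → ℝ) × (E → ℕ → ℝ) => fun e => f e (p.1 e, p.2 e))
      ((Measure.pi fun _ : E => expMeasure 1).prod (poissonSpacings E)) (poissonSpacings E) :=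
    (measurePreserving_pi (fun _ => (expMeasure 1).prod spacingLaw) (fun _ => spacingLaw) hf).comp
      (measurePreserving_arrowProdEquivProdArrow ℝ (ℕ → ℝ) E (fun _ => expMeasure 1)
        (fun _ => spacingLaw)).symm
  have hfm := hF.measurable
  have hgm := hg.measurable
  have hm4 : Measurable fun z : ((E → ℝ) × (E → ℝ)) × (ℕ → E → ℝ) × (E → ℕ → ℝ) =>
      K (g (z.1.1, z.2.1), fun e => f e (z.1.2 e, z.2.2 e)) :=
    hK.comp (Measurable.prodMk (by fun_prop) (hfm.comp
      (f := fun z : ((E → ℝ) × (E → ℝ)) × (ℕ → E → ℝ) × (E → ℕ → ℝ) => (z.1.2, z.2.2))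
      (by fun_prop)))
  have h1 := (measurePreserving_sumPiEquivProdPi
    (X := fun _ : E ⊕ E => ℝ) fun i => expMeasure (G.alarmRate i)).lintegral_comp
    (f := fun p => ∫⁻ q, K (g (p.1, q.1), fun e => f e (p.2 e, q.2 e))
      ∂(G.clockLaw.prod (poissonSpacings E))) (hm4.lintegral_prod_right' )
  refine h1.trans ?_
  change ∫⁻ p, _ ∂((Measure.pi fun e => expMeasure (G.W e)).prod
    (Measure.pi fun _ : E => expMeasure 1)) = _
  rw [lintegral_prod _ (hm4.lintegral_prod_right').aemeasurable]
  have h2 : ∀ a : E → ℝ, ∫⁻ b : E → ℝ, ∫⁻ q, K (g (a, q.1), fun e => f e (b e, q.2 e))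
      ∂(G.clockLaw.prod (poissonSpacings E)) ∂(Measure.pi fun _ : E => expMeasure 1) =
      ∫⁻ ξ, ∫⁻ γ, K (g (a, ξ), γ) ∂(poissonSpacings E) ∂G.clockLaw := by
    intro a
    have hma : Measurable fun z : (E → ℝ) × (ℕ → E → ℝ) × (E → ℕ → ℝ) =>
        K (g (a, z.2.1), fun e => f e (z.1 e, z.2.2 e)) :=
      hm4.comp (f := fun z : (E → ℝ) × (ℕ → E → ℝ) × (E → ℕ → ℝ) => ((a, z.1), z.2)) (by fun_prop)
    have h3 : ∀ b : E → ℝ, ∫⁻ q, K (g (a, q.1), fun e => f e (b e, q.2 e))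
        ∂(G.clockLaw.prod (poissonSpacings E)) = ∫⁻ ξ, ∫⁻ γ, K (g (a, ξ), fun e => f e (b e, γ e))
        ∂(poissonSpacings E) ∂G.clockLaw := fun b =>
      lintegral_prod _ (hma.comp (measurable_const.prodMk measurable_id)).aemeasurable
    simp only [h3]
    have hmb : Measurable fun z : ((E → ℝ) × (ℕ → E → ℝ)) × (E → ℕ → ℝ) =>
        K (g (a, z.1.2), fun e => f e (z.1.1 e, z.2 e)) :=
      hma.comp (f := fun z : ((E → ℝ) × (ℕ → E → ℝ)) × (E → ℕ → ℝ) => (z.1.1, z.1.2, z.2))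
        (by fun_prop)
    rw [lintegral_lintegral_swap (hmb.lintegral_prod_right').aemeasurable]
    refine lintegral_congr fun ξ => ?_
    have hmc : Measurable fun γ : E → ℕ → ℝ => K (g (a, ξ), γ) :=
      hK.comp (measurable_const.prodMk measurable_id)
    rw [← hF.lintegral_comp hmc]
    exact (lintegral_prod _ (hmc.comp hfm).aemeasurable).symm
  have hmk : Measurable fun ξ => ∫⁻ γ, K (ξ, γ) ∂(poissonSpacings E) := hK.lintegral_prod_right'
  simp only [h2]
  rw [lintegral_prod _ hK.aemeasurable, ← hg.lintegral_comp hmk]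
  exact (lintegral_prod _ (hmk.comp hgm).aemeasurable).symm

theorem ae_alarm_pos : ∀ᵐ α ∂(alarmLaw G.alarmRate), ∀ i, 0 < α i := by
  have := G.isProbabilityMeasure_alarm
  rw [ae_all_iff]
  exact fun i => (measurePreserving_eval (fun i => expMeasure (G.alarmRate i))
    i).quasiMeasurePreserving.ae (ae_pos_expMeasure _)

theorem ae_good : ∀ᵐ q ∂(G.clockLaw.prod (poissonSpacings E)),
    G.GoodClocks q.1 ∧ ∀ e, GoodSpacing (q.2 e) := by
  have h : ∀ᵐ γ ∂(poissonSpacings E), ∀ e, GoodSpacing (γ e) := by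
    rw [ae_all_iff]
    exact fun e => (measurePreserving_eval (fun _ : E => spacingLaw)
      e).quasiMeasurePreserving.ae ae_goodSpacing
  exact (Measure.quasiMeasurePreserving_fst.ae G.ae_goodClocks).and
    (Measure.quasiMeasurePreserving_snd.ae h)

variable [MeasurableSpace V] [MeasurableSingletonClass V]

/-- The expectation of a function of the process. -/
def fwdExp (F : (V → ℝ) → LifePath V E → ℝ≥0∞) (x : V) (u : ℝ) (r : V → ℝ) (n : E → ℕ) : ℝ≥0∞ :=
  ∫⁻ q, G.fwdVal x₀ F x u r n q.1 q.2 ∂(G.clockLaw.prod (poissonSpacings E))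

theorem measurableSet_allowed (x : V) (u : ℝ) :
    MeasurableSet {s : ℝ | 0 < s ∧ 0 < u - if x = x₀ then s else 0} := by
  have h : Measurable fun s : ℝ => u - if x = x₀ then s else 0 := by
    split_ifs <;> fun_prop
  exact (measurableSet_lt measurable_const measurable_id).inter
    (measurableSet_lt measurable_const h)

/-- The expectation of a function of the process, given the values of the alarms. -/
def alarmVal (F : (V → ℝ) → LifePath V E → ℝ≥0∞) (x : V) (u : ℝ) (r : V → ℝ) (n : E → ℕ)
    (α : E ⊕ E → ℝ) : ℝ≥0∞ :=
  ∫⁻ q, G.fwdVal x₀ F x u r n (seqCons (fun e => α (.inl e)) q.1)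
    (fun e => seqCons (α (.inr e)) (q.2 e)) ∂(G.clockLaw.prod (poissonSpacings E))

theorem measurable_alarmVal {F : (V → ℝ) → LifePath V E → ℝ≥0∞} (hF : ProcMeasurable F) (x : V) {u : ℝ}
    (hu : 0 < u) (r : V → ℝ) (n : E → ℕ) : Measurable (G.alarmVal x₀ F x u r n) := by
  refine Measurable.lintegral_prod_right' (f := fun z : (E ⊕ E → ℝ) × (ℕ → E → ℝ) × (E → ℕ → ℝ) =>
    G.fwdVal x₀ F x u r n (seqCons (fun e => z.1 (.inl e)) z.2.1)
      (fun e => seqCons (z.1 (.inr e)) (z.2.2 e))) ?_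
  refine G.measurable_fwdVal x₀ hF x hu n measurable_const (Measurable.seqCons (by fun_prop)
    (by fun_prop)) (measurable_pi_lambda _ fun e => Measurable.seqCons (by fun_prop) (by fun_prop))

theorem measurePreserving_clock_cons :
    MeasurePreserving (fun p : (E → ℝ) × (ℕ → E → ℝ) => seqCons p.1 p.2)
      ((Measure.pi fun e => expMeasure (G.W e)).prod G.clockLaw) G.clockLaw := by
  have := G.isProbabilityMeasure_clock
  exact measurePreserving_seqCons _

theorem measurePreserving_spacing_cons :
    MeasurePreserving (fun p : ℝ × (ℕ → ℝ) => seqCons p.1 p.2)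
      ((expMeasure 1).prod spacingLaw) spacingLaw := by
  exact measurePreserving_seqCons _

theorem lintegral_fwdVal_split {g : (E → ℝ) × (ℕ → E → ℝ) → ℕ → E → ℝ}
    (hg : MeasurePreserving g ((Measure.pi fun e => expMeasure (G.W e)).prod G.clockLaw) G.clockLaw)
    {f : E → ℝ × (ℕ → ℝ) → ℕ → ℝ}
    (hf : ∀ e, MeasurePreserving (f e) ((expMeasure 1).prod spacingLaw) spacingLaw)
    {F : (V → ℝ) → LifePath V E → ℝ≥0∞} (hF : ProcMeasurable F) (x : V) {u : ℝ} (hu : 0 < u) (r : V → ℝ)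
    (n : E → ℕ) :
    ∫⁻ α, ∫⁻ q, G.fwdVal x₀ F x u r n (g (fun e => α (.inl e), q.1))
      (fun e => f e (α (.inr e), q.2 e))
      ∂(G.clockLaw.prod (poissonSpacings E)) ∂(alarmLaw G.alarmRate) = G.fwdExp x₀ F x u r n := by
  have hK : Measurable fun q : (ℕ → E → ℝ) × (E → ℕ → ℝ) => G.fwdVal x₀ F x u r n q.1 q.2 :=
    G.measurable_fwdVal x₀ hF x hu n measurable_const measurable_fst measurable_snd
  exact G.lintegral_alarm_split hg hf hK

theorem lintegral_alarmVal {F : (V → ℝ) → LifePath V E → ℝ≥0∞} (hF : ProcMeasurable F) (x : V) {u : ℝ}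
    (hu : 0 < u) (r : V → ℝ) (n : E → ℕ) :
    ∫⁻ α, G.alarmVal x₀ F x u r n α ∂(alarmLaw G.alarmRate) = G.fwdExp x₀ F x u r n :=
  G.lintegral_fwdVal_split x₀ G.measurePreserving_clock_cons
    (fun _ => measurePreserving_spacing_cons) hF x hu r n

/-- After a crossing the residual clocks at `x` play no role and are integrated out, which is why
the clocks are rebuilt with `Prod.snd`. The residual Poisson alarms remain as first spacings. -/
theorem lintegral_alarmVal_cross {F : (V → ℝ) → LifePath V E → ℝ≥0∞} (hF : ProcMeasurable F) {x : V} {u s : ℝ}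
    {r : V → ℝ} (n : E → ℕ) {e : E} (he : G.Incident e x) (hs : 0 < s) (hu : 0 < u)
    (hu' : 0 < u - if x = x₀ then s else 0) :
    ∫⁻ α, G.alarmVal x₀ F x u r n (ringAt (G.alarmHazard x r) (.inl e) s α)
        ∂(alarmLaw G.alarmRate) =
      G.fwdExp x₀ (fun a T => F a (consPath s (x, n) T)) (G.other e x) (u - if x = x₀ then s else 0)
        (r + Pi.single x s) (n + Pi.single e 1) := by
  have := G.isProbabilityMeasure_clock
  have hsnd : MeasurePreserving (Prod.snd : (E → ℝ) × (ℕ → E → ℝ) → _)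
      ((Measure.pi fun e => expMeasure (G.W e)).prod G.clockLaw) G.clockLaw :=
    measurePreserving_snd
  have hFc := hF.comp_consPath s (x, n)
  rw [← G.lintegral_fwdVal_split x₀ (g := Prod.snd) (f := fun _ p => seqCons p.1 p.2) hsnd
    (fun _ => measurePreserving_spacing_cons) hFc (G.other e x) hu']
  refine lintegral_congr_ae ?_
  filter_upwards [G.ae_alarm_pos] with α hα
  refine lintegral_congr_ae ?_
  filter_upwards [G.ae_good] with q hq
  rw [← G.fwdVal_cross x₀ n (r := r) he hs hu hu' (c := fun e => α (.inl e))
    (fun e => hα _) hq.1 (γ := fun e => seqCons (α (.inr e)) (q.2 e))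
    (fun e => (hq.2 e).seqCons (hα _)) F]
  have h1 : (fun e' => ringAt (G.alarmHazard x r) (.inl e) s α (.inl e')) =
      update (G.delay x s fun e => α (.inl e)) e s := by
    funext e'
    by_cases hee : e' = e
    · subst hee; rw [ringAt_same]; simp [alarmHazard, he]
    · rw [ringAt_of_ne _ (by simpa using hee)]; simp [hee, alarmHazard, delay]
  have h2 : (fun e' => seqCons (ringAt (G.alarmHazard x r) (.inl e) s α (.inr e')) (q.2 e')) =
      fun e' => addHead (G.hazardJ x r s e') (seqCons (α (.inr e')) (q.2 e')) := by
    funext e'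
    rw [ringAt_of_ne _ (by simp)]; rfl
  rw [h1, h2]

/-- After a Poisson point of `e` all the residual clocks are kept, and only the alarm of N_e is
discarded in favour of the next spacings. -/
theorem lintegral_alarmVal_stay {F : (V → ℝ) → LifePath V E → ℝ≥0∞} (hF : ProcMeasurable F) {x : V} {u s : ℝ}
    {r : V → ℝ} (hr : ∀ z, z ≠ x → 0 < r z) (hrx : 0 ≤ r x) (n : E → ℕ) {e : E}
    (he : G.Incident e x) (hs : 0 < s) (hu : 0 < u) (hu' : 0 < u - if x = x₀ then s else 0) :
    ∫⁻ α, G.alarmVal x₀ F x u r n (ringAt (G.alarmHazard x r) (.inr e) s α)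
        ∂(alarmLaw G.alarmRate) =
      G.fwdExp x₀ (fun a T => F a (consPath s (x, n) T)) x (u - if x = x₀ then s else 0)
        (r + Pi.single x s) (n + Pi.single e 1) := by
  have hsnd : MeasurePreserving (Prod.snd : ℝ × (ℕ → ℝ) → _)
      ((expMeasure 1).prod spacingLaw) spacingLaw := measurePreserving_snd
  have hFc := hF.comp_consPath s (x, n)
  rw [← G.lintegral_fwdVal_split x₀ (g := fun p => seqCons p.1 p.2)
    G.measurePreserving_clock_cons
    (f := fun e' p => if e' = e then p.2 else seqCons p.1 p.2)
    (fun e' => by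
      by_cases hee : e' = e
      · simp only [hee, if_true]; exact hsnd
      · simp only [hee, if_false]; exact measurePreserving_spacing_cons)
    hFc x hu']
  refine lintegral_congr_ae ?_
  filter_upwards [G.ae_alarm_pos] with α hα
  refine lintegral_congr_ae ?_
  filter_upwards [G.ae_good] with q hq
  rw [← G.fwdVal_stay x₀ n (r := r) he hr hrx hs hu hu' (c := fun e => α (.inl e))
    (fun e => hα _) q.1 (γ := fun e' => if e' = e then q.2 e' else seqCons (α (.inr e')) (q.2 e'))
    (fun e' => by split_ifs; exacts [hq.2 e', (hq.2 e').seqCons (hα _)]) F]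
  have h1 : (fun e' => ringAt (G.alarmHazard x r) (.inr e) s α (.inl e')) =
      G.delay x s fun e => α (.inl e) := by
    funext e'
    rw [ringAt_of_ne _ (by simp)]; rfl
  have h2 : (fun e' => seqCons (ringAt (G.alarmHazard x r) (.inr e) s α (.inr e')) (q.2 e')) =
      fun e' => if e' = e then seqCons (G.hazardJ x r s e')
        (if e' = e then q.2 e' else seqCons (α (.inr e')) (q.2 e'))
        else addHead (G.hazardJ x r s e')
          (if e' = e then q.2 e' else seqCons (α (.inr e')) (q.2 e')) := by
    funext e'
    by_cases hee : e' = e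
    · subst hee; rw [ringAt_same, if_pos rfl, if_pos rfl]; rfl
    · rw [ringAt_of_ne _ (by simpa using hee), if_neg hee, if_neg hee]; rfl
  rw [h1, h2]

theorem lintegral_alarmVal_nil {F : (V → ℝ) → LifePath V E → ℝ≥0∞} (hFl : IsLocal F) {u : ℝ} (r : V → ℝ)
    (n : E → ℕ) (hu : 0 < u) :
    ∫⁻ α, G.alarmVal x₀ F x₀ u r n (fun j => α j + G.alarmHazard x₀ r j u)
      ∂(alarmLaw G.alarmRate) = F (r + Pi.single x₀ u) (u, fun _ => (x₀, n)) := by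
  have := G.isProbabilityMeasure_alarm
  refine (lintegral_congr_ae (g := fun _ => F (r + Pi.single x₀ u) (u, fun _ => (x₀, n))) ?_).trans (by simp)
  filter_upwards [G.ae_alarm_pos] with α hα
  refine (lintegral_congr_ae (g := fun _ => F (r + Pi.single x₀ u) (u, fun _ => (x₀, n))) ?_).trans (by simp)
  filter_upwards [G.ae_good] with q hq
  exact G.fwdVal_const x₀ (r := r) n hu (c := fun e => α (.inl e)) (fun e => hα _) hq.1.pos
    (γ := fun e => seqCons (α (.inr e)) (q.2 e)) (fun e => (hq.2 e).seqCons (hα _)) hFl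

/-- The decomposition of the forward process according to its first event. -/
theorem fwdExp_peel {F : (V → ℝ) → LifePath V E → ℝ≥0∞} (hF : ProcMeasurable F) (hFl : IsLocal F) {x : V}
    {u : ℝ} (hu : 0 < u) {r : V → ℝ} (hr : ∀ z, z ≠ x → 0 < r z) (hrx : 0 ≤ r x) (n : E → ℕ) :
    (∑ e, ∑ y, ∫⁻ s in {s | 0 < s ∧ 0 < u - if x = x₀ then s else 0},
        ofReal (G.fwdRate (r + Pi.single x s) e x y *
          exp (-(G.hamil (r + Pi.single x s) - G.hamil r))) *
        G.fwdExp x₀ (fun a T => F a (consPath s (x, n) T)) y (u - if x = x₀ then s else 0)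
          (r + Pi.single x s) (n + Pi.single e 1)) +
      (if x = x₀ then ofReal (exp (-(G.hamil (r + Pi.single x₀ u) - G.hamil r))) *
        F (r + Pi.single x₀ u) (u, fun _ => (x₀, n)) else 0) ≤ G.fwdExp x₀ F x u r n := by
  have hmain := sum_ringAt_add_le G.alarmRate_pos (G.hazards hr hrx)
    (G.measurable_alarmVal x₀ hF x hu r n) hu (x = x₀) rfl
  rw [G.lintegral_alarmVal x₀ hF x hu r n] at hmain
  refine le_trans (le_of_eq ?_) hmain
  congr 1
  · rw [activeAlarms, Finset.sum_disjSum, ← sum_add_distrib, Finset.sum_filter]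
    refine sum_congr rfl fun e _ => ?_
    by_cases he : G.Incident e x
    swap
    · simp [fwdRate, he]
    -- Only two positions can follow an event at `e`: the opposite end, by a clock, and `x` itself,
    -- by a Poisson point.
    rw [if_pos he, ← Finset.sum_subset (Finset.subset_univ {G.other e x, x}), Finset.sum_pair (G.other_ne e x)]
    · congr 1
      · refine setLIntegral_congr_fun (measurableSet_allowed x₀ x u) fun s hs => ?_
        simp only [G.lintegral_alarmVal_cross x₀ hF n he hs.1 hu hs.2, G.sum_alarmRate_mul]
        simp [fwdRate, he, alarmRate, alarmHazardRate]
      · refine setLIntegral_congr_fun (measurableSet_allowed x₀ x u) fun s hs => ?_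
        simp only [G.lintegral_alarmVal_stay x₀ hF hr hrx n he hs.1 hu hs.2, G.sum_alarmRate_mul]
        have hp : 0 ≤ G.W e * √(r (G.other e x) / (r x + s)) :=
          mul_nonneg (G.W_pos e).le (sqrt_nonneg _)
        simp [fwdRate, he, alarmRate, alarmHazardRate, (G.other_ne e x).symm, abs_of_nonneg hp]
    · intro y _ hy
      simp only [Finset.mem_insert, Finset.mem_singleton, not_or] at hy
      simp [fwdRate, hy.1, hy.2]
  · by_cases hx : x = x₀
    · subst hx
      rw [if_pos rfl, if_pos rfl, G.lintegral_alarmVal_nil x hFl r n hu, G.sum_alarmRate_mul]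
    · rw [if_neg hx, if_neg hx]

theorem posTimes_of_fwdProd_ne_zero {r : V → ℝ} {L : List (V × ℝ × E)} {q : V × ℝ}
    (h : G.fwdProd r L q ≠ 0) : posTimes L q := by
  induction L generalizing r with
  | nil =>
    unfold fwdProd at h
    split_ifs at h with h1
    exacts [⟨by simp, h1⟩, absurd rfl h]
  | cons p L ih =>
    rw [fwdProd] at h
    exact posTimes_cons.2 ⟨by by_contra hc; simp [hc] at h,
      ih (right_ne_zero_of_mul (right_ne_zero_of_mul h))⟩

theorem listTime_nonneg {L : List (V × ℝ × E)} (h : ∀ p ∈ L, 0 < p.2.1) (z : V) :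
    0 ≤ listTime L z := by
  induction L with
  | nil => simp
  | cons p L ih =>
    obtain ⟨x, s, e⟩ := p
    rw [listTime_cons]
    have h1 := ih fun p hp => h p (List.mem_cons_of_mem _ hp)
    have h2 : 0 < s := h (x, s, e) (List.mem_cons_self ..)
    split_ifs <;> linarith

theorem skelTime_nonneg {L : List (V × ℝ × E)} {q : V × ℝ} (h : posTimes L q) (z : V) :
    0 ≤ skelTime (L, q) z := by
  have h1 := listTime_nonneg h.1 z
  have h2 := h.2
  simp only [skelTime]
  split_ifs <;> linarith

theorem skelTime_last_pos {L : List (V × ℝ × E)} {q : V × ℝ} (h : posTimes L q) :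
    0 < skelTime (L, q) q.1 := by
  have h1 := listTime_nonneg h.1 q.1
  have h2 := h.2
  simp only [skelTime, if_true]
  linarith

theorem skelTime_cons (p : V × ℝ × E) (L : List (V × ℝ × E)) (q : V × ℝ) :
    skelTime (p :: L, q) = Pi.single p.1 p.2.1 + skelTime (L, q) := by
  funext z
  obtain ⟨a, b, c⟩ := p
  simp [skelTime, add_assoc, Pi.single_apply, eq_comm]

theorem skelTime_nil (q : V × ℝ) :
    skelTime (([], q) : Skeleton V E) = Pi.single q.1 q.2 := by
  funext z
  simp [skelTime, Pi.single_apply, eq_comm]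

/-- The law of the forward process is bounded from below by its density on skeletons. -/
theorem fwdInt_le_fwdExp (M : ℕ) {F : (V → ℝ) → LifePath V E → ℝ≥0∞} (hF : ProcMeasurable F) (hFl : IsLocal F)
    {x : V} {u : ℝ} (hu : 0 < u) {r : V → ℝ} (hr : ∀ z, z ≠ x → 0 < r z) (hrx : 0 ≤ r x)
    (n : E → ℕ) :
    fwdInt x₀ M x u (fun p : Skeleton V E => ofReal (G.fwdProd r p.1 p.2 *
      exp (-(G.hamil (r + skelTime p) - G.hamil r))) * F (r + skelTime p) (fwdPath n p.1 p.2)) ≤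
      G.fwdExp x₀ F x u r n := by
  have hnil : ∀ {x : V} {u : ℝ}, 0 < u → ∀ (F : (V → ℝ) → LifePath V E → ℝ≥0∞) (r : V → ℝ) (n : E → ℕ),
      (if x = x₀ then (fun p : Skeleton V E => ofReal (G.fwdProd r p.1 p.2 *
      exp (-(G.hamil (r + skelTime p) - G.hamil r))) * F (r + skelTime p) (fwdPath n p.1 p.2)) ([], x₀, u)
        else 0) = if x = x₀ then ofReal (exp (-(G.hamil (r + Pi.single x₀ u) -
        G.hamil r))) * F (r + Pi.single x₀ u) (u, fun _ => (x₀, n)) else 0 := by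
    intro x u hu F r n
    simp [fwdProd, hu, skelTime_nil, fwdPath]
  induction M generalizing F x u r n with
  | zero =>
    refine le_trans (le_of_eq ?_) (le_trans le_add_self (G.fwdExp_peel x₀ hF hFl hu hr hrx n))
    exact hnil hu F r n
  | succ M ih =>
    refine le_trans ?_ (G.fwdExp_peel x₀ hF hFl hu hr hrx n)
    rw [fwdInt, add_comm]
    refine add_le_add (sum_le_sum fun e _ => sum_le_sum fun y _ => ?_)
      (hnil hu F r n).le
    rw [← lintegral_indicator]
    swap
    · exact measurableSet_allowed x₀ x u
    refine lintegral_mono fun s => ?_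
    by_cases hs : s ∈ {s | 0 < s ∧ 0 < u - if x = x₀ then s else 0}
    · rw [indicator_of_mem hs]
      have hpos : ∀ z, 0 < (r + Pi.single x s : V → ℝ) z := by
        intro z
        by_cases hz : z = x
        · subst hz
          simp only [Pi.add_apply, Pi.single_eq_same]
          linarith [hs.1]
        · simpa [hz] using hr z hz
      refine le_trans ?_ (mul_le_mul_right (ih (hF.comp_consPath s _)
        (hFl.comp_consPath s _) hs.2 (fun z _ => hpos z) (hpos y).le (n + Pi.single e 1)) _)
      rw [← fwdInt_const_mul _ _ _ _ _ ofReal_ne_top]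
      refine fwdInt_mono x₀ M y _ fun p hp _ _ => le_of_eq ?_
      obtain ⟨L, q⟩ := p
      have hnn := G.fwdRate_nonneg (r + Pi.single x s) e x y
      simp only at hp
      have hs0 : 0 < s := hs.1
      simp only [fwdProd, fwdPath, skelTime_cons, hp, hs0, if_true, one_mul]
      rw [← mul_assoc (ofReal _), ← ofReal_mul (mul_nonneg hnn (exp_pos _).le),
        ← add_assoc]
      congr 2
      -- The exponents telescope through the field right after the first stay.
      have : ∀ a b c : ℝ, exp (-(a - c)) = exp (-(b - c)) * exp (-(a - b)) := by
        intro a b c; rw [← exp_add]; congr 1; ring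
      rw [this _ (G.hamil (r + Pi.single x s))]
      ring
    -- A skeleton of nonzero weight has positive holding times and ends at `x₀`, so some local time
    -- at `x₀` must be left after the first stay; excluded values of `s` contribute nothing.
    · rw [indicator_of_notMem hs]
      refine le_trans (fwdInt_mono x₀ M y _ (g := fun _ => 0) fun p hp hl ht => ?_) (le_of_eq ?_)
      · obtain ⟨L, q⟩ := p
        by_cases h0 : G.fwdProd r ((x, s, e) :: L) q = 0
        · simp [h0]
        · have h1 := posTimes_cons.1 (G.posTimes_of_fwdProd_ne_zero h0)
          have h2 := skelTime_last_pos h1.2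
          simp only at hl
          rw [hl, ht] at h2
          exact absurd ⟨h1.1, h2⟩ hs
      · simpa using fwdInt_const_mul x₀ M y (u - if x = x₀ then s else 0) 0 (by simp)
          (fun _ : Skeleton V E => 0)

end Peel

end Network

theorem sum_localTime {V : Type*} [Fintype V] [MeasurableSpace V] [MeasurableSingletonClass V]
    {X : ℝ → V} (hX : Measurable X) (t : ℝ) : ∑ x, localTime X t x = t := by
  simp only [localTime]
  rw [← intervalIntegral.integral_finsetSum fun x _ => intervalIntegrable_occupation hX x 0 t]
  simp

theorem localTime_const {V : Type*} (x : V) (t : ℝ) : localTime (fun _ => x) t = Pi.single x t := by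
  funext z
  simp only [localTime, Pi.single_apply]
  by_cases h : z = x
  · simp [h]
  · simp [h, Ne.symm h]

namespace Network

variable {V E : Type*} (G : Network V E) (x₀ : V)

/-! ### The self-interacting process restarted after its first drop -/

section Shift

variable {st st' : (V → ℝ) → E → ℕ}

theorem dropWait_nonneg (st : (V → ℝ) → E → ℕ) (x : V) (ℓ : V → ℝ) : 0 ≤ dropWait st x ℓ :=
  Real.sInf_nonneg fun _ ht => ht.1

theorem single_nonneg' {x : V} {s : ℝ} (hs : 0 ≤ s) : (0 : V → ℝ) ≤ Pi.single x s :=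
  Pi.single_nonneg.2 hs

theorem dropState_succ (st : (V → ℝ) → E → ℕ) (x : V) (c : ℕ → Bool) (k : ℕ) :
    G.dropState x₀ st x c (k + 1) = G.checkStep x₀
      (fun e => st ((G.dropState x₀ st x c k).2.2 + Pi.single (G.dropState x₀ st x c k).2.1
        (dropWait st (G.dropState x₀ st x c k).2.1 (G.dropState x₀ st x c k).2.2)) e <
          st (G.dropState x₀ st x c k).2.2 e)
      (G.dropState x₀ st x c k).1 (G.dropState x₀ st x c k).2.1 (G.dropState x₀ st x c k).2.2
      (dropWait st (G.dropState x₀ st x c k).2.1 (G.dropState x₀ st x c k).2.2)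
      ((G.dropState x₀ st x c k).2.2 + Pi.single (G.dropState x₀ st x c k).2.1
        (dropWait st (G.dropState x₀ st x c k).2.1 (G.dropState x₀ st x c k).2.2))
      {e | 0 < st ((G.dropState x₀ st x c k).2.2 + Pi.single (G.dropState x₀ st x c k).2.1
        (dropWait st (G.dropState x₀ st x c k).2.1 (G.dropState x₀ st x c k).2.2)) e} (c k) := rfl

theorem dropState_nonneg (st : (V → ℝ) → E → ℕ) (x : V) (c : ℕ → Bool) (k : ℕ) :
    0 ≤ (G.dropState x₀ st x c k).2.2 := by
  induction k with
  | zero => exact le_rfl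
  | succ k ih =>
    rw [dropState_succ, checkStep]
    split_ifs; exacts [add_nonneg ih (single_nonneg' (dropWait_nonneg _ _ _)), ih]

theorem dropState_congr (h : ∀ ℓ, 0 ≤ ℓ → st ℓ = st' ℓ) (x : V) (c : ℕ → Bool) (k : ℕ) :
    G.dropState x₀ st x c k = G.dropState x₀ st' x c k := by
  induction k with
  | zero => rfl
  | succ k ih =>
    have h0 := G.dropState_nonneg x₀ st x c k
    rw [dropState_succ, dropState_succ, ← ih]
    have hw : ∀ y ℓ, 0 ≤ ℓ → dropWait st y ℓ = dropWait st' y ℓ := by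
      intro y ℓ hℓ
      unfold dropWait
      congr 1
      ext s
      refine and_congr_right fun hs => ?_
      rw [h _ hℓ, h _ (add_nonneg hℓ (single_nonneg' hs))]
    rw [← hw _ _ h0, ← h _ h0, ← h _ (add_nonneg h0 (single_nonneg' (dropWait_nonneg _ _ _)))]

theorem dropWalk_congr (h : ∀ ℓ, 0 ≤ ℓ → st ℓ = st' ℓ) (x : V) (c : ℕ → Bool) :
    G.dropWalk x₀ st x c = G.dropWalk x₀ st' x c := by
  unfold dropWalk
  simp only [G.dropState_congr x₀ h]

/-- The process with its stacks, up to the first time when the local time exceeds `r` somewhere. -/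
def dropPath (st : (V → ℝ) → E → ℕ) (r : V → ℝ) (x : V) (c : ℕ → Bool) : LifePath V E :=
  (G.dropTime x₀ st r x c, fun t => (G.dropWalk x₀ st x c (max t 0),
    st (localTime (G.dropWalk x₀ st x c) (max t 0))))

theorem dropPath_congr [Fintype V] [Fintype E] [MeasurableSpace V] [MeasurableSingletonClass V]
    (h : ∀ ℓ, 0 ≤ ℓ → st ℓ = st' ℓ) (r : V → ℝ) (x : V) (c : ℕ → Bool) :
    G.dropPath x₀ st r x c = G.dropPath x₀ st' r x c := by
  simp only [dropPath, dropTime, G.dropWalk_congr x₀ h]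
  refine Prod.ext rfl (funext fun t => Prod.ext rfl ?_)
  exact h _ fun z => localTime_nonneg (G.measurable_dropWalk_path x₀ st' x c) z (le_max_right _ _)

/-- The stack at `e` is the first one which drops, after a time `s` at `x`. -/
structure FirstDrop (st : (V → ℝ) → E → ℕ) (x : V) (s : ℝ) (e : E) : Prop where
  pos : 0 < s
  before : ∀ t, 0 ≤ t → t < s → st (Pi.single x t) = st 0
  drop : st (Pi.single x s) e < st 0 e
  other : ∀ e' ≠ e, st (Pi.single x s) e' = st 0 e'

/-- The stacks, after a time `s` at `x`. -/
def shiftStack (st : (V → ℝ) → E → ℕ) (x : V) (s : ℝ) (ℓ : V → ℝ) : E → ℕ := st (Pi.single x s + ℓ)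

theorem FirstDrop.dropWait_eq {x : V} {s : ℝ} {e : E} (h : FirstDrop st x s e) :
    dropWait st x 0 = s := by
  have hmem : s ∈ {s : ℝ | 0 ≤ s ∧ ∃ e, st (0 + Pi.single x s) e < st 0 e} :=
    ⟨h.pos.le, e, by rw [zero_add]; exact h.drop⟩
  refine le_antisymm (csInf_le ⟨0, fun t ht => ht.1⟩ hmem) (le_csInf ⟨s, hmem⟩ ?_)
  rintro t ⟨ht, e', he'⟩
  by_contra hts
  rw [zero_add, h.before t ht (not_le.1 hts)] at he'
  exact lt_irrefl _ he'

theorem checkStep_add (p : E → Prop) (T : ℝ≥0∞) (x : V) (ℓ : V → ℝ) (s : ℝ) (ℓ' : V → ℝ)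
    (C : Set E) (coin : Bool) (s₁ : ℝ) (ℓ₁ : V → ℝ) :
    G.checkStep x₀ p (ofReal s₁ + T) x (ℓ₁ + ℓ) s (ℓ₁ + ℓ') C coin =
      (ofReal s₁ + (G.checkStep x₀ p T x ℓ s ℓ' C coin).1,
        (G.checkStep x₀ p T x ℓ s ℓ' C coin).2.1,
        ℓ₁ + (G.checkStep x₀ p T x ℓ s ℓ' C coin).2.2) := by
  by_cases h : ∃ e, p e
  · simp only [checkStep, h, dite_true, add_assoc]
  · simp only [checkStep, h, dite_false, add_top]

/-- Only one stack drops at time `s`, so the arbitrary choice of a dropping edge must give `e`.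
Afterwards the process is of the same kind, with shifted stacks and shifted coins. -/
theorem FirstDrop.dropState {x : V} {s : ℝ} {e : E} (h : FirstDrop st x s e) (c : ℕ → Bool)
    (k : ℕ) {y : V} (hy : y = G.checkMove x₀ x e {e | 0 < st (Pi.single x s) e} (c 0)) :
    G.dropState x₀ st x c (k + 1) =
      (ofReal s + (G.dropState x₀ (shiftStack st x s) y (fun k => c (k + 1)) k).1,
        (G.dropState x₀ (shiftStack st x s) y (fun k => c (k + 1)) k).2.1,
        Pi.single x s + (G.dropState x₀ (shiftStack st x s) y (fun k => c (k + 1)) k).2.2) := by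
  induction k with
  | zero =>
    rw [dropState_succ]
    simp only [Network.dropState, h.dropWait_eq, zero_add, checkStep]
    have hex : ∃ e, st (Pi.single x s) e < st 0 e := ⟨e, h.drop⟩
    have hch : hex.choose = e := by
      by_contra hne
      exact absurd hex.choose_spec (by rw [h.other _ hne]; exact lt_irrefl _)
    rw [dif_pos hex, hch, ← hy, add_zero, add_zero]
  | succ k ih =>
    rw [dropState_succ, ih, dropState_succ]
    set S := G.dropState x₀ (shiftStack st x s) y (fun k => c (k + 1)) k
    have hw : dropWait st S.2.1 (Pi.single x s + S.2.2) =
        dropWait (shiftStack st x s) S.2.1 S.2.2 := by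
      simp only [dropWait, shiftStack, add_assoc]
    rw [hw, add_assoc]
    exact G.checkStep_add x₀ _ _ _ _ _ _ _ _ _ _

/-- Each drop uses up at least one unit of the total stack, so that there are at most as many drops
as initial points. -/
theorem dropState_lt (hst : Antitone st) (x : V) (c : ℕ → Bool) [Fintype E] (k : ℕ)
    (hk : (G.dropState x₀ st x c k).1 ≠ ⊤) :
    ∑ e, st (G.dropState x₀ st x c k).2.2 e + k ≤ ∑ e, st 0 e := by
  induction k with
  | zero => exact le_rfl
  | succ k ih =>
    rw [dropState_succ, checkStep] at hk ⊢
    split_ifs at hk ⊢ with hex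
    · simp only [ne_eq, ENNReal.add_eq_top, ofReal_ne_top, or_false] at hk
      refine le_trans ?_ (ih hk)
      rw [← add_assoc, add_right_comm]
      refine Nat.add_le_add_right (Nat.succ_le_of_lt (Finset.sum_lt_sum (fun e _ => ?_) ?_)) k
      · refine hst ?_ e
        exact le_add_of_nonneg_right (single_nonneg' (dropWait_nonneg _ _ _))
      · exact ⟨hex.choose, mem_univ _, hex.choose_spec⟩
    · exact absurd rfl hk

theorem finite_dropState (hst : Antitone st) (x : V) (c : ℕ → Bool) [Fintype E] (t : ℝ) :
    {k | (G.dropState x₀ st x c (k + 1)).1 ≤ ofReal t}.Finite := by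
  refine (Set.finite_le_nat (∑ e, st 0 e)).subset fun k hk => ?_
  have := G.dropState_lt x₀ hst x c (k + 1) (ne_top_of_le_ne_top ofReal_ne_top hk)
  simp only [mem_ofPred_eq]
  omega

theorem antitone_shiftStack (hst : Antitone st) (x : V) (s : ℝ) : Antitone (shiftStack st x s) :=
  fun _ _ h => hst (add_le_add_right h _)

theorem FirstDrop.dropWalk [Fintype E] (hst : Antitone st) {x : V} {s : ℝ} {e : E}
    (h : FirstDrop st x s e) (c : ℕ → Bool) {y : V}
    (hy : y = G.checkMove x₀ x e {e | 0 < st (Pi.single x s) e} (c 0)) :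
    G.dropWalk x₀ st x c =
      concatPath s x (G.dropWalk x₀ (shiftStack st x s) y fun k => c (k + 1)) := by
  have hD := fun k => h.dropState G x₀ c k hy
  funext t
  simp only [Network.dropWalk, stepPath, concatPath, hD, ofReal_add_le_ofReal_iff h.pos]
  split_ifs with ht
  · rw [natCard_eq_zero_of_forall fun k hk => absurd ht (not_lt.2 hk.1)]
    rfl
  · have ht' := not_lt.1 ht
    simp only [ht', true_and]
    rw [natCard_eq_add_one (by simp [Network.dropState])
      (G.finite_dropState x₀ (antitone_shiftStack hst x s) _ _ _), hD]

variable [Fintype V] [Fintype E] [MeasurableSpace V] [MeasurableSingletonClass V]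

/-- The local times add up to `t`, so they cannot all stay below `r` once `t` reaches the sum of the
|r y|. The extinction time is thus an infimum over a nonempty set. -/
theorem exists_le_localTime {X : ℝ → V} (hX : Measurable X) (r : V → ℝ) :
    ∃ t, 0 ≤ t ∧ ∃ y, r y ≤ localTime X t y := by
  by_contra hne
  push Not at hne
  have h1 := hne (∑ y, |r y|) (Finset.sum_nonneg fun y _ => abs_nonneg _)
  have h2 := sum_localTime hX (∑ y, |r y|)
  have hV : Nonempty V := ⟨X 0⟩
  have h3 := Finset.sum_lt_sum_of_nonempty (Finset.univ_nonempty (α := V)) fun y _ => h1 y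
  rw [h2] at h3
  exact absurd (sum_le_sum fun y (_ : y ∈ univ) => le_abs_self (r y)) (not_le.2 h3)

/-- The hypothesis `hr` ensures that the threshold `r` is reached nowhere up to time `s`, so the
lifetime is `s` plus the remaining lifetime. -/
theorem FirstDrop.dropPath (hst : Antitone st) {x : V} {s : ℝ} {e : E}
    (h : FirstDrop st x s e) (c : ℕ → Bool) {y : V}
    (hy : y = G.checkMove x₀ x e {e | 0 < st (Pi.single x s) e} (c 0)) {r : V → ℝ}
    (hr : ∀ z, 0 < (r - Pi.single x s : V → ℝ) z) :
    G.dropPath x₀ st r x c = consPath s (x, st 0)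
      (G.dropPath x₀ (shiftStack st x s) (r - Pi.single x s) y fun k => c (k + 1)) := by
  have hX := h.dropWalk G x₀ hst c hy
  have hm := G.measurable_dropWalk_path x₀ (shiftStack st x s) y fun k => c (k + 1)
  set X := G.dropWalk x₀ (shiftStack st x s) y fun k => c (k + 1)
  have hL1 : ∀ t, t < s → localTime (concatPath s x X) t = Pi.single x t := by
    intro t ht
    funext z
    rw [localTime_concatPath h.pos x hm, if_pos ht]
    simp [Pi.single_apply, eq_comm]
  have hL2 : ∀ t, s ≤ t → localTime (concatPath s x X) t = Pi.single x s + localTime X (t - s) := by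
    intro t ht
    funext z
    rw [localTime_concatPath h.pos x hm, if_neg (not_lt.2 ht)]
    simp [Pi.single_apply, eq_comm]
  have hpos := h.pos
  refine Prod.ext ?_ (funext fun t => ?_)
  · simp only [Network.dropPath, consPath, dropTime, hX]
    have hset : {t : ℝ | 0 ≤ t ∧ ∃ y, r y ≤ localTime (concatPath s x X) t y} =
        (fun t => s + t) '' {t : ℝ | 0 ≤ t ∧ ∃ y, (r - Pi.single x s : V → ℝ) y ≤ localTime X t y} := by
      ext t
      simp only [mem_ofPred_eq, Set.mem_image]
      constructor
      · rintro ⟨h0, z, hz⟩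
        rcases lt_or_ge t s with hts | hts
        · rw [hL1 t hts] at hz
          have h1 := hr z
          rw [Pi.sub_apply] at h1
          have h2 : (Pi.single x t : V → ℝ) z ≤ (Pi.single x s : V → ℝ) z :=
            Pi.single_mono x hts.le z
          linarith
        · rw [hL2 t hts, Pi.add_apply] at hz
          exact ⟨t - s, ⟨by linarith, z, by rw [Pi.sub_apply]; linarith⟩, by ring⟩
      · rintro ⟨t', ⟨h0, z, hz⟩, rfl⟩
        refine ⟨by linarith, z, ?_⟩
        rw [hL2 _ (by linarith), Pi.add_apply, add_sub_cancel_left]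
        rw [Pi.sub_apply] at hz
        linarith
    rw [hset]
    exact ((OrderIso.addLeft s).map_csInf' (exists_le_localTime hm _)
      ⟨0, fun t ht => ht.1⟩).symm
  · simp only [Network.dropPath, consPath, hX]
    split_ifs with ht
    · have ht' : max t 0 < s := max_lt ht hpos
      rw [hL1 _ ht', h.before _ (le_max_right _ _) ht', concatPath, if_pos ht']
    · have ht' := not_lt.1 ht
      rw [max_eq_left (hpos.le.trans ht'), max_eq_left (sub_nonneg.2 ht'), hL2 t ht', concatPath,
        if_neg ht]
      rfl

theorem dropPath_of_no_drop {x : V} (h : ∀ t, 0 ≤ t → st (Pi.single x t) = st 0) (c : ℕ → Bool)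
    {r : V → ℝ} (hr : ∀ z, 0 < r z) : G.dropPath x₀ st r x c = (r x, fun _ => (x, st 0)) := by
  have hD : ∀ k, (G.dropState x₀ st x c k).2 = (x, 0) ∧ (G.dropState x₀ st x c (k + 1)).1 = ⊤ := by
    intro k
    have hstep : ∀ k, (G.dropState x₀ st x c k).2 = (x, 0) →
        G.dropState x₀ st x c (k + 1) = (⊤, x, 0) := by
      intro k hk
      rw [dropState_succ, hk, checkStep, dif_neg]
      rintro ⟨e, he⟩
      rw [zero_add, h _ (dropWait_nonneg _ _ _)] at he
      exact lt_irrefl _ he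
    induction k with
    | zero => exact ⟨rfl, by rw [hstep 0 rfl]⟩
    | succ k ih =>
      have h1 : (G.dropState x₀ st x c (k + 1)).2 = (x, 0) := by rw [hstep k ih.1]
      exact ⟨h1, by rw [hstep (k + 1) h1]⟩
  have hX : G.dropWalk x₀ st x c = fun _ => x := by
    funext t
    rw [dropWalk, stepPath, (hD _).1]
  refine Prod.ext ?_ (funext fun t => ?_)
  · simp only [dropPath, dropTime, hX, localTime_const]
    have hmem : r x ∈ {t : ℝ | 0 ≤ t ∧ ∃ y, r y ≤ (Pi.single x t : V → ℝ) y} :=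
      ⟨(hr x).le, x, by simp⟩
    refine le_antisymm (csInf_le ⟨0, fun t ht => ht.1⟩ hmem) (le_csInf ⟨_, hmem⟩ ?_)
    rintro t ⟨-, z, hz⟩
    by_cases hzx : z = x
    · subst hzx; simpa using hz
    · rw [Pi.single_eq_of_ne hzx] at hz
      exact absurd hz (not_le.2 (hr z))
  · simp only [dropPath, hX, localTime_const, h _ (le_max_right t 0)]

end Shift

end Network

/-! ### Truncated counting functions -/

section CapCount

/-- The number of points in `[0, a)`, among the first `n` points. -/
def capCount (γ : ℕ → ℝ) (n : ℕ) (a : ℝ) : ℕ :=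
  ((range n).filter fun k => point γ k < a).card

theorem capCount_mono (γ : ℕ → ℝ) (n : ℕ) {a b : ℝ} (h : a ≤ b) : capCount γ n a ≤ capCount γ n b :=
  Finset.card_le_card (Finset.monotone_filter_right _ fun _ _ hk => lt_of_lt_of_le hk h)

theorem capCount_eq_self {γ : ℕ → ℝ} (hγ : ∀ k, 0 < γ k) {n : ℕ} {a : ℝ}
    (h : n = 0 ∨ psum γ n < a) : capCount γ n a = n := by
  rw [capCount, Finset.filter_true_of_mem, Finset.card_range]
  intro k hk
  have hk' := mem_range.1 hk
  rcases h with rfl | h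
  · omega
  · obtain ⟨m, rfl⟩ : ∃ m, n = m + 1 := ⟨n - 1, by omega⟩
    rw [psum_succ_eq_point] at h
    exact ((strictMono_point hγ).monotone (by omega)).trans_lt h

theorem capCount_succ_of_le {γ : ℕ → ℝ} {m : ℕ} {a : ℝ} (h : a ≤ point γ m) :
    capCount γ (m + 1) a = capCount γ m a := by
  rw [capCount, Finset.range_add_one, Finset.filter_insert, if_neg (not_lt.2 h), capCount]

theorem capCount_congr {γ γ' : ℕ → ℝ} {n : ℕ} (h : ∀ k < n, γ k = γ' k) (a : ℝ) :
    capCount γ n a = capCount γ' n a := by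
  rw [capCount, capCount]
  congr 1
  refine Finset.filter_congr fun k hk => ?_
  have : point γ k = point γ' k := sum_congr rfl fun i hi => h i (by
    rw [mem_range] at hk hi; omega)
  rw [this]

/-- Levels only decrease, so points beyond the initial level `b` never matter. Freezing the initial
number of points makes the stack a function of finitely many spacings. -/
theorem countBefore_eq_capCount {γ : ℕ → ℝ} (hγ : GoodSpacing γ) {a b : ℝ} (hab : a ≤ b) :
    countBefore γ a = capCount γ (countBefore γ b) a := by
  obtain ⟨n, hn1, hn2⟩ := hγ.exists_countBefore b
  obtain ⟨m, hm1, hm2⟩ := hγ.exists_countBefore a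
  rw [countBefore_eq hγ.1 hn1 hn2, countBefore_eq hγ.1 hm1 hm2]
  have hmn : m ≤ n := by
    by_contra h
    exact absurd ((hm1 n (not_le.1 h)).trans_le hab) (not_lt.2 hn2)
  have : (range n).filter (fun k => point γ k < a) = range m := by
    ext k
    simp only [mem_filter, mem_range]
    refine ⟨fun h => ?_, fun h => ⟨by omega, hm1 k h⟩⟩
    by_contra hk
    exact absurd (hm2.trans ((strictMono_point hγ.1).monotone (not_lt.1 hk))) (not_le.2 h.2)
  rw [capCount, this, Finset.card_range]

theorem measurable_capCount {Z : Type*} [MeasurableSpace Z] {γ : Z → ℕ → ℝ} {a : Z → ℝ} (n : ℕ)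
    (hγ : Measurable γ) (ha : Measurable a) : Measurable fun z => capCount (γ z) n (a z) := by
  simp only [capCount, Finset.card_filter]
  refine Finset.measurable_sum _ fun k _ => Measurable.ite ?_ measurable_const measurable_const
  exact measurableSet_lt ((measurable_point k).comp hγ) ha

end CapCount

/-! ### The last point below a decreasing level -/

section LastPoint

/-- The density exp(-τ) of the last spacing, times the probability exp(-(a - (q + τ))) of no further
point below `a`, does not depend on τ. Substituting q + τ = A s therefore leaves only the Jacobian.
-/
theorem lintegral_last_point_le {q a b : ℝ} {A A' : ℝ → ℝ} (hq : 0 ≤ q)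
    (hd : ∀ s ∈ Ioo 0 b, HasDerivAt A (A' s) s) (hinj : Set.InjOn A (Ioo 0 b))
    (hsurj : Ioo 0 a ⊆ A '' Ioo 0 b) (Φ : ℝ → ℝ≥0∞) :
    ∫⁻ τ, (if q + τ < a then ofReal (exp (-(a - (q + τ)))) else 0) * Φ (q + τ)
      ∂(expMeasure 1) ≤
    ∫⁻ s in Ioo 0 b, ofReal |A' s| *
      ((if q < A s then ofReal (exp (-(a - q))) else 0) * Φ (A s)) := by
  set Ξ : ℝ → ℝ≥0∞ := fun p => (if q < p then ofReal (exp (-(a - q))) else 0) * Φ p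
  rw [← lintegral_image_eq_lintegral_abs_deriv_mul measurableSet_Ioo
    (fun s hs => (hd s hs).hasDerivWithinAt) hinj Ξ]
  refine le_trans ?_ (lintegral_indicator_le Ξ _)
  rw [lintegral_expMeasure, ← lintegral_indicator measurableSet_Ioi,
    ← lintegral_add_left_eq_self ((A '' Ioo 0 b).indicator Ξ) q]
  refine lintegral_mono fun τ => ?_
  by_cases hτ : 0 < τ
  swap
  · rw [indicator_of_notMem (by simpa using hτ)]; exact zero_le
  rw [indicator_of_mem (by simpa using hτ)]
  by_cases h : q + τ < a
  swap
  · simp [h]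
  rw [indicator_of_mem (hsurj ⟨by linarith, h⟩), if_pos h]
  simp only [Ξ]
  rw [if_pos (by linarith), ← mul_assoc, ← ofReal_mul (by positivity)]
  refine le_of_eq ?_
  congr 2
  rw [one_mul, one_mul, ← exp_add]
  congr 1
  ring

theorem expMeasure_singleton (w v : ℝ) : expMeasure w {v} = 0 := by
  rw [← setLIntegral_one, ← lintegral_indicator (measurableSet_singleton v), lintegral_expMeasure]
  refine (lintegral_congr_ae (g := fun _ => 0) ?_).trans lintegral_zero
  refine ae_restrict_of_ae ?_
  filter_upwards [compl_mem_ae_iff.2 (measure_singleton v : volume {v} = 0)] with x hx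
  have hx : x ∉ ({v} : Set ℝ) := hx
  simp [hx]

/-- The last spacing is diffuse given the others. This excludes simultaneous drops. -/
theorem ae_psum_ne (n : ℕ) (hn : n ≠ 0) (v : ℝ) : ∀ᵐ γ ∂spacingLaw, psum γ n ≠ v := by
  obtain ⟨m, rfl⟩ := Nat.exists_eq_succ_of_ne_zero hn
  have hm : MeasurableSet {γ : ℕ → ℝ | psum γ (m + 1) = v} :=
    measurable_psum (m + 1) (measurableSet_singleton v)
  rw [ae_iff]
  simp only [Nat.succ_eq_add_one, ne_eq, not_not]
  rw [← setLIntegral_one, ← lintegral_indicator hm, lintegral_seqUpdate (expMeasure 1) m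
    (measurable_const.indicator hm)]
  refine (lintegral_congr (g := fun _ => 0) fun γ => ?_).trans lintegral_zero
  have : ∀ τ, ({γ : ℕ → ℝ | psum γ (m + 1) = v}.indicator (fun _ => (1 : ℝ≥0∞))
      (update γ m τ)) = ({v - psum γ m} : Set ℝ).indicator (fun _ => 1) τ := by
    intro τ
    simp only [indicator_apply, mem_ofPred_eq, Set.mem_singleton_iff, psum_succ,
      psum_update γ le_rfl, update_self]
    congr 1
    exact propext ⟨fun h => by linarith, fun h => by linarith⟩
  simp only [this]
  rw [lintegral_indicator (measurableSet_singleton _), setLIntegral_one, expMeasure_singleton]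

end LastPoint

/-! ### Which stack drops first -/

section CapWeight

/-- The conditional probability that there are exactly `n` points in `[0, a)`, given the first `n`
spacings. -/
def capWeight (n : ℕ) (a : ℝ) (γ : ℕ → ℝ) : ℝ≥0∞ :=
  if n = 0 ∨ psum γ n < a then ofReal (exp (-(a - psum γ n))) else 0

theorem measurable_capWeight (n : ℕ) : Measurable fun p : ℝ × (ℕ → ℝ) => capWeight n p.1 p.2 := by
  have h1 : Measurable fun p : ℝ × (ℕ → ℝ) => psum p.2 n :=
    (measurable_psum n).comp measurable_snd
  refine Measurable.ite ((MeasurableSet.const _).union (measurableSet_lt h1 measurable_fst))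
    (measurable_fst.sub h1).neg.exp.ennreal_ofReal measurable_const

theorem Measurable.capWeight {Z : Type*} [MeasurableSpace Z] (n : ℕ) {a : Z → ℝ} {γ : Z → ℕ → ℝ}
    (ha : Measurable a) (hγ : Measurable γ) : Measurable fun z => capWeight n (a z) (γ z) :=
  (measurable_capWeight n).comp (ha.prodMk hγ)

theorem capWeight_le {n : ℕ} {a a' : ℝ} {γ : ℕ → ℝ} (h : n = 0 ∨ psum γ n < a') :
    capWeight n a γ ≤ ofReal (exp (-(a - a'))) * capWeight n a' γ := by
  rw [capWeight, capWeight, if_pos h, ← ofReal_mul (exp_pos _).le, ← exp_add]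
  split_ifs; exacts [ofReal_le_ofReal (Real.exp_le_exp.2 (by linarith)), zero_le]

variable {E : Type*} [Fintype E]

/-- Replace a spacing. -/
def setSpacing (e : E) (m : ℕ) (γ : E → ℕ → ℝ) (τ : ℝ) : E → ℕ → ℝ :=
  update γ e (update (γ e) m τ)

theorem setSpacing_of_ne {e e' : E} (h : e' ≠ e) (m : ℕ) (γ : E → ℕ → ℝ) (τ : ℝ) :
    setSpacing e m γ τ e' = γ e' := by simp [setSpacing, h]

theorem setSpacing_same (e : E) (m : ℕ) (γ : E → ℕ → ℝ) (τ : ℝ) :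
    setSpacing e m γ τ e = update (γ e) m τ := by simp [setSpacing]

theorem measurable_setSpacing (e : E) (m : ℕ) :
    Measurable fun p : (E → ℕ → ℝ) × ℝ => setSpacing e m p.1 p.2 := by
  refine measurable_pi_lambda _ fun e' => measurable_pi_lambda _ fun k => ?_
  by_cases h : e' = e
  · subst h
    simp only [setSpacing_same]
    by_cases hk : k = m
    · subst hk; simp only [update_self]; exact measurable_snd
    · simp only [update_of_ne hk]; fun_prop
  · simp only [setSpacing_of_ne h]; fun_prop

theorem lintegral_setSpacing (e : E) (m : ℕ) {F : (E → ℕ → ℝ) → ℝ≥0∞} (hF : Measurable F) :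
    ∫⁻ γ, F γ ∂(poissonSpacings E) =
      ∫⁻ γ, ∫⁻ τ, F (setSpacing e m γ τ) ∂(expMeasure 1) ∂(poissonSpacings E) := by
  have hm : Measurable fun γ => ∫⁻ τ, F (setSpacing e m γ τ) ∂(expMeasure 1) :=
    (hF.comp (measurable_setSpacing e m)).lintegral_prod_right'
  unfold poissonSpacings
  rw [lintegral_piUpdate (fun _ : E => spacingLaw) e hF,
    lintegral_piUpdate (fun _ : E => spacingLaw) e hm]
  refine lintegral_congr fun γ => ?_
  refine (lintegral_seqUpdate (expMeasure 1) m (F := fun g => F (update γ e g))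
    (hF.comp (measurable_update γ))).trans ?_
  refine lintegral_congr fun g => lintegral_congr fun τ => ?_
  simp [setSpacing]

theorem ae_goodSpacings : ∀ᵐ γ ∂(poissonSpacings E), ∀ e, GoodSpacing (γ e) := by
  rw [ae_all_iff]
  exact fun e => (measurePreserving_eval (fun _ : E => spacingLaw)
    e).quasiMeasurePreserving.ae ae_goodSpacing

theorem ae_psums_ne (n : E → ℕ) (v : E → ℝ) :
    ∀ᵐ γ ∂(poissonSpacings E), ∀ e, n e ≠ 0 → psum (γ e) (n e) ≠ v e := by
  rw [ae_all_iff]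
  intro e
  by_cases hn : n e = 0
  · simp [hn]
  filter_upwards [(measurePreserving_eval (fun _ : E => spacingLaw)
    e).quasiMeasurePreserving.ae (ae_psum_ne (n e) hn (v e))] with γ h _
  exact h

/-- The expectation of a function of the first spacings on the event that there are `n e` points in
`[0, a e)`. -/
def capExp (n : E → ℕ) (a : E → ℝ) (K : (E → ℕ → ℝ) → ℝ≥0∞) : ℝ≥0∞ :=
  ∫⁻ γ, K γ * ∏ e, capWeight (n e) (a e) (γ e) ∂(poissonSpacings E)

theorem measurable_prod_capWeight (s : Finset E) (n : E → ℕ) {Z : Type*} [MeasurableSpace Z]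
    {a : Z → E → ℝ} {γ : Z → E → ℕ → ℝ} (ha : ∀ e, Measurable fun z => a z e)
    (hγ : Measurable γ) : Measurable fun z => ∏ e ∈ s, capWeight (n e) (a z e) (γ z e) :=
  Finset.measurable_prod _ fun e _ =>
    Measurable.capWeight (n e) (ha e) ((measurable_pi_apply e).comp hγ)

/-- The event that the last point of `γ e` is the first one to be left when the levels decrease. -/
def lastFirst (I : Finset E) (n : E → ℕ) (a : E → ℝ) (e : E) : Set (E → ℕ → ℝ) :=
  {γ | ∀ e' ∈ I, psum (γ e') (n e') * a e ≤ psum (γ e) (n e) * a e'}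

theorem measurableSet_lastFirst (I : Finset E) (n : E → ℕ) (a : E → ℝ) (e : E) :
    MeasurableSet (lastFirst I n a e) := by
  have h : ∀ e, Measurable fun γ : E → ℕ → ℝ => psum (γ e) (n e) := fun e =>
    (measurable_psum (n e)).comp (measurable_pi_apply e)
  refine measurableSet_forall fun e' => ?_
  by_cases he : e' ∈ I
  · simpa [he] using measurableSet_le ((h e').mul_const _) ((h e).mul_const _)
  · simp [he]

/-- When levels decrease in proportion, the first one to meet its last point is that with the
largest ratio of last point to level. Ties are counted several times, which only helps. -/
theorem capExp_le_sum_lastFirst {I : Finset E} (hI : I.Nonempty) (n : E → ℕ) {a : E → ℝ}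
    (ha : ∀ e ∈ I, 0 < a e) {K : (E → ℕ → ℝ) → ℝ≥0∞} (hK : Measurable K) :
    capExp n a K ≤ ∑ e ∈ I, capExp n a ((lastFirst I n a e).indicator K) := by
  unfold capExp
  rw [← lintegral_finsetSum]
  · refine lintegral_mono fun γ => ?_
    obtain ⟨e, he, hmax⟩ := I.exists_max_image (fun e => psum (γ e) (n e) / a e) hI
    refine le_trans (le_of_eq ?_) (Finset.single_le_sum (f := fun e =>
      (lastFirst I n a e).indicator K γ * ∏ e, capWeight (n e) (a e) (γ e))
      (fun _ _ => zero_le) he)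
    simp only
    rw [indicator_of_mem]
    intro e' he'
    have := hmax e' he'
    rwa [div_le_div_iff₀ (ha e' he') (ha e he)] at this
  · exact fun e _ => (hK.indicator (measurableSet_lastFirst I n a e)).mul
      (measurable_prod_capWeight _ n (fun _ => measurable_const) measurable_id)

variable {A : E → ℝ → ℝ} {A' : ℝ → ℝ}

/-- The last point of `e` is written as the level `A e s`, so `s` is the time of the first drop. By
proportionality, the last point of every other competing edge is then below its level at `s`, and
passing its weight from time 0 to time `s` costs exp(-(A e' 0 - A e' s)). Edges outside `I` which
carry points have constant levels; edges without points impose no condition. -/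
theorem capExp_lastFirst_le {I : Finset E} {n : E → ℕ} {b : ℝ} {e : E} {m : ℕ} (he : e ∈ I)
    (hm : n e = m + 1) (hA : ∀ e, Measurable (A e)) (hA' : Measurable A') (ha : 0 < A e 0)
    (hd : ∀ s ∈ Ioo 0 b, HasDerivAt (A e) (A' s) s) (hinj : Set.InjOn (A e) (Ioo 0 b))
    (hsurj : Ioo 0 (A e 0) ⊆ A e '' Ioo 0 b)
    (hprop : ∀ e' ∈ I, ∀ s ∈ Ioo 0 b, A e s * A e' 0 = A e' s * A e 0)
    (hconst : ∀ e' ∉ I, n e' ≠ 0 → ∀ s, A e' s = A e' 0) {K : (E → ℕ → ℝ) → ℝ≥0∞}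
    (hK : Measurable K) :
    capExp n (fun e => A e 0) ((lastFirst I n (fun e => A e 0) e).indicator K) ≤
      ∫⁻ s in Ioo 0 b, ofReal |A' s| *
        (ofReal (exp (-∑ e, (A e 0 - A e s))) *
          capExp (update n e m) (fun e => A e s)
            fun γ => K (setSpacing e m γ (A e s - psum (γ e) m))) := by
  set P : (E → ℕ → ℝ) → ℝ → Prop := fun γ p =>
    ∀ e' ∈ I, e' ≠ e → psum (γ e') (n e') * A e 0 ≤ p * A e' 0 with hP
  set R : (E → ℕ → ℝ) → ℝ≥0∞ := fun γ =>
    ∏ e' ∈ univ.erase e, capWeight (n e') (A e' 0) (γ e') with hR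
  set Φ : (E → ℕ → ℝ) → ℝ → ℝ≥0∞ := fun γ p =>
    K (setSpacing e m γ (p - psum (γ e) m)) * if P γ p then R γ else 0 with hΦ
  have hps : ∀ (e : E) (k : ℕ), Measurable fun γ : E → ℕ → ℝ => psum (γ e) k := fun e k =>
    (measurable_psum k).comp (measurable_pi_apply e)
  have hRm : Measurable R := measurable_prod_capWeight _ n (fun _ => measurable_const) measurable_id
  have hKm : Measurable fun q : (E → ℕ → ℝ) × ℝ =>
      K (setSpacing e m q.1 (q.2 - psum (q.1 e) m)) :=
    hK.comp ((measurable_setSpacing e m).comp (measurable_fst.prodMk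
      (measurable_snd.sub ((hps e m).comp measurable_fst))))
  have hΦm : Measurable fun q : (E → ℕ → ℝ) × ℝ => Φ q.1 q.2 := by
    refine hKm.mul (Measurable.ite ?_ (hRm.comp measurable_fst) measurable_const)
    refine measurableSet_forall fun e' => ?_
    by_cases h1 : e' ∈ I ∧ e' ≠ e
    · simp only [h1.1, ne_eq, h1.2, not_false_eq_true, forall_const]
      exact measurableSet_le (((hps _ _).comp measurable_fst).mul_const _)
        (measurable_snd.mul_const _)
    · have : ∀ q : (E → ℕ → ℝ) × ℝ, (e' ∈ I → e' ≠ e → psum (q.1 e') (n e') * A e 0 ≤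
          q.2 * A e' 0) := fun q h2 h3 => absurd ⟨h2, h3⟩ h1
      convert MeasurableSet.univ
      exact Set.eq_univ_of_forall this
  unfold capExp
  rw [lintegral_setSpacing e m (F := fun γ => (lastFirst I n (fun e => A e 0) e).indicator K γ *
    ∏ e', capWeight (n e') (A e' 0) (γ e')) ((hK.indicator (measurableSet_lastFirst I n _ e)).mul
    (measurable_prod_capWeight _ n (fun _ => measurable_const) measurable_id))]
  have h1 : ∀ γ τ, (lastFirst I n (fun e => A e 0) e).indicator K (setSpacing e m γ τ) *
      ∏ e', capWeight (n e') (A e' 0) (setSpacing e m γ τ e') =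
      (if psum (γ e) m + τ < A e 0 then
        ofReal (exp (-(A e 0 - (psum (γ e) m + τ)))) else 0) *
        Φ γ (psum (γ e) m + τ) := by
    intro γ τ
    have hsum : psum (setSpacing e m γ τ e) (n e) = psum (γ e) m + τ := by
      rw [setSpacing_same, hm, psum_succ, psum_update _ le_rfl, update_self]
    have hmem : setSpacing e m γ τ ∈ lastFirst I n (fun e => A e 0) e ↔
        P γ (psum (γ e) m + τ) := by
      simp only [lastFirst, mem_ofPred_eq, hsum, hP]
      refine forall_congr' fun e' => imp_congr_right fun he' => ?_
      by_cases hee : e' = e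
      · subst hee; simp [hsum]
      · simp [hee, setSpacing_of_ne]
    rw [← mul_prod_erase _ _ (mem_univ e), indicator_apply, hΦ]
    simp only [hmem, add_sub_cancel_left]
    have hRe : ∏ e' ∈ univ.erase e, capWeight (n e') (A e' 0) (setSpacing e m γ τ e') =
        R γ := prod_congr rfl fun e' he' => by
      rw [setSpacing_of_ne (ne_of_mem_erase he')]
    rw [hRe, capWeight, hsum, hm]
    simp only [Nat.add_eq_zero_iff, one_ne_zero, and_false, false_or]
    split_ifs <;> ring
  simp only [h1]
  refine (lintegral_mono_ae (g := fun γ => ∫⁻ s in Ioo 0 b, ofReal |A' s| *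
      ((if psum (γ e) m < A e s then ofReal (exp (-(A e 0 - psum (γ e) m))) else 0) *
        Φ γ (A e s))) ?_).trans ?_
  · filter_upwards [ae_goodSpacings] with γ hγ
    exact lintegral_last_point_le (psum_nonneg (hγ e).1 m) hd hinj hsurj _
  rw [lintegral_lintegral_swap]
  swap
  · refine Measurable.aemeasurable (Measurable.mul ?_ (Measurable.mul ?_ ?_))
    · exact (hA'.comp measurable_snd).abs.ennreal_ofReal
    · exact Measurable.ite (measurableSet_lt ((hps e m).comp measurable_fst)
        ((hA e).comp measurable_snd))
        (measurable_const.sub ((hps e m).comp measurable_fst)).neg.exp.ennreal_ofReal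
        measurable_const
    · exact hΦm.comp (measurable_fst.prodMk ((hA e).comp measurable_snd))
  refine setLIntegral_mono' measurableSet_Ioo fun s hs => ?_
  refine (le_of_eq (lintegral_const_mul' _ _ ofReal_ne_top)).trans ?_
  refine mul_le_mul_right ?_ _
  refine le_trans ?_ (le_of_eq (lintegral_const_mul' _ _ ofReal_ne_top))
  refine lintegral_mono_ae ?_
  filter_upwards [ae_psums_ne n fun e' => A e' s] with γ hne
  rw [hΦ]
  simp only
  by_cases hcond : P γ (A e s)
  swap
  · simp [hcond]
  rw [if_pos hcond]
  have hexp : ofReal (exp (-∑ e, (A e 0 - A e s))) =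
      ∏ e, ofReal (exp (-(A e 0 - A e s))) := by
    rw [← Finset.sum_neg_distrib, exp_sum,
      ofReal_prod_of_nonneg fun _ _ => (exp_pos _).le]
  -- For `e` itself the weight left is that of its first `m` points at the level `A e s`, since the
  -- last point, being at this level, is no longer counted.
  have hfac : (if psum (γ e) m < A e s then
      ofReal (exp (-(A e 0 - psum (γ e) m))) else 0) * R γ ≤
      ∏ e', ofReal (exp (-(A e' 0 - A e' s))) *
        capWeight (update n e m e') (A e' s) (γ e') := by
    rw [← mul_prod_erase _ _ (mem_univ e)]
    refine mul_le_mul' ?_ (Finset.prod_le_prod' fun e' he' => ?_)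
    · split_ifs with h
      · rw [update_self, capWeight, if_pos (Or.inr h),
          ← ofReal_mul (exp_pos _).le, ← exp_add]
        exact ofReal_le_ofReal (Real.exp_le_exp.2 (by linarith))
      · exact zero_le
    · have hee := ne_of_mem_erase he'
      rw [update_of_ne hee]
      by_cases hn : n e' = 0
      · exact capWeight_le (Or.inl hn)
      by_cases heI : e' ∈ I
      · have h2 := hcond e' heI hee
        rw [hprop e' heI s hs] at h2
        exact capWeight_le (Or.inr (lt_of_le_of_ne (le_of_mul_le_mul_right h2 ha) (hne e' hn)))
      · rw [hconst e' heI hn s]; simp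
  rw [hexp]
  calc _ = K (setSpacing e m γ (A e s - psum (γ e) m)) * ((if psum (γ e) m < A e s then
      ofReal (exp (-(A e 0 - psum (γ e) m))) else 0) * R γ) := by ring
    _ ≤ _ := mul_le_mul_right hfac _
    _ = _ := by rw [Finset.prod_mul_distrib]; ring

end CapWeight

section SqrtLevel

/-! ### The function `s ↦ c √(2 (b - s))` -/

variable {b c : ℝ}

theorem hasDerivAt_sqrtLevel {s : ℝ} (hs : s < b) :
    HasDerivAt (fun s => c * √(2 * (b - s))) (-(c / √(2 * (b - s)))) s := by
  have h0 : 2 * (b - s) ≠ 0 := by linarith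
  have h1 : HasDerivAt (fun s => 2 * (b - s)) (-2) s := by
    simpa using ((hasDerivAt_id s).const_sub b).const_mul 2
  refine ((h1.sqrt h0).const_mul c).congr_deriv ?_
  ring

theorem sqrtLevel_lt (hc : 0 < c) {s t : ℝ} (hst : s < t) (ht : t ≤ b) :
    c * √(2 * (b - t)) < c * √(2 * (b - s)) :=
  mul_lt_mul_of_pos_left (Real.sqrt_lt_sqrt (by linarith) (by linarith)) hc

theorem injOn_sqrtLevel (hc : 0 < c) :
    Set.InjOn (fun s => c * √(2 * (b - s))) (Ioo 0 b) := by
  intro s hs t ht h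
  rcases lt_trichotomy s t with h1 | h1 | h1
  exacts [absurd h (sqrtLevel_lt hc h1 ht.2.le).ne', h1, absurd h (sqrtLevel_lt hc h1 hs.2.le).ne]

theorem surjOn_sqrtLevel (hc : 0 < c) :
    Ioo 0 (c * √(2 * (b - 0))) ⊆ (fun s => c * √(2 * (b - s))) '' Ioo 0 b := by
  rintro y ⟨hy0, hy⟩
  have h0 : 0 < y / c := div_pos hy0 hc
  have h1 : (y / c) ^ 2 < 2 * (b - 0) := by
    rw [← Real.lt_sqrt h0.le, div_lt_iff₀ hc, mul_comm]
    exact hy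
  refine ⟨b - (y / c) ^ 2 / 2, ⟨by linarith, by nlinarith⟩, ?_⟩
  simp only
  rw [show 2 * (b - (b - (y / c) ^ 2 / 2)) = (y / c) ^ 2 by ring, Real.sqrt_sq h0.le]
  field_simp

end SqrtLevel

section CapWeightMass

theorem psum_seqCons (a : ℝ) (γ : ℕ → ℝ) (n : ℕ) : psum (seqCons a γ) (n + 1) = a + psum γ n := by
  rw [psum, Finset.sum_range_succ', add_comm]
  rfl

/-- The Poisson probability of `n` points, by induction on the first spacing: its density and the
remaining exponential combine into exp(-a), and the powers of a - τ integrate. -/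
theorem lintegral_capWeight_le (n : ℕ) {a : ℝ} (ha : 0 ≤ a) :
    ∫⁻ γ, capWeight n a γ ∂spacingLaw ≤
      ofReal (exp (-a) * (a ^ n / n.factorial)) := by
  induction n generalizing a with
  | zero => simp [capWeight, psum_zero]
  | succ n ih =>
    rw [lintegral_seqCons (expMeasure 1) (F := fun γ => capWeight (n + 1) a γ)
      (Measurable.capWeight (n + 1) measurable_const measurable_id)]
    have h1 : ∀ τ : ℝ, ∫⁻ γ, capWeight (n + 1) a (seqCons τ γ) ∂spacingLaw ≤
        (Set.Iic a).indicator (fun τ => ofReal (exp (-(a - τ)) *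
          ((a - τ) ^ n / n.factorial))) τ := by
      intro τ
      by_cases hτ : τ ≤ a
      · rw [indicator_of_mem (by exact hτ)]
        refine le_trans (lintegral_mono fun γ => ?_) (ih (sub_nonneg.2 hτ))
        simp only [capWeight, psum_seqCons, Nat.add_eq_zero_iff, one_ne_zero, and_false, false_or]
        by_cases h : τ + psum γ n < a
        · rw [if_pos h, if_pos (Or.inr (by linarith))]
          exact le_of_eq (by congr 2; ring)
        · rw [if_neg h]; exact zero_le
      · rw [indicator_of_notMem (by exact hτ)]
        refine le_of_eq ((lintegral_congr_ae (g := fun _ => 0) ?_).trans lintegral_zero)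
        filter_upwards [ae_goodSpacing] with γ hγ
        have := psum_nonneg hγ.1 n
        simp only [capWeight, psum_seqCons, Nat.add_eq_zero_iff, one_ne_zero, and_false, false_or]
        rw [if_neg (by linarith)]
    refine (lintegral_mono h1).trans ?_
    rw [lintegral_expMeasure, setLIntegral_congr Ioi_ae_eq_Ici]
    have h2 : ∀ τ : ℝ, ofReal (1 * exp (-(1 * τ))) *
        (Set.Iic a).indicator (fun τ => ofReal (exp (-(a - τ)) *
          ((a - τ) ^ n / n.factorial))) τ =
        (Set.Iic a).indicator (fun τ => ofReal (exp (-a) *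
          ((a - τ) ^ n / n.factorial))) τ := by
      intro τ
      by_cases hτ : τ ∈ Set.Iic a
      · rw [indicator_of_mem hτ, indicator_of_mem hτ,
          ← ofReal_mul (by positivity), ← mul_assoc, one_mul, one_mul, ← exp_add]
        congr 3; ring_nf
      · rw [indicator_of_notMem hτ, indicator_of_notMem hτ, mul_zero]
    simp only [h2]
    rw [lintegral_indicator measurableSet_Iic, Measure.restrict_restrict measurableSet_Iic,
      Set.inter_comm, Set.Ici_inter_Iic, ← setLIntegral_congr Ioc_ae_eq_Icc,
      ← ofReal_integral_eq_lintegral_ofReal]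
    · refine ofReal_le_ofReal (le_of_eq ?_)
      rw [← intervalIntegral.integral_of_le ha, intervalIntegral.integral_const_mul,
        intervalIntegral.integral_div, intervalIntegral.integral_comp_sub_left (fun x => x ^ n),
        integral_pow]
      simp only [sub_self, sub_zero, Nat.factorial_succ]
      push_cast
      have : (n.factorial : ℝ) ≠ 0 := by positivity
      field_simp
      simp
    · exact (by fun_prop : Continuous fun τ : ℝ => exp (-a) *
        ((a - τ) ^ n / n.factorial)).integrableOn_Ioc
    · filter_upwards [ae_restrict_mem measurableSet_Ioc] with τ hτ
      have := sub_nonneg.2 hτ.2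
      positivity

/-- Superadditivity of the lower integral requires no measurability, which spares it for many
intermediate functions below. -/
theorem sum_lintegral_le {α ι : Type*} [MeasurableSpace α] (μ : Measure α) (s : Finset ι)
    (f : ι → α → ℝ≥0∞) : ∑ i ∈ s, ∫⁻ a, f i a ∂μ ≤ ∫⁻ a, ∑ i ∈ s, f i a ∂μ := by
  induction s using Finset.induction_on with
  | empty => simp
  | insert i s hi ih =>
    rw [Finset.sum_insert hi]
    simp only [Finset.sum_insert hi]
    exact (add_le_add le_rfl ih).trans (le_lintegral_add _ _)

theorem lintegral_fairCoins {F : (ℕ → Bool) → ℝ≥0∞} (hF : Measurable F) :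
    ∫⁻ c, F c ∂fairCoins = (∫⁻ c, F (seqCons true c) ∂fairCoins) / 2 +
      (∫⁻ c, F (seqCons false c) ∂fairCoins) / 2 := by
  have : IsProbabilityMeasure (uniformOn (Set.univ : Set Bool)) :=
    isProbabilityMeasure_uniformOn Set.finite_univ Set.univ_nonempty
  unfold fairCoins
  rw [lintegral_seqCons _ hF, lintegral_fintype]
  have h : ∀ b : Bool, uniformOn (Set.univ : Set Bool) {b} = 2⁻¹ := fun b => by
    rw [uniformOn_univ]; simp
  simp only [h, Fintype.sum_bool]
  rfl

end CapWeightMass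

namespace Network

variable {V E : Type*} (G : Network V E) (x₀ : V)

/-! ### The position stays in the cluster of the root -/

section Reach

theorem reachable_insert {C : Set E} {e : E} {a b : V}
    (h : (G.openGraph (insert e C)).Reachable a b) :
    (G.openGraph C).Reachable a b ∨ (G.openGraph C).Reachable a (G.fst e) ∨
      (G.openGraph C).Reachable a (G.snd e) := by
  rw [SimpleGraph.reachable_iff_reflTransGen] at h
  induction h with
  | refl => exact Or.inl (SimpleGraph.Reachable.refl _)
  | tail _ hbc ih =>
    rcases ih with ih | ih
    swap
    · exact Or.inr ih
    obtain ⟨-, ⟨e', he', rfl, rfl⟩ | ⟨e', he', rfl, rfl⟩⟩ := (SimpleGraph.fromRel_adj _ _ _).1 hbc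
    · rcases he' with rfl | he'
      exacts [Or.inr (Or.inl ih), Or.inl (ih.trans (G.openGraph_adj_of_mem he').reachable)]
    · rcases he' with rfl | he'
      exacts [Or.inr (Or.inr ih), Or.inl (ih.trans (G.openGraph_adj_of_mem he').symm.reachable)]

/-- Deleting `e` from the cluster of `x₀` leaves at least one end of `e` connected to `x₀`. If the
ends remain connected to each other, either choice is admissible; otherwise the rule selects the
correct end. -/
theorem reachable_checkMove {C : Set E} {e : E} {x : V} (hx : G.Incident e x)
    (h : (G.openGraph (insert e C)).Reachable x₀ x) (b : Bool) :
    (G.openGraph C).Reachable x₀ (G.checkMove x₀ x e C b) := by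
  have h1 : (G.openGraph C).Reachable x₀ (G.fst e) ∨ (G.openGraph C).Reachable x₀ (G.snd e) := by
    rcases G.reachable_insert h with h | h
    · rcases hx with rfl | rfl
      exacts [Or.inl h, Or.inr h]
    · exact h
  unfold checkMove
  split_ifs with h2 h3 h4
  · unfold other
    split_ifs; exacts [h1.elim (fun h => h.trans h2) id, h1.elim id (fun h => h.trans h2.symm)]
  · rcases hx with rfl | rfl
    exacts [h1.elim id (fun h => h.trans h2.symm), h1.elim (fun h => h.trans h2) id]
  · exact h4
  · exact h1.resolve_left h4

/-- Together with the invariance of the cluster, this shows that the process can only run out of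
adjacent stacks at `x₀`. -/
theorem exists_incident_of_reachable {C : Set E} {x : V} (h : (G.openGraph C).Reachable x₀ x)
    (hx : x ≠ x₀) : ∃ e ∈ C, G.Incident e x := by
  rw [SimpleGraph.reachable_iff_reflTransGen] at h
  cases h with
  | refl => exact absurd rfl hx
  | tail _ hbc =>
    obtain ⟨-, ⟨e', he', h1, h2⟩ | ⟨e', he', h1, h2⟩⟩ := (SimpleGraph.fromRel_adj _ _ _).1 hbc
    exacts [⟨e', he', Or.inr h2⟩, ⟨e', he', Or.inl h1⟩]

end Reach

/-! ### Stacks as truncated counts below the levels -/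

section Levels

/-- The levels `2 J_e` for the edges of `A`, as functions of the halved squared field. -/
def rateA (A : Set E) (r : V → ℝ) (e : E) : ℝ := if e ∈ A then 2 * G.rateJ r e else 0

variable (A : Set E)

theorem rateA_nonneg (r : V → ℝ) (e : E) : 0 ≤ G.rateA A r e := by
  have := G.rateJ_nonneg r e
  unfold rateA
  split_ifs <;> linarith

theorem rateA_mono {r r' : V → ℝ} (h : r ≤ r') (e : E) : G.rateA A r e ≤ G.rateA A r' e := by
  have := G.rateJ_mono h e
  unfold rateA
  split_ifs <;> linarith

/-- During a stay at `x`, all the levels at adjacent edges of `A` are proportional to √(2 (r x -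
s)); this is the proportionality used to find the first drop. -/
theorem rateA_sub_single {r : V → ℝ} {e : E} {x : V} (hx : G.Incident e x) (he : e ∈ A) (s : ℝ) :
    G.rateA A (r - Pi.single x s) e =
      2 * G.W e * √(2 * r (G.other e x)) * √(2 * (r x - s)) := by
  rw [rateA, if_pos he, G.rateJ_eq_of_incident _ hx, Pi.sub_apply, Pi.sub_apply,
    Pi.single_eq_same, Pi.single_eq_of_ne (G.other_ne e x), sub_zero]
  ring

theorem rateA_sub_single_of_not {r : V → ℝ} {e : E} {x : V} (h : ¬ (G.Incident e x ∧ e ∈ A))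
    (s : ℝ) : G.rateA A (r - Pi.single x s) e = G.rateA A r e := by
  by_cases he : e ∈ A
  · have hx : ¬ G.Incident e x := fun hx => h ⟨hx, he⟩
    simp only [Incident, not_or] at hx
    simp [rateA, rateJ, J, hx.1, hx.2]
  · simp [rateA, he]

theorem measurable_rateA {Z : Type*} [MeasurableSpace Z] {r : Z → V → ℝ} (hr : Measurable r)
    (e : E) : Measurable fun z => G.rateA A (r z) e := by
  unfold rateA
  split_ifs
  · unfold rateJ J
    fun_prop
  · exact measurable_const

/-- The stacks made of the first `n e` points. -/
def capStack (r : V → ℝ) (n : E → ℕ) (γ : E → ℕ → ℝ) (ℓ : V → ℝ) (e : E) : ℕ :=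
  capCount (γ e) (n e) (G.rateA A (r - ℓ) e)

theorem antitone_capStack (r : V → ℝ) (n : E → ℕ) (γ : E → ℕ → ℝ) :
    Antitone (G.capStack A r n γ) := fun _ _ h e =>
  capCount_mono _ _ (G.rateA_mono A (sub_le_sub_left h r) e)

theorem measStack_capStack [Fintype V] [Fintype E] (r : V → ℝ) (n : E → ℕ) :
    MeasStack (G.capStack A r n) where
  joint e := measurable_capCount (n e) (by fun_prop)
    (G.measurable_rateA A (by fun_prop) e)
  anti γ _ _ h e := G.antitone_capStack A r n γ h e

end Levels

end Network

namespace Network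

universe v w

variable {V : Type v} {E : Type w} (G : Network V E) (x₀ : V) (A : Set E)

section CapStackDrop

variable [Fintype E] {r : V → ℝ} {n : E → ℕ} {γ : E → ℕ → ℝ} {x : V} {s : ℝ} {e : E} {m : ℕ}

theorem capStack_eq_self {ℓ : V → ℝ} (hγ : ∀ e k, 0 < γ e k)
    (h : ∀ e, n e = 0 ∨ psum (γ e) (n e) < G.rateA A (r - ℓ) e) : G.capStack A r n γ ℓ = n :=
  funext fun e => capCount_eq_self (hγ e) (h e)

theorem rateA_sub_single_lt (hx : G.Incident e x) (he : e ∈ A) (hr : ∀ z, 0 < r z) {t : ℝ}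
    (hst : s < t) (ht : t ≤ r x) :
    G.rateA A (r - Pi.single x t) e < G.rateA A (r - Pi.single x s) e := by
  rw [G.rateA_sub_single A hx he, G.rateA_sub_single A hx he]
  refine sqrtLevel_lt (mul_pos (mul_pos two_pos (G.W_pos e)) (sqrt_pos.2 ?_)) hst ht
  linarith [hr (G.other e x)]

theorem rateA_pos (he : e ∈ A) (hr : ∀ z, 0 < r z) : 0 < G.rateA A r e := by
  rw [rateA, if_pos he, rateJ, J]
  have h := fun z => sqrt_pos.2 (mul_pos two_pos (hr z))
  have := G.W_pos e
  have := h (G.fst e)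
  have := h (G.snd e)
  positivity

/-- The spacings for which the stack at `e` drops from `m + 1` to `m` when the level is `a`. -/
def lastAt (e : E) (m : ℕ) (γ : E → ℕ → ℝ) (a : ℝ) : E → ℕ → ℝ :=
  setSpacing e m γ (a - psum (γ e) m)

theorem sub_single_pos (hr : ∀ z, 0 < r z) (hs : s < r x) (z : V) :
    0 < (r - Pi.single x s : V → ℝ) z := by
  by_cases hz : z = x
  · subst hz; simp [hs]
  · simpa [hz] using hr z

variable {A}

/-- These conditions do not involve the spacing `m` of `γ e`, which is to be replaced by the value
given by `lastAt`. The last field says that, at time `s`, the remaining stacks `update n e m` are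
still complete. -/
structure LastDrop (r : V → ℝ) (n : E → ℕ) (γ : E → ℕ → ℝ) (x : V) (s : ℝ) (e : E) (m : ℕ) :
    Prop where
  incident : G.Incident e x
  mem : e ∈ A
  field : ∀ z, 0 < r z
  time : s ∈ Ioo 0 (r x)
  stack : n e = m + 1
  spacing : ∀ e k, 0 < γ e k
  below : ∀ e', update n e m e' = 0 ∨
    psum (γ e') (update n e m e') < G.rateA A (r - Pi.single x s) e'

variable {G}

theorem LastDrop.psum_lt (h : G.LastDrop (A := A) r n γ x s e m) :
    psum (γ e) m < G.rateA A (r - Pi.single x s) e := by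
  have h1 := h.below e
  rw [update_self] at h1
  rcases h1 with rfl | h1
  · rw [psum_zero]
    exact G.rateA_pos A h.mem (sub_single_pos h.field h.time.2)
  · exact h1

theorem LastDrop.spacing_lastAt (h : G.LastDrop (A := A) r n γ x s e m) (e' : E) (k : ℕ) :
    0 < lastAt e m γ (G.rateA A (r - Pi.single x s) e) e' k := by
  by_cases he : e' = e
  · subst he
    rw [lastAt, setSpacing_same]
    by_cases hk : k = m
    · subst hk; rw [update_self]; exact sub_pos.2 h.psum_lt
    · rw [update_of_ne hk]; exact h.spacing e' k
  · rw [lastAt, setSpacing_of_ne he]; exact h.spacing e' k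

theorem LastDrop.point_lastAt (_ : G.LastDrop (A := A) r n γ x s e m) :
    point (lastAt e m γ (G.rateA A (r - Pi.single x s) e) e) m =
      G.rateA A (r - Pi.single x s) e := by
  rw [← psum_succ_eq_point, psum_succ, lastAt, setSpacing_same, psum_update _ le_rfl,
    update_self]
  ring

theorem LastDrop.before (h : G.LastDrop (A := A) r n γ x s e m) {t : ℝ} (hts : t < s) :
    G.capStack A r n (lastAt e m γ (G.rateA A (r - Pi.single x s) e)) (Pi.single x t) = n := by
  refine G.capStack_eq_self A h.spacing_lastAt fun e' => ?_
  by_cases he : e' = e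
  · subst he
    rw [h.stack, psum_succ_eq_point, h.point_lastAt]
    exact Or.inr (G.rateA_sub_single_lt A h.incident h.mem h.field hts h.time.2.le)
  · have h1 := h.below e'
    rw [update_of_ne he] at h1
    rw [lastAt, setSpacing_of_ne he]
    exact h1.imp_right fun h2 => h2.trans_le
      (G.rateA_mono A (sub_le_sub_left (Pi.single_mono x hts.le) r) e')

/-- The top point of `e` sits at the level of time `s`; counts are strict, so it is never counted
from then on. The remaining stack only uses the spacings before `m`, which `lastAt` does not alter.
-/
theorem LastDrop.shift (h : G.LastDrop (A := A) r n γ x s e m) {ℓ : V → ℝ} (hℓ : 0 ≤ ℓ) :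
    shiftStack (G.capStack A r n (lastAt e m γ (G.rateA A (r - Pi.single x s) e))) x s ℓ =
      G.capStack A (r - Pi.single x s) (update n e m) γ ℓ := by
  funext e'
  rw [shiftStack, capStack, capStack, ← sub_sub]
  by_cases he : e' = e
  · subst he
    rw [update_self, h.stack, capCount_succ_of_le]
    · refine capCount_congr (fun k hk => ?_) _
      rw [lastAt, setSpacing_same, update_of_ne hk.ne]
    · rw [h.point_lastAt]
      exact G.rateA_mono A (sub_le_self _ hℓ) e'
  · rw [update_of_ne he, lastAt, setSpacing_of_ne he]

theorem LastDrop.at_zero (h : G.LastDrop (A := A) r n γ x s e m) :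
    G.capStack A r n (lastAt e m γ (G.rateA A (r - Pi.single x s) e)) 0 = n := by
  simpa using h.before h.time.1

theorem LastDrop.at_time (h : G.LastDrop (A := A) r n γ x s e m) :
    G.capStack A r n (lastAt e m γ (G.rateA A (r - Pi.single x s) e)) (Pi.single x s) =
      update n e m := by
  have h1 := h.shift (le_refl (0 : V → ℝ))
  rw [shiftStack, add_zero] at h1
  rw [h1]
  exact G.capStack_eq_self A h.spacing (by simpa using h.below)

theorem LastDrop.firstDrop (h : G.LastDrop (A := A) r n γ x s e m) :
    FirstDrop (G.capStack A r n (lastAt e m γ (G.rateA A (r - Pi.single x s) e))) x s e where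
  pos := h.time.1
  before t _ hts := by rw [h.before hts, h.at_zero]
  drop := by rw [h.at_time, h.at_zero, update_self, h.stack]; exact Nat.lt_succ_self m
  other e' he := by rw [h.at_time, h.at_zero, update_of_ne he]

theorem LastDrop.dropPath [Fintype V] [MeasurableSpace V] [MeasurableSingletonClass V]
    (h : G.LastDrop (A := A) r n γ x s e m) (c : ℕ → Bool) {b : Bool} :
    G.dropPath x₀ (G.capStack A r n (lastAt e m γ (G.rateA A (r - Pi.single x s) e))) r x
        (seqCons b c) =
      consPath s (x, n) (G.dropPath x₀
        (G.capStack A (r - Pi.single x s) (update n e m) γ) (r - Pi.single x s)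
        (G.checkMove x₀ x e {e' | 0 < update n e m e'} b) c) := by
  rw [h.firstDrop.dropPath G x₀ (G.antitone_capStack A r n _) (seqCons b c)
    (y := G.checkMove x₀ x e {e' | 0 < update n e m e'} b) (by rw [h.at_time]; rfl)
    (sub_single_pos h.field h.time.2), h.at_zero]
  congr 1
  exact G.dropPath_congr x₀ (fun ℓ hℓ => h.shift hℓ) _ _ _

end CapStackDrop

section DropExp

variable [Fintype V] [Fintype E] [MeasurableSpace V] [MeasurableSingletonClass V]

theorem _root_.Network.ProcMeasurable.dropPath {F : LifePath V E → ℝ≥0∞}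
    (hF : ProcMeasurable fun _ => F) {Z : Type w} [MeasurableSpace Z] {st : Z → (V → ℝ) → E → ℕ}
    (hst : MeasStack st) (r : V → ℝ) (x : V) {c : Z → ℕ → Bool} (hc : Measurable c) :
    Measurable fun z => F (G.dropPath x₀ (st z) r x (c z)) := by
  refine hF (fun _ => 0) _ measurable_const
    (G.measurable_dropTime x₀ hst measurable_const measurable_const hc) ?_
  have hst' : MeasStack fun p : Z × ℝ => st p.1 := hst.comp measurable_fst
  have hc' : Measurable fun p : Z × ℝ => c p.1 := hc.comp measurable_fst
  have ht : Measurable fun p : Z × ℝ => max p.2 0 := measurable_snd.max measurable_const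
  refine (G.measurable_dropWalk x₀ hst' measurable_const hc' ht).prodMk
    (measurable_pi_lambda _ fun e => ?_)
  exact hst'.meas _ (G.measurable_dropWalk_localTime x₀ hst' measurable_const hc' ht) e

instance isProbabilityMeasure_fairCoins : IsProbabilityMeasure fairCoins := by
  have : IsProbabilityMeasure (uniformOn (Set.univ : Set Bool)) :=
    isProbabilityMeasure_uniformOn Set.finite_univ Set.univ_nonempty
  unfold fairCoins
  infer_instance

/-- The expectation, over the coins, of a function of the process. -/
def dropExp (F : LifePath V E → ℝ≥0∞) (r : V → ℝ) (n : E → ℕ) (x : V) (γ : E → ℕ → ℝ) : ℝ≥0∞ :=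
  ∫⁻ c, F (G.dropPath x₀ (G.capStack A r n γ) r x c) ∂fairCoins

theorem measurable_dropExp_aux {F : LifePath V E → ℝ≥0∞} (hF : ProcMeasurable fun _ => F) (r : V → ℝ)
    (n : E → ℕ) (x : V) : Measurable fun p : (E → ℕ → ℝ) × (ℕ → Bool) =>
      F (G.dropPath x₀ (G.capStack A r n p.1) r x p.2) :=
  hF.dropPath G x₀ ((G.measStack_capStack A r n).comp measurable_fst) r x measurable_snd

theorem measurable_dropExp {F : LifePath V E → ℝ≥0∞} (hF : ProcMeasurable fun _ => F) (r : V → ℝ)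
    (n : E → ℕ) (x : V) : Measurable (G.dropExp x₀ A F r n x) :=
  (G.measurable_dropExp_aux x₀ A hF r n x).lintegral_prod_right'

/-- Averaging over the first coin produces the two halves in the definition of `moveProb`; the other
coins drive the restarted process. -/
theorem LastDrop.dropExp {r : V → ℝ} {n : E → ℕ} {γ : E → ℕ → ℝ} {x : V} {s : ℝ} {e : E} {m : ℕ}
    (h : G.LastDrop (A := A) r n γ x s e m) {F : LifePath V E → ℝ≥0∞} (hF : ProcMeasurable fun _ => F) :
    G.dropExp x₀ A F r n x (lastAt e m γ (G.rateA A (r - Pi.single x s) e)) =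
      ∑ y, ofReal (G.moveProb x₀ {e' | 0 < update n e m e'} e x y) *
        G.dropExp x₀ A (fun T => F (consPath s (x, n) T)) (r - Pi.single x s)
          (update n e m) y γ := by
  unfold Network.dropExp
  have hm : ∀ γ, Measurable fun c => F (G.dropPath x₀ (G.capStack A r n γ) r x c) := by
    intro γ
    have h := G.measurable_dropExp_aux x₀ A hF r n x
    generalize hK : (fun p : (E → ℕ → ℝ) × (ℕ → Bool) =>
      F (G.dropPath x₀ (G.capStack A r n p.1) r x p.2)) = K at h
    have h2 : (fun c => F (G.dropPath x₀ (G.capStack A r n γ) r x c)) = fun c => K (γ, c) := by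
      rw [← hK]
    rw [h2]
    exact h.comp measurable_prodMk_left
  rw [lintegral_fairCoins (hm _)]
  simp only [h.dropPath]
  set X : V → ℝ≥0∞ := fun y => ∫⁻ c, F (consPath s (x, n) (G.dropPath x₀
        (G.capStack A (r - Pi.single x s) (update n e m) γ) (r - Pi.single x s)
        y c)) ∂fairCoins
  have h1 : ∀ y, ofReal (G.moveProb x₀ {e' | 0 < update n e m e'} e x y) * X y =
      (if G.checkMove x₀ x e {e' | 0 < update n e m e'} true = y then X y / 2 else 0) +
      (if G.checkMove x₀ x e {e' | 0 < update n e m e'} false = y then X y / 2 else 0) := by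
    intro y
    have h2 : ofReal ((1 + 1) / 2) = 1 := by norm_num
    have h3 : ofReal (1 / 2) = 2⁻¹ := by
      rw [one_div, ENNReal.ofReal_inv_of_pos two_pos]; simp
    unfold moveProb
    split_ifs
    · rw [h2, one_mul, ENNReal.add_halves]
    · rw [add_zero, h3, add_zero, ENNReal.div_eq_inv_mul]
    · rw [zero_add, h3, zero_add, ENNReal.div_eq_inv_mul]
    · simp
  change _ = ∑ y, ofReal (G.moveProb x₀ {e' | 0 < update n e m e'} e x y) * X y
  simp only [h1, sum_add_distrib, Finset.sum_ite_eq, mem_univ, if_true]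
  rfl

/-- The contribution of a skeleton to the law of the self-interacting process. -/
def bwdVal (F : LifePath V E → ℝ≥0∞) (r : V → ℝ) (n : E → ℕ) (p : Skeleton V E) : ℝ≥0∞ :=
  if listCount p.1 ≤ n ∧ ∀ z, z ≠ x₀ → 0 < (r - skelTime p) z then
    ofReal (exp (-∑ e, G.rateA A r e) *
      (∏ e, G.rateA A (r - skelTime p) e ^ (n - listCount p.1) e /
        ((n - listCount p.1) e).factorial) *
      G.bwdProd x₀ A (r - skelTime p) (n - listCount p.1) p.1 p.2) *
    F (bwdPath (n - listCount p.1) p.1 p.2)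
  else 0

/-- The first drop in reversed time is the last event of the skeleton. Its rate is the last factor
of the product, the exponential of the levels telescopes, and the contribution of the surviving
points depends only on the field and stacks at the other end. -/
theorem ofReal_mul_bwdVal_le {r : V → ℝ} {n : E → ℕ} {x : V} {s : ℝ} {e : E} {m : ℕ}
    (hx : G.Incident e x) (he : e ∈ A) (hm : n e = m + 1) (hs : 0 < s)
    (F : LifePath V E → ℝ≥0∞) (p : Skeleton V E) :
    ofReal (2 * G.W e * √(r (G.other e x) / (r x - s)) *
      exp (-∑ e, (G.rateA A r e - G.rateA A (r - Pi.single x s) e)) *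
      G.moveProb x₀ {e' | 0 < update n e m e'} e x p.2.1) *
      G.bwdVal x₀ A (fun T => F (consPath s (x, n) T)) (r - Pi.single x s)
        (update n e m) p ≤
      G.bwdVal x₀ A F r n (p.1 ++ [(p.2.1, p.2.2, e)], x, s) := by
  obtain ⟨L, y, t⟩ := p
  unfold bwdVal
  by_cases hLr : listCount L ≤ update n e m ∧ ∀ z, z ≠ x₀ →
      0 < (r - Pi.single x s - skelTime ((L, y, t) : Skeleton V E) : V → ℝ) z
  swap
  · rw [if_neg hLr, mul_zero]; exact zero_le
  obtain ⟨hL, hr⟩ := hLr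
  have hn : n = update n e m + Pi.single e 1 := by
    funext e'
    by_cases h : e' = e
    · subst h; simp [hm]
    · simp [h]
  have hL' : listCount (L ++ [(y, t, e)]) ≤ n := by
    rw [listCount_concat, hn]
    exact add_le_add_left hL _
  have hn0 : n - listCount (L ++ [(y, t, e)]) = update n e m - listCount L := by
    rw [listCount_concat]
    conv_lhs => rw [hn]
    funext e'
    simp only [Pi.sub_apply, Pi.add_apply]
    omega
  have hsk : r - skelTime ((L ++ [(y, t, e)], x, s) : Skeleton V E) =
      r - Pi.single x s - skelTime ((L, y, t) : Skeleton V E) := by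
    funext z
    simp only [Pi.sub_apply, skelTime, listTime_concat, Pi.single_apply, eq_comm (a := x)]
    ring
  rw [if_pos ⟨hL, hr⟩, if_pos ⟨hL', by rw [hsk]; exact hr⟩, hn0, hsk, bwdProd_concat, if_pos hs, sub_add_cancel, tsub_add_cancel_of_le hL]
  set n' := update n e m
  set r' : V → ℝ := r - Pi.single x s with hr'
  set B := G.bwdProd x₀ A (r' - skelTime ((L, y, t) : Skeleton V E)) (n' - listCount L) L (y, t)
    with hB
  by_cases hB0 : B = 0
  · simp [hB0]
  rw [bwdPath_concat _ (G.posTimes_of_bwdProd_ne_zero x₀ hB0).1, tsub_add_cancel_of_le hL, ← hn,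
    ← mul_assoc, ← ofReal_mul]
  · refine le_of_eq ?_
    congr 2
    rw [bwdRate, if_pos ⟨hx, he⟩]
    have h1 : r' (G.other e x) = r (G.other e x) := by
      rw [hr', Pi.sub_apply, Pi.single_eq_of_ne (G.other_ne e x), sub_zero]
    have h2 : r' x = r x - s := by rw [hr', Pi.sub_apply, Pi.single_eq_same]
    rw [h1, h2]
    have h3 : exp (-∑ e, G.rateA A r e) =
        exp (-∑ e, (G.rateA A r e - G.rateA A r' e)) * exp (-∑ e, G.rateA A r' e) := by
      rw [← exp_add, Finset.sum_sub_distrib]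
      congr 1
      ring
    rw [h3]
    ring
  · have := (G.W_pos e).le
    have := G.moveProb_nonneg x₀ {e' | 0 < n' e'} e x y
    positivity

end DropExp

end Network

/-! ### Upper bound for the law of the self-interacting process on skeletons -/

namespace Network

universe v w

variable {V : Type v} {E : Type w} (G : Network V E) (x₀ : V) (A : Set E) [Fintype V] [Fintype E]

theorem lintegral_prod_capWeight_le (n : E → ℕ) {a : E → ℝ} (ha : ∀ e, 0 ≤ a e) :
    ∫⁻ γ, ∏ e, capWeight (n e) (a e) (γ e) ∂(poissonSpacings E) ≤
      ofReal (exp (-∑ e, a e) * ∏ e, a e ^ n e / (n e).factorial) := by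
  have hm : ∀ e, Measurable (capWeight (n e) (a e)) := fun e =>
    Measurable.capWeight (n e) measurable_const measurable_id
  have hev : ∀ e, MeasurePreserving (fun γ : E → ℕ → ℝ => γ e) (poissonSpacings E) spacingLaw :=
    measurePreserving_eval (fun _ : E => spacingLaw)
  have hind : iIndepFun (fun e (γ : E → ℕ → ℝ) => capWeight (n e) (a e) (γ e))
      (poissonSpacings E) := iIndepFun_pi fun e => (hm e).aemeasurable
  rw [lintegral_prod_eq_prod_lintegral_of_indepFun univ _ hind
    (fun e => (hm e).comp (measurable_pi_apply e))]
  simp only [fun e => (hev e).lintegral_comp (hm e)]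
  refine (Finset.prod_le_prod' fun e _ => lintegral_capWeight_le (n e) (ha e)).trans (le_of_eq ?_)
  rw [← ofReal_prod_of_nonneg fun e _ => by have := ha e; positivity,
    Finset.prod_mul_distrib, ← exp_sum, Finset.sum_neg_distrib]

variable [MeasurableSpace V] [MeasurableSingletonClass V]

theorem capExp_const_mul (n : E → ℕ) (a : E → ℝ) {c : ℝ≥0∞} (hc : c ≠ ⊤)
    (K : (E → ℕ → ℝ) → ℝ≥0∞) : capExp n a (fun γ => c * K γ) = c * capExp n a K := by
  unfold capExp
  rw [← lintegral_const_mul' _ _ hc]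
  simp only [mul_assoc]

theorem capExp_sum {ι : Type*} (s : Finset ι) (n : E → ℕ) (a : E → ℝ)
    {K : ι → (E → ℕ → ℝ) → ℝ≥0∞} (hK : ∀ i, Measurable (K i)) :
    capExp n a (fun γ => ∑ i ∈ s, K i γ) = ∑ i ∈ s, capExp n a (K i) := by
  unfold capExp
  rw [← lintegral_finsetSum]
  · simp only [Finset.sum_mul]
  · exact fun i _ => (hK i).mul
      (measurable_prod_capWeight _ n (fun _ => measurable_const) measurable_id)

/-- With no stack left around `x₀`, the process waits there until the local time is `r x₀`. The
edges which still carry points keep their levels meanwhile, so the Poisson weights at the beginning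
and at the end of this stay coincide. -/
theorem capExp_dropExp_of_no_drop {F : LifePath V E → ℝ≥0∞} {r : V → ℝ} (hr : ∀ z, 0 < r z)
    {n : E → ℕ} (hx : ∀ e, 0 < n e → e ∈ A → ¬ G.Incident e x₀) :
    capExp n (G.rateA A r) (G.dropExp x₀ A F r n x₀) ≤
      G.bwdVal x₀ A F r n ([], x₀, r x₀) := by
  have h0 : skelTime (([], x₀, r x₀) : Skeleton V E) = Pi.single x₀ (r x₀) := by
    funext z; simp [skelTime, Pi.single_apply, eq_comm]
  have hval : G.bwdVal x₀ A F r n ([], x₀, r x₀) =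
      F (r x₀, fun _ => (x₀, n)) * ofReal (exp (-∑ e, G.rateA A r e) *
        ∏ e, G.rateA A r e ^ n e / (n e).factorial) := by
    have hoff : ∀ z, z ≠ x₀ → 0 < (r - Pi.single x₀ (r x₀) : V → ℝ) z := fun z hz => by
      simpa [hz] using hr z
    rw [bwdVal, if_pos ⟨fun _ => Nat.zero_le _, by rw [h0]; exact hoff⟩, mul_comm]
    simp only [listCount, tsub_zero, bwdProd, hr x₀, if_true, mul_one, bwdPath, h0]
    congr 3
    refine prod_congr rfl fun e _ => ?_
    by_cases hn : n e = 0
    · simp [hn]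
    · rw [G.rateA_sub_single_of_not]
      exact fun h => hx e (Nat.pos_of_ne_zero hn) h.2 h.1
  rw [hval]
  refine le_trans ?_ (mul_le_mul_right (lintegral_prod_capWeight_le n (G.rateA_nonneg A r)) _)
  unfold capExp
  have hw : Measurable fun γ : E → ℕ → ℝ => ∏ e, capWeight (n e) (G.rateA A r e) (γ e) :=
    measurable_prod_capWeight _ n (fun _ => measurable_const) measurable_id
  rw [← lintegral_const_mul _ hw]
  refine lintegral_mono_ae ?_
  filter_upwards [ae_goodSpacings] with γ hγ
  by_cases hw : ∃ e, capWeight (n e) (G.rateA A r e) (γ e) = 0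
  · obtain ⟨e, he⟩ := hw
    refine le_trans (le_of_eq ?_) zero_le
    exact mul_eq_zero_of_right _ (Finset.prod_eq_zero (mem_univ e) he)
  push Not at hw
  have hb : ∀ e, n e = 0 ∨ psum (γ e) (n e) < G.rateA A r e := by
    intro e
    by_contra h
    exact hw e (if_neg h)
  refine mul_le_mul_left (le_of_eq ?_) _
  have hst : ∀ ℓ : V → ℝ, (∃ t, ℓ = Pi.single x₀ t) → G.capStack A r n γ ℓ = n := by
    rintro _ ⟨t, rfl⟩
    refine G.capStack_eq_self A (fun e => (hγ e).1) fun e => ?_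
    by_cases hn : n e = 0
    · exact Or.inl hn
    · refine Or.inr ?_
      have h := (hb e).resolve_left hn
      rw [G.rateA_sub_single_of_not]
      exacts [h, fun h => hx e (Nat.pos_of_ne_zero hn) h.2 h.1]
  unfold dropExp
  have : ∀ c, G.dropPath x₀ (G.capStack A r n γ) r x₀ c = (r x₀, fun _ => (x₀, n)) := by
    intro c
    have h0 : G.capStack A r n γ 0 = n := hst 0 ⟨0, by simp⟩
    rw [G.dropPath_of_no_drop x₀ (fun t _ => by rw [hst _ ⟨t, rfl⟩, h0]) c hr, h0]
  simp only [this, lintegral_const, measure_univ, mul_one]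

/-- Induction on a bound for the total stack, which bounds the number of drops. Either some adjacent
stack drops first, and the process restarts from the field, stacks and position after the drop, or
no drop is possible and the position must be `x₀`. -/
theorem capExp_dropExp_le_bwdInt (M : ℕ) {F : LifePath V E → ℝ≥0∞} (hF : ProcMeasurable fun _ => F)
    {r : V → ℝ} (hr : ∀ z, 0 < r z) {n : E → ℕ} (hn : ∑ e, n e ≤ M) {x : V}
    (hx : (G.openGraph {e | 0 < n e}).Reachable x₀ x) :
    capExp n (G.rateA A r) (G.dropExp x₀ A F r n x) ≤
      bwdInt x₀ M x (r x₀) (G.bwdVal x₀ A F r n) := by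
  induction M generalizing F r n x with
  | zero =>
    have hn0 : ∀ e, n e = 0 := by simpa using hn
    have hxx : x = x₀ := by
      by_contra hne
      obtain ⟨e, he, -⟩ := G.exists_incident_of_reachable x₀ hx hne
      simp [hn0 e] at he
    subst hxx
    rw [bwdInt, if_pos rfl]
    exact G.capExp_dropExp_of_no_drop x A hr fun e he => by simp [hn0 e] at he
  | succ M ih =>
    rw [bwdInt]
    set I : Finset E := univ.filter fun e => (G.Incident e x ∧ e ∈ A) ∧ 0 < n e with hI
    have hmI : ∀ {e}, e ∈ I ↔ (G.Incident e x ∧ e ∈ A) ∧ 0 < n e := by simp [hI]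
    rcases I.eq_empty_or_nonempty with hempty | hne
    -- An edge outside `A` has level 0, so requiring it to carry points makes the weight vanish.
    -- Otherwise no open edge touches `x`, which forces `x = x₀`.
    · by_cases hbad : ∃ e, 0 < n e ∧ e ∉ A
      · obtain ⟨e, he, heA⟩ := hbad
        refine le_trans (le_of_eq ?_) zero_le
        unfold capExp
        refine (lintegral_congr_ae (g := fun _ => 0) ?_).trans lintegral_zero
        filter_upwards [ae_goodSpacings] with γ hγ
        rw [Finset.prod_eq_zero (mem_univ e), mul_zero]
        have := psum_nonneg (hγ e).1 (n e)
        rw [capWeight, if_neg]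
        rw [rateA, if_neg heA]
        rintro (h | h)
        · omega
        · linarith
      · push Not at hbad
        have hnone : ∀ e, 0 < n e → ¬ G.Incident e x := by
          intro e he hi
          have : e ∈ I := hmI.2 ⟨⟨hi, hbad e he⟩, he⟩
          rw [hempty] at this
          simp at this
        have hxx : x = x₀ := by
          by_contra hne
          obtain ⟨e, he, hi⟩ := G.exists_incident_of_reachable x₀ hx hne
          exact hnone e he hi
        subst hxx
        rw [if_pos rfl]
        exact (G.capExp_dropExp_of_no_drop x A hr fun e he _ => hnone e he).trans le_self_add
    · refine le_trans ?_ le_add_self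
      refine (capExp_le_sum_lastFirst hne n
        (fun e he => G.rateA_pos A (hmI.1 he).1.2 hr) (G.measurable_dropExp x₀ A hF r n x)).trans ?_
      refine le_trans ?_ (sum_lintegral_le volume univ _)
      refine le_trans (sum_le_sum fun e he => ?_)
        (Finset.sum_le_sum_of_subset (Finset.subset_univ I))
      obtain ⟨⟨hinc, heA⟩, hne0⟩ := hmI.1 he
      obtain ⟨m, hm⟩ : ∃ m, n e = m + 1 := ⟨n e - 1, by omega⟩
      set c : E → ℝ := fun e => 2 * G.W e * √(2 * r (G.other e x)) with hc
      have hcpos : ∀ e, 0 < c e := fun e =>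
        mul_pos (mul_pos two_pos (G.W_pos e)) (sqrt_pos.2 (by linarith [hr (G.other e x)]))
      have hlev : ∀ e ∈ I, ∀ s, G.rateA A (r - Pi.single x s) e = c e * √(2 * (r x - s)) :=
        fun e he s => G.rateA_sub_single A (hmI.1 he).1.1 (hmI.1 he).1.2 s
      have hlevf : ∀ e ∈ I, (fun s => G.rateA A (r - Pi.single x s) e) =
          fun s => c e * √(2 * (r x - s)) := fun e he => funext (hlev e he)
      have hr0 : r - Pi.single x 0 = r := by simp
      have hpeel := capExp_lastFirst_le (A := fun e s => G.rateA A (r - Pi.single x s) e)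
        (A' := fun s => -(c e / √(2 * (r x - s)))) (I := I) (n := n) (b := r x) he hm
        (fun e => G.measurable_rateA A (measurable_pi_lambda _ fun z => by
          by_cases hz : z = x
          · subst hz; simp only [Pi.sub_apply, Pi.single_eq_same]; fun_prop
          · simp only [Pi.sub_apply, Pi.single_eq_of_ne hz]; fun_prop) e)
        (by fun_prop)
        (by simp only [hr0]; exact G.rateA_pos A heA hr)
        (fun s hs => by simp only [hlevf e he]; exact hasDerivAt_sqrtLevel hs.2)
        (by simp only [hlevf e he]; exact injOn_sqrtLevel (hcpos e))
        (by simp only [hlevf e he]; rw [hlev e he]; exact surjOn_sqrtLevel (hcpos e))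
        (fun e' he' s _ => by simp only [hlev e he, hlev e' he']; ring)
        (fun e' he' hn' s => by
          have : ¬ (G.Incident e' x ∧ e' ∈ A) := fun h => he' (hmI.2 ⟨h, Nat.pos_of_ne_zero hn'⟩)
          simp only [G.rateA_sub_single_of_not A this])
        (G.measurable_dropExp x₀ A hF r n x)
      simp only [hr0] at hpeel
      refine hpeel.trans (le_trans (lintegral_mono_ae ?_) (setLIntegral_le_lintegral (Ioo 0 (r x)) _))
      filter_upwards [ae_restrict_mem measurableSet_Ioo] with s hs
      set r' : V → ℝ := r - Pi.single x s with hr'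
      set n' := update n e m with hn'
      have hr'pos : ∀ z, 0 < r' z := sub_single_pos hr hs.2
      have hn'M : ∑ e, n' e ≤ M := by
        have h1 := Finset.add_sum_erase univ n (mem_univ e)
        have h2 := Finset.add_sum_erase univ n' (mem_univ e)
        have h3 : ∑ e' ∈ univ.erase e, n' e' = ∑ e' ∈ univ.erase e, n e' :=
          sum_congr rfl fun e' he' => update_of_ne (ne_of_mem_erase he') _ _
        have h4 : n' e = m := update_self _ _ _
        omega
      have hins : {e' | 0 < n e'} = insert e {e' | 0 < n' e'} := by
        ext e'
        by_cases h : e' = e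
        · subst h; simp [hm]
        · simp [h, hn']
      have hcap : capExp n' (G.rateA A r')
          (fun γ => G.dropExp x₀ A F r n x (setSpacing e m γ (G.rateA A r' e - psum (γ e) m))) ≤
          ∑ y, ofReal (G.moveProb x₀ {e' | 0 < n' e'} e x y) *
            capExp n' (G.rateA A r')
              (G.dropExp x₀ A (fun T => F (consPath s (x, n) T)) r' n' y) := by
        simp only [← capExp_const_mul n' (G.rateA A r') ofReal_ne_top]
        have hmy : ∀ y, Measurable fun γ => ofReal (G.moveProb x₀ {e' | 0 < n' e'} e x y) *
            G.dropExp x₀ A (fun T => F (consPath s (x, n) T)) r' n' y γ := fun y =>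
          (G.measurable_dropExp x₀ A (hF.comp_consPath s (x, n)) r' n' y).const_mul _
        rw [← capExp_sum _ _ _ hmy]
        unfold capExp
        refine lintegral_mono_ae ?_
        filter_upwards [ae_goodSpacings] with γ hγ
        by_cases hw : ∃ e, capWeight (n' e) (G.rateA A r' e) (γ e) = 0
        · obtain ⟨e, he⟩ := hw
          refine le_trans (le_of_eq ?_) zero_le
          exact mul_eq_zero_of_right _ (Finset.prod_eq_zero (mem_univ e) he)
        push Not at hw
        refine mul_le_mul_left (le_of_eq ?_) _
        exact LastDrop.dropExp x₀ (G := G) (A := A) ⟨hinc, heA, hr, hs, hm, fun e => (hγ e).1,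
          fun e' => by by_contra h; exact hw e' (if_neg h)⟩ hF
      refine (mul_le_mul_right (mul_le_mul_right hcap _) _).trans ?_
      rw [Finset.mul_sum, Finset.mul_sum]
      refine sum_le_sum fun y _ => ?_
      by_cases hy : G.moveProb x₀ {e' | 0 < n' e'} e x y = 0
      · simp [hy]
      have hreach : (G.openGraph {e' | 0 < n' e'}).Reachable x₀ y := by
        rw [hins] at hx
        have h1 := G.reachable_checkMove x₀ hinc hx
        by_cases h2 : G.checkMove x₀ x e {e' | 0 < n' e'} true = y
        · rw [← h2]; exact h1 true
        by_cases h3 : G.checkMove x₀ x e {e' | 0 < n' e'} false = y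
        · rw [← h3]; exact h1 false
        · simp [moveProb, h2, h3] at hy
      have hih := ih (hF.comp_consPath s (x, n)) hr'pos hn'M hreach
      have hru : r' x₀ = r x₀ - if x = x₀ then s else 0 := by
        rw [hr', Pi.sub_apply, Pi.single_apply]; simp only [eq_comm]
      rw [← hru, ← mul_assoc, ← mul_assoc, ← ofReal_mul (abs_nonneg _),
        ← ofReal_mul (by positivity)]
      refine (mul_le_mul_right hih _).trans ?_
      rw [← bwdInt_const_mul _ _ _ _ _ ofReal_ne_top]
      refine bwdInt_mono x₀ M y _ fun p hp _ _ => ?_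
      refine le_trans (le_of_eq ?_) (G.ofReal_mul_bwdVal_le x₀ A (r := r) hinc heA hm hs.1 F p)
      rw [hp]
      congr 2
      -- The speed at which the level decreases is the rate of the drop.
      have h1 : |(-(c e / √(2 * (r x - s))))| =
          2 * G.W e * √(r (G.other e x) / (r x - s)) := by
        rw [abs_neg, abs_of_nonneg (div_nonneg (hcpos e).le (sqrt_nonneg _)), hc]
        simp only
        rw [mul_div_assoc, ← Real.sqrt_div (by linarith [hr (G.other e x)]),
          mul_div_mul_left _ _ two_ne_zero]
      rw [h1]

end Network

section CutSet

/-- There are exactly `n` points in `[0, a)`. -/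
def cutSet (n : ℕ) (a : ℝ) : Set (ℕ → ℝ) :=
  {γ | (n = 0 ∨ psum γ n < a) ∧ a ≤ psum γ (n + 1)}

theorem measurableSet_cutSet (n : ℕ) (a : ℝ) : MeasurableSet (cutSet n a) :=
  ((MeasurableSet.const _).union (measurableSet_lt (measurable_psum n) measurable_const)).inter
    (measurableSet_le measurable_const (measurable_psum (n + 1)))

theorem mem_cutSet {γ : ℕ → ℝ} (hγ : GoodSpacing γ) (a : ℝ) : γ ∈ cutSet (countBefore γ a) a := by
  obtain ⟨m, h1, h2⟩ := hγ.exists_countBefore a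
  rw [countBefore_eq hγ.1 h1 h2]
  refine ⟨?_, by rwa [psum_succ_eq_point]⟩
  rcases m with _ | m
  exacts [Or.inl rfl, Or.inr (by rw [psum_succ_eq_point]; exact h1 m (Nat.lt_succ_self m))]

theorem lintegral_cutSet_update (n : ℕ) {a : ℝ} (ha : 0 ≤ a) (γ : ℕ → ℝ) :
    ∫⁻ τ, (cutSet n a).indicator 1 (update γ n τ) ∂(expMeasure 1) = capWeight n a γ := by
  have h1 : ∀ τ, (cutSet n a).indicator (1 : (ℕ → ℝ) → ℝ≥0∞) (update γ n τ) =
      if n = 0 ∨ psum γ n < a then (Set.Ici (a - psum γ n)).indicator 1 τ else 0 := by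
    intro τ
    simp only [indicator_apply, cutSet, mem_ofPred_eq, psum_succ, psum_update γ le_rfl,
      update_self, Set.mem_Ici, Pi.one_apply, sub_le_iff_le_add']
    by_cases h : n = 0 ∨ psum γ n < a <;> simp [h]
  simp only [h1, capWeight]
  by_cases h : n = 0 ∨ psum γ n < a
  · have h0 : 0 ≤ a - psum γ n := by
      rcases h with rfl | h
      · simpa using ha
      · linarith
    simp only [h, if_true]
    rw [lintegral_indicator_one measurableSet_Ici, ← Set.Ioi_union_left, measure_union (by simp)
      (measurableSet_singleton _), expMeasure_singleton, add_zero, expMeasure_Ioi one_pos h0, one_mul]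
  · simp [h]

variable {E : Type*} [Fintype E]

/-- The spacing of index `n e` only serves to carry the next point beyond the level, and `K` does
not depend on it. Integrating it out, one edge after the other, gives the weights. -/
theorem lintegral_cutSet_le (n : E → ℕ) {a : E → ℝ} (ha : ∀ e, 0 ≤ a e)
    {K : (E → ℕ → ℝ) → ℝ≥0∞} (hK : Measurable K)
    (hKe : ∀ e γ τ, K (setSpacing e (n e) γ τ) = K γ) :
    ∫⁻ γ, K γ * ∏ e, (cutSet (n e) (a e)).indicator 1 (γ e) ∂(poissonSpacings E) =
      capExp n a K := by
  set g : Finset E → E → (ℕ → ℝ) → ℝ≥0∞ := fun s e =>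
    if e ∈ s then capWeight (n e) (a e) else (cutSet (n e) (a e)).indicator 1 with hg
  have hgm : ∀ s e, Measurable (g s e) := by
    intro s e
    simp only [hg]
    split_ifs
    · exact Measurable.capWeight (n e) measurable_const measurable_id
    · exact measurable_one.indicator (measurableSet_cutSet _ _)
  have hgP : ∀ s, Measurable fun γ : E → ℕ → ℝ => K γ * ∏ e, g s e (γ e) := fun s =>
    hK.mul (Finset.measurable_prod _ fun e _ => (hgm s e).comp (measurable_pi_apply e))
  have key : ∀ s : Finset E, ∫⁻ γ, K γ * ∏ e, g ∅ e (γ e) ∂(poissonSpacings E) =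
      ∫⁻ γ, K γ * ∏ e, g s e (γ e) ∂(poissonSpacings E) := by
    intro s
    induction s using Finset.induction_on with
    | empty => rfl
    | insert e s he ih =>
      rw [ih, lintegral_setSpacing e (n e) (hgP s)]
      refine lintegral_congr fun γ => ?_
      simp only [hKe]
      have hprod : ∀ τ, ∏ e', g s e' (setSpacing e (n e) γ τ e') =
          (∏ e' ∈ univ.erase e, g (insert e s) e' (γ e')) *
            (cutSet (n e) (a e)).indicator 1 (update (γ e) (n e) τ) := by
        intro τ
        rw [← mul_prod_erase _ _ (mem_univ e), mul_comm, setSpacing_same]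
        congr 1
        · refine prod_congr rfl fun e' he' => ?_
          have := ne_of_mem_erase he'
          rw [setSpacing_of_ne this]
          simp [hg, this]
        · simp [hg, he]
      have hm : Measurable fun τ => (cutSet (n e) (a e)).indicator (1 : (ℕ → ℝ) → ℝ≥0∞)
          (update (γ e) (n e) τ) :=
        (measurable_one.indicator (measurableSet_cutSet _ _)).comp (measurable_update (γ e))
      simp only [hprod]
      rw [lintegral_const_mul _ (hm.const_mul _), lintegral_const_mul _ hm,
        lintegral_cutSet_update _ (ha e), ← mul_prod_erase univ
          (fun e' => g (insert e s) e' (γ e')) (mem_univ e)]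
      simp only [hg, Finset.mem_insert_self, if_true]
      ring
  have h := key univ
  simpa [hg, capExp] using h

end CutSet

namespace Network

universe v w

variable {V : Type v} {E : Type w} (G : Network V E) (x₀ : V)

/-- The edges at the ends of which the signs of the field agree. -/
def agree (φ : V → ℝ) : Set E := {e | fieldSign x₀ φ (G.fst e) * fieldSign x₀ φ (G.snd e) = 1}

theorem checkStack_eq_capStack {φ : V → ℝ} {γ : E → ℕ → ℝ} (hγ : ∀ e, GoodSpacing (γ e))
    {r : V → ℝ} (hr : ∀ x, r x = φ x ^ 2 / 2) {ℓ : V → ℝ} (hℓ : 0 ≤ ℓ) :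
    G.checkStack x₀ φ γ ℓ = G.capStack (G.agree x₀ φ) r
      (fun e => countBefore (γ e) (G.rateA (G.agree x₀ φ) r e)) γ ℓ := by
  have hP : checkPhi φ ℓ = fun x => √(2 * (r - ℓ) x) := by
    funext x
    rw [checkPhi, sq_abs, Pi.sub_apply, hr]
    congr 1
    ring
  funext e
  rw [capStack, ← countBefore_eq_capCount (hγ e) (G.rateA_mono _ (sub_le_self r hℓ) e), checkStack,
    rateA, hP]
  by_cases he : fieldSign x₀ φ (G.fst e) * fieldSign x₀ φ (G.snd e) = 1
  · rw [if_pos he, if_pos (show e ∈ G.agree x₀ φ from he)]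
    rfl
  · rw [if_neg he, if_neg (show e ∉ G.agree x₀ φ from he), countBefore_of_nonpos (hγ e).1 le_rfl]

variable [Fintype V] [Fintype E] [MeasurableSpace V] [MeasurableSingletonClass V]

theorem dropExp_setSpacing (A : Set E) (F : LifePath V E → ℝ≥0∞) (r : V → ℝ) (n : E → ℕ) (x : V)
    (e : E) (γ : E → ℕ → ℝ) (τ : ℝ) :
    G.dropExp x₀ A F r n x (setSpacing e (n e) γ τ) = G.dropExp x₀ A F r n x γ := by
  have : G.capStack A r n (setSpacing e (n e) γ τ) = G.capStack A r n γ := by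
    funext ℓ e'
    refine capCount_congr (fun k hk => ?_) _
    by_cases h : e' = e
    · subst h; rw [setSpacing_same, update_of_ne hk.ne]
    · rw [setSpacing_of_ne h]
  rw [dropExp, this, dropExp]

/-- The law of the self-interacting process is bounded from above by its density on skeletons. -/
theorem lintegral_checkStack_le {F : LifePath V E → ℝ≥0∞} (hF : ProcMeasurable fun _ => F)
    {φ r : V → ℝ} (hr : ∀ x, r x = φ x ^ 2 / 2) :
    ∫⁻ γ, ∫⁻ c, F (G.dropPath x₀ (G.checkStack x₀ φ γ) r x₀ c) ∂fairCoins ∂(poissonSpacings E) ≤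
      ∑' n, capExp n (G.rateA (G.agree x₀ φ) r) (G.dropExp x₀ (G.agree x₀ φ) F r n x₀) := by
  set A := G.agree x₀ φ
  have hD := fun n => G.measurable_dropExp x₀ A hF r n x₀
  have hI : ∀ n : E → ℕ, Measurable fun γ : E → ℕ → ℝ =>
      ∏ e, (cutSet (n e) (G.rateA A r e)).indicator (1 : (ℕ → ℝ) → ℝ≥0∞) (γ e) := fun n =>
    Finset.measurable_prod _ fun e _ =>
      (measurable_one.indicator (measurableSet_cutSet _ _)).comp (measurable_pi_apply e)
  have h1 : ∀ n, capExp n (G.rateA A r) (G.dropExp x₀ A F r n x₀) =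
      ∫⁻ γ, G.dropExp x₀ A F r n x₀ γ * ∏ e, (cutSet (n e) (G.rateA A r e)).indicator 1 (γ e)
        ∂(poissonSpacings E) := fun n =>
    (lintegral_cutSet_le n (G.rateA_nonneg A r) (hD n)
      (G.dropExp_setSpacing x₀ A F r n x₀)).symm
  simp only [h1]
  rw [← lintegral_tsum (f := fun n γ => G.dropExp x₀ A F r n x₀ γ *
    ∏ e, (cutSet (n e) (G.rateA A r e)).indicator 1 (γ e)) fun n => ((hD n).mul (hI n)).aemeasurable]
  refine lintegral_mono_ae ?_
  filter_upwards [ae_goodSpacings] with γ hγ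
  refine le_trans (le_of_eq ?_) (ENNReal.le_tsum fun e => countBefore (γ e) (G.rateA A r e))
  rw [Finset.prod_eq_one fun e _ => indicator_of_mem (mem_cutSet (hγ e) _) _, mul_one]
  unfold dropExp
  refine lintegral_congr fun c => ?_
  rw [G.dropPath_congr x₀ fun ℓ hℓ => G.checkStack_eq_capStack x₀ hγ hr hℓ]

end Network

/-! ### Measurability with respect to the skeleton -/

section SkeletonMeasurable

variable {V E : Type*} [Fintype V] [Fintype E] [MeasurableSpace V] [MeasurableSingletonClass V]
  [MeasurableSpace E] [MeasurableSingletonClass E]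

theorem measurable_headPos :
    Measurable fun p : (V × ℝ) × List (V × ℝ × E) => headPos p.2 p.1 := by
  refine measurable_list_rec (g := fun L q => headPos L q) ?_ fun m ih => ?_
  exacts [measurable_fst, measurable_fst.snd.fst]

theorem measurable_single_edge : Measurable fun e : E => (Pi.single e 1 : E → ℕ) := by
  refine measurable_pi_lambda _ fun e' => ?_
  simp only [Pi.single_apply]
  exact Measurable.ite (measurableSet_eq_fun measurable_const measurable_id) measurable_const
    measurable_const

theorem measurable_listCount : Measurable (listCount : List (V × ℝ × E) → E → ℕ) := by
  have := measurable_list_rec (α := V × ℝ × E) (Z := Unit) (g := fun L _ => listCount L)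
    measurable_const fun m ih => ?_
  · exact this.comp (measurable_const.prodMk measurable_id : Measurable fun L => ((), L))
  · simp only [listCount]
    exact (measurable_single_edge.comp measurable_fst.snd.snd.snd).add
      (ih.comp (measurable_fst.fst.prodMk measurable_snd))

theorem measurable_bwdPath_fst :
    Measurable fun p : ((E → ℕ) × (V × ℝ)) × List (V × ℝ × E) =>
      (bwdPath p.1.1 p.2 p.1.2).1 := by
  refine measurable_list_rec (g := fun L (z : (E → ℕ) × (V × ℝ)) => (bwdPath z.1 L z.2).1) ?_ fun m ih => ?_
  · exact measurable_snd.snd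
  · simp only [bwdPath, snocPath]
    have h : Measurable fun p : (((E → ℕ) × (V × ℝ)) × (V × ℝ × E)) × (Fin m → V × ℝ × E) =>
        p.1.1.1 + Pi.single p.1.2.2.2 1 :=
      measurable_fst.fst.fst.add (measurable_single_edge.comp measurable_fst.snd.snd.snd)
    exact (ih.comp ((h.prodMk measurable_fst.fst.snd).prodMk measurable_snd)).add
      measurable_fst.snd.snd.fst

theorem measurable_bwdPath_snd :
    Measurable fun p : (((E → ℕ) × (V × ℝ)) × ℝ) × List (V × ℝ × E) =>
      (bwdPath p.1.1.1 p.2 p.1.1.2).2 p.1.2 := by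
  refine measurable_list_rec (g := fun L (z : ((E → ℕ) × (V × ℝ)) × ℝ) =>
    (bwdPath z.1.1 L z.1.2).2 z.2) ?_ fun m ih => ?_
  · exact measurable_fst.snd.fst.prodMk measurable_fst.fst
  · simp only [bwdPath, snocPath]
    have h : Measurable fun p : ((((E → ℕ) × (V × ℝ)) × ℝ) × (V × ℝ × E)) ×
        (Fin m → V × ℝ × E) => p.1.1.1.1 + Pi.single p.1.2.2.2 1 :=
      measurable_fst.fst.fst.fst.add (measurable_single_edge.comp measurable_fst.snd.snd.snd)
    have h1 : Measurable fun p : ((((E → ℕ) × (V × ℝ)) × ℝ) × (V × ℝ × E)) ×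
        (Fin m → V × ℝ × E) => (bwdPath (p.1.1.1.1 + Pi.single p.1.2.2.2 1) (List.ofFn p.2)
          p.1.1.1.2).1 :=
      measurable_bwdPath_fst.comp ((h.prodMk measurable_fst.fst.fst.snd).prodMk
        ((measurable_ofFn m).comp measurable_snd))
    refine Measurable.ite (measurableSet_lt measurable_fst.fst.snd h1) ?_ ?_
    · exact ih.comp (((h.prodMk measurable_fst.fst.fst.snd).prodMk measurable_fst.fst.snd).prodMk
        measurable_snd)
    · exact measurable_fst.snd.fst.prodMk measurable_fst.fst.fst.fst

theorem measurableSet_isEvent :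
    MeasurableSet {p : ℝ × List (V × ℝ × E) | isEvent p.2 p.1} := by
  refine measurableSet_setOfPred.2 (measurable_list_rec (g := fun L t => isEvent L t) ?_ fun m ih => ?_)
  · exact measurable_const
  · simp only [isEvent]
    refine measurableSet_setOfPred.1 (MeasurableSet.union ?_ ?_)
    · exact measurableSet_eq_fun measurable_fst.fst measurable_fst.snd.snd.fst
    · exact measurableSet_setOfPred.2 (ih.comp
        ((measurable_fst.fst.sub measurable_fst.snd.snd.fst).prodMk measurable_snd))

namespace Network

variable (G : Network V E) (x₀ : V) (A : Set E)

theorem measurable_bwdProd :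
    Measurable fun p : ((V → ℝ) × (E → ℕ) × (V × ℝ)) × List (V × ℝ × E) =>
      G.bwdProd x₀ A p.1.1 p.1.2.1 p.2 p.1.2.2 := by
  refine measurable_list_rec (g := fun L (z : (V → ℝ) × (E → ℕ) × (V × ℝ)) =>
    G.bwdProd x₀ A z.1 z.2.1 L z.2.2) ?_ fun m ih => ?_
  · exact Measurable.ite (measurableSet_lt measurable_const measurable_snd.snd.snd)
      measurable_const measurable_const
  · simp only [bwdProd]
    have hrate : Measurable fun q : (V → ℝ) × (E → ℕ) × E × V × V =>
        G.bwdRate x₀ A q.2.1 q.1 q.2.2.1 q.2.2.2.1 q.2.2.2.2 := by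
      refine measurable_of_fibers (g := fun q : (V → ℝ) × (E → ℕ) × E × V × V => q.2)
        (f := fun d q => G.bwdRate x₀ A d.1 q.1 d.2.1 d.2.2.1 d.2.2.2)
        (fun d => measurable_snd (measurableSet_singleton d)) fun d => ?_
      unfold bwdRate
      split_ifs
      · have h1 : ∀ z : V, Measurable fun q : (V → ℝ) × (E → ℕ) × E × V × V => q.1 z :=
          fun z => (measurable_pi_apply z).comp measurable_fst
        exact Measurable.mul_const (measurable_const.mul ((h1 _).div (h1 _)).sqrt) _
      · exact measurable_const
    have hr : Measurable fun p : (((V → ℝ) × (E → ℕ) × (V × ℝ)) × (V × ℝ × E)) ×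
        (Fin m → V × ℝ × E) => p.1.1.1 + Pi.single p.1.2.1 p.1.2.2.1 := by
      refine measurable_pi_lambda _ fun z => ?_
      simp only [Pi.add_apply, Pi.single_apply]
      exact ((measurable_pi_apply z).comp measurable_fst.fst.fst).add (Measurable.ite
        (measurableSet_eq_fun measurable_const measurable_fst.snd.fst) measurable_fst.snd.snd.fst
          measurable_const)
    have hn : Measurable fun p : (((V → ℝ) × (E → ℕ) × (V × ℝ)) × (V × ℝ × E)) ×
        (Fin m → V × ℝ × E) => p.1.1.2.1 + Pi.single p.1.2.2.2 1 :=
      measurable_fst.fst.snd.fst.add (measurable_single_edge.comp measurable_fst.snd.snd.snd)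
    refine Measurable.mul (Measurable.ite (measurableSet_lt measurable_const
      measurable_fst.snd.snd.fst) measurable_const measurable_const) (Measurable.mul ?_ ?_)
    · exact hrate.comp (hr.prodMk (measurable_fst.fst.snd.fst.prodMk
        (measurable_fst.snd.snd.snd.prodMk (measurable_fst.snd.fst.prodMk
        (measurable_headPos.comp (measurable_fst.fst.snd.snd.prodMk
          ((measurable_ofFn m).comp measurable_snd)))))))
    · exact ih.comp ((hr.prodMk (hn.prodMk measurable_fst.fst.snd.snd)).prodMk measurable_snd)

end Network

end SkeletonMeasurable

/-! ### Finite sums over skeletons and negligible observation times -/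

section SkeletonSums

variable {V E : Type*} [Fintype V] [Fintype E]

theorem bwdInt_mono_left (x₀ : V) {M M' : ℕ} (h : M ≤ M') (x : V) (u : ℝ)
    (f : Skeleton V E → ℝ≥0∞) : bwdInt x₀ M x u f ≤ bwdInt x₀ M' x u f := by
  induction M generalizing x u f M' with
  | zero =>
    cases M' with
    | zero => exact le_rfl
    | succ M' => exact le_self_add
  | succ M ih =>
    obtain ⟨M', rfl⟩ : ∃ k, M' = k + 1 := ⟨M' - 1, by omega⟩
    exact add_le_add le_rfl (lintegral_mono fun s => sum_le_sum fun e _ =>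
      sum_le_sum fun y _ => ih (by omega) _ _ _)

theorem sum_bwdInt_le {ι : Type*} (t : Finset ι) (x₀ : V) (M : ℕ) (x : V) (u : ℝ)
    (f : ι → Skeleton V E → ℝ≥0∞) :
    ∑ i ∈ t, bwdInt x₀ M x u (f i) ≤ bwdInt x₀ M x u fun p => ∑ i ∈ t, f i p := by
  induction M generalizing x u f with
  | zero =>
    simp only [bwdInt]
    split_ifs <;> simp
  | succ M ih =>
    simp only [bwdInt, sum_add_distrib]
    refine add_le_add (by split_ifs <;> simp) ((sum_lintegral_le _ _ _).trans
      (lintegral_mono fun s => ?_))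
    rw [sum_comm]
    refine sum_le_sum fun e _ => ?_
    rw [sum_comm]
    exact sum_le_sum fun y _ => ih _ _ _

variable [MeasurableSpace V] [MeasurableSingletonClass V]
  [MeasurableSpace E] [MeasurableSingletonClass E]

theorem measurable_bwdInt (x₀ : V) (M : ℕ) (u : ℝ) {f : (V → ℝ) × Skeleton V E → ℝ≥0∞}
    (hf : Measurable f) :
    Measurable fun r : V → ℝ => bwdInt x₀ M x₀ u fun p => f (r, p) := by
  have eB : ∀ r : V → ℝ, bwdInt x₀ M x₀ u (fun p => f (r, p)) = _ := fun r =>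
    bwdInt_eq x₀ M x₀ u (hf.comp (measurable_const.prodMk measurable_id))
  simp only [eB, if_true]
  refine Measurable.add (hf.comp (measurable_id.prodMk measurable_const))
    (Finset.measurable_sum _ fun k _ => ?_)
  have h1 : Measurable fun q : ((V → ℝ) × ℝ) × E × List (V × ℝ × E) =>
      f (q.1.1, skelOfLast x₀ x₀ u q.1.2 q.2) :=
    hf.comp (measurable_fst.fst.prodMk ((measurable_skelOfLast x₀ x₀ u).comp
      (measurable_fst.snd.prodMk measurable_snd)))
  have h2 : Measurable fun q : (V → ℝ) × ℝ => ∫⁻ p, f (q.1, skelOfLast x₀ x₀ u q.2 p)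
      ∂midMeasure V E k := h1.lintegral_prod_right'
  exact h2.lintegral_prod_right'

/-- The skeletons with an event at a given time are negligible. -/
theorem fwdInt_sum_le {ι : Type*} (t : Finset ι) (I : Finset ℝ≥0) (x₀ : V) (M : ℕ) (x : V) (u : ℝ)
    {f : ι → Skeleton V E → ℝ≥0∞} (hf : ∀ i, Measurable (f i)) :
    fwdInt x₀ M x u (fun p => ∑ i ∈ t, f i p) ≤ ∑ i ∈ t, fwdInt x₀ M x u
      (fun p => if ∃ a ∈ I, isEvent p.1 (a : ℝ) then 0 else f i p) := by
  have hE : MeasurableSet {p : Skeleton V E | ∃ a ∈ I, isEvent p.1 (a : ℝ)} := by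
    have : {p : Skeleton V E | ∃ a ∈ I, isEvent p.1 (a : ℝ)} =
        ⋃ a ∈ I, {p | isEvent p.1 (a : ℝ)} := by ext; simp
    rw [this]
    exact Finset.measurableSet_biUnion _ fun a _ => measurableSet_isEvent.preimage
      (measurable_const.prodMk measurable_fst)
  have hf' : ∀ i, Measurable fun p => if ∃ a ∈ I, isEvent p.1 (a : ℝ) then 0 else f i p :=
    fun i => Measurable.ite hE measurable_const (hf i)
  have hsum : Measurable fun p => ∑ i ∈ t, f i p := Finset.measurable_sum _ fun i _ => hf i
  rw [fwdInt_eq x₀ M x u hsum]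
  simp only [fun i => fwdInt_eq x₀ M x u (hf' i), sum_add_distrib]
  refine add_le_add ?_ ?_
  · have h0 : ¬ ∃ a ∈ I, isEvent ([] : List (V × ℝ × E)) (a : ℝ) := by
      rintro ⟨a, -, ha⟩; exact ha
    simp only [h0, if_false]
    split_ifs; exacts [le_rfl, zero_le]
  rw [sum_comm]
  refine sum_le_sum fun k _ => ?_
  have hg : ∀ {g : Skeleton V E → ℝ≥0∞}, Measurable g →
      Measurable fun q : ℝ × E × List (V × ℝ × E) => g (skelOfFirst x₀ x u q.1 q.2) := fun hg =>
    hg.comp (measurable_skelOfFirst x₀ x u)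
  have hswap : ∀ {g : Skeleton V E → ℝ≥0∞}, Measurable g →
      ∫⁻ s : ℝ, ∫⁻ p, g (skelOfFirst x₀ x u s p) ∂midMeasure V E k =
        ∫⁻ p, (∫⁻ s : ℝ, g (skelOfFirst x₀ x u s p)) ∂midMeasure V E k := fun h =>
    lintegral_lintegral_swap (hg h).aemeasurable
  simp only [hswap hsum, fun i => hswap (hf' i)]
  have hm1 : ∀ i, Measurable fun p => ∫⁻ s : ℝ, (if ∃ a ∈ I,
      isEvent (skelOfFirst x₀ x u s p).1 (a : ℝ) then 0 else f i (skelOfFirst x₀ x u s p)) :=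
    fun i => (hg (hf' i)).lintegral_prod_left'
  rw [← lintegral_finsetSum _ fun i _ => hm1 i]
  refine lintegral_mono fun p => ?_
  have hm2 : ∀ i, Measurable fun s : ℝ => (if ∃ a ∈ I,
      isEvent (skelOfFirst x₀ x u s p).1 (a : ℝ) then 0 else f i (skelOfFirst x₀ x u s p)) :=
    fun i => (hg (hf' i)).comp (measurable_id.prodMk measurable_const)
  rw [← lintegral_finsetSum _ fun i _ => hm2 i]
  refine (lintegral_congr_ae ?_).le
  have hfin : {s : ℝ | ∃ a ∈ I, isEvent (skelOfFirst x₀ x u s p).1 (a : ℝ)}.Finite := by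
    have : {s : ℝ | ∃ a ∈ I, isEvent (skelOfFirst x₀ x u s p).1 (a : ℝ)} =
        ⋃ a ∈ I, {s | isEvent (skelOfFirst x₀ x u s p).1 (a : ℝ)} := by ext; simp
    rw [this]
    exact Set.Finite.biUnion I.finite_toSet fun a _ => countable_isEvent (x, p.1) p.2 a
  filter_upwards [hfin.countable.ae_notMem volume] with s hs
  exact sum_congr rfl fun i _ => (if_neg hs).symm

end SkeletonSums

/-! ### From a field to its halved square and its signs -/

section SquareRoots

theorem lintegral_fin_prod {n : ℕ} {f : Fin n → ℝ → ℝ≥0∞} (hf : ∀ i, Measurable (f i)) :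
    ∫⁻ x : Fin n → ℝ, ∏ i, f i (x i) = ∏ i, ∫⁻ t, f i t := by
  induction n with
  | zero => simp [volume_pi]
  | succ n ih =>
    have hm : Measurable fun x : Fin (n + 1) → ℝ => ∏ i, f i (x i) :=
      Finset.measurable_prod _ fun i _ => (hf i).comp (measurable_pi_apply i)
    rw [volume_pi, ← ((measurePreserving_piFinSuccAbove (fun _ : Fin (n + 1) =>
      (volume : Measure ℝ)) 0).symm).lintegral_comp hm]
    simp only [MeasurableEquiv.piFinSuccAbove_symm_apply, Fin.prod_univ_succ]
    rw [← ih fun i => hf _]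
    exact lintegral_prod_mul (μ := (volume : Measure ℝ)) (ν := Measure.pi fun _ : Fin n => volume)
      (f := f 0) (g := fun x : Fin n → ℝ => ∏ i, f i.succ (x i))
      (hf 0).aemeasurable (Finset.measurable_prod _ fun i _ =>
        (hf i.succ).comp (measurable_pi_apply i)).aemeasurable

variable {ι : Type*} [Fintype ι]

/-- Tonelli's theorem for a product of functions of the coordinates. -/
theorem lintegral_fintype_prod {f : ι → ℝ → ℝ≥0∞} (hf : ∀ i, Measurable (f i)) :
    ∫⁻ x : ι → ℝ, ∏ i, f i (x i) = ∏ i, ∫⁻ t, f i t := by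
  let e := (Fintype.equivFin ι).symm
  have hm : Measurable fun x : ι → ℝ => ∏ i, f i (x i) :=
    Finset.measurable_prod _ fun i _ => (hf i).comp (measurable_pi_apply i)
  rw [volume_pi, ← (measurePreserving_piCongrLeft (fun _ : ι => (volume : Measure ℝ)) e).lintegral_comp
    hm]
  simp_rw [← e.prod_comp, MeasurableEquiv.coe_piCongrLeft, Equiv.piCongrLeft_apply_apply]
  exact lintegral_fin_prod fun i => hf _

/-- The density of the halved square of a real variable of a given sign. -/
def sqrtDens (r : ℝ) : ℝ≥0∞ := if 0 < r then ofReal (1 / √(2 * r)) else 0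

theorem measurable_sqrtDens : Measurable sqrtDens :=
  Measurable.ite (measurableSet_lt measurable_const measurable_id)
    ((measurable_const.div (measurable_id.const_mul 2).sqrt).ennreal_ofReal) measurable_const

theorem lintegral_sqrtDens_mul (g : ℝ → ℝ≥0∞) :
    ∫⁻ r, sqrtDens r * g (√(2 * r)) = ∫⁻ t in Ioi 0, g t := by
  have h1 : (fun t : ℝ => t ^ 2 / 2) '' Ioi 0 = Ioi 0 := by
    ext r
    constructor
    · rintro ⟨t, ht, rfl⟩
      have : 0 < t := ht
      exact Set.mem_Ioi.2 (by positivity)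
    · intro hr
      have hr' : (0 : ℝ) < r := hr
      refine ⟨√(2 * r), sqrt_pos.2 (by linarith), ?_⟩
      simp only
      rw [sq_sqrt (by linarith)]
      ring
  have h2 : ∫⁻ r, sqrtDens r * g (√(2 * r)) =
      ∫⁻ r in Ioi 0, ofReal (1 / √(2 * r)) * g (√(2 * r)) := by
    rw [← lintegral_indicator measurableSet_Ioi]
    refine lintegral_congr fun r => ?_
    by_cases hr : 0 < r <;> simp [sqrtDens, Set.indicator, hr]
  rw [h2]
  nth_rewrite 1 [← h1]
  rw [lintegral_image_eq_lintegral_abs_deriv_mul (f' := fun t => t) measurableSet_Ioi]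
  · refine setLIntegral_congr_fun measurableSet_Ioi fun t ht => ?_
    have ht' : 0 < t := ht
    have h3 : √(2 * (t ^ 2 / 2)) = t := by
      rw [mul_div_cancel₀ _ two_ne_zero, Real.sqrt_sq ht'.le]
    simp only [h3, abs_of_pos ht']
    rw [← mul_assoc, ← ofReal_mul ht'.le, mul_one_div_cancel ht'.ne', ENNReal.ofReal_one,
      one_mul]
  · intro t _
    have := ((hasDerivAt_pow 2 t).div_const 2).hasDerivWithinAt (s := Ioi 0)
    simpa using this
  · intro s hs t ht h
    have hs' : 0 < s := hs
    have ht' : 0 < t := ht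
    have h' : s ^ 2 / 2 = t ^ 2 / 2 := h
    nlinarith

theorem sum_lintegral_sqrtDens_mul {g : ℝ → ℝ≥0∞} (hg : Measurable g) :
    ∑ s : ℤˣ, ∫⁻ r, sqrtDens r * g (((s : ℤ) : ℝ) * √(2 * r)) = ∫⁻ t, g t := by
  have h : (univ : Finset ℤˣ) = {1, -1} := by decide
  rw [h, Finset.sum_pair (by decide)]
  simp only [lintegral_sqrtDens_mul fun t => g (((1 : ℤˣ) : ℤ) * t),
    lintegral_sqrtDens_mul fun t => g (((-1 : ℤˣ) : ℤ) * t)]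
  simp only [Units.val_one, Int.cast_one, one_mul, Units.val_neg, Int.cast_neg, neg_mul]
  have hIoi : MeasurableSet (Ioi (0 : ℝ)) := measurableSet_Ioi
  rw [← lintegral_add_compl (μ := volume) g hIoi, Set.compl_Ioi]
  congr 1
  have hIio : MeasurableSet (Set.Iio (0 : ℝ)) := measurableSet_Iio
  have := (Measure.measurePreserving_neg (volume : Measure ℝ)).setLIntegral_comp_preimage hIio hg
  simp only [Set.neg_preimage, Set.neg_Iio, neg_zero] at this
  rw [this]
  exact setLIntegral_congr (Iio_ae_eq_Iic (μ := (volume : Measure ℝ)) (a := 0))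

/-- In each coordinate, substitute t = ±√(2r), so that |dt| = dr/√(2r); the value 0 is negligible.
Expanding the product over coordinates yields the sum over signs. -/
theorem volume_eq_sum_map_sqrt [DecidableEq ι] : (volume : Measure (ι → ℝ)) = ∑ s : ι → ℤˣ,
    ((volume : Measure (ι → ℝ)).withDensity fun r => ∏ i, sqrtDens (r i)).map
      fun r i => ((s i : ℤ) : ℝ) * √(2 * r i) := by
  have hK : ∀ s : ι → ℤˣ, Measurable fun (r : ι → ℝ) i => ((s i : ℤ) : ℝ) * √(2 * r i) := fun s =>
    measurable_pi_lambda _ fun i => (((measurable_pi_apply i).const_mul 2).sqrt).const_mul _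
  rw [volume_pi]
  refine Measure.pi_eq fun B hB => ?_
  rw [← volume_pi, Measure.finsetSum_apply]
  have e : ∀ s : ι → ℤˣ, (((volume : Measure (ι → ℝ)).withDensity fun r =>
      ∏ i, sqrtDens (r i)).map fun r i => ((s i : ℤ) : ℝ) * √(2 * r i)) (Set.univ.pi B) =
      ∏ i, ∫⁻ t, sqrtDens t * (B i).indicator 1 (((s i : ℤ) : ℝ) * √(2 * t)) := by
    intro s
    rw [Measure.map_apply (hK s) (MeasurableSet.univ_pi hB),
      withDensity_apply _ ((hK s) (MeasurableSet.univ_pi hB)), ← lintegral_indicator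
      ((hK s) (MeasurableSet.univ_pi hB)), ← lintegral_fintype_prod]
    · refine lintegral_congr fun r => ?_
      by_cases h : ∀ i, ((s i : ℤ) : ℝ) * √(2 * r i) ∈ B i
      · rw [indicator_of_mem (by simpa using h)]
        exact prod_congr rfl fun i _ => by rw [indicator_of_mem (h i)]; simp
      · rw [indicator_of_notMem (by simpa using h)]
        obtain ⟨i, hi⟩ := not_forall.1 h
        exact (Finset.prod_eq_zero (mem_univ i)
          (by rw [indicator_of_notMem hi, mul_zero])).symm
    · exact fun i => measurable_sqrtDens.mul ((measurable_one.indicator (hB i)).comp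
        ((measurable_id.const_mul 2).sqrt.const_mul _))
  simp only [e]
  rw [← Fintype.piFinset_univ, ← Finset.prod_univ_sum (fun _ : ι => (univ : Finset ℤˣ))
    fun i s => ∫⁻ t, sqrtDens t * (B i).indicator 1 (((s : ℤ) : ℝ) * √(2 * t))]
  refine prod_congr rfl fun i _ => ?_
  rw [sum_lintegral_sqrtDens_mul (measurable_one.indicator (hB i)), lintegral_indicator_one (hB i)]

theorem measurable_prod_sqrtDens : Measurable fun r : ι → ℝ => ∏ i, sqrtDens (r i) :=
  Finset.measurable_prod _ fun i _ => measurable_sqrtDens.comp (measurable_pi_apply i)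

theorem measurable_signs_mul_sqrt (s : ι → ℤˣ) :
    Measurable fun (r : ι → ℝ) i => ((s i : ℤ) : ℝ) * √(2 * r i) :=
  measurable_pi_lambda _ fun i => (((measurable_pi_apply i).const_mul 2).sqrt).const_mul _

/-- The inequality holds without measurability of `g`. It is applied to means of the
self-interacting process before their measurability in the field is known. -/
theorem lintegral_le_lintegral_sqrtDens [DecidableEq ι] (g : (ι → ℝ) → ℝ≥0∞) :
    ∫⁻ f, g f ≤ ∫⁻ r : ι → ℝ, ∑ s : ι → ℤˣ, (∏ i, sqrtDens (r i)) *
      g fun i => ((s i : ℤ) : ℝ) * √(2 * r i) := by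
  refine le_trans ?_ (sum_lintegral_le _ _ _)
  nth_rewrite 1 [volume_eq_sum_map_sqrt]
  rw [lintegral_finsetSum_measure]
  exact sum_le_sum fun s _ => (lintegral_map_le _ _).trans
    (lintegral_withDensity_le_lintegral_mul _ measurable_prod_sqrtDens _)

theorem lintegral_eq_lintegral_sqrtDens [DecidableEq ι] {g : (ι → ℝ) → ℝ≥0∞} (hg : Measurable g) :
    ∫⁻ f, g f = ∫⁻ r : ι → ℝ, ∑ s : ι → ℤˣ, (∏ i, sqrtDens (r i)) *
      g fun i => ((s i : ℤ) : ℝ) * √(2 * r i) := by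
  have hm : ∀ s : ι → ℤˣ, Measurable fun r : ι → ℝ => (∏ i, sqrtDens (r i)) *
      g fun i => ((s i : ℤ) : ℝ) * √(2 * r i) := fun s =>
    measurable_prod_sqrtDens.mul (hg.comp (measurable_signs_mul_sqrt s))
  rw [lintegral_finsetSum _ fun s _ => hm s]
  nth_rewrite 1 [volume_eq_sum_map_sqrt]
  rw [lintegral_finsetSum_measure]
  refine sum_congr rfl fun s _ => ?_
  rw [lintegral_map hg (measurable_signs_mul_sqrt s)]
  exact lintegral_withDensity_eq_lintegral_mul _ measurable_prod_sqrtDens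
    (hg.comp (measurable_signs_mul_sqrt s))

end SquareRoots

section Signs

variable {V : Type*} [Fintype V] (x₀ : V)

/-- The assignments of signs which are equal to `1` at `x₀`. -/
def pinnedSigns : Finset (V → ℤˣ) := univ.filter fun σ => σ x₀ = 1

/-- The field with a given halved square and given signs. -/
def signField (σ : V → ℤˣ) (r : V → ℝ) (z : V) : ℝ := ((σ z : ℤ) : ℝ) * √(2 * r z)

/-- The density of the halved squared field. -/
def fieldDens (r : V → ℝ) : ℝ≥0∞ := ∏ z ∈ univ.erase x₀, sqrtDens (r z)

theorem measurable_signField (σ : V → ℤˣ) : Measurable (signField σ) :=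
  measurable_pi_lambda _ fun z => (((measurable_pi_apply z).const_mul 2).sqrt).const_mul _

theorem measurable_fieldDens : Measurable (fieldDens x₀) :=
  Finset.measurable_prod _ fun z _ => measurable_sqrtDens.comp (measurable_pi_apply z)

theorem fieldDens_eq {r : V → ℝ} (hr : ∀ z, z ≠ x₀ → 0 < r z) :
    fieldDens x₀ r = ofReal ((1 / √2) ^ (univ.erase x₀).card / Network.prodOff r x₀) := by
  rw [fieldDens, Network.prodOff, ← Finset.prod_const, ← Finset.prod_div_distrib,
    ofReal_prod_of_nonneg fun z _ => by positivity]
  refine prod_congr rfl fun z hz => ?_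
  have h := hr z (ne_of_mem_erase hz)
  rw [sqrtDens, if_pos h, Real.sqrt_mul (by norm_num), div_div]

theorem fieldDens_eq_zero {r : V → ℝ} (hr : ¬ ∀ z, z ≠ x₀ → 0 < r z) : fieldDens x₀ r = 0 := by
  push Not at hr
  obtain ⟨z, hz, h⟩ := hr
  exact Finset.prod_eq_zero (Finset.mem_erase.2 ⟨hz, mem_univ z⟩) (if_neg h.not_gt)

theorem sum_signs_extendAt (a : ℝ) (r : Off x₀) (g : (V → ℝ) → ℝ≥0∞) :
    ∑ s : {x : V // x ≠ x₀} → ℤˣ, (∏ i, sqrtDens (r i)) *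
        g (extendAt x₀ √(2 * a) fun i => ((s i : ℤ) : ℝ) * √(2 * r i)) =
      ∑ σ ∈ pinnedSigns x₀, fieldDens x₀ (extendAt x₀ a r) *
        g (signField σ (extendAt x₀ a r)) := by
  have hd : ∏ i, sqrtDens (r i) = fieldDens x₀ (extendAt x₀ a r) := by
    rw [fieldDens, Finset.prod_subtype (p := fun x => x ≠ x₀) (F := inferInstance)
      (univ.erase x₀) (by simp) fun z => sqrtDens (extendAt x₀ a r z)]
    refine prod_congr (by congr!) fun i _ => ?_
    simp [extendAt, i.2]
  rw [hd]
  refine (Finset.sum_bij (fun σ _ (i : {x : V // x ≠ x₀}) => σ i) (fun σ _ => mem_univ _)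
    ?_ ?_ ?_).symm
  · intro σ hσ σ' hσ' h
    funext z
    by_cases hz : z = x₀
    · rw [hz, (mem_filter.1 hσ).2, (mem_filter.1 hσ').2]
    · exact congrFun h ⟨z, hz⟩
  · intro s _
    refine ⟨fun z => if h : z = x₀ then 1 else s ⟨z, h⟩, by simp [pinnedSigns], ?_⟩
    funext i
    simp [i.2]
  · intro σ hσ
    congr 2
    funext z
    by_cases hz : z = x₀
    · subst hz
      simp [signField, extendAt, (mem_filter.1 hσ).2]
    · simp [signField, extendAt, hz]

theorem lintegral_extendAt_le (a : ℝ) (g : (V → ℝ) → ℝ≥0∞) :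
    ∫⁻ f : Off x₀, g (extendAt x₀ √(2 * a) f) ≤
      ∫⁻ r : Off x₀, ∑ σ ∈ pinnedSigns x₀, fieldDens x₀ (extendAt x₀ a r) *
        g (signField σ (extendAt x₀ a r)) := by
  simp only [← sum_signs_extendAt]
  exact lintegral_le_lintegral_sqrtDens _

theorem lintegral_extendAt [MeasurableSpace V] [MeasurableSingletonClass V] (a : ℝ)
    {g : (V → ℝ) → ℝ≥0∞} (hg : Measurable g) :
    ∫⁻ f : Off x₀, g (extendAt x₀ √(2 * a) f) =
      ∫⁻ r : Off x₀, ∑ σ ∈ pinnedSigns x₀, fieldDens x₀ (extendAt x₀ a r) *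
        g (signField σ (extendAt x₀ a r)) := by
  simp only [← sum_signs_extendAt]
  have hg' : Measurable fun f : Off x₀ => g (extendAt x₀ √(2 * a) f) :=
    hg.comp (measurable_extendAt x₀ _)
  exact lintegral_eq_lintegral_sqrtDens hg'

end Signs

namespace Network

universe v w

variable {V : Type v} {E : Type w} (G : Network V E) (x₀ : V)

/-! ### Energy, levels and signs -/

section Energy

/-- The edges at the ends of which the signs agree. -/
def agreeSigns (σ : V → ℤˣ) : Set E := {e | σ (G.fst e) = σ (G.snd e)}

variable [Fintype V] [Fintype E]

theorem agree_signField {σ : V → ℤˣ} (hσ : σ x₀ = 1) {r : V → ℝ} (hr : ∀ z, z ≠ x₀ → 0 < r z) :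
    G.agree x₀ (signField σ r) = G.agreeSigns σ := by
  have key : ∀ z, fieldSign x₀ (signField σ r) z = if σ z = 1 then 1 else -1 := by
    intro z
    unfold fieldSign signField
    split_ifs with hz hs hs
    · rfl
    · exact absurd (hz ▸ hσ) hs
    · have := sqrt_pos.2 (by linarith [hr z hz] : 0 < 2 * r z)
      rw [hs]
      exact sign_pos (by simpa using this)
    · have := sqrt_pos.2 (by linarith [hr z hz] : 0 < 2 * r z)
      rw [(Int.units_eq_one_or (σ z)).resolve_left hs]
      exact sign_neg (by simpa using this)
  ext e
  simp only [agree, agreeSigns, mem_ofPred_eq, key]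
  rcases Int.units_eq_one_or (σ (G.fst e)) with h1 | h1 <;>
    rcases Int.units_eq_one_or (σ (G.snd e)) with h2 | h2 <;> simp [h1, h2]

/-- Edge by edge, with a and b the absolute values at the ends: ½W(a - b)² + 2Wab when the signs
agree, and ½W(a + b)² when they do not, are both equal to ½W(a² + b²) + Wab. Hence the Gaussian
density times the Poisson normalization does not depend on the signs. -/
theorem energy_signField (σ : V → ℤˣ) {r : V → ℝ} (hr : ∀ z, 0 ≤ r z) :
    1 / 2 * G.energy (signField σ r) + ∑ e, G.rateA (G.agreeSigns σ) r e = G.hamil r := by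
  have h1 : ∑ x, (∑ e, if G.Incident e x then G.W e else 0) * r x =
      ∑ e, G.W e * (r (G.fst e) + r (G.snd e)) := by
    simp only [Finset.sum_mul]
    rw [sum_comm]
    refine sum_congr rfl fun e _ => ?_
    have : ∀ x, (if G.Incident e x then G.W e else 0) * r x =
        (if G.fst e = x then G.W e * r x else 0) + if G.snd e = x then G.W e * r x else 0 := by
      intro x
      by_cases h1 : G.fst e = x <;> by_cases h2 : G.snd e = x
      · exact absurd (h1.trans h2.symm) (G.ne e)
      all_goals simp [Incident, h1, h2]
    simp only [this, sum_add_distrib, Finset.sum_ite_eq, mem_univ, if_true]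
    ring
  rw [hamil, h1, energy, Finset.mul_sum, ← sum_add_distrib, ← sum_add_distrib]
  refine sum_congr rfl fun e _ => ?_
  have ha := sq_sqrt (by linarith [hr (G.fst e)] : 0 ≤ 2 * r (G.fst e))
  have hb := sq_sqrt (by linarith [hr (G.snd e)] : 0 ≤ 2 * r (G.snd e))
  simp only [rateA, agreeSigns, mem_ofPred_eq, rateJ, J, signField]
  set a := √(2 * r (G.fst e))
  set b := √(2 * r (G.snd e))
  rcases Int.units_eq_one_or (σ (G.fst e)) with h1 | h1 <;>
    rcases Int.units_eq_one_or (σ (G.snd e)) with h2 | h2 <;> simp only [h1, h2]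
  · simp
    linear_combination (G.W e / 2) * ha + (G.W e / 2) * hb
  · rw [if_neg (by decide)]
    simp
    linear_combination (G.W e / 2) * ha + (G.W e / 2) * hb
  · rw [if_neg (by decide)]
    simp
    linear_combination (G.W e / 2) * ha + (G.W e / 2) * hb
  · simp
    linear_combination (G.W e / 2) * ha + (G.W e / 2) * hb

theorem signField_sq_half {σ : V → ℤˣ} {r : V → ℝ} (hr : ∀ z, 0 ≤ r z) (z : V) :
    signField σ r z ^ 2 / 2 = r z := by
  rw [signField, mul_pow, sq_sqrt (by linarith [hr z])]
  rcases Int.units_eq_one_or (σ z) with h | h <;> simp [h]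

theorem clusterSignLaw_singleton [Nonempty V] (C : Set E) (σ : V → ℤˣ) :
    G.clusterSignLaw x₀ C {σ} =
      if σ ∈ G.clusterSigns x₀ C then ofReal (1 / (G.clusterSigns x₀ C).ncard) else 0 := by
  have hpos : 0 < (G.clusterSigns x₀ C).ncard :=
    (Set.ncard_pos (Set.toFinite _)).2 ⟨_, G.one_mem_clusterSigns x₀ C⟩
  have h1 : G.clusterSignLaw x₀ C = uniformOn (G.clusterSigns x₀ C) := rfl
  rw [h1, uniformOn, cond_apply (Set.toFinite _).measurableSet,
    Measure.count_apply_finite _ (Set.toFinite _), ← Set.ncard_eq_toFinset_card,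
    one_div, ENNReal.ofReal_inv_of_pos (by exact_mod_cast hpos), ENNReal.ofReal_natCast]
  split_ifs with h
  · rw [Set.inter_eq_right.2 (Set.singleton_subset_iff.2 h), Measure.count_singleton, mul_one]
  · rw [Set.inter_singleton_eq_empty.2 h]
    simp

end Energy

section Observables

variable {I : Finset ℝ≥0} (f : (V → ℝ) × ℝ × (I → V × (E → ℕ)) → ℝ≥0∞)

/-- A function of the field, of the lifetime and of finitely many values of the reversed path. -/
def revObs (φ : V → ℝ) (T : LifePath V E) : ℝ≥0∞ :=
  f (φ, T.1, fun t => T.2 (T.1 - min ((t : ℝ≥0) : ℝ) T.1))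

variable [Fintype V] [Fintype E]

/-- The mean of a function of the field, of the lifetime and of finitely many values of the path,
when the signs of the field are chosen from the last value of the path. -/
def fwdObs (r : V → ℝ) (T : LifePath V E) : ℝ≥0∞ :=
  ∑ σ : V → ℤˣ, G.clusterSignLaw x₀ {e | 0 < (T.2 T.1).2 e} {σ} *
    f (signField σ r, T.1, fun t => T.2 (min ((t : ℝ≥0) : ℝ) T.1))

theorem isLocal_fwdObs : IsLocal (G.fwdObs x₀ f) := by
  intro a T T' h1 h2
  have h3 : ∀ t : I, T.2 (min ((t : ℝ≥0) : ℝ) T.1) = T'.2 (min ((t : ℝ≥0) : ℝ) T.1) := fun t =>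
    h2 _ (min_le_right _ _)
  simp only [fwdObs, ← h1, h3, h2 T.1 le_rfl]

variable [MeasurableSpace V] [MeasurableSingletonClass V]

variable {f}

theorem procMeasurable_revObs (hf : Measurable f) (φ : V → ℝ) :
    ProcMeasurable fun _ : V → ℝ => revObs f φ := by
  intro Z _ a T ha h1 h2
  refine hf.comp (measurable_const.prodMk (h1.prodMk (measurable_pi_lambda _ fun t => ?_)))
  exact h2.comp (measurable_id.prodMk (h1.sub (measurable_const.min h1)))

theorem procMeasurable_fwdObs (hf : Measurable f) : ProcMeasurable (G.fwdObs x₀ f) := by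
  intro Z _ a T ha h1 h2
  refine Finset.measurable_sum _ fun σ _ => Measurable.mul ?_ ?_
  · have h3 : Measurable fun z => ((T z).2 (T z).1).2 := (h2.comp (measurable_id.prodMk h1)).snd
    exact (measurable_of_countable fun n : E → ℕ => G.clusterSignLaw x₀ {e | 0 < n e} {σ}).comp h3
  · refine hf.comp (((measurable_signField σ).comp ha).prodMk (h1.prodMk
      (measurable_pi_lambda _ fun t => ?_)))
    exact h2.comp (measurable_id.prodMk (measurable_const.min h1))

end Observables

/-! ### Comparison of the two densities of a skeleton -/

section Matching

variable [Fintype V] [Fintype E] [MeasurableSpace V] [MeasurableSingletonClass V] {I : Finset ℝ≥0}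
  (f : (V → ℝ) × ℝ × (I → V × (E → ℕ)) → ℝ≥0∞)

/-- The density of a skeleton for the self-interacting process, in terms of the initial data of the
forward process. -/
def revDens (σ : V → ℤˣ) (n : E → ℕ) (q : (V → ℝ) × Skeleton V E) : ℝ≥0∞ :=
  if ∀ z, z ≠ x₀ → 0 < q.1 z then
    ofReal (exp (-∑ e, G.rateA (G.agreeSigns σ) (q.1 + skelTime q.2) e) *
      (∏ e, G.rateA (G.agreeSigns σ) q.1 e ^ n e / (n e).factorial) *
      G.bwdProd x₀ (G.agreeSigns σ) q.1 n q.2.1 q.2.2) *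
    revObs f (signField σ (q.1 + skelTime q.2)) (bwdPath n q.2.1 q.2.2) *
    (fieldDens x₀ (q.1 + skelTime q.2) *
      ofReal (exp (-(1 / 2) * G.energy (signField σ (q.1 + skelTime q.2)))))
  else 0

theorem mul_bwdVal_eq (σ : V → ℤˣ) (n : E → ℕ) (r : V → ℝ) (p : Skeleton V E) :
    fieldDens x₀ r * ofReal (exp (-(1 / 2) * G.energy (signField σ r))) *
        G.bwdVal x₀ (G.agreeSigns σ) (revObs f (signField σ r)) r n p =
      if listCount p.1 ≤ n then G.revDens x₀ f σ (n - listCount p.1) (r - skelTime p, p) else 0 := by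
  by_cases h1 : listCount p.1 ≤ n
  · by_cases h2 : ∀ z, z ≠ x₀ → 0 < (r - skelTime p) z
    · simp only [bwdVal, revDens]
      rw [if_pos ⟨h1, h2⟩, if_pos h1, if_pos h2]
      simp only [sub_add_cancel]
      rw [mul_comm]
    · simp only [bwdVal, revDens]
      rw [if_neg (fun h => h2 h.2), if_neg h2]
      simp
  · simp only [bwdVal]
    rw [if_neg (fun h => h1 h.1), if_neg h1, mul_zero]

/-- The density of the initial halved squared field and stacks, summed over the signs. -/
def fwdDens (r : V → ℝ) (n : E → ℕ) : ℝ≥0∞ :=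
  ofReal ((1 / √2) ^ (univ.erase x₀).card / prodOff r x₀ * exp (-G.hamil r) *
    (∏ e, (2 * G.rateJ r e) ^ n e / (n e).factorial) * (G.clusterSigns x₀ {e | 0 < n e}).ncard)

variable {f}

theorem _root_.fwdPath_last (n : E → ℕ) {L : List (V × ℝ × E)} {q : V × ℝ} (h : posTimes L q) :
    (fwdPath n L q).2 (fwdPath n L q).1 = (q.1, n + listCount L) := by
  induction L generalizing n with
  | nil => simp [fwdPath, listCount]
  | cons p L ih =>
    rw [posTimes_cons] at h
    have hp := bwdPath_fst_pos (n + Pi.single p.2.2 1) h.2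
    rw [← fwdPath_fst] at hp
    simp only [fwdPath, consPath, listCount]
    rw [if_neg (by linarith), add_sub_cancel_left, ih _ h.2, add_assoc]

/-- When the left side is nonzero, only edges with agreeing signs carry points or events, so `σ` is
constant on the final clusters and is chosen with probability 1/c, where c is their number of sign
assignments. Chained detailed balance turns the backward product into the forward one, replaces the
final Jacobian by the initial one, and exchanges c with the initial count, kept in `fwdDens`. The
energy identity accounts for the exponentials. -/
theorem revDens_le {σ : V → ℤˣ} (hσ : σ x₀ = 1) (n : E → ℕ) {r : V → ℝ}
    (hr : ∀ z, z ≠ x₀ → 0 < r z) (hr₀ : r x₀ = 0) {p : Skeleton V E} (hh : headPos p.1 p.2 = x₀)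
    (hl : p.2.1 = x₀) (hI : ¬ ∃ a ∈ I, isEvent p.1 (a : ℝ)) :
    G.revDens x₀ f σ n (r, p) ≤ G.fwdDens x₀ r n *
      (ofReal (G.fwdProd r p.1 p.2 *
        exp (-(G.hamil (r + skelTime p) - G.hamil r))) *
      (G.clusterSignLaw x₀
        {e | 0 < ((fwdPath n p.1 p.2).2 (fwdPath n p.1 p.2).1).2 e} {σ} *
        f (signField σ (r + skelTime p), (fwdPath n p.1 p.2).1,
          fun t => (fwdPath n p.1 p.2).2 (min ((t : ℝ≥0) : ℝ) (fwdPath n p.1 p.2).1)))) := by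
  have : Nonempty V := ⟨x₀⟩
  obtain ⟨L, q⟩ := p
  simp only at hh hl hI ⊢
  set A := G.agreeSigns σ
  set R := r + skelTime (L, q)
  have hrest : ∀ e, 0 ≤ G.rateA A r e := G.rateA_nonneg A r
  by_cases h0 : (∏ e, G.rateA A r e ^ n e / (n e).factorial) * G.bwdProd x₀ A r n L q = 0
  · simp only [revDens, if_pos hr]
    rw [mul_assoc (exp _), h0]
    simp
  rw [mul_eq_zero, not_or] at h0
  obtain ⟨hpos, hLA⟩ := G.posTimes_of_bwdProd_ne_zero x₀ h0.2
  have hnA : ∀ e, n e ≠ 0 → e ∈ A := by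
    intro e he
    by_contra h
    refine h0.1 (Finset.prod_eq_zero (mem_univ e) ?_)
    rw [rateA, if_neg h, zero_pow he, zero_div]
  have hcs : σ ∈ G.clusterSigns x₀ {e | 0 < (n + listCount L) e} := by
    refine (G.mem_clusterSigns x₀).2 ⟨hσ, fun e he => ?_⟩
    have he' : 0 < n e + listCount L e := he
    by_cases h : n e = 0
    exacts [hLA e (by omega), hnA e h]
  have hR : ∀ z, z ≠ x₀ → 0 < R z := fun z hz => add_pos_of_pos_of_nonneg (hr z hz)
    (skelTime_nonneg hpos z)
  have hR0 : ∀ z, 0 ≤ R z := by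
    intro z
    by_cases hz : z = x₀
    · subst hz; exact add_nonneg hr₀.ge (skelTime_nonneg hpos z)
    · exact (hR z hz).le
  have hprod : ∏ e, G.rateA A r e ^ n e / (n e).factorial =
      ∏ e, (2 * G.rateJ r e) ^ n e / (n e).factorial := by
    refine prod_congr rfl fun e _ => ?_
    by_cases h : n e = 0
    · simp [h]
    · rw [rateA, if_pos (hnA e h)]
  -- The two paths agree away from event times. Observation times are not event times by assumption,
  -- nor is the lifetime, since the last holding time is positive.
  have hpath : revObs f (signField σ R) (bwdPath n L q) = f (signField σ R, (fwdPath n L q).1,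
      fun t => (fwdPath n L q).2 (min ((t : ℝ≥0) : ℝ) (fwdPath n L q).1)) := by
    rw [revObs, ← fwdPath_fst]
    congr 3
    funext t
    rw [fwdPath_eq_bwdPath, fwdPath_fst]
    rcases le_total ((t : ℝ≥0) : ℝ) (fwdPath n L q).1 with h | h
    · rw [min_eq_left h]
      exact fun h' => hI ⟨t, t.2, h'⟩
    · rw [min_eq_right h]
      exact not_isEvent_of_lifetime_le n hpos (fwdPath_fst n L q).ge
  have hmain := G.bwdProd_mul_le x₀ A L q n r (fun z hz => hr z (hh ▸ hz)) (hh ▸ hr₀.ge)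
  rw [hh, hl] at hmain
  have hc : 0 < ((G.clusterSigns x₀ {e | 0 < (n + listCount L) e}).ncard : ℝ) := by
    exact_mod_cast (Set.ncard_pos (Set.toFinite _)).2 ⟨_, hcs⟩
  have hE : exp (-∑ e, G.rateA A R e) * exp (-(1 / 2) * G.energy (signField σ R)) =
      exp (-G.hamil r) * exp (-(G.hamil R - G.hamil r)) := by
    rw [← exp_add, ← exp_add]
    congr 1
    linarith [G.energy_signField σ hR0]
  simp only [revDens, if_pos hr]
  rw [hpath, fwdPath_last n hpos, clusterSignLaw_singleton, if_pos hcs, fieldDens_eq x₀ hR, fwdDens, hprod]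
  have hP : 0 ≤ ∏ e, (2 * G.rateJ r e) ^ n e / (n e).factorial :=
    Finset.prod_nonneg fun e _ => by have := G.rateJ_nonneg r e; positivity
  have hpo : ∀ r : V → ℝ, 0 ≤ prodOff r x₀ := fun r =>
    Finset.prod_nonneg fun z _ => sqrt_nonneg _
  have hb := G.bwdProd_nonneg x₀ A r n L q
  have hfw := G.fwdProd_nonneg r L q
  have hpr := hpo r
  have hpR := hpo R
  set K : ℝ := (1 / √2) ^ (univ.erase x₀).card
  have hK : 0 ≤ K := by positivity
  set Y := f (signField σ R, (fwdPath n L q).1,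
      fun t => (fwdPath n L q).2 (min ((t : ℝ≥0) : ℝ) (fwdPath n L q).1))
  set PP := ∏ e, (2 * G.rateJ r e) ^ n e / (n e).factorial
  set c := ((G.clusterSigns x₀ {e | 0 < (n + listCount L) e}).ncard : ℝ)
  set c0 := ((G.clusterSigns x₀ {e | 0 < n e}).ncard : ℝ)
  have e1 : ∀ a b d : ℝ≥0∞, a * Y * (b * d) = a * b * d * Y := fun a b d => by ring
  have e2 : ∀ a b d : ℝ≥0∞, a * (b * (d * Y)) = a * b * d * Y := fun a b d => by ring
  rw [e1, e2, ← ofReal_mul (by positivity), ← ofReal_mul (by positivity),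
    ← ofReal_mul (by positivity), ← ofReal_mul (by positivity)]
  refine mul_le_mul_left (ofReal_le_ofReal ?_) _
  have e3 : exp (-∑ e, G.rateA A R e) * PP * G.bwdProd x₀ A r n L q * (K / prodOff R x₀) *
      exp (-(1 / 2) * G.energy (signField σ R)) =
      (exp (-G.hamil r) * exp (-(G.hamil R - G.hamil r))) * PP * K *
        (G.bwdProd x₀ A r n L q * (c / prodOff R x₀)) * (1 / c) := by
    rw [← hE]
    field_simp
  have e4 : K / prodOff r x₀ * exp (-G.hamil r) * PP * c0 *
      (G.fwdProd r L q * exp (-(G.hamil R - G.hamil r))) * (1 / c) =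
      (exp (-G.hamil r) * exp (-(G.hamil R - G.hamil r))) * PP * K *
        (G.fwdProd r L q * (c0 / prodOff r x₀)) * (1 / c) := by
    ring
  rw [e3, e4]
  gcongr

end Matching

/-! ### Reversal of the means of observables -/

section Reversal

variable [Fintype V] [Fintype E] {I : Finset ℝ≥0}
  {f : (V → ℝ) × ℝ × (I → V × (E → ℕ)) → ℝ≥0∞}
  [MeasurableSpace V] [MeasurableSingletonClass V]

theorem measurable_energy : Measurable (G.energy : (V → ℝ) → ℝ) := by
  unfold energy
  fun_prop

theorem measurable_revDens [MeasurableSpace E] [MeasurableSingletonClass E] (hf : Measurable f)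
    (σ : V → ℤˣ) (n : E → ℕ) : Measurable (G.revDens x₀ f σ n) := by
  have h0 : MeasurableSet {q : (V → ℝ) × Skeleton V E | ∀ z, z ≠ x₀ → 0 < q.1 z} := by
    have : {q : (V → ℝ) × Skeleton V E | ∀ z, z ≠ x₀ → 0 < q.1 z} =
        ⋂ z : V, ⋂ _ : z ≠ x₀, {q | 0 < q.1 z} := by ext; simp
    rw [this]
    exact MeasurableSet.iInter fun z => MeasurableSet.iInter fun _ =>
      measurableSet_lt measurable_const ((measurable_pi_apply z).comp measurable_fst)
  have h1 : Measurable fun q : (V → ℝ) × Skeleton V E => q.1 + skelTime q.2 :=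
    measurable_fst.add (measurable_skelTime_pi.comp measurable_snd)
  have hs : Measurable fun q : (V → ℝ) × Skeleton V E => signField σ (q.1 + skelTime q.2) :=
    (measurable_signField σ).comp h1
  have hb : Measurable fun q : (V → ℝ) × Skeleton V E =>
      G.bwdProd x₀ (G.agreeSigns σ) q.1 n q.2.1 q.2.2 :=
    (G.measurable_bwdProd x₀ (G.agreeSigns σ)).comp ((measurable_fst.prodMk
      (measurable_const.prodMk measurable_snd.snd)).prodMk measurable_snd.fst)
  have hT : Measurable fun q : (V → ℝ) × Skeleton V E => (bwdPath n q.2.1 q.2.2).1 :=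
    measurable_bwdPath_fst.comp ((measurable_const.prodMk measurable_snd.snd).prodMk
      measurable_snd.fst)
  have hX : Measurable fun p : ((V → ℝ) × Skeleton V E) × ℝ => (bwdPath n p.1.2.1 p.1.2.2).2 p.2 :=
    measurable_bwdPath_snd.comp (((measurable_const.prodMk measurable_fst.snd.snd).prodMk
      measurable_snd).prodMk measurable_fst.snd.fst)
  refine Measurable.ite h0 (Measurable.mul (Measurable.mul (Measurable.ennreal_ofReal
    (Measurable.mul (Measurable.mul ?_ ?_) hb)) ?_) (Measurable.mul
      ((measurable_fieldDens x₀).comp h1) ?_)) measurable_const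
  · exact measurable_exp.comp (Finset.measurable_sum _ fun e _ =>
      G.measurable_rateA _ h1 e).neg
  · exact Finset.measurable_prod _ fun e _ =>
      ((G.measurable_rateA _ measurable_fst e).pow_const _).div_const _
  · refine hf.comp (hs.prodMk (hT.prodMk (measurable_pi_lambda _ fun t => ?_)))
    exact hX.comp (measurable_id.prodMk (hT.sub (measurable_const.min hT)))
  · exact (measurable_exp.comp ((G.measurable_energy.comp hs).const_mul _)).ennreal_ofReal

/-- The mean of an observable of the self-interacting process, reversed in time. -/
def revExp (f : (V → ℝ) × ℝ × (I → V × (E → ℕ)) → ℝ≥0∞) (φ : V → ℝ) : ℝ≥0∞ :=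
  ∫⁻ γ, ∫⁻ c, revObs f φ (G.dropPath x₀ (G.checkStack x₀ φ γ) (fun x => φ x ^ 2 / 2) x₀ c)
    ∂fairCoins ∂(poissonSpacings E)

theorem fieldDens_ne_top (r : V → ℝ) : fieldDens x₀ r ≠ ⊤ := by
  refine ENNReal.prod_ne_top fun z _ => ?_
  unfold sqrtDens
  split_ifs; exacts [ofReal_ne_top, ENNReal.zero_ne_top]

theorem mul_revExp_le (hf : Measurable f) {σ : V → ℤˣ} (hσ : σ x₀ = 1) {r : V → ℝ}
    (hr₀ : 0 < r x₀) :
    fieldDens x₀ r * (ofReal (exp (-(1 / 2) * G.energy (signField σ r))) *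
        G.revExp x₀ f (signField σ r)) ≤
      ∑' n : E → ℕ, bwdInt x₀ (∑ e, n e) x₀ (r x₀) fun p => if listCount p.1 ≤ n then
        G.revDens x₀ f σ (n - listCount p.1) (r - skelTime p, p) else 0 := by
  by_cases hr : ∀ z, z ≠ x₀ → 0 < r z
  swap
  · rw [fieldDens_eq_zero x₀ hr, zero_mul]
    exact zero_le
  have hr' : ∀ z, 0 < r z := fun z => if h : z = x₀ then h ▸ hr₀ else hr z h
  have hsq : (fun x => signField σ r x ^ 2 / 2) = r :=
    funext (signField_sq_half fun z => (hr' z).le)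
  rw [← mul_assoc]
  set wt := fieldDens x₀ r * ofReal (exp (-(1 / 2) * G.energy (signField σ r)))
  have hwt : wt ≠ ⊤ := ENNReal.mul_ne_top (fieldDens_ne_top x₀ r) ofReal_ne_top
  have h1 := G.lintegral_checkStack_le x₀ (procMeasurable_revObs hf (signField σ r))
    (φ := signField σ r) (r := r) fun x => (congrFun hsq x).symm
  rw [G.agree_signField x₀ hσ hr] at h1
  rw [revExp, hsq]
  refine (mul_le_mul_right h1 wt).trans ?_
  rw [← ENNReal.tsum_mul_left]
  refine ENNReal.tsum_le_tsum fun n => ?_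
  simp only [← G.mul_bwdVal_eq x₀ f σ n r]
  rw [bwdInt_const_mul _ _ _ _ _ hwt]
  exact mul_le_mul_right (G.capExp_dropExp_le_bwdInt x₀ _ _
    (procMeasurable_revObs hf (signField σ r)) hr' le_rfl (SimpleGraph.Reachable.refl x₀)) wt

/-- Subtracting the events `m` is injective on the stacks above `m`. A sum over final stacks thus
becomes a sum over initial stacks, on a finite set independent of the skeleton. -/
theorem sum_shift_le (s : Finset (E → ℕ)) (m : E → ℕ) (g : (E → ℕ) → ℝ≥0∞) :
    ∑ n ∈ s, (if m ≤ n then g (n - m) else 0) ≤ ∑ n ∈ s.biUnion Finset.Iic, g n := by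
  rw [← Finset.sum_filter, ← Finset.sum_image (f := g) (g := fun n => n - m)]
  · refine Finset.sum_le_sum_of_subset fun k hk => ?_
    obtain ⟨n, hn, rfl⟩ := Finset.mem_image.1 hk
    exact Finset.mem_biUnion.2 ⟨n, (mem_filter.1 hn).1, Finset.mem_Iic.2 tsub_le_self⟩
  · intro n hn n' hn' h
    have h1 := (mem_filter.1 hn).2
    have h2 := (mem_filter.1 hn').2
    rw [← tsub_add_cancel_of_le h1, ← tsub_add_cancel_of_le h2]
    exact congrArg (· + m) h

theorem measurable_fwdDens (n : E → ℕ) : Measurable fun r => G.fwdDens x₀ r n := by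
  have hJ := fun e => G.measurable_rateJ e
  have hH : Measurable (G.hamil : (V → ℝ) → ℝ) :=
    (Finset.measurable_sum _ fun x _ => (measurable_pi_apply x).const_mul _).add
      (Finset.measurable_sum _ fun e _ => hJ e)
  refine ((((Measurable.const_div ?_ _).mul (measurable_exp.comp hH.neg)).mul
    (Finset.measurable_prod _ fun e _ => ?_)).mul_const _).ennreal_ofReal
  · exact Finset.measurable_prod _ fun z _ => (measurable_pi_apply z).sqrt
  · exact (((hJ e).const_mul 2).pow_const _).div_const _

/-- The parameter spaces in `ProcMeasurable` live in the universe of `E`, which need not contain `V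
→ ℝ`; the field is therefore transported to coordinates indexed by `Fin`. -/
theorem measurable_fwdExp {F : (V → ℝ) → LifePath V E → ℝ≥0∞} (hF : ProcMeasurable F) (x : V)
    {u : ℝ} (hu : 0 < u) (n : E → ℕ) : Measurable fun r => G.fwdExp x₀ F x u r n := by
  let i := Fintype.equivFin V
  have hi : Measurable fun (c : Fin (Fintype.card V) → ℝ) (z : V) => c (i z) :=
    measurable_pi_lambda _ fun z => measurable_pi_apply (i z)
  have h : Measurable fun p : (Fin (Fintype.card V) → ℝ) × ((ℕ → E → ℝ) × (E → ℕ → ℝ)) =>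
      G.fwdVal x₀ F x u (fun z => p.1 (i z)) n p.2.1 p.2.2 :=
    G.measurable_fwdVal x₀ hF x hu n (hi.comp measurable_fst) measurable_snd.fst measurable_snd.snd
  have h1 : Measurable fun c : Fin (Fintype.card V) → ℝ => G.fwdExp x₀ F x u (fun z => c (i z)) n :=
    h.lintegral_prod_right'
  have h2 : Measurable fun (r : V → ℝ) (k : Fin (Fintype.card V)) => r (i.symm k) :=
    measurable_pi_lambda _ fun k => measurable_pi_apply (i.symm k)
  have h3 := h1.comp h2
  have h4 : ∀ r : V → ℝ, (fun z => r (i.symm (i z))) = r := fun r => by simp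
  simpa only [Function.comp_def, h4] using h3

/-- Expand the self-interacting mean over signs, final stacks and skeletons; reverse the
integration, so that initial data become the variables; discard skeletons with an event at an
observation time; then compare densities pointwise and recognize a lower bound for the forward mean.
-/
theorem lintegral_revExp_le {u : ℝ} (hu : 0 < u) (hf : Measurable f) :
    ∫⁻ g : Off x₀,
        ofReal (exp (-(1 / 2) * G.energy (extendAt x₀ √(2 * u) g))) *
          G.revExp x₀ f (extendAt x₀ √(2 * u) g) ≤
      ∑' n : E → ℕ, ∫⁻ r : Off x₀, (if ∀ i, 0 < r i then
        G.fwdDens x₀ (extendAt x₀ 0 r) n *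
          G.fwdExp x₀ (G.fwdObs x₀ f) x₀ u (extendAt x₀ 0 r) n else 0) := by
  let _ : MeasurableSpace E := ⊤
  have : MeasurableSingletonClass E := ⟨fun _ => trivial⟩
  have hRu : ∀ r : Off x₀, extendAt x₀ u r x₀ = u := fun r => by simp [extendAt]
  have hRD : ∀ σ n, Measurable (G.revDens x₀ f σ n) := fun σ n => G.measurable_revDens x₀ hf σ n
  set Q : (E → ℕ) → (V → ℝ) × Skeleton V E → ℝ≥0∞ := fun n q =>
    ∑ σ ∈ pinnedSigns x₀, G.revDens x₀ f σ n q with hQ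
  have hQm : ∀ n, Measurable (Q n) := fun n => Finset.measurable_sum _ fun σ _ => hRD σ n
  set T : (E → ℕ) → (V → ℝ) × Skeleton V E → ℝ≥0∞ := fun n q =>
    if listCount q.2.1 ≤ n then Q (n - listCount q.2.1) (q.1 - skelTime q.2, q.2) else 0 with hT
  have hTm : ∀ n, Measurable (T n) := by
    intro n
    refine measurable_of_fibers (g := fun q : (V → ℝ) × Skeleton V E => listCount q.2.1)
      (f := fun m q => if m ≤ n then Q (n - m) (q.1 - skelTime q.2, q.2) else 0)
      (fun m => (measurable_listCount.comp measurable_snd.fst) (measurableSet_singleton m))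
      fun m => ?_
    split_ifs
    · exact (hQm _).comp ((measurable_fst.sub (measurable_skelTime_pi.comp measurable_snd)).prodMk
        measurable_snd)
    · exact measurable_const
  have step1 : ∫⁻ g : Off x₀,
        ofReal (exp (-(1 / 2) * G.energy (extendAt x₀ √(2 * u) g))) *
          G.revExp x₀ f (extendAt x₀ √(2 * u) g) ≤
      ∑' n : E → ℕ, ∫⁻ r : Off x₀, bwdInt x₀ (∑ e, n e) x₀ u
        fun p => T n (extendAt x₀ u r, p) := by
    refine (lintegral_extendAt_le x₀ u fun φ =>
      ofReal (exp (-(1 / 2) * G.energy φ)) * G.revExp x₀ f φ).trans ?_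
    have hB : ∀ n : E → ℕ, Measurable fun r : Off x₀ =>
        bwdInt x₀ (∑ e, n e) x₀ u fun p => T n (extendAt x₀ u r, p) := fun n =>
      (measurable_bwdInt x₀ _ u (hTm n)).comp (measurable_extendAt x₀ u)
    rw [← lintegral_tsum fun n => (hB n).aemeasurable]
    refine lintegral_mono fun r => ?_
    refine (sum_le_sum fun σ hσ => G.mul_revExp_le x₀ hf (mem_filter.1 hσ).2
      (r := extendAt x₀ u r) (by rw [hRu]; exact hu)).trans ?_
    rw [← Summable.tsum_finsetSum fun _ _ => ENNReal.summable]
    refine ENNReal.tsum_le_tsum fun n => (sum_bwdInt_le _ _ _ _ _ _).trans ?_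
    rw [hRu]
    refine bwdInt_mono _ _ _ _ fun p _ _ _ => ?_
    simp only [hT, hQ]
    split_ifs
    · exact le_rfl
    · simp
  refine step1.trans (ENNReal.summable.tsum_le_of_sum_le fun s => ?_)
  -- A finite partial sum over final stacks provides a common bound for the number of events, and a
  -- finite set `s'` containing all the initial stacks involved.
  set M := s.sup fun n => ∑ e, n e
  set s' := s.biUnion Finset.Iic
  have step2 : ∑ n ∈ s, ∫⁻ r : Off x₀, bwdInt x₀ (∑ e, n e) x₀ u
        (fun p => T n (extendAt x₀ u r, p)) ≤
      ∫⁻ r : Off x₀, fwdInt x₀ M x₀ u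
        fun p => ∑ n ∈ s', Q n (extendAt x₀ 0 r, p) := by
    have hm : Measurable fun q : (V → ℝ) × Skeleton V E => ∑ n ∈ s', Q n q :=
      Finset.measurable_sum _ fun n _ => hQm n
    rw [← lintegral_bwdInt_eq_fwdInt x₀ u M hm]
    refine (sum_lintegral_le _ _ _).trans (lintegral_mono fun r => ?_)
    refine (sum_le_sum fun n hn => bwdInt_mono_left x₀
      (Finset.le_sup (f := fun n : E → ℕ => ∑ e, n e) hn) x₀ u _).trans ?_
    refine (sum_bwdInt_le _ _ _ _ _ _).trans (bwdInt_mono _ _ _ _ fun p _ _ _ => ?_)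
    exact sum_shift_le s (listCount p.1) fun n => Q n (extendAt x₀ u r - skelTime p, p)
  refine step2.trans ?_
  refine le_trans (lintegral_mono (g := fun r => ∑ n ∈ s', (if ∀ i, 0 < r i then
        G.fwdDens x₀ (extendAt x₀ 0 r) n *
          G.fwdExp x₀ (G.fwdObs x₀ f) x₀ u (extendAt x₀ 0 r) n else 0)) fun r => ?_) ?_
  · refine (fwdInt_sum_le s' I x₀ M x₀ u (f := fun n p => Q n (extendAt x₀ 0 r, p)) fun n =>
      (hQm n).comp (measurable_const.prodMk measurable_id)).trans
      (sum_le_sum fun n _ => ?_)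
    have hr₀ : extendAt x₀ 0 r x₀ = 0 := by simp [extendAt]
    split_ifs with hr
    · have hr' : ∀ z, z ≠ x₀ → 0 < extendAt x₀ 0 r z := fun z hz => by
        simpa [extendAt, hz] using hr ⟨z, hz⟩
      refine le_trans ?_ (mul_le_mul_right (G.fwdInt_le_fwdExp x₀ M (G.procMeasurable_fwdObs x₀ hf)
        (G.isLocal_fwdObs x₀ f) hu hr' hr₀.ge n) _)
      rw [← fwdInt_const_mul _ _ _ _ _ (by unfold fwdDens; exact ofReal_ne_top)]
      refine fwdInt_mono _ _ _ _ fun p hh hl _ => ?_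
      split_ifs with hI
      · exact zero_le
      · refine (sum_le_sum fun σ hσ => G.revDens_le x₀ (mem_filter.1 hσ).2 n hr' hr₀
          hh hl hI).trans ?_
        rw [← Finset.mul_sum, ← Finset.mul_sum, fwdObs]
        refine mul_le_mul_right (mul_le_mul_right ?_ _) _
        exact Finset.sum_le_sum_of_subset (Finset.subset_univ _)
    · have hr' : ¬ ∀ z, z ≠ x₀ → 0 < extendAt x₀ 0 r z := fun h => hr fun i => by
        simpa [extendAt, i.2] using h i i.2
      have h0 : ∀ p : Skeleton V E, Q n (extendAt x₀ 0 r, p) = 0 := fun p =>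
        Finset.sum_eq_zero fun σ _ => by rw [revDens]; exact if_neg hr'
      simp only [h0, ite_self]
      have := fwdInt_const_mul x₀ M x₀ u 0 ENNReal.zero_ne_top (fun _ : Skeleton V E => 0)
      simp only [zero_mul] at this
      exact this.le
  · have hpos : MeasurableSet {r : Off x₀ | ∀ i, 0 < r i} := by
      have : {r : Off x₀ | ∀ i, 0 < r i} = ⋂ i, {r | 0 < r i} := by ext; simp
      rw [this]
      exact MeasurableSet.iInter fun i => measurableSet_lt measurable_const (measurable_pi_apply i)
    have hm : ∀ n, Measurable fun r : Off x₀ => if ∀ i, 0 < r i then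
        G.fwdDens x₀ (extendAt x₀ 0 r) n *
          G.fwdExp x₀ (G.fwdObs x₀ f) x₀ u (extendAt x₀ 0 r) n else 0 := fun n =>
      Measurable.ite hpos
      (((G.measurable_fwdDens x₀ n).comp (measurable_extendAt x₀ 0)).mul ((G.measurable_fwdExp x₀
        (G.procMeasurable_fwdObs x₀ hf) x₀ hu n).comp (measurable_extendAt x₀ 0)))
        measurable_const
    rw [lintegral_finsetSum _ fun n _ => hm n]
    exact ENNReal.sum_le_tsum _

end Reversal

end Network

/-! ### The enlarged process through its successive conditional laws -/

section CountableConditioning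

/-- The law of `(B, N)`, when `N` is discrete and has the conditional law `q` given `B`. -/
theorem lintegral_of_discrete_condLaw {Ω β D : Type*} [MeasurableSpace Ω] [MeasurableSpace β]
    [MeasurableSpace D] [MeasurableSingletonClass D] [Countable D] {P : Measure Ω} {B : Ω → β}
    {N : Ω → D} (hB : AEMeasurable B P) (hN : AEMeasurable N P) {q : β → D → ℝ≥0∞}
    (hq : ∀ n, Measurable fun b => q b n)
    (h : ∀ A : Set β, MeasurableSet A → ∀ n,
      P {ω | B ω ∈ A ∧ N ω = n} = ∫⁻ ω in {ω | B ω ∈ A}, q (B ω) n ∂P)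
    {F : β → D → ℝ≥0∞} (hF : ∀ n, Measurable fun b => F b n) :
    ∫⁻ ω, F (B ω) (N ω) ∂P = ∑' n, ∫⁻ b, q b n * F b n ∂(P.map B) := by
  have hF' : Measurable fun p : β × D => F p.1 p.2 := measurable_from_prod_countable_left hF
  have hpair : ∀ n : D, Measurable fun b : β => (b, n) := fun n =>
    measurable_id.prodMk measurable_const
  have key : P.map (fun ω => (B ω, N ω)) = Measure.sum fun n =>
      ((P.map B).withDensity fun b => q b n).map fun b => (b, n) := by
    ext S hS
    have hSn : ∀ n, MeasurableSet {b | (b, n) ∈ S} := fun n => hpair n hS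
    rw [Measure.sum_apply _ hS, Measure.map_apply_of_aemeasurable (hB.prodMk hN) hS]
    have e1 : (fun ω => (B ω, N ω)) ⁻¹' S = ⋃ n, {ω | B ω ∈ {b | (b, n) ∈ S} ∧ N ω = n} := by
      ext ω; simp
    rw [e1, measure_iUnion₀]
    · refine tsum_congr fun n => ?_
      rw [h _ (hSn n), Measure.map_apply (hpair n) hS, withDensity_apply _ (hpair n hS), Set.preimage,
        Measure.restrict_map_of_aemeasurable hB (hSn n),
        lintegral_map' (hq n).aemeasurable hB.restrict]
      rfl
    · intro n m hnm
      refine Disjoint.aedisjoint (Set.disjoint_left.2 fun ω h1 h2 => hnm (h1.2.symm.trans h2.2))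
    · intro n
      exact (hB.nullMeasurable (hSn n)).inter (hN.nullMeasurable (measurableSet_singleton n))
  rw [← lintegral_map' (f := fun p : β × D => F p.1 p.2) hF'.aemeasurable (hB.prodMk hN), key,
    lintegral_sum_measure]
  refine tsum_congr fun n => ?_
  rw [lintegral_map hF' (hpair n)]
  exact lintegral_withDensity_eq_lintegral_mul _ (hq n) (hF n)

end CountableConditioning

namespace Network

universe v w

variable {V : Type v} {E : Type w} (G : Network V E) (x₀ : V) [Fintype V] [Fintype E]
  [MeasurableSpace V] [MeasurableSingletonClass V]

theorem initialStackLaw_singleton (φ : V → ℝ) (n : E → ℕ) :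
    G.initialStackLaw x₀ φ {n} = ofReal
      (exp (-∑ e, G.rateA (G.agree x₀ φ) (fun x => φ x ^ 2 / 2) e) *
        ∏ e, G.rateA (G.agree x₀ φ) (fun x => φ x ^ 2 / 2) e ^ n e / (n e).factorial) := by
  have hA := G.rateA_nonneg (G.agree x₀ φ) (fun x => φ x ^ 2 / 2)
  have hs : ∀ e, SigmaFinite (if fieldSign x₀ φ (G.fst e) * fieldSign x₀ φ (G.snd e) = 1 then
      poissonMeasure (2 * G.J (fun x => |φ x|) e).toNNReal else Measure.dirac 0) := by
    intro e
    split_ifs <;> infer_instance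
  rw [initialStackLaw, Measure.pi_singleton, ← Finset.sum_neg_distrib, exp_sum,
    ← Finset.prod_mul_distrib, ofReal_prod_of_nonneg fun e _ => by
      have := hA e; positivity]
  refine prod_congr rfl fun e _ => ?_
  have hJ : G.J (fun x => |φ x|) e = G.rateJ (fun x => φ x ^ 2 / 2) e := by
    have : ∀ x, √(2 * (φ x ^ 2 / 2)) = |φ x| := fun x => by
      rw [mul_div_cancel₀ _ two_ne_zero, Real.sqrt_sq_eq_abs]
    simp only [rateJ, this]
  have h0 := G.rateJ_nonneg (fun x => φ x ^ 2 / 2) e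
  by_cases he : fieldSign x₀ φ (G.fst e) * fieldSign x₀ φ (G.snd e) = 1
  · rw [if_pos he, rateA, if_pos (show e ∈ G.agree x₀ φ from he), poissonMeasure_singleton, hJ,
      Real.coe_toNNReal _ (by linarith), mul_div_assoc]
  · rw [if_neg he, rateA, if_neg (show e ∉ G.agree x₀ φ from he)]
    by_cases hn : n e = 0 <;> simp [hn]

theorem measurable_initialStackLaw (n : E → ℕ) :
    Measurable fun φ : V → ℝ => G.initialStackLaw x₀ φ {n} := by
  simp only [initialStackLaw_singleton]
  refine measurable_of_fibers (g := fun φ : V → ℝ => G.agree x₀ φ) (f := fun A φ => ofReal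
    (exp (-∑ e, G.rateA A (fun x => φ x ^ 2 / 2) e) *
      ∏ e, G.rateA A (fun x => φ x ^ 2 / 2) e ^ n e / (n e).factorial))
    (measurableSet_fiber_set fun e => measurableSet_fieldSign x₀ measurable_id _ _) fun A => ?_
  have h := fun e => G.measurable_rateA A
    (r := fun φ : V → ℝ => fun x => φ x ^ 2 / 2) (by fun_prop) e
  exact ((measurable_exp.comp (Finset.measurable_sum _ fun e _ => h e).neg).mul
    (Finset.measurable_prod _ fun e _ => ((h e).pow_const _).div_const _)).ennreal_ofReal

variable {I : Finset ℝ≥0} (f : (V → ℝ) × ℝ × (I → V × (E → ℕ)) → ℝ≥0∞) (u : ℝ)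

/-- A function of the final field, and of the enlarged process at finitely many times. -/
def enlargedObs (φ : V → ℝ) (ξ : ℕ → E → ℝ) (γ : E → ℕ → ℝ) (n : E → ℕ) (σ : V → ℤˣ) : ℝ≥0∞ :=
  f (G.finalField x₀ u φ ξ σ, (G.trajectory x₀ u φ ξ γ n).1,
    fun t => (G.trajectory x₀ u φ ξ γ n).2 t)

/-- The mean of `enlargedObs` over the signs. -/
def signMean (φ : V → ℝ) (ξ : ℕ → E → ℝ) (γ : E → ℕ → ℝ) (n : E → ℕ) : ℝ≥0∞ :=
  ∑ σ : V → ℤˣ, G.clusterSignLaw x₀ {e | 0 < G.stack x₀ φ ξ γ n (G.tau x₀ u ξ) e} {σ} *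
    G.enlargedObs x₀ f u φ ξ γ n σ

variable {f u}

theorem measurable_enlargedObs (hu : 0 < u) (hf : Measurable f) {Z : Type*} [MeasurableSpace Z]
    {φ : Z → V → ℝ} {ξ : Z → ℕ → E → ℝ} {γ : Z → E → ℕ → ℝ} {n : Z → E → ℕ} (hφ : Measurable φ)
    (hξ : Measurable ξ) (hγ : Measurable γ) (hn : Measurable n) (σ : V → ℤˣ) :
    Measurable fun z => G.enlargedObs x₀ f u (φ z) (ξ z) (γ z) (n z) σ := by
  have hT := G.measurable_trajectory x₀ hu hφ hξ hγ hn
  exact hf.comp ((G.measurable_finalField x₀ hu hφ hξ measurable_const).prodMk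
    (hT.fst.prodMk (measurable_pi_lambda _ fun t => (measurable_pi_apply (t : ℝ≥0)).comp hT.snd)))

theorem measurable_clusterSignLaw (hu : 0 < u) {Z : Type*} [MeasurableSpace Z]
    {φ : Z → V → ℝ} {ξ : Z → ℕ → E → ℝ} {γ : Z → E → ℕ → ℝ} {n : Z → E → ℕ} (hφ : Measurable φ)
    (hξ : Measurable ξ) (hγ : Measurable γ) (hn : Measurable n) (σ : V → ℤˣ) :
    Measurable fun z => G.clusterSignLaw x₀
      {e | 0 < G.stack x₀ (φ z) (ξ z) (γ z) (n z) (G.tau x₀ u (ξ z)) e} {σ} := by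
  have h : Measurable fun z => G.stack x₀ (φ z) (ξ z) (γ z) (n z) (G.tau x₀ u (ξ z)) :=
    measurable_pi_lambda _ fun e => G.measurable_stack x₀ hφ hξ hγ hn (G.measurable_tau x₀ hu hξ) e
  exact (measurable_of_countable fun m : E → ℕ => G.clusterSignLaw x₀ {e | 0 < m e} {σ}).comp h

theorem measurable_signMean (hu : 0 < u) (hf : Measurable f) {Z : Type*} [MeasurableSpace Z]
    {φ : Z → V → ℝ} {ξ : Z → ℕ → E → ℝ} {γ : Z → E → ℕ → ℝ} {n : Z → E → ℕ} (hφ : Measurable φ)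
    (hξ : Measurable ξ) (hγ : Measurable γ) (hn : Measurable n) :
    Measurable fun z => G.signMean x₀ f u (φ z) (ξ z) (γ z) (n z) :=
  Finset.measurable_sum _ fun σ _ => (G.measurable_clusterSignLaw x₀ hu hφ hξ hγ hn σ).mul
    (G.measurable_enlargedObs x₀ hu hf hφ hξ hγ hn σ)

theorem lintegral_enlargedObs (hu : 0 < u) (hf : Measurable f) {Ω : Type*} [MeasurableSpace Ω]
    {P : Measure Ω} {φ₀ : Ω → V → ℝ} {ξ : Ω → ℕ → E → ℝ} {γ : Ω → E → ℕ → ℝ} {n₀ : Ω → E → ℕ}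
    {σ : Ω → V → ℤˣ} (h : G.IsEnlarged x₀ u P φ₀ ξ γ n₀ σ) :
    ∫⁻ ω, G.enlargedObs x₀ f u (φ₀ ω) (ξ ω) (γ ω) (n₀ ω) (σ ω) ∂P =
      ∑' n, ∫⁻ b, G.initialStackLaw x₀ b.1 {n} * G.signMean x₀ f u b.1 b.2.1 b.2.2 n
        ∂((G.pinnedGFF x₀ 0).prod (G.clockLaw.prod (poissonSpacings E))) := by
  have hB := h.law_base.aemeasurable
  have hB' : AEMeasurable (fun ω => (φ₀ ω, ξ ω, γ ω, n₀ ω)) P :=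
    hB.fst.prodMk (hB.snd.fst.prodMk (hB.snd.snd.prodMk h.aemeasurable_stacks))
  have h1 := lintegral_of_discrete_condLaw hB' h.aemeasurable_signs
    (q := fun b s => G.clusterSignLaw x₀
      {e | 0 < G.stack x₀ b.1 b.2.1 b.2.2.1 b.2.2.2 (G.tau x₀ u b.2.1) e} {s})
    (fun s => G.measurable_clusterSignLaw x₀ hu measurable_fst measurable_snd.fst
      measurable_snd.snd.fst measurable_snd.snd.snd s) h.law_signs
    (F := fun b s => G.enlargedObs x₀ f u b.1 b.2.1 b.2.2.1 b.2.2.2 s)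
    fun s => G.measurable_enlargedObs x₀ hu hf measurable_fst measurable_snd.fst
      measurable_snd.snd.fst measurable_snd.snd.snd s
  have hm : ∀ s : V → ℤˣ, Measurable fun b : (V → ℝ) × (ℕ → E → ℝ) × (E → ℕ → ℝ) × (E → ℕ) =>
      G.clusterSignLaw x₀ {e | 0 < G.stack x₀ b.1 b.2.1 b.2.2.1 b.2.2.2 (G.tau x₀ u b.2.1) e} {s} *
        G.enlargedObs x₀ f u b.1 b.2.1 b.2.2.1 b.2.2.2 s := fun s =>
    (G.measurable_clusterSignLaw x₀ hu measurable_fst measurable_snd.fst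
      measurable_snd.snd.fst measurable_snd.snd.snd s).mul
      (G.measurable_enlargedObs x₀ hu hf measurable_fst measurable_snd.fst
      measurable_snd.snd.fst measurable_snd.snd.snd s)
  rw [h1, tsum_fintype, ← lintegral_finsetSum _ fun s _ => hm s,
    lintegral_map' (Finset.measurable_sum _ fun s _ => hm s).aemeasurable hB']
  have h2 := lintegral_of_discrete_condLaw hB h.aemeasurable_stacks
    (q := fun b n => G.initialStackLaw x₀ b.1 {n})
    (fun n => (G.measurable_initialStackLaw x₀ n).comp measurable_fst) h.law_stacks
    (F := fun b n => G.signMean x₀ f u b.1 b.2.1 b.2.2 n)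
    fun n => G.measurable_signMean x₀ hu hf measurable_fst measurable_snd.fst measurable_snd.snd
      measurable_const
  rw [h.law_base.map_eq] at h2
  exact h2

end Network

theorem lintegral_splice {E : Type*} [Fintype E] {a : E → ℝ} (ha : ∀ e, 0 ≤ a e)
    {K : (E → ℕ → ℝ) → ℝ≥0∞} (hK : Measurable K) :
    ∫⁻ γ, K γ ∂(poissonSpacings E) = ∫⁻ γ, ∫⁻ δ, K fun e => splice (a e) (γ e) (δ e)
      ∂(poissonSpacings E) ∂(poissonSpacings E) := by
  have h1 := measurePreserving_pi (fun _ : E => spacingLaw.prod spacingLaw)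
    (fun _ : E => spacingLaw) fun e => measurePreserving_splice (ha e)
  have h2 := measurePreserving_arrowProdEquivProdArrow (ℕ → ℝ) (ℕ → ℝ) E
    (fun _ => spacingLaw) (fun _ => spacingLaw)
  have h3 := h1.comp h2.symm
  have h4 := h3.lintegral_comp hK
  have hm := hK.comp h3.measurable
  have h5 := lintegral_prod _ hm.aemeasurable (μ := poissonSpacings E) (ν := poissonSpacings E)
  exact h4.symm.trans h5

namespace Network

universe v w

variable {V : Type v} {E : Type w} (G : Network V E) (x₀ : V) [Fintype V] [Fintype E]
  [MeasurableSpace V] [MeasurableSingletonClass V]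
  {I : Finset ℝ≥0} {f : (V → ℝ) × ℝ × (I → V × (E → ℕ)) → ℝ≥0∞} {u : ℝ}

theorem tau_nonneg (ξ : ℕ → E → ℝ) : 0 ≤ G.tau x₀ u ξ := Real.sInf_nonneg fun _ h => h.1

theorem Phi_eq (φ : V → ℝ) (ξ : ℕ → E → ℝ) (t : ℝ) (x : V) :
    G.Phi x₀ φ ξ t x = √(2 * (((fun x => φ x ^ 2 / 2) + localTime (G.walk x₀ ξ) t : V → ℝ) x)) := by
  rw [Phi, sq_abs]
  congr 1
  simp only [Pi.add_apply]
  ring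

theorem stack_splice (φ : V → ℝ) (ξ : ℕ → E → ℝ) {γ δ : E → ℕ → ℝ} (hγ : ∀ e, GoodSpacing (γ e))
    (hδ : ∀ e, GoodSpacing (δ e)) (n : E → ℕ) {t : ℝ} (ht : 0 ≤ t) (e : E) :
    G.stack x₀ φ ξ (fun e => splice (G.rateJ (fun x => φ x ^ 2 / 2) e) (γ e) (δ e)) n t e =
      n e + countUpTo (δ e) (G.rateJ ((fun x => φ x ^ 2 / 2) + localTime (G.walk x₀ ξ) t) e -
        G.rateJ (fun x => φ x ^ 2 / 2) e) + G.crossings x₀ ξ t e := by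
  set r : V → ℝ := fun x => φ x ^ 2 / 2 with hr
  have h1 : G.J (G.Phi x₀ φ ξ t) e = G.rateJ (r + localTime (G.walk x₀ ξ) t) e := by
    simp only [J, rateJ, Phi_eq, ← hr]
  have h2 : G.J (fun x => |φ x|) e = G.rateJ r e := by
    have : ∀ x, |φ x| = √(2 * r x) := fun x => by
      rw [hr, mul_div_cancel₀ _ two_ne_zero, Real.sqrt_sq_eq_abs]
    simp only [rateJ, this]
  have h3 : 0 ≤ G.rateJ (r + localTime (G.walk x₀ ξ) t) e - G.rateJ r e :=
    sub_nonneg.2 (G.rateJ_mono (le_add_of_nonneg_right fun x =>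
      localTime_nonneg (G.measurable_walk_path x₀ ξ) x ht) e)
  have h4 := countUpTo_splice (G.rateJ_nonneg r e) (hγ e) (hδ e) h3
  have h5 := countUpTo_splice (G.rateJ_nonneg r e) (hγ e) (hδ e) le_rfl
  rw [add_sub_cancel] at h4
  rw [add_zero, countUpTo_of_nonpos (hδ e).1 le_rfl, add_zero] at h5
  rw [stack, h1, h2, h4, h5, Nat.add_sub_cancel_left]

/-- The two sides agree if the local time at `x₀` reaches `u`; otherwise the left one is 0. Here `γ`
supplies the points up to the initial level and `δ` those beyond, the only ones that the process
sees. -/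
theorem fwdVal_le_signMean (φ : V → ℝ) (ξ : ℕ → E → ℝ) {γ δ : E → ℕ → ℝ}
    (hγ : ∀ e, GoodSpacing (γ e)) (hδ : ∀ e, GoodSpacing (δ e)) (n : E → ℕ) :
    G.fwdVal x₀ (G.fwdObs x₀ f) x₀ u (fun x => φ x ^ 2 / 2) n ξ δ ≤ G.signMean x₀ f u φ ξ
      (fun e => splice (G.rateJ (fun x => φ x ^ 2 / 2) e) (γ e) (δ e)) n := by
  unfold fwdVal
  split_ifs
  swap
  · exact zero_le
  have hT : sInf (hitSet (G.walk x₀ ξ) x₀ u) = G.tau x₀ u ξ := rfl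
  have h0 := G.tau_nonneg x₀ (u := u) ξ
  refine sum_le_sum fun σ _ => le_of_eq ?_
  have hF : signField σ ((fun x => φ x ^ 2 / 2) + localTime (G.walk x₀ ξ) (G.tau x₀ u ξ)) =
      G.finalField x₀ u φ ξ σ := funext fun x => by
    rw [finalField, Phi_eq, signField]
  have hS : ∀ t, 0 ≤ t → (G.fwdProc x₀ x₀ u (fun x => φ x ^ 2 / 2) n ξ δ).2 t = (G.walk x₀ ξ t,
      G.stack x₀ φ ξ (fun e => splice (G.rateJ (fun x => φ x ^ 2 / 2) e) (γ e) (δ e)) n t) :=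
    fun t ht => Prod.ext rfl (funext fun e => (G.stack_splice x₀ φ ξ hγ hδ n ht e).symm)
  have h1 : (G.fwdProc x₀ x₀ u (fun x => φ x ^ 2 / 2) n ξ δ).1 = G.tau x₀ u ξ := rfl
  simp only [enlargedObs, trajectory, hT, h1, hF, hS _ h0,
    fun t : I => hS (min ((t : ℝ≥0) : ℝ) (G.tau x₀ u ξ)) (le_min t.1.2 h0)]

theorem fwdExp_le_lintegral_signMean (hu : 0 < u) (hf : Measurable f) (φ : V → ℝ) (n : E → ℕ) :
    G.fwdExp x₀ (G.fwdObs x₀ f) x₀ u (fun x => φ x ^ 2 / 2) n ≤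
      ∫⁻ q, G.signMean x₀ f u φ q.1 q.2 n ∂(G.clockLaw.prod (poissonSpacings E)) := by
  have h1 : Measurable fun q : (ℕ → E → ℝ) × (E → ℕ → ℝ) => G.fwdVal x₀ (G.fwdObs x₀ f) x₀ u
      (fun x => φ x ^ 2 / 2) n q.1 q.2 :=
    G.measurable_fwdVal x₀ (G.procMeasurable_fwdObs x₀ hf) x₀ hu n measurable_const measurable_fst
      measurable_snd
  have h2 : Measurable fun q : (ℕ → E → ℝ) × (E → ℕ → ℝ) => G.signMean x₀ f u φ q.1 q.2 n :=
    G.measurable_signMean x₀ hu hf measurable_const measurable_fst measurable_snd measurable_const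
  rw [fwdExp, lintegral_prod _ h1.aemeasurable, lintegral_prod _ h2.aemeasurable]
  refine lintegral_mono fun ξ => ?_
  have h3 : Measurable fun γ => G.signMean x₀ f u φ ξ γ n :=
    G.measurable_signMean x₀ hu hf measurable_const measurable_const measurable_id measurable_const
  have h4 := lintegral_splice (G.rateJ_nonneg fun x => φ x ^ 2 / 2) h3
  refine le_of_le_of_eq ?_ h4.symm
  calc _ = ∫⁻ _ : E → ℕ → ℝ, ∫⁻ δ, G.fwdVal x₀ (G.fwdObs x₀ f) x₀ u (fun x => φ x ^ 2 / 2) n ξ δ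
        ∂(poissonSpacings E) ∂(poissonSpacings E) := by
        rw [lintegral_const, measure_univ, mul_one]
    _ ≤ _ := by
        refine lintegral_mono_ae ?_
        filter_upwards [ae_goodSpacings] with γ hγ
        refine lintegral_mono_ae ?_
        filter_upwards [ae_goodSpacings] with δ hδ
        exact G.fwdVal_le_signMean x₀ φ ξ hγ hδ n

/-- For every sign assignment constant on the initial clusters, Gaussian density times Poisson
probability has the same value, by the energy identity. Their number is the cardinality appearing in
`fwdDens`, and the other assignments are dropped. -/
theorem fwdDens_mul_le {r : V → ℝ} (hr : ∀ z, z ≠ x₀ → 0 < r z) (hr₀ : r x₀ = 0) (n : E → ℕ)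
    {X : ℝ≥0∞} {Y : (V → ℝ) → ℝ≥0∞} (hY : ∀ σ, X ≤ Y (signField σ r)) :
    G.fwdDens x₀ r n * X ≤ ∑ σ ∈ pinnedSigns x₀, fieldDens x₀ r *
      (ofReal (exp (-(1 / 2) * G.energy (signField σ r))) *
        (G.initialStackLaw x₀ (signField σ r) {n} * Y (signField σ r))) := by
  have hr' : ∀ z, 0 ≤ r z := fun z => if h : z = x₀ then (h ▸ hr₀).ge else (hr z h).le
  have hfin := Set.toFinite (G.clusterSigns x₀ {e | 0 < n e})
  set B : ℝ := (1 / √2) ^ (univ.erase x₀).card / prodOff r x₀ * exp (-G.hamil r) *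
    (∏ e, (2 * G.rateJ r e) ^ n e / (n e).factorial) with hB
  have hsub : hfin.toFinset ⊆ pinnedSigns x₀ := fun σ hσ =>
    mem_filter.2 ⟨mem_univ _, ((hfin.mem_toFinset).1 hσ).1⟩
  refine le_trans ?_ (Finset.sum_le_sum_of_subset hsub)
  have hpo : 0 ≤ prodOff r x₀ := Finset.prod_nonneg fun z _ => sqrt_nonneg _
  have hP : 0 ≤ ∏ e, (2 * G.rateJ r e) ^ n e / (n e).factorial :=
    Finset.prod_nonneg fun e _ => by have := G.rateJ_nonneg r e; positivity
  have hterm : ∀ σ ∈ hfin.toFinset, ofReal B * X ≤ fieldDens x₀ r *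
      (ofReal (exp (-(1 / 2) * G.energy (signField σ r))) *
        (G.initialStackLaw x₀ (signField σ r) {n} * Y (signField σ r))) := by
    intro σ hσ
    have hσ' := (G.mem_clusterSigns x₀).1 (hfin.mem_toFinset.1 hσ)
    have hprod : ∏ e, G.rateA (G.agreeSigns σ) r e ^ n e / (n e).factorial =
        ∏ e, (2 * G.rateJ r e) ^ n e / (n e).factorial := by
      refine prod_congr rfl fun e _ => ?_
      by_cases h : n e = 0
      · simp [h]
      · rw [rateA, if_pos (show e ∈ G.agreeSigns σ from hσ'.2 e (Nat.pos_of_ne_zero h))]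
    rw [initialStackLaw_singleton, G.agree_signField x₀ hσ'.1 hr,
      show (fun x => signField σ r x ^ 2 / 2) = r from funext (signField_sq_half hr'), hprod,
      fieldDens_eq x₀ hr, ← mul_assoc, ← mul_assoc, ← ofReal_mul (by positivity),
      ← ofReal_mul (by positivity)]
    refine mul_le_mul' (ofReal_le_ofReal (le_of_eq ?_)) (hY σ)
    have hE : exp (-G.hamil r) = exp (-(1 / 2) * G.energy (signField σ r)) *
        exp (-∑ e, G.rateA (G.agreeSigns σ) r e) := by
      rw [← exp_add, ← G.energy_signField σ hr']
      congr 1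
      ring
    rw [hB, hE]
    ring
  refine le_trans (le_of_eq ?_) (sum_le_sum hterm)
  rw [Finset.sum_const, nsmul_eq_mul, fwdDens, ← hB, ofReal_mul (by positivity),
    ENNReal.ofReal_natCast, Set.ncard_eq_toFinset_card _ hfin]
  ring

theorem tsum_fwdDens_le (hu : 0 < u) (hf : Measurable f) :
    ∑' n : E → ℕ, ∫⁻ r : Off x₀, (if ∀ i, 0 < r i then
        G.fwdDens x₀ (extendAt x₀ 0 r) n *
          G.fwdExp x₀ (G.fwdObs x₀ f) x₀ u (extendAt x₀ 0 r) n else 0) ≤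
      ∑' n : E → ℕ, ∫⁻ g : Off x₀,
        ofReal (exp (-(1 / 2) * G.energy (extendAt x₀ 0 g))) *
          (G.initialStackLaw x₀ (extendAt x₀ 0 g) {n} *
            ∫⁻ q, G.signMean x₀ f u (extendAt x₀ 0 g) q.1 q.2 n
              ∂(G.clockLaw.prod (poissonSpacings E))) := by
  refine ENNReal.tsum_le_tsum fun n => ?_
  have h1 : Measurable fun p : (V → ℝ) × ((ℕ → E → ℝ) × (E → ℕ → ℝ)) =>
      G.signMean x₀ f u p.1 p.2.1 p.2.2 n :=
    G.measurable_signMean x₀ hu hf measurable_fst measurable_snd.fst measurable_snd.snd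
      measurable_const
  have h2 : Measurable fun φ : V → ℝ => ∫⁻ q, G.signMean x₀ f u φ q.1 q.2 n
      ∂(G.clockLaw.prod (poissonSpacings E)) := h1.lintegral_prod_right'
  have h3 : Measurable fun φ : V → ℝ => ofReal (exp (-(1 / 2) * G.energy φ)) *
      (G.initialStackLaw x₀ φ {n} * ∫⁻ q, G.signMean x₀ f u φ q.1 q.2 n
      ∂(G.clockLaw.prod (poissonSpacings E))) :=
    ((measurable_exp.comp (G.measurable_energy.const_mul _)).ennreal_ofReal).mul
      ((G.measurable_initialStackLaw x₀ n).mul h2)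
  have h4 := lintegral_extendAt x₀ 0 h3
  rw [mul_zero, Real.sqrt_zero] at h4
  rw [h4]
  refine lintegral_mono fun r => ?_
  split_ifs with hr
  swap
  · exact zero_le
  have hr₀ : extendAt x₀ 0 r x₀ = 0 := by simp [extendAt]
  have hr' : ∀ z, z ≠ x₀ → 0 < extendAt x₀ 0 r z := fun z hz => by
    simpa [extendAt, hz] using hr ⟨z, hz⟩
  have hr'' : ∀ z, 0 ≤ extendAt x₀ 0 r z := fun z => by
    by_cases h : z = x₀
    · rw [h, hr₀]
    · exact (hr' z h).le
  refine G.fwdDens_mul_le x₀ hr' hr₀ n (Y := fun φ => ∫⁻ q, G.signMean x₀ f u φ q.1 q.2 n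
      ∂(G.clockLaw.prod (poissonSpacings E))) fun σ => ?_
  have h5 := G.fwdExp_le_lintegral_signMean x₀ hu hf (signField σ (extendAt x₀ 0 r)) n
  rwa [show (fun x => signField σ (extendAt x₀ 0 r) x ^ 2 / 2) = extendAt x₀ 0 r from
    funext (signField_sq_half hr'')] at h5

end Network

namespace Network

universe v w

variable {V : Type v} {E : Type w} (G : Network V E) (x₀ : V) [Fintype V] [Fintype E]

/-! ### Normalization of the pinned Gaussian field -/

section PinnedField

/-- The normalization of the pinned field. -/
def partition (a : ℝ) : ℝ :=
  ∫ g : Off x₀, exp (-(1 / 2) * G.energy (extendAt x₀ a g))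

/-- Without killing, the energy only sees differences, so the boundary value amounts to a
translation. Hence the partition functions agree. -/
theorem energy_extendAt (a : ℝ) (g : Off x₀) :
    G.energy (extendAt x₀ a g) = G.energy (extendAt x₀ 0 (g - fun _ => a)) := by
  have h : ∀ x, extendAt x₀ 0 (g - fun _ => a) x = extendAt x₀ a g x - a := by
    intro x
    unfold extendAt
    split_ifs <;> simp
  simp only [energy, h, sub_sub_sub_cancel_right]

theorem partition_eq (a : ℝ) : G.partition x₀ a = G.partition x₀ 0 := by
  simp only [partition, fun g => G.energy_extendAt x₀ a g]
  exact integral_sub_right_eq_self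
    (fun g : Off x₀ => exp (-(1 / 2) * G.energy (extendAt x₀ 0 g))) _

/-- Tilting by a weight which is not integrable gives the zero measure by convention, so
integrability can be read from `h`. -/
theorem integrable_exp_energy (h : G.pinnedGFF x₀ 0 ≠ 0) (a : ℝ) :
    Integrable fun g : Off x₀ =>
      exp (-(1 / 2) * G.energy (extendAt x₀ a g)) := by
  have h0 : Integrable fun g : Off x₀ =>
      exp (-(1 / 2) * G.energy (extendAt x₀ 0 g)) := by
    by_contra hi
    exact h (by rw [pinnedGFF, tilted_of_not_integrable hi, Measure.map_zero])
  simp only [fun g => G.energy_extendAt x₀ a g]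
  exact h0.comp_sub_right _

variable [MeasurableSpace V] [MeasurableSingletonClass V]

theorem isProbabilityMeasure_pinnedGFF (h : G.pinnedGFF x₀ 0 ≠ 0) (a : ℝ) :
    IsProbabilityMeasure (G.pinnedGFF x₀ a) := by
  have := isProbabilityMeasure_tilted (G.integrable_exp_energy x₀ h a)
  exact Measure.isProbabilityMeasure_map (measurable_extendAt x₀ a).aemeasurable

theorem lintegral_tilted_energy (h : G.pinnedGFF x₀ 0 ≠ 0) (a : ℝ) (K : (V → ℝ) → ℝ≥0∞) :
    ∫⁻ g, K (extendAt x₀ a g) ∂((volume : Measure (Off x₀)).tilted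
        fun f => -(1 / 2) * G.energy (extendAt x₀ a f)) =
      ofReal (1 / G.partition x₀ 0) * ∫⁻ g : Off x₀,
        ofReal (exp (-(1 / 2) * G.energy (extendAt x₀ a g))) * K (extendAt x₀ a g) := by
  rw [lintegral_tilted, ← lintegral_const_mul' _ _ ofReal_ne_top]
  have hZ : 0 < G.partition x₀ 0 := integral_exp_pos (G.integrable_exp_energy x₀ h 0)
  have hZ' : ∫ g : Off x₀, exp (-(1 / 2) * G.energy (extendAt x₀ a g)) =
      G.partition x₀ 0 := G.partition_eq x₀ a
  refine lintegral_congr fun g => ?_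
  rw [hZ', ← mul_assoc, ← ofReal_mul (by positivity), one_div_mul_eq_div]

variable {I : Finset ℝ≥0} {f : (V → ℝ) × ℝ × (I → V × (E → ℕ)) → ℝ≥0∞} {u : ℝ}

/-- The mean of an observable of the reversed self-interacting process started from the pinned field
is at most its mean for the enlarged process. -/
theorem lintegral_revExp_pinnedGFF_le (hu : 0 < u) (hf : Measurable f) {Ω : Type*}
    [MeasurableSpace Ω] {P : Measure Ω} {φ₀ : Ω → V → ℝ} {ξ : Ω → ℕ → E → ℝ}
    {γ : Ω → E → ℕ → ℝ} {n₀ : Ω → E → ℕ} {σ : Ω → V → ℤˣ} (h : G.IsEnlarged x₀ u P φ₀ ξ γ n₀ σ)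
    (h0 : G.pinnedGFF x₀ 0 ≠ 0) :
    ∫⁻ φ, G.revExp x₀ f φ ∂(G.pinnedGFF x₀ √(2 * u)) ≤
      ∫⁻ ω, G.enlargedObs x₀ f u (φ₀ ω) (ξ ω) (γ ω) (n₀ ω) (σ ω) ∂P := by
  have := G.isProbabilityMeasure_pinnedGFF x₀ h0 0
  rw [G.lintegral_enlargedObs x₀ hu hf h]
  refine (lintegral_map_le _ _).trans ?_
  rw [G.lintegral_tilted_energy x₀ h0]
  refine (mul_le_mul_right ((G.lintegral_revExp_le x₀ hu hf).trans
    (G.tsum_fwdDens_le x₀ hu hf)) _).trans (le_of_eq ?_)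
  rw [← ENNReal.tsum_mul_left]
  refine tsum_congr fun n => ?_
  have h1 : Measurable fun p : (V → ℝ) × ((ℕ → E → ℝ) × (E → ℕ → ℝ)) =>
      G.signMean x₀ f u p.1 p.2.1 p.2.2 n :=
    G.measurable_signMean x₀ hu hf measurable_fst measurable_snd.fst measurable_snd.snd
      measurable_const
  have hi := G.measurable_initialStackLaw x₀ n
  have h2 : Measurable fun φ : V → ℝ => ∫⁻ q, G.signMean x₀ f u φ q.1 q.2 n
      ∂(G.clockLaw.prod (poissonSpacings E)) := h1.lintegral_prod_right'
  have h3 : Measurable fun p : (V → ℝ) × ((ℕ → E → ℝ) × (E → ℕ → ℝ)) =>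
      G.initialStackLaw x₀ p.1 {n} * G.signMean x₀ f u p.1 p.2.1 p.2.2 n :=
    (hi.comp measurable_fst).mul h1
  have h4 : Measurable fun φ : V → ℝ => G.initialStackLaw x₀ φ {n} * ∫⁻ q,
      G.signMean x₀ f u φ q.1 q.2 n ∂(G.clockLaw.prod (poissonSpacings E)) := hi.mul h2
  have h5 : ∀ φ : V → ℝ, Measurable fun q : (ℕ → E → ℝ) × (E → ℕ → ℝ) =>
      G.signMean x₀ f u φ q.1 q.2 n := fun φ =>
    G.measurable_signMean x₀ hu hf measurable_const measurable_fst measurable_snd measurable_const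
  have e : (∫⁻ p, G.initialStackLaw x₀ p.1 {n} * G.signMean x₀ f u p.1 p.2.1 p.2.2 n
      ∂((G.pinnedGFF x₀ 0).prod (G.clockLaw.prod (poissonSpacings E)))) =
      ∫⁻ φ, G.initialStackLaw x₀ φ {n} * ∫⁻ q, G.signMean x₀ f u φ q.1 q.2 n
        ∂(G.clockLaw.prod (poissonSpacings E)) ∂(G.pinnedGFF x₀ 0) := by
    rw [lintegral_prod _ h3.aemeasurable]
    refine lintegral_congr fun φ => ?_
    rw [← lintegral_const_mul _ (h5 φ)]
  refine Eq.trans ?_ e.symm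
  rw [pinnedGFF, lintegral_map h4 (measurable_extendAt x₀ 0), G.lintegral_tilted_energy x₀ h0 0
    fun φ => G.initialStackLaw x₀ φ {n} * ∫⁻ q,
      G.signMean x₀ f u φ q.1 q.2 n ∂(G.clockLaw.prod (poissonSpacings E))]

end PinnedField

end Network

/-! ### From an inequality of means to an equality of laws -/

section FiniteTimes

variable {A S : Type*} [MeasurableSpace A] [MeasurableSpace S]

/-- The evaluation of a path at finitely many times. -/
def finiteEval (I : Finset ℝ≥0) (p : A × ℝ × (ℝ≥0 → S)) : A × ℝ × (I → S) :=
  (p.1, p.2.1, fun t => p.2.2 t)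

theorem measurable_finiteEval (I : Finset ℝ≥0) :
    Measurable (finiteEval I : A × ℝ × (ℝ≥0 → S) → A × ℝ × (I → S)) :=
  measurable_fst.prodMk (measurable_snd.fst.prodMk (measurable_pi_lambda _ fun t =>
    (measurable_pi_apply (t : ℝ≥0)).comp measurable_snd.snd))

/-- Laws on a space of paths are determined by the evaluations at finitely many times. -/
theorem ext_of_map_finiteEval {μ ν : Measure (A × ℝ × (ℝ≥0 → S))} [IsFiniteMeasure μ]
    (h : ∀ I, μ.map (finiteEval I) = ν.map (finiteEval I)) : μ = ν := by
  -- The field and the lifetime are copied at every time, so that a single process indexed by `ℝ≥0`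
  -- carries everything and uniqueness of projective limits applies.
  have hi : Measurable fun (p : A × ℝ × (ℝ≥0 → S)) (t : ℝ≥0) => (p.1, p.2.1, p.2.2 t) :=
    measurable_pi_lambda _ fun t => measurable_fst.prodMk (measurable_snd.fst.prodMk
      ((measurable_pi_apply t).comp measurable_snd.snd))
  have hj : Measurable fun y : ℝ≥0 → A × ℝ × S => ((y 0).1, (y 0).2.1, fun t => (y t).2.2) :=
    (measurable_pi_apply 0).fst.prodMk ((measurable_pi_apply 0).snd.fst.prodMk
      (measurable_pi_lambda _ fun t => (measurable_pi_apply t).snd.snd))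
  have hr : ∀ I : Finset ℝ≥0, Measurable fun (q : A × ℝ × (I → S)) (t : I) =>
      (q.1, q.2.1, q.2.2 t) := fun I =>
    measurable_pi_lambda _ fun t => measurable_fst.prodMk (measurable_snd.fst.prodMk
      ((measurable_pi_apply t).comp measurable_snd.snd))
  have hres : ∀ (κ : Measure (A × ℝ × (ℝ≥0 → S))) (I : Finset ℝ≥0),
      (κ.map fun p t => (p.1, p.2.1, p.2.2 t)).map I.restrict =
        (κ.map (finiteEval I)).map fun q t => (q.1, q.2.1, q.2.2 t) := fun κ I => by
    rw [Measure.map_map (Finset.measurable_restrict I) hi,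
      Measure.map_map (hr I) (measurable_finiteEval I)]
    rfl
  have key : μ.map (fun p t => (p.1, p.2.1, p.2.2 t)) = ν.map fun p t => (p.1, p.2.1, p.2.2 t) :=
    IsProjectiveLimit.unique (P := fun I => (μ.map fun p t => (p.1, p.2.1, p.2.2 t)).map I.restrict)
      (fun _ => rfl) fun I => by
        change Measure.map I.restrict _ = Measure.map I.restrict _
        rw [hres, hres, h]
  have := congrArg (Measure.map fun y : ℝ≥0 → A × ℝ × S =>
    ((y 0).1, (y 0).2.1, fun t => (y t).2.2)) key
  rw [Measure.map_map hj hi, Measure.map_map hj hi] at this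
  simpa [Function.comp_def] using this

/-- A pair has the joint law given by a law and a kernel as soon as the means of the observables at
finitely many times are at least those for the joint law. -/
theorem hasLaw_and_hasCondDistrib_of_lintegral_le {Ω : Type*} [MeasurableSpace Ω] {P : Measure Ω}
    [IsProbabilityMeasure P] {μ : Measure A} [IsProbabilityMeasure μ]
    {κ : Kernel A (ℝ × (ℝ≥0 → S))} [IsMarkovKernel κ] {Y : Ω → A} {X : Ω → ℝ × (ℝ≥0 → S)}
    (hY : AEMeasurable Y P) (hX : AEMeasurable X P)
    (h : ∀ (I : Finset ℝ≥0) (f : A × ℝ × (I → S) → ℝ≥0∞), Measurable f →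
      ∫⁻ y, ∫⁻ T, f (finiteEval I (y, T)) ∂(κ y) ∂μ ≤ ∫⁻ ω, f (finiteEval I (Y ω, X ω)) ∂P) :
    HasLaw Y μ P ∧ HasCondDistrib X Y κ P := by
  have hXY := hY.prodMk hX
  have hprob := Measure.isProbabilityMeasure_map (μ := P) hXY
  have key : P.map (fun ω => (Y ω, X ω)) = μ ⊗ₘ κ := by
    refine ext_of_map_finiteEval fun I => ?_
    have hI := measurable_finiteEval (A := A) (S := S) I
    have := Measure.isProbabilityMeasure_map (μ := μ ⊗ₘ κ) hI.aemeasurable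
    have := Measure.isProbabilityMeasure_map (μ := P.map fun ω => (Y ω, X ω)) hI.aemeasurable
    -- This is where one inequality is enough: both measures have mass 1.
    refine (Measure.eq_of_le_of_isProbabilityMeasure (Measure.le_iff.2 fun B hB => ?_)).symm
    have hf : Measurable (B.indicator (1 : A × ℝ × (I → S) → ℝ≥0∞)) := measurable_one.indicator hB
    have h2 := hf.comp hI
    rw [← lintegral_indicator_one hB, ← lintegral_indicator_one hB, lintegral_map hf hI,
      lintegral_map hf hI]
    refine le_of_eq_of_le (Measure.lintegral_compProd h2) ((h I _ hf).trans_eq ?_)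
    exact (lintegral_map' h2.aemeasurable hXY).symm
  have hlaw : HasLaw Y μ P := by
    refine ⟨hY, ?_⟩
    have h1 := congrArg (Measure.map Prod.fst) key
    rw [AEMeasurable.map_map_of_aemeasurable measurable_fst.aemeasurable hXY] at h1
    exact h1.trans (Measure.fst_compProd _ _)
  refine ⟨hlaw, ⟨hXY, ?_⟩⟩
  rw [hlaw.map_eq]
  exact key

end FiniteTimes

namespace Network

universe v w

variable {V : Type v} {E : Type w} (G : Network V E) (x₀ : V) [Fintype V] [Fintype E]
  [MeasurableSpace V] [MeasurableSingletonClass V]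

theorem checkTrajectory_eq (φ : V → ℝ) (γ : E → ℕ → ℝ) (c : ℕ → Bool) (t : ℝ≥0) :
    (G.checkTrajectory x₀ φ γ c).2 t =
      (G.dropPath x₀ (G.checkStack x₀ φ γ) (fun x => φ x ^ 2 / 2) x₀ c).2
        (G.checkT x₀ φ γ c - min (t : ℝ) (G.checkT x₀ φ γ c)) := by
  have h : max (G.checkT x₀ φ γ c - min (t : ℝ) (G.checkT x₀ φ γ c)) 0 =
      max (G.checkT x₀ φ γ c - t) 0 := by
    rcases le_total (t : ℝ) (G.checkT x₀ φ γ c) with h | h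
    · rw [min_eq_left h]
    · rw [min_eq_right h, sub_self, max_self, max_eq_right (by linarith)]
  simp only [checkTrajectory, dropPath, h, checkWalk_eq]

theorem revObs_dropPath {I : Finset ℝ≥0} (f : (V → ℝ) × ℝ × (I → V × (E → ℕ)) → ℝ≥0∞)
    (φ : V → ℝ) (γ : E → ℕ → ℝ) (c : ℕ → Bool) :
    revObs f φ (G.dropPath x₀ (G.checkStack x₀ φ γ) (fun x => φ x ^ 2 / 2) x₀ c) =
      f (finiteEval I (φ, G.checkTrajectory x₀ φ γ c)) := by
  have h : (G.dropPath x₀ (G.checkStack x₀ φ γ) (fun x => φ x ^ 2 / 2) x₀ c).1 =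
      G.checkT x₀ φ γ c := (G.checkT_eq x₀ φ γ c).symm
  have h' : (G.checkTrajectory x₀ φ γ c).1 = G.checkT x₀ φ γ c := rfl
  simp only [revObs, finiteEval, checkTrajectory_eq, h, h']

/-- The spacings can be chosen good everywhere. -/
theorem exists_goodSpacing_modification : ∃ rep : (E → ℕ → ℝ) → E → ℕ → ℝ, Measurable rep ∧
    (∀ γ e, GoodSpacing (rep γ e)) ∧ ∀ᵐ γ ∂(poissonSpacings E), rep γ = γ := by
  obtain ⟨γ₁, hγ₁⟩ := (ae_goodSpacings (E := E)).exists
  obtain ⟨B, hB, hBm, hB0⟩ := exists_measurable_superset_of_null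
    (ae_iff.1 (ae_goodSpacings (E := E)))
  refine ⟨fun γ => if γ ∈ B then γ₁ else γ,
    Measurable.ite hBm measurable_const measurable_id, fun γ e => ?_, ?_⟩
  · dsimp only
    split_ifs with h
    · exact hγ₁ e
    · by_contra hc
      exact h (hB fun h' => hc (h' e))
  · filter_upwards [measure_eq_zero_iff_ae_notMem.1 hB0] with γ hγ
    exact if_neg hγ

/-- The laws of the reversed self-interacting process are given by a Markov kernel. -/
theorem exists_checkKernel : ∃ κ : Kernel (V → ℝ) (Trajectory V E), IsMarkovKernel κ ∧
    (∀ φ : V → ℝ, κ φ = G.checkLaw x₀ φ) ∧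
    ∀ {I : Finset ℝ≥0} {f : (V → ℝ) × ℝ × (I → V × (E → ℕ)) → ℝ≥0∞}, Measurable f → ∀ φ,
      ∫⁻ T, f (finiteEval I (φ, T)) ∂(κ φ) = G.revExp x₀ f φ := by
  obtain ⟨rep, hrepm, hgood, hae⟩ := exists_goodSpacing_modification (E := E)
  set Q := (poissonSpacings E).prod fairCoins
  have haeQ : ∀ᵐ p ∂Q, rep p.1 = p.1 := Measure.quasiMeasurePreserving_fst.ae hae
  have hm : Measurable fun z : (V → ℝ) × ((E → ℕ → ℝ) × (ℕ → Bool)) =>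
      G.checkTrajectory x₀ z.1 (rep z.2.1) z.2.2 :=
    G.measurable_checkTrajectory x₀ measurable_fst (hrepm.comp measurable_snd.fst)
      measurable_snd.snd fun z e => hgood _ e
  have hm' : ∀ φ, Measurable fun p : (E → ℕ → ℝ) × (ℕ → Bool) =>
      G.checkTrajectory x₀ φ (rep p.1) p.2 := fun φ =>
    G.measurable_checkTrajectory x₀ measurable_const (hrepm.comp measurable_fst) measurable_snd
      fun z e => hgood _ e
  have hκ : Measurable fun φ : V → ℝ => Q.map fun p => G.checkTrajectory x₀ φ (rep p.1) p.2 := by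
    refine Measure.measurable_of_measurable_coe _ fun S hS => ?_
    simp only [fun φ => Measure.map_apply (μ := Q) (hm' φ) hS]
    exact measurable_measure_prodMk_left (ν := Q) (hm hS)
  refine ⟨⟨_, hκ⟩, ⟨fun φ => Measure.isProbabilityMeasure_map (hm' φ).aemeasurable⟩,
    fun φ => ?_, fun {I f} hf φ => ?_⟩
  · refine Measure.map_congr ?_
    filter_upwards [haeQ] with p hp
    rw [hp]
  · change ∫⁻ T, f (finiteEval I (φ, T)) ∂(Q.map fun p => G.checkTrajectory x₀ φ (rep p.1) p.2) = _
    have h1 : Measurable fun T : Trajectory V E => f (finiteEval I (φ, T)) :=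
      hf.comp ((measurable_finiteEval I).comp (measurable_const.prodMk measurable_id))
    have h2 : Measurable fun p : (E → ℕ → ℝ) × (ℕ → Bool) =>
        f (finiteEval I (φ, G.checkTrajectory x₀ φ (rep p.1) p.2)) := h1.comp (hm' φ)
    rw [lintegral_map h1 (hm' φ), lintegral_prod _ h2.aemeasurable, revExp]
    refine lintegral_congr_ae ?_
    filter_upwards [hae] with γ hγ
    simp only [hγ, revObs_dropPath]

end Network

end

theorem theorem4p2 {V E : Type*} [Fintype V] [Fintype E]
    [MeasurableSpace V] [MeasurableSingletonClass V]
    (G : Network V E) (hG : (G.openGraph Set.univ).Connected) (x₀ : V) (u : ℝ) (hu : 0 < u)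
    {Ω : Type*} [MeasurableSpace Ω] (P : Measure Ω) [IsProbabilityMeasure P]
    (φ₀ : Ω → V → ℝ) (ξ : Ω → ℕ → E → ℝ) (γ : Ω → E → ℕ → ℝ) (n₀ : Ω → E → ℕ) (σ : Ω → V → ℤˣ)
    (h : G.IsEnlarged x₀ u P φ₀ ξ γ n₀ σ) :
    HasLaw (fun ω => G.finalField x₀ u (φ₀ ω) (ξ ω) (σ ω)) (G.pinnedGFF x₀ √(2 * u)) P ∧
    ∃ κ : Kernel (V → ℝ) (Trajectory V E), IsMarkovKernel κ ∧
      (∀ φ : V → ℝ, φ x₀ = √(2 * u) → κ φ = G.checkLaw x₀ φ) ∧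
      HasCondDistrib (fun ω => G.trajectory x₀ u (φ₀ ω) (ξ ω) (γ ω) (n₀ ω))
        (fun ω => G.finalField x₀ u (φ₀ ω) (ξ ω) (σ ω)) κ P := by
  obtain ⟨κ, hκ, hκ1, hκ2⟩ := G.exists_checkKernel x₀
  -- A zero Gaussian measure would make the law of the base variables zero, although `P` is a
  -- probability measure. The integrability of the Gaussian weight is thus deduced from the
  -- existence of the enlarged process.
  have h0 : G.pinnedGFF x₀ 0 ≠ 0 := by
    intro h0
    have h1 := h.law_base.map_eq
    rw [h0, Measure.zero_prod] at h1
    have := Measure.isProbabilityMeasure_map (μ := P) h.law_base.aemeasurable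
    exact IsProbabilityMeasure.ne_zero _ h1
  have := G.isProbabilityMeasure_pinnedGFF x₀ h0 √(2 * u)
  have hB := h.law_base.aemeasurable
  have hXm : Measurable fun z : (V → ℝ) × (ℕ → E → ℝ) × (E → ℕ → ℝ) × (E → ℕ) =>
      G.trajectory x₀ u z.1 z.2.1 z.2.2.1 z.2.2.2 :=
    G.measurable_trajectory x₀ hu measurable_fst measurable_snd.fst measurable_snd.snd.fst
      measurable_snd.snd.snd
  have hYm : Measurable fun z : (V → ℝ) × (ℕ → E → ℝ) × (V → ℤˣ) =>
      G.finalField x₀ u z.1 z.2.1 z.2.2 :=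
    G.measurable_finalField x₀ hu measurable_fst measurable_snd.fst measurable_snd.snd
  have hX := hXm.comp_aemeasurable (hB.fst.prodMk (hB.snd.fst.prodMk
    (hB.snd.snd.prodMk h.aemeasurable_stacks)))
  have hY := hYm.comp_aemeasurable (hB.fst.prodMk (hB.snd.fst.prodMk h.aemeasurable_signs))
  have hle : ∀ (I : Finset ℝ≥0) (f : (V → ℝ) × ℝ × (I → V × (E → ℕ)) → ℝ≥0∞), Measurable f →
      ∫⁻ φ, ∫⁻ T, f (finiteEval I (φ, T)) ∂(κ φ) ∂(G.pinnedGFF x₀ √(2 * u)) ≤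
        ∫⁻ ω, G.enlargedObs x₀ f u (φ₀ ω) (ξ ω) (γ ω) (n₀ ω) (σ ω) ∂P := fun I f hf => by
    simp only [hκ2 hf]
    exact G.lintegral_revExp_pinnedGFF_le x₀ hu hf h h0
  obtain ⟨h1, h2⟩ := hasLaw_and_hasCondDistrib_of_lintegral_le hY hX hle
  exact ⟨h1, κ, hκ, fun φ _ => hκ1 φ, h2⟩
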